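/- Let $h\ge 0$ and $n,m\ge 1$ be integers. Radial slit configurations. Let $R=\frac1{2\pi}+\frac12$ and take $n$ copies of the annulus $\{\frac1{2\pi}\le|z|\le R\}$. A (possibly degenerate) radial slit preconfiguration $L=(\zeta,\lambda,\tilde\omega,r,P)$ consists of $2h$ points $\zeta_i$ (slits) on the annuli, $m$ points $P_k$ (parametrization points) on the outer boundaries, a fixed point free involution $\lambda$ of the slits with $|\zeta_{\lambda(i)}|=|\zeta_i|$, a permutation $\tilde\omega$ of the $2h+m$ slits and parametrization points whose cycles are the sets of those lying on the $n$ annuli (each of them non-empty), in a weakly counterclockwise cyclic order, and the counterclockwise angular distances $r_x\in[0,2\pi]$ from $x$ to $\tilde\omega(x)$ (with sum $2\pi$ on each annulus). It is required that each cycle of $\lambda\circ\tilde\omega$, where $\lambda$ is extended by the identity on parametrization points, contains exactly one parametrization point. Configurations are the equivalence classes under relabeling of slits and under jumps: if $j=\tilde\omega(x)$ is a slit other than $x$ with $\lambda(j)\neq x$, $r_x=0$, and the modulus of $x$ is at least $|\zeta_j|$, then $x$ may be moved, with its modulus kept, to the radial segment of $\zeta_{\lambda(j)}$, directly after $\lambda(j)$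 in the order $\tilde\omega$. The radial segments through slits and parametrization points, together with the positive real line, cut the $i$-th annulus into $q_i+1$ radial chambers, and the circles of radii $|\zeta_i|$ cut the annuli into $p+1$ annular chambers. Two configurations have the same combinatorial type if they differ only in the sizes of chambers. The harmonic compactification $\overline{\mathfrak{Rad}}_h(n,m)$ is the quotient of the disjoint union of the cells $\Delta^{q_1}\times\dots\times\Delta^{q_n}\times\Delta^p$, one for each combinatorial type, in which a face of a cell is identified with the cell of the type obtained by collapsing the corresponding chamber. The unilevel harmonic compactification $\overline{\mathfrak{URad}}_h(n,m)$ is the subcomplex of the cells whose configurations satisfy $|\zeta_i|=R$ for all $i$; let $\Upsilon_{\mathfrak U}$ be the set of their types. Sullivan diagrams. An admissible fat graph is a finite graph with a cyclic ordering of the half edges at each vertex, with $n$ incoming and $m$ outgoing ordered leaves (its univalent vertices), all other vertices being at least trivalent, such that there is exactly one leaf on each boundary cycle and the boundary cycles of the incoming leaves, with the leaves removed, are disjoint embedded circles (the admissible cycles). Consider those of Euler characteristic $-h$ in which every component has an incoming leaf. A length function assigns to each edge a length in $[0,1]$, namely $1$ to leaves, with sum $1$ over each admissible cycle, such that the edges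 of length $0$ form a forest whose collapse is again an admissible fat graph. The space of metric admissible fat graphs is the quotient of the disjoint union over all graphs of the spaces of length functions by isomorphism and by collapse of edges of length $0$. The space $\mathcal{SD}_h(n,m)$ of Sullivan diagrams is its quotient by slides of vertices along edges not on admissible cycles and by arbitrary changes of the lengths of edges not on admissible cycles. A non-metric Sullivan diagram is an equivalence class of Sullivan diagrams under changes of the positive lengths of the edges on the admissible cycles; let $\Lambda$ be the set of these. Claim. The space $\mathcal{SD}_h(n,m)$ is homotopy equivalent to $\overline{\mathfrak{Rad}}_h(n,m)$. Moreover there are a bijection $f:\Upsilon_{\mathfrak U}\to\Lambda$ and a homeomorphism $\Phi:\overline{\mathfrak{URad}}_h(n,m)\to\mathcal{SD}_h(n,m)$ of Hausdorff spaces such that: 1. $\overline{\mathfrak{URad}}_h(n,m)$ has a CW structure whose open cells are the interiors of the cells of the types $T\in\Upsilon_{\mathfrak U}$, of dimension $q_1+\dots+q_n+p$, and $\mathcal{SD}_h(n,m)$ has a CW structure whose open cells are the sets of Sullivan diagrams with a given underlying non-metric Sullivan diagram $G\in\Lambda$; 2. $\Phi$ maps the open cell of $T$ onto the open cell of $f(T)$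 for every $T\in\Upsilon_{\mathfrak U}$, and maps the $k$-skeleton onto the $k$-skeleton for every $k$, so that $\Phi$ is a cellular homeomorphism; 3. for every unilevel preconfiguration $L$ there is an admissible fat graph $\Gamma$ that is the unfolded graph of $L$ (the inner boundaries of the annuli, with incoming leaves at the positive real lines, with one edge for each pair of slits joining the two points of the circles at the arguments of these slits, and with an outgoing leaf at the argument of each parametrization point, attached in the order given by $\tilde\omega$ and $r$), such that $\Phi$ maps the point with coordinates $(t_1,\dots,t_n)\in\Delta^{q_1}\times\dots\times\Delta^{q_n}$ of the closed cell of the type of $L$ to the Sullivan diagram represented by $\Gamma$ with $t_{ij}$ as the length of the $j$-th edge of the $i$-th admissible cycle. -/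

import Mathlib

noncomputable section

/-! # Radial slit configurations and the harmonic compactification -/

namespace RadialSlit

/-- The common inner radius of all annuli. -/
def innerRadius : ℝ := 1 / (2 * Real.pi)

/-- The common outer radius of all annuli. -/
def outerRadius : ℝ := 1 / (2 * Real.pi) + 1 / 2

/-- The argument of a complex number, normalised to lie in `[0, 2π)`. -/
def angle (z : ℂ) : ℝ := toIcoMod Real.two_pi_pos 0 z.arg

/-- Indices of the `2h` slits (left summand) and the `m` parametrization points (right summand). -/
abbrev Mark (h m : ℕ) : Type := Fin (2 * h) ⊕ Fin m

/-- Move `x` in the cyclic orders given by `ω`: take `x` out of its cycle and put it back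
directly after `y` (for `x ≠ y`). -/
def moveAfter {α : Type*} [DecidableEq α] (ω : Equiv.Perm α) (x y : α) : Equiv.Perm α :=
  ω * Equiv.swap x (ω⁻¹ x) * Equiv.swap x y

/-- The tuple `(ζ, λ, ω̃, r, P)` of a radial slit preconfiguration on `n` annuli. A point of the
disjoint union of `n` complex planes is a pair `(j, z)`. -/
structure SlitData (h n m : ℕ) where
  /-- the end points of the slits -/
  slit : Fin (2 * h) → Fin n × ℂ
  /-- the slit pairing -/
  pairing : Equiv.Perm (Fin (2 * h))
  /-- the successor permutation, on slits and parametrization points -/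
  succ : Equiv.Perm (Mark h m)
  /-- the angular distances -/
  dist : Mark h m → ℝ
  /-- the parametrization points -/
  param : Fin m → Fin n × ℂ

namespace SlitData

variable {h n m : ℕ} (L : SlitData h n m)

/-- All slits and parametrization points together. -/
def xi : Mark h m → Fin n × ℂ := Sum.elim L.slit L.param

/-- The annulus on which a slit or parametrization point lies. -/
def ann (x : Mark h m) : Fin n := (L.xi x).1

/-- The argument of a slit or parametrization point. -/
def ang (x : Mark h m) : ℝ := angle (L.xi x).2

/-- The modulus of a slit or parametrization point. -/
def modulus (x : Mark h m) : ℝ := ‖(L.xi x).2‖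

/-- The boundary component permutation `λ ∘ ω̃`, with the slit pairing extended by the identity on
the parametrization points. -/
def boundaryPerm : Equiv.Perm (Mark h m) :=
  (Equiv.sumCongr L.pairing (Equiv.refl (Fin m)) : Equiv.Perm (Mark h m)) * L.succ

end SlitData

/-- Possibly degenerate radial slit preconfigurations.

* `succ_ang`, `dist_nonneg`, `dist_le` and `dist_sum` say that `dist x` is the counterclockwise
  angular distance from `x` to its successor and that running once through all marks of an annulus
  goes around it exactly once. So the successor permutation preserves the weak cyclic order; if not
  all marks of the annulus lie on one radial segment then `dist x < 2π` is determined by the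
  positions, and otherwise every `dist x` is `0` or `2π`, with exactly one of them `2π`.
* `boundary`: the cycles of the boundary component permutation are the outgoing boundary components
  (those of annuli without slits included), and each of them has exactly one parametrization point
  on it. In particular there are `m` of them. -/
structure PreConfig (h n m : ℕ) extends SlitData h n m where
  inner_le_slit : ∀ i, innerRadius ≤ ‖(slit i).2‖
  slit_le_outer : ∀ i, ‖(slit i).2‖ ≤ outerRadius
  norm_param : ∀ p, ‖(param p).2‖ = outerRadius
  pairing_ne : ∀ i, pairing i ≠ i
  pairing_pairing : ∀ i, pairing (pairing i) = i
  norm_pairing : ∀ i, ‖(slit (pairing i)).2‖ = ‖(slit i).2‖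
  sameCycle_iff : ∀ x y, succ.SameCycle x y ↔ toSlitData.ann x = toSlitData.ann y
  annulus_nonempty : ∀ j : Fin n, ∃ x, toSlitData.ann x = j
  dist_nonneg : ∀ x, 0 ≤ dist x
  dist_le : ∀ x, dist x ≤ 2 * Real.pi
  succ_ang : ∀ x, toSlitData.ang (succ x) =
    toIcoMod Real.two_pi_pos 0 (toSlitData.ang x + dist x)
  dist_sum : ∀ j : Fin n,
    ∑ x ∈ Finset.univ.filter (fun x => toSlitData.ann x = j), dist x = 2 * Real.pi
  boundary : ∀ x, ∃! p : Fin m, toSlitData.boundaryPerm.SameCycle x (Sum.inr p)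

namespace PreConfig

variable {h n m : ℕ}

/-- `L'` is obtained from `L` by relabeling the slits. -/
def Relabel (L L' : PreConfig h n m) : Prop :=
  ∃ τ : Equiv.Perm (Fin (2 * h)),
    (∀ i, L'.slit i = L.slit (τ i)) ∧
    (∀ i, τ (L'.pairing i) = L.pairing (τ i)) ∧
    (∀ x, Equiv.sumCongr τ (Equiv.refl (Fin m)) (L'.succ x) =
      L.succ (Equiv.sumCongr τ (Equiv.refl (Fin m)) x)) ∧
    (∀ x, L'.dist x = L.dist (Equiv.sumCongr τ (Equiv.refl (Fin m)) x)) ∧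
    L'.param = L.param

/-- `L'` is obtained from `L` by letting the mark `x` (a slit, or a parametrization point) jump
over the slit `j`. The mark `x` comes directly before `j` on the same radial segment and is at
least as far out as `j`; it is moved to the radial segment of the slit paired with `j`, directly
after that slit. -/
def Jump (L L' : PreConfig h n m) : Prop :=
  ∃ (x : Mark h m) (j : Fin (2 * h)),
    L.succ x = Sum.inl j ∧ L.dist x = 0 ∧
    L.modulus (Sum.inl j) ≤ L.modulus x ∧
    x ≠ Sum.inl j ∧ x ≠ Sum.inl (L.pairing j) ∧
    L'.pairing = L.pairing ∧
    L'.succ = moveAfter L.succ x (Sum.inl (L.pairing j)) ∧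
    (∀ y, y ≠ x → L'.xi y = L.xi y) ∧
    L'.xi x = ((L.slit (L.pairing j)).1,
      ((L.modulus x / L.modulus (Sum.inl (L.pairing j)) : ℝ) : ℂ) * (L.slit (L.pairing j)).2) ∧
    L'.dist x = L.dist (Sum.inl (L.pairing j)) ∧
    L'.dist (Sum.inl (L.pairing j)) = 0 ∧
    (∀ y, y ≠ x → y ≠ Sum.inl (L.pairing j) → L'.dist y = L.dist y)

/-- The arguments of the radial segments which bound the radial chambers of the `i`-th annulus:
the segments of the slits and the parametrization points, and the positive real line. -/
def walls (L : PreConfig h n m) (i : Fin n) : Finset ℝ :=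
  insert 0 ((Finset.univ.filter (fun x => L.ann x = i)).image L.ang)

/-- The number of radial chambers of the `i`-th annulus, minus one. -/
def radialDegree (L : PreConfig h n m) (i : Fin n) : ℕ := (L.walls i).card - 1

/-- The radii of the circles which bound the annular chambers. -/
def circles (L : PreConfig h n m) : Finset ℝ :=
  {innerRadius, outerRadius} ∪ Finset.univ.image (fun i => L.modulus (Sum.inl i))

/-- The number of annular chambers, minus one. -/
def annularDegree (L : PreConfig h n m) : ℕ := L.circles.card - 2

/-- The radial walls of an annulus are numbered counterclockwise from the positive real line, which
has number `0`. This is the number of the wall on which a mark lies. The `k`-th radial chamber is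
the one between the `k`-th wall and the next. -/
def radialPos (L : PreConfig h n m) (x : Mark h m) : ℕ :=
  ((L.walls (L.ann x)).filter (fun a => a < L.ang x)).card

/-- The circles are numbered from the inside, the inner boundary having number `0`. This is the
number of the circle on which the end point of a slit lies. The `k`-th annular chamber is the one
between the `k`-th circle and the next. -/
def level (L : PreConfig h n m) (i : Fin (2 * h)) : ℕ :=
  (L.circles.filter (fun a => a < L.modulus (Sum.inl i))).card

/-- Equality of the pairing, of the successor permutation, and of the annuli of all marks. -/
def SameFrame (L L' : PreConfig h n m) : Prop :=
  L'.pairing = L.pairing ∧ L'.succ = L.succ ∧ ∀ x, L'.ann x = L.ann x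

/-- `L` and `L'` have the same combinatorial data: they differ only in the sizes of the
chambers. -/
def SameType (L L' : PreConfig h n m) : Prop :=
  SameFrame L L' ∧
  (∀ i, L'.radialDegree i = L.radialDegree i) ∧
  (∀ x, L'.radialPos x = L.radialPos x) ∧
  (∀ x, L'.dist x = 0 ↔ L.dist x = 0) ∧
  L'.annularDegree = L.annularDegree ∧
  (∀ k, L'.level k = L.level k)

/-- Up to the sizes of the chambers, `L'` is obtained from `L` by collapsing the `j`-th radial
chamber on the `i`-th annulus (`0 ≤ j ≤ q_i`, where `q_i ≥ 1`). The last chamber is bounded by the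
last wall and by the positive real line. -/
def RadialCollapse (i : Fin n) (j : ℕ) (L L' : PreConfig h n m) : Prop :=
  SameFrame L L' ∧
  j ≤ L.radialDegree i ∧
  L'.radialDegree i + 1 = L.radialDegree i ∧
  (∀ k, k ≠ i → L'.radialDegree k = L.radialDegree k) ∧
  (∀ x, L.ann x ≠ i → L'.radialPos x = L.radialPos x) ∧
  (∀ x, L.ann x = i → L'.radialPos x =
    (if L.radialPos x ≤ j then L.radialPos x else L.radialPos x - 1) % L.radialDegree i) ∧
  (∀ x, L'.dist x = 0 ↔ L.dist x = 0 ∨ (L.ann x = i ∧ L.radialPos x = j ∧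
    L.radialPos (L.succ x) = (j + 1) % (L.radialDegree i + 1))) ∧
  L'.annularDegree = L.annularDegree ∧
  (∀ k, L'.level k = L.level k)

/-- Up to the sizes of the chambers, `L'` is obtained from `L` by collapsing the `j`-th annular
chamber (`0 ≤ j ≤ p`, where `p ≥ 1`). -/
def AnnularCollapse (j : ℕ) (L L' : PreConfig h n m) : Prop :=
  SameFrame L L' ∧
  (∀ i, L'.radialDegree i = L.radialDegree i) ∧
  (∀ x, L'.radialPos x = L.radialPos x) ∧
  (∀ x, L'.dist x = 0 ↔ L.dist x = 0) ∧
  j ≤ L.annularDegree ∧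
  L'.annularDegree + 1 = L.annularDegree ∧
  (∀ k, L'.level k = if L.level k ≤ j then L.level k else L.level k - 1)

/-- All slits end on the outer boundary. -/
def Unilevel (L : PreConfig h n m) : Prop := ∀ i, ‖(L.slit i).2‖ = outerRadius

/-- The relation generating equality of combinatorial types of configurations: relabelings, jumps,
and equality of combinatorial data. -/
def TypeStep (L L' : PreConfig h n m) : Prop := Relabel L L' ∨ Jump L L' ∨ SameType L L'

theorem innerRadius_pos : 0 < innerRadius := by unfold innerRadius; positivity

theorem angle_real_mul {c : ℝ} (hc : 0 < c) (z : ℂ) : angle ((c : ℂ) * z) = angle z := by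
  unfold angle; rw [Complex.arg_real_mul z hc]

theorem angle_mem (z : ℂ) : 0 ≤ angle z ∧ angle z < 2 * Real.pi := by
  have := toIcoMod_mem_Ico Real.two_pi_pos 0 z.arg
  simpa [angle] using this

theorem modulus_pos (L : PreConfig h n m) (x : Mark h m) : 0 < L.modulus x := by
  rcases x with i | p
  · exact lt_of_lt_of_le innerRadius_pos (L.inner_le_slit i)
  · have : L.modulus (Sum.inr p) = outerRadius := L.norm_param p
    rw [this]; unfold outerRadius; positivity

theorem Relabel.spec {L L' : PreConfig h n m} (H : Relabel L L') :
    ∃ e : Equiv.Perm (Mark h m), (∀ x, L'.xi x = L.xi (e x)) ∧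
      ∃ τ : Equiv.Perm (Fin (2 * h)), ∀ i, e (Sum.inl i) = Sum.inl (τ i) := by
  obtain ⟨τ, h1, -, -, -, h5⟩ := H
  refine ⟨Equiv.sumCongr τ (Equiv.refl _), ?_, τ, fun i => rfl⟩
  rintro (i | p)
  · exact h1 i
  · simp [SlitData.xi, h5]

theorem Relabel.walls_eq {L L' : PreConfig h n m} (H : Relabel L L') (i : Fin n) :
    L'.walls i = L.walls i := by
  obtain ⟨e, he, -⟩ := H.spec
  unfold walls
  congr 1
  ext a
  have h1 : ∀ x, L'.ann x = L.ann (e x) := fun x => by simp only [SlitData.ann, he]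
  have h2 : ∀ x, L'.ang x = L.ang (e x) := fun x => by simp only [SlitData.ang, he]
  simp only [Finset.mem_image, Finset.mem_filter, Finset.mem_univ, true_and]
  constructor
  · rintro ⟨x, hx, rfl⟩; exact ⟨e x, by rw [← h1, hx], (h2 x).symm⟩
  · rintro ⟨x, hx, rfl⟩; exact ⟨e.symm x, by rw [h1]; simpa using hx, by rw [h2]; simp⟩

theorem Relabel.circles_eq {L L' : PreConfig h n m} (H : Relabel L L') :
    L'.circles = L.circles := by
  obtain ⟨e, he, τ, hτ⟩ := H.spec
  unfold circles
  congr 1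
  ext a
  simp only [Finset.mem_image, Finset.mem_univ, true_and, SlitData.modulus, he, hτ]
  constructor
  · rintro ⟨x, rfl⟩; exact ⟨τ x, rfl⟩
  · rintro ⟨x, rfl⟩; exact ⟨τ.symm x, by simp⟩

theorem Jump.walls_eq {L L' : PreConfig h n m} (H : Jump L L') (i : Fin n) :
    L'.walls i = L.walls i := by
  obtain ⟨x, j, h1, h2, h3, h4, h5, -, -, h8, h9, -, -, -⟩ := H
  have hann : L.ann x = L.ann (Sum.inl j) := by
    rw [← h1]
    exact (L.sameCycle_iff _ _).1 (Equiv.Perm.sameCycle_apply_right.2 (Equiv.Perm.SameCycle.refl _ _))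
  have hang : L.ang (Sum.inl j) = L.ang x := by
    rw [← h1, L.succ_ang, h2, add_zero, toIcoMod_eq_self]
    simpa [SlitData.ang] using angle_mem (L.xi x).2
  have hann' : L'.ann x = L.ann (Sum.inl (L.pairing j)) := by
    simp only [SlitData.ann, h9]; rfl
  have hang' : L'.ang x = L.ang (Sum.inl (L.pairing j)) := by
    simp only [SlitData.ang, h9]
    rw [angle_real_mul (div_pos (L.modulus_pos _) (L.modulus_pos _))]; rfl
  have hann2 : ∀ y, y ≠ x → L'.ann y = L.ann y := fun y hy => by simp only [SlitData.ann, h8 y hy]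
  have hang2 : ∀ y, y ≠ x → L'.ang y = L.ang y := fun y hy => by simp only [SlitData.ang, h8 y hy]
  unfold walls
  congr 1
  ext a
  simp only [Finset.mem_image, Finset.mem_filter, Finset.mem_univ, true_and]
  constructor
  · rintro ⟨y, hy, rfl⟩
    by_cases hyx : y = x
    · subst hyx
      exact ⟨_, by rw [← hann', hy], hang'.symm⟩
    · exact ⟨y, by rw [← hann2 y hyx, hy], (hang2 y hyx).symm⟩
  · rintro ⟨y, hy, rfl⟩
    by_cases hyx : y = x
    · subst hyx
      exact ⟨Sum.inl j, by rw [hann2 _ h4.symm, ← hann, hy], by rw [hang2 _ h4.symm, hang]⟩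
    · exact ⟨y, by rw [hann2 y hyx, hy], hang2 y hyx⟩

theorem Jump.circles_eq {L L' : PreConfig h n m} (H : Jump L L') : L'.circles = L.circles := by
  obtain ⟨x, j, -, -, -, -, -, -, -, h8, h9, -, -, -⟩ := H
  have key : ∀ y, L'.modulus y = L.modulus y := by
    intro y
    by_cases hyx : y = x
    · subst hyx
      have hp := L.modulus_pos (Sum.inl (L.pairing j))
      have hq := L.modulus_pos y
      simp only [SlitData.modulus, h9, norm_mul, Complex.norm_real, norm_div, norm_norm]
      exact div_mul_cancel₀ _ hp.ne'
    · simp only [SlitData.modulus, h8 y hyx]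
  unfold circles
  simp only [key]

theorem TypeStep.radialDegree_eq {L L' : PreConfig h n m} (H : TypeStep L L') (i : Fin n) :
    L.radialDegree i = L'.radialDegree i := by
  rcases H with H | H | H
  · unfold radialDegree; rw [H.walls_eq]
  · unfold radialDegree; rw [H.walls_eq]
  · exact (H.2.1 i).symm

theorem TypeStep.annularDegree_eq {L L' : PreConfig h n m} (H : TypeStep L L') :
    L.annularDegree = L'.annularDegree := by
  rcases H with H | H | H
  · unfold annularDegree; rw [H.circles_eq]
  · unfold annularDegree; rw [H.circles_eq]
  · exact H.2.2.2.2.1.symm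

end PreConfig

open PreConfig

/-- Combinatorial types of (possibly degenerate) radial slit configurations. -/
def CombType (h n m : ℕ) : Type := Quot (TypeStep (h := h) (n := n) (m := m))

namespace CombType

variable {h n m : ℕ}

/-- The combinatorial type of the configuration represented by a preconfiguration. -/
def mk (L : PreConfig h n m) : CombType h n m := Quot.mk _ L

/-- The components `q_i` of the multi-degree. -/
def radialDegree (T : CombType h n m) (i : Fin n) : ℕ :=
  Quot.lift (fun L : PreConfig h n m => L.radialDegree i) (fun _ _ H => H.radialDegree_eq i) T

/-- The last component `p` of the multi-degree. -/
def annularDegree (T : CombType h n m) : ℕ :=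
  Quot.lift (fun L : PreConfig h n m => L.annularDegree) (fun _ _ H => H.annularDegree_eq) T

/-- Combinatorial types of unilevel configurations. -/
def Unilevel (T : CombType h n m) : Prop := ∃ L : PreConfig h n m, L.Unilevel ∧ mk L = T

/-- `T'` is the face of `T` obtained by collapsing the `j`-th radial chamber on annulus `i`. -/
def IsRadialFace (i : Fin n) (j : ℕ) (T T' : CombType h n m) : Prop :=
  ∃ L L' : PreConfig h n m, mk L = T ∧ mk L' = T' ∧ RadialCollapse i j L L'

/-- `T'` is the face of `T` obtained by collapsing the `j`-th annular chamber. -/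
def IsAnnularFace (j : ℕ) (T T' : CombType h n m) : Prop :=
  ∃ L L' : PreConfig h n m, mk L = T ∧ mk L' = T' ∧ AnnularCollapse j L L'

/-- The dimension of the cell of `T`. -/
def dim (T : CombType h n m) : ℕ := (∑ i, T.radialDegree i) + T.annularDegree

/-- The product of simplices `Δ^{q_1} × ⋯ × Δ^{q_n} × Δ^p`. -/
abbrev Cell (T : CombType h n m) : Type :=
  ((i : Fin n) → stdSimplex ℝ (Fin (T.radialDegree i + 1))) ×
    stdSimplex ℝ (Fin (T.annularDegree + 1))

/-- All coordinates are positive. -/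
def Cell.IsInterior {T : CombType h n m} (t : T.Cell) : Prop :=
  (∀ i k, 0 < (t.1 i).1 k) ∧ ∀ k, 0 < t.2.1 k

end CombType

/-- The coordinates of a point of a simplex, as a sequence that is continued by zero. -/
def coord {k : ℕ} (t : stdSimplex ℝ (Fin k)) (a : ℕ) : ℝ := if ha : a < k then t.1 ⟨a, ha⟩ else 0

/-- Insert a zero at place `j`. -/
def coface (j : ℕ) (t : ℕ → ℝ) (a : ℕ) : ℝ :=
  if a < j then t a else if a = j then 0 else t (a - 1)

/-- The identifications between the cells and their faces. -/
def FaceStep {h n m : ℕ} (x y : Σ T : CombType h n m, T.Cell) : Prop :=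
  (∃ (i : Fin n) (j : ℕ), CombType.IsRadialFace i j x.1 y.1 ∧
    coord (x.2.1 i) = coface j (coord (y.2.1 i)) ∧
    (∀ k, k ≠ i → coord (x.2.1 k) = coord (y.2.1 k)) ∧
    coord x.2.2 = coord y.2.2) ∨
  (∃ j : ℕ, CombType.IsAnnularFace j x.1 y.1 ∧
    (∀ k, coord (x.2.1 k) = coord (y.2.1 k)) ∧
    coord x.2.2 = coface j (coord y.2.2))

/-- The harmonic compactification: the cell complex of possibly degenerate radial slit
configurations, with the quotient topology from the disjoint union of all cells. -/
def Rad (h n m : ℕ) : Type := Quot (FaceStep (h := h) (n := n) (m := m))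

instance (h n m : ℕ) : TopologicalSpace (Rad h n m) :=
  inferInstanceAs (TopologicalSpace (Quot (FaceStep (h := h) (n := n) (m := m))))

/-- The point of the harmonic compactification with given type and simplicial coordinates. -/
def Rad.mk {h n m : ℕ} (T : CombType h n m) (t : T.Cell) : Rad h n m := Quot.mk _ ⟨T, t⟩

/-- The unilevel harmonic compactification: the union of the closed cells of unilevel types. -/
abbrev URad (h n m : ℕ) : Type :=
  {x : Rad h n m // ∃ (T : CombType h n m) (t : T.Cell), T.Unilevel ∧ x = Rad.mk T t}

/-- Combinatorial types of unilevel radial slit configurations. -/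
abbrev UnilevelType (h n m : ℕ) : Type := {T : CombType h n m // T.Unilevel}

/-- The open cell of the unilevel harmonic compactification with index `T`. -/
def URad.openCell {h n m : ℕ} (T : UnilevelType h n m) : Set (URad h n m) :=
  {x | ∃ t : T.1.Cell, t.IsInterior ∧ x.1 = Rad.mk T.1 t}

end RadialSlit

/-! # Admissible fat graphs and Sullivan diagrams -/

namespace FatGraphs

/-- A fat graph: a finite combinatorial graph with a cyclic ordering of the half edges at each
vertex. The cyclic orderings are the cycles of the permutation `rot` of the half edges. -/
structure FatGraph : Type 1 where
  /-- vertices -/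
  V : Type
  /-- half edges -/
  H : Type
  finite_V : Finite V
  finite_H : Finite H
  /-- the source map -/
  src : H → V
  /-- the edge pairing -/
  inv : Equiv.Perm H
  inv_inv : ∀ a, inv (inv a) = a
  inv_ne : ∀ a, inv a ≠ a
  /-- the fat structure -/
  rot : Equiv.Perm H
  sameCycle_rot : ∀ a b, rot.SameCycle a b ↔ src a = src b

namespace FatGraph

variable (Γ : FatGraph)

/-- The permutation whose cycles are the boundary cycles. -/
def next : Equiv.Perm Γ.H := Γ.rot * Γ.inv

/-- The valence of a vertex. -/
def valence (v : Γ.V) : ℕ := Nat.card {a : Γ.H // Γ.src a = v}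

/-- The vertices `v` and `w` are joined by a path in the edges of the set `F` of half edges. -/
def Reach (F : Set Γ.H) : Γ.V → Γ.V → Prop :=
  Relation.EqvGen (fun v w => ∃ a ∈ F, Γ.src a = v ∧ Γ.src (Γ.inv a) = w)

/-- `F` is the set of half edges of a subgraph which is a forest: it is a union of edges, and no
edge of it lies on a cycle. -/
def IsForest (F : Set Γ.H) : Prop :=
  (∀ a ∈ F, Γ.inv a ∈ F) ∧
  ∀ a ∈ F, ¬ Γ.Reach (F \ {a, Γ.inv a}) (Γ.src a) (Γ.src (Γ.inv a))

end FatGraph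

/-- A closed fat graph with `n` incoming and `m` outgoing leaves. A leaf (a univalent vertex) is
given by the half edge that issues from it. -/
structure ClosedFatGraph (n m : ℕ) extends FatGraph where
  /-- the incoming and the outgoing leaves -/
  leaf : Fin n ⊕ Fin m → H
  valence_leaf : ∀ l, toFatGraph.valence (src (leaf l)) = 1
  three_le_valence : ∀ v, (∀ l, src (leaf l) ≠ v) → 3 ≤ toFatGraph.valence v
  existsUnique_leaf : ∀ a, ∃! l, toFatGraph.next.SameCycle (leaf l) a

namespace ClosedFatGraph

variable {n m : ℕ} (Γ : ClosedFatGraph n m)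

/-- The boundary cycle of the `i`-th incoming leaf without the two half edges of the leaf. -/
def circle (i : Fin n) : Set Γ.H :=
  {a | Γ.next.SameCycle (Γ.leaf (Sum.inl i)) a ∧
    a ≠ Γ.leaf (Sum.inl i) ∧ a ≠ Γ.inv (Γ.leaf (Sum.inl i))}

/-- The half edges of the edges on the boundary cycles of the incoming leaves (leaves excluded). -/
def admissibleEdges : Set Γ.H := {a | ∃ i, a ∈ Γ.circle i ∨ Γ.inv a ∈ Γ.circle i}

/-- The half edges of the edges leading to leaves. -/
def leafEdges : Set Γ.H := {a | ∃ l, a = Γ.leaf l ∨ a = Γ.inv (Γ.leaf l)}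

/-- The edges of the `i`-th admissible cycle, numbered `0, 1, 2, …` from the incoming leaf on.
The direction is opposite to that of the boundary cycle: for the inner boundary of an annulus it is
the counterclockwise one. -/
def circleEdge (i : Fin n) (k : ℕ) : Γ.H := (Γ.next⁻¹ ^ (k + 2)) (Γ.leaf (Sum.inl i))

end ClosedFatGraph

/-- Admissible fat graphs with `n` admissible cycles and `m` outgoing leaves, which are graphs in
cobordisms of Euler characteristic `-h` (so that `h = 2g - 2 + n + m` for connected ones of genus
`g`), every component of which has an incoming boundary component.

A boundary cycle without its leaf is an embedded circle if it does not visit a vertex or an edge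
twice. -/
structure AdmissibleFatGraph (h n m : ℕ) extends ClosedFatGraph n m where
  circle_injOn : ∀ i, Set.InjOn src (toClosedFatGraph.circle i)
  inv_notMem_circle : ∀ i, ∀ a ∈ toClosedFatGraph.circle i, inv a ∉ toClosedFatGraph.circle i
  circle_disjoint : ∀ i j, i ≠ j → ∀ a ∈ toClosedFatGraph.circle i,
    ∀ b ∈ toClosedFatGraph.circle j, src a ≠ src b
  reach_incoming : ∀ v, ∃ i, toFatGraph.Reach Set.univ (src (leaf (Sum.inl i))) v
  card_H : Nat.card H = 2 * (Nat.card V + h)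

/-- An identification of `Γ'` with the graph `Γ / F` obtained from `Γ` by collapsing the edges in
`F`. The boundary cycles of `Γ / F` are those of `Γ` with the half edges in `F` left out. -/
structure Collapse {n m : ℕ} (Γ Γ' : ClosedFatGraph n m) (F : Set Γ.H) where
  /-- the map on vertices -/
  onV : Γ.V → Γ'.V
  onV_surjective : Function.Surjective onV
  onV_eq_iff : ∀ v w, onV v = onV w ↔ Γ.Reach F v w
  /-- the bijection on the half edges which are not collapsed -/
  onH : {a : Γ.H // a ∉ F} ≃ Γ'.H
  src_onH : ∀ a, Γ'.src (onH a) = onV (Γ.src a.1)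
  inv_onH : ∀ a b : {a : Γ.H // a ∉ F}, Γ.inv a.1 = b.1 → Γ'.inv (onH a) = onH b
  next_onH : ∀ (a b : {a : Γ.H // a ∉ F}) (k : ℕ), (Γ.next ^ (k + 1)) a.1 = b.1 →
    (∀ j < k, (Γ.next ^ (j + 1)) a.1 ∈ F) → Γ'.next (onH a) = onH b
  onH_leaf : ∀ l, ∃ hl : Γ.leaf l ∉ F, onH ⟨Γ.leaf l, hl⟩ = Γ'.leaf l

section Metric

variable {h n m : ℕ}

/-- Length functions on an admissible fat graph, as functions of half edges. -/
structure IsLengthFunction (Γ : AdmissibleFatGraph h n m) (len : Γ.H → ℝ) : Prop where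
  mem_Icc : ∀ a, len a ∈ Set.Icc (0 : ℝ) 1
  len_inv : ∀ a, len (Γ.inv a) = len a
  len_leaf : ∀ a ∈ Γ.leafEdges, len a = 1
  forest : Γ.IsForest {a | len a = 0}
  collapse_admissible : ∃ Γ' : AdmissibleFatGraph h n m,
    Nonempty (Collapse Γ.toClosedFatGraph Γ'.toClosedFatGraph {a | len a = 0})
  sum_circle : ∀ i, ∑ᶠ a ∈ Γ.circle i, len a = 1

/-- The space of length functions on `Γ`. -/
def LengthFunction (Γ : AdmissibleFatGraph h n m) : Type :=
  {len : Γ.H → ℝ // IsLengthFunction Γ len}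

instance (Γ : AdmissibleFatGraph h n m) : TopologicalSpace (LengthFunction Γ) :=
  inferInstanceAs (TopologicalSpace {len : Γ.H → ℝ // IsLengthFunction Γ len})

/-- After collapsing the edges of length zero, the two metric fat graphs are isomorphic. -/
def MetricIso (x y : Σ Γ : AdmissibleFatGraph h n m, LengthFunction Γ) : Prop :=
  ∃ (Γ' : AdmissibleFatGraph h n m)
    (c : Collapse x.1.toClosedFatGraph Γ'.toClosedFatGraph {a | x.2.1 a = 0})
    (d : Collapse y.1.toClosedFatGraph Γ'.toClosedFatGraph {a | y.2.1 a = 0}),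
    ∀ a b, c.onH a = d.onH b → x.2.1 a.1 = y.2.1 b.1

variable (h n m) in
/-- The space of metric admissible fat graphs. -/
def MFat : Type 1 := Quot (MetricIso (h := h) (n := n) (m := m))

instance : TopologicalSpace (MFat h n m) :=
  inferInstanceAs (TopologicalSpace (Quot (MetricIso (h := h) (n := n) (m := m))))

/-- The metric admissible fat graph `(Γ, len)`. -/
def MFat.mk (Γ : AdmissibleFatGraph h n m) (len : LengthFunction Γ) : MFat h n m :=
  Quot.mk _ ⟨Γ, len⟩

/-- The relation generating the equivalence of metric admissible fat graphs under slides away from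
the admissible cycles. In an elementary slide, vertices slide along edges which do not belong to
the admissible cycles, all the way to the other ends of these edges: the edges in a forest `F`, none
of which belongs to an admissible cycle or leads to a leaf, are collapsed. (To slide an end of an
edge over a vertex, slide it up to that vertex, and then from that vertex on in another direction,
which is the inverse of an elementary slide.) The lengths of the edges on the admissible cycles stay
the same, and all other lengths are arbitrary; in particular, for `F = ∅`, they may be changed. -/
def SlideStep (x y : MFat h n m) : Prop :=
  ∃ (Γ Γ' : AdmissibleFatGraph h n m) (len : LengthFunction Γ) (len' : LengthFunction Γ')
    (F : Set Γ.H) (c : Collapse Γ.toClosedFatGraph Γ'.toClosedFatGraph F),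
    x = MFat.mk Γ len ∧ y = MFat.mk Γ' len' ∧
    Γ.IsForest F ∧ Disjoint F Γ.admissibleEdges ∧ Disjoint F Γ.leafEdges ∧
    ∀ a, a.1 ∈ Γ.admissibleEdges → len'.1 (c.onH a) = len.1 a.1

variable (h n m) in
/-- The space of (metric) Sullivan diagrams. -/
def SD : Type 1 := Quot (SlideStep (h := h) (n := n) (m := m))

instance : TopologicalSpace (SD h n m) :=
  inferInstanceAs (TopologicalSpace (Quot (SlideStep (h := h) (n := n) (m := m))))

/-- The Sullivan diagram represented by the metric admissible fat graph `(Γ, len)`. -/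
def SD.mk (Γ : AdmissibleFatGraph h n m) (len : LengthFunction Γ) : SD h n m :=
  Quot.mk _ (MFat.mk Γ len)

/-- Two Sullivan diagrams have the same combinatorial data if they differ only in the (positive)
lengths of the edges on the admissible cycles. -/
def SD.SameData (x y : SD h n m) : Prop :=
  ∃ (Γ : AdmissibleFatGraph h n m) (len len' : LengthFunction Γ),
    (∀ a ∈ Γ.admissibleEdges, 0 < len.1 a ∧ 0 < len'.1 a) ∧
    x = SD.mk Γ len ∧ y = SD.mk Γ len'

variable (h n m) in
/-- Non-metric Sullivan diagrams. -/
def NonMetricSD : Type 1 := Quot (SD.SameData (h := h) (n := n) (m := m))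

/-- The underlying non-metric Sullivan diagram. -/
def SD.toNonMetric (x : SD h n m) : NonMetricSD h n m := Quot.mk _ x

/-- The Sullivan diagrams with a given underlying non-metric Sullivan diagram. -/
def SD.openCell (G : NonMetricSD h n m) : Set (SD h n m) := {x | x.toNonMetric = G}

/-- `Γ` is the unfolded graph of the unilevel preconfiguration `L`: the admissible cycles are the
inner boundaries of the annuli, with the incoming leaves attached at the positive real lines. The
half edge `att x` is attached at the radial segment of the mark `x`, on the outside. For paired
slits the two half edges form an edge, and at a parametrization point there is an outgoing leaf. The
half edges on the same radial segment are attached in the order given by `L`: after the last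
of them comes the half edge of the admissible cycle going on counterclockwise. -/
def IsUnfoldedGraph (L : RadialSlit.PreConfig h n m) (Γ : AdmissibleFatGraph h n m) : Prop :=
  (∀ i, (Γ.circle i).ncard = L.radialDegree i + 1) ∧
  ∃ att : RadialSlit.Mark h m → Γ.H,
    Function.Injective att ∧
    (∀ x, att x ∉ Γ.admissibleEdges) ∧
    (∀ a, a ∈ Γ.admissibleEdges ∨ a ∈ Γ.leafEdges ∨ a ∈ Set.range att) ∧
    (∀ i, Γ.inv (att (Sum.inl i)) = att (Sum.inl (L.pairing i))) ∧
    (∀ p, Γ.inv (att (Sum.inr p)) = Γ.leaf (Sum.inr p)) ∧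
    (∀ x, Γ.src (att x) = Γ.src (Γ.inv (Γ.circleEdge (L.ann x) (L.radialPos x)))) ∧
    (∀ x, L.dist x = 0 → Γ.rot (att x) = att (L.succ x)) ∧
    (∀ x, L.dist x ≠ 0 → Γ.rot (att x) = Γ.inv (Γ.circleEdge (L.ann x) (L.radialPos x)))

end Metric

end FatGraphs

end

noncomputable section

open Sum (inl inr elim inl_injective)
open Function (update update_of_ne update_self Injective Surjective surjInv surjInv_eq comp_apply)
open Equiv (apply_symm_apply symm_apply_apply ofBijective swap swap_apply_of_ne_of_ne Perm)
open Equiv.Perm (SameCycle.refl SameCycle.trans mul_apply inv_eq_iff_eq iterate_eq_pow)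
open Finset (mem_range range mem_filter mem_erase mem_image mem_insert sum_congr sum_range_succ mem_univ mul_sum card_le_card sum_add_distrib sum_range coe_range card_pair sum_filter card_range card_erase_of_mem)
open Nat (lt_succ_iff mod_eq_of_lt mod_self lt_succ_of_le mod_lt strong_induction_on)
open Set (disjoint_left toFinite mem_ofPred_eq ncard_pair)
open Real (two_pi_pos pi)
open Subtype (ext_iff val_injective)
open RadialSlit.CombType (mk)

/-! # First returns of a permutation -/

namespace PermHit

variable {X : Type*}

/-- `Hit σ F a b`: iterating `σ` on `a` at least once, one reaches `b`, and all elements strictly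
between are in `F`. -/
inductive Hit (σ : Perm X) (F : Set X) (a : X) : X → Prop
  | base : Hit σ F a (σ a)
  | step {c : X} : Hit σ F a c → c ∈ F → Hit σ F a (σ c)

variable {σ : Perm X} {F : Set X} {a b c : X}

lemma Hit.of_eq (h : σ a = b) : Hit σ F a b := h ▸ Hit.base

lemma Hit.of_step (h : Hit σ F a c) (hc : c ∈ F) (hb : σ c = b) : Hit σ F a b := hb ▸ Hit.step h hc

lemma Hit.iff_pow : Hit σ F a b ↔ ∃ k : ℕ, (σ ^ (k + 1)) a = b ∧ ∀ j < k, (σ ^ (j + 1)) a ∈ F := by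
  constructor
  · intro h
    induction h with
    | base => exact ⟨0, by simp, by simp⟩
    | step _ hc ih =>
      obtain ⟨k, hk, hF⟩ := ih
      refine ⟨k + 1, by rw [pow_succ', mul_apply, hk], fun j hj => ?_⟩; grind
  · rintro ⟨k, hk, hF⟩
    induction k generalizing b with
    | zero => exact Hit.of_eq (by simpa using hk)
    | succ k ih =>
      refine Hit.of_step (ih rfl fun j hj => hF j (by omega)) (hF k (by omega)) ?_
      rw [← hk, pow_succ' σ (k + 1), mul_apply]

lemma Hit.mono (hF : F ⊆ F') (h : Hit σ F a b) : Hit σ F' a b := by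
  induction h with
  | base => exact Hit.base
  | step _ hc ih => exact Hit.step ih (hF hc)

lemma Hit.trans (h : Hit σ F a b) (hb : b ∈ F) (h' : Hit σ F b c) : Hit σ F a c := by
  induction h' with
  | base => exact Hit.step h hb
  | step _ hc ih => exact Hit.step ih hc

lemma Hit.sameCycle (h : Hit σ F a b) : σ.SameCycle a b := by
  induction h with
  | base => exact Equiv.Perm.sameCycle_apply_right.2 (SameCycle.refl _ _)
  | step _ _ ih => simp_all

lemma Hit.exists [Finite X] (σ) (ha : a ∉ F) : ∃ b, b ∉ F ∧ Hit σ F a b := by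
  by_contra! H
  have key : ∀ k : ℕ, Hit σ F a ((σ ^ (k + 1)) a) := by
    intro k
    induction k with
    | zero => exact Hit.of_eq (by simp)
    | succ k ih =>
      refine Hit.of_step ih (by_contra fun h => H _ h ih) ?_; rw [pow_succ' σ (k + 1), mul_apply]
  obtain ⟨N, hN, h1⟩ := (isOfFinOrder_of_finite σ).exists_pow_eq_one
  obtain ⟨k, rfl⟩ := Nat.exists_eq_succ_of_ne_zero hN.ne'
  exact H a ha (by simpa [Nat.succ_eq_add_one, h1] using key k)

lemma Hit.unique (h : Hit σ F a b) (hb : b ∉ F) (h' : Hit σ F a b') (hb' : b' ∉ F) : b = b' := by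
  grind [Hit.iff_pow]

lemma Hit.injective (h : Hit σ F a b) (ha : a ∉ F) (h' : Hit σ F a' b) (ha' : a' ∉ F) : a = a' := by
  obtain ⟨k, hk, hF⟩ := Hit.iff_pow.1 h
  obtain ⟨l, hl, hG⟩ := Hit.iff_pow.1 h'
  wlog hkl : k ≤ l generalizing a a' k l
  · grind
  obtain ⟨d, rfl⟩ := Nat.exists_eq_add_of_le hkl
  have : (σ ^ d) a' = a := by
    apply (σ ^ (k + 1)).injective; rw [hk, ← hl, ← mul_apply, ← pow_add]; congr 2; omega
  rcases d with _ | d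
  · simpa using this.symm
  grind

lemma sc_equiv (σ : Perm X) : Equivalence σ.SameCycle :=
  ⟨SameCycle.refl σ, Equiv.Perm.SameCycle.symm, SameCycle.trans⟩

lemma sc_apply (σ : Perm X) (a : X) : σ.SameCycle a (σ a) :=
  Equiv.Perm.sameCycle_apply_right.2 (SameCycle.refl _ _)

lemma sc_induct {R : Y → Y → Prop} (hR : Equivalence R) (f : X → Y)
    (hf : ∀ x, R (f x) (f (σ x))) (h : σ.SameCycle a b) : R (f a) (f b) := by
  obtain ⟨i, rfl⟩ := h
  induction i with
  | zero => simpa using hR.refl _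
  | succ n ih => rw [add_comm, zpow_add, zpow_one]; exact hR.trans ih (hf _)
  | pred n ih =>
    refine hR.trans ih (hR.symm ?_); have := hf ((σ ^ (-(n : ℤ) - 1)) a)
    rwa [← mul_apply, ← zpow_one_add, add_sub_cancel] at this

lemma step_of_forall_ne [Finite X] {R : Y → Y → Prop} (hR : Equivalence R)
    (f : X → Y) (z : X) (hf : ∀ x, x ≠ z → R (f x) (f (σ x))) (x : X) : R (f x) (f (σ x)) := by
  by_cases hx : x = z
  · subst hx; obtain ⟨b, hb, h⟩ := Hit.exists (a := x) (F := {x}ᶜ) σ⁻¹ (by simp)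
    simp only [Set.mem_compl_iff, Set.mem_singleton_iff, not_not] at hb; subst hb
    suffices H : ∀ c, Hit σ (({b} : Set X)ᶜ) b c → R (f (σ b)) (f c) by
      obtain ⟨d, hd, h'⟩ := Hit.exists (a := b) (F := {b}ᶜ) σ (by simp)
      simp only [Set.mem_compl_iff, Set.mem_singleton_iff, not_not] at hd; subst hd
      exact hR.symm (H d h')
    intro c hc
    induction hc with
    | base => exact hR.refl _
    | step _ hc ih => exact hR.trans ih (hf _ hc)
  · exact hf x hx

lemma sc_iff_of_hit [Finite X] {att : M → X} (hinj : Injective att)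
    (hF : ∀ x, att x ∉ F) (β : Perm M) (hβ : ∀ x, Hit σ F (att x) (att (β x))) {x y : M} :
    σ.SameCycle (att x) (att y) ↔ β.SameCycle x y := by
  constructor
  · intro h; obtain ⟨N, hN⟩ := h.exists_nat_pow_eq
    induction N using strong_induction_on generalizing x with
    | _ N ih =>
      rcases N.eq_zero_or_pos with rfl | hpos
      · rw [hinj (by simpa using hN : att x = att y)]
      obtain ⟨k, hk, hk'⟩ := Hit.iff_pow.1 (hβ x)
      have hle : k + 1 ≤ N := by
        by_contra hlt; obtain ⟨M, rfl⟩ := Nat.exists_eq_succ_of_ne_zero hpos.ne'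
        exact hF y (hN ▸ hk' M (by omega))
      obtain ⟨d, rfl⟩ := Nat.exists_eq_add_of_le hle
      have hd : (σ ^ d) (att (β x)) = att y := by rw [← hk, ← mul_apply, ← pow_add, add_comm d, hN]
      exact Equiv.Perm.sameCycle_apply_left.1 (ih d (by omega) (hd ▸ ⟨d, by simp⟩) hd)
  · exact fun h => sc_induct (sc_equiv σ) att (fun x => (hβ x).sameCycle) h

lemma ex_perm_hit [Finite X] {M : Type*} {att : M → X} (hinj : Injective att)
    (hF : ∀ x, x ∉ F ↔ x ∈ Set.range att) (σ : Perm X) :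
    ∃ β : Perm M, ∀ x, Hit σ F (att x) (att (β x)) := by
  have hatt : ∀ x, att x ∉ F := fun x => (hF _).2 ⟨x, rfl⟩
  have : ∀ x, ∃ y, Hit σ F (att x) (att y) := fun x => by
    obtain ⟨b, hb, h⟩ := Hit.exists σ (hatt x)
    grind
  choose β hβ using this; have : Finite M := Finite.of_injective att hinj
  have hb : Injective β := fun x y hxy => hinj ((hβ x).injective (hatt x) (hxy ▸ hβ y) (hatt y))
  exact ⟨ofBijective β (Finite.injective_iff_bijective.1 hb), hβ⟩

end PermHit

/-! # Collapses of fat graphs -/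

namespace FatGraphs

open PermHit

instance (G : FatGraph) : Finite G.H := G.finite_H
instance (G : FatGraph) : Finite G.V := G.finite_V

namespace FatGraph

variable (G : FatGraph)

lemma rot_inv (a) : G.rot a = G.next (G.inv a) := by simp [next, G.inv_inv]

lemma next_apply (a) : G.next a = G.rot (G.inv a) := rfl

lemma src_rot (a) : G.src (G.rot a) = G.src a := ((G.sameCycle_rot _ _).1 (sc_apply G.rot a)).symm

abbrev pair (a : G.H) : Set G.H := {a, G.inv a}

lemma reach_equiv (F) : Equivalence (G.Reach F) := Relation.EqvGen.is_equivalence _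

variable {G}

lemma Reach.of_mem (ha : a ∈ F) :
    G.Reach F (G.src a) (G.src (G.inv a)) := Relation.EqvGen.rel _ _ ⟨a, ha, rfl, rfl⟩

lemma Reach.induct {R : Y → Y → Prop} (hR : Equivalence R)
    (f : G.V → Y) (hf : ∀ a ∈ F, R (f (G.src a)) (f (G.src (G.inv a))))
    (h : G.Reach F v w) : R (f v) (f w) := by
  induction h with
  | rel _ _ h => grind
  | refl _ => exact hR.refl _
  | symm _ _ _ ih => exact hR.symm ih
  | trans _ _ _ _ _ ih1 ih2 => exact hR.trans ih1 ih2

lemma Reach.mono {F K : Set G.H} (hFG : F ⊆ K) {v w : G.V} (h : G.Reach F v w) : G.Reach K v w :=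
  Reach.induct (G.reach_equiv K) id (fun _ ha => Reach.of_mem (hFG ha)) h

lemma Reach.empty {v w : G.V} (h : G.Reach ∅ v w) : v = w :=
  Reach.induct eq_equivalence id (fun _ ha => ha.elim) h

end FatGraph

/-- A set of half edges which is a union of edges. -/
def InvClosed {G : FatGraph} (F : Set G.H) : Prop := ∀ a ∈ F, G.inv a ∈ F

lemma InvClosed.notMem {G : FatGraph} {F : Set G.H} (hF : InvClosed F) {a : G.H} (ha : a ∉ F) :
    G.inv a ∉ F := fun h => ha (G.inv_inv a ▸ hF _ h)

lemma ic_pair {G : FatGraph} (a) : InvClosed {a, G.inv a} := by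
  rintro b (rfl | rfl)
  · simp
  · simp [G.inv_inv]

namespace ClosedFatGraph

variable {n m : ℕ} (G : ClosedFatGraph n m)

lemma rot_leaf (l) : G.rot (G.leaf l) = G.leaf l := by
  have h := G.valence_leaf l
  have := (Nat.card_eq_one_iff_unique.1 h).1
  have h2 := this.elim ⟨G.leaf l, rfl⟩ ⟨G.rot (G.leaf l), G.src_rot _⟩
  exact (congrArg Subtype.val h2).symm

lemma eq_leaf_of_src (h : G.src a = G.src (G.leaf l)) : a = G.leaf l := by
  have := (Nat.card_eq_one_iff_unique.1 (G.valence_leaf l)).1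
  exact congrArg Subtype.val (this.elim ⟨a, h⟩ ⟨G.leaf l, rfl⟩)

lemma next_inv_leaf (l) : G.next (G.inv (G.leaf l)) = G.leaf l := by
  rw [FatGraph.next_apply, G.inv_inv, G.rot_leaf]

lemma sc_inv_leaf (l) : G.next.SameCycle (G.leaf l) (G.inv (G.leaf l)) := by
  have := sc_apply G.next (G.inv (G.leaf l))
  rw [G.next_inv_leaf] at this; exact this.symm

lemma leaf_eq_of_sc (h : G.next.SameCycle (G.leaf l) (G.leaf l')) : l = l' :=
  (G.existsUnique_leaf (G.leaf l')).unique h (SameCycle.refl _ _)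

lemma leaf_injective : Injective G.leaf := fun _ _ h => G.leaf_eq_of_sc (h ▸ SameCycle.refl _ _)

lemma leaf_ne_inv_leaf (l l' : Fin n ⊕ Fin m) : G.leaf l ≠ G.inv (G.leaf l') := fun h => by
  grind [ClosedFatGraph.leaf_eq_of_sc, ClosedFatGraph.sc_inv_leaf, FatGraph.inv_ne]

lemma ic_leaves : InvClosed G.leafEdges := by
  rintro a ⟨l, rfl | rfl⟩
  · exact ⟨l, .inr rfl⟩
  · exact ⟨l, .inl (G.inv_inv _)⟩

lemma ic_adm : InvClosed G.admissibleEdges := by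
  rintro a ⟨i, h | h⟩
  · exact ⟨i, .inr (by rwa [G.inv_inv])⟩
  · exact ⟨i, .inl h⟩

lemma circle_subset (i) : G.circle i ⊆ G.admissibleEdges := fun _ h => ⟨i, .inl h⟩

lemma notMem_leaves_of_mem_circle {i : Fin n} {a : G.H} (h : a ∈ G.circle i) : a ∉ G.leafEdges := by
  obtain ⟨h1, h2, h3⟩ := h
  rintro ⟨l, rfl | rfl⟩
  · have := G.leaf_eq_of_sc h1; exact h2 (by rw [this])
  · have := G.leaf_eq_of_sc (h1.trans (G.sc_inv_leaf l).symm); exact h3 (by rw [this])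

lemma disj_adm_leaves : Disjoint G.admissibleEdges G.leafEdges := by
  rw [disjoint_left]; rintro a ⟨i, h | h⟩ h'
  · exact G.notMem_leaves_of_mem_circle h h'
  · exact G.notMem_leaves_of_mem_circle h (G.ic_leaves _ h')

end ClosedFatGraph

namespace Collapse

variable {n m : ℕ} {G G' G'' : ClosedFatGraph n m} {F : Set G.H} (c : Collapse G G' F)

include c in
lemma leaf_notMem (l) : G.leaf l ∉ F := (c.onH_leaf l).1

lemma onH_leaf' (l h) : c.onH ⟨G.leaf l, h⟩ = G'.leaf l := (c.onH_leaf l).2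

lemma next_eq (h : Hit G.next F a.1 b.1) : G'.next (c.onH a) = c.onH b := by
  grind [Hit.iff_pow, Collapse.next_onH]

lemma hit_next (a : {a : G.H // a ∉ F}) :
    ∃ b, Hit G.next F a.1 b.1 ∧ G'.next (c.onH a) = c.onH b := by
  obtain ⟨b, hb, h⟩ := Hit.exists G.next a.2
  exact ⟨⟨b, hb⟩, h, c.next_eq (b := ⟨b, hb⟩) h⟩

lemma hit_of_next (h : G'.next (c.onH a) = c.onH b) : Hit G.next F a.1 b.1 := by
  obtain ⟨b', h1, h2⟩ := c.hit_next a
  simp_all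

lemma ex_onH (y) : ∃ a : {a : G.H // a ∉ F}, c.onH a = y := c.onH.surjective y

lemma sameCycle_iff : G'.next.SameCycle (c.onH a) (c.onH b) ↔ G.next.SameCycle a.1 b.1 := by
  let β : Perm {a : G.H // a ∉ F} := (c.onH.trans G'.next).trans c.onH.symm
  have hβ : ∀ x, Hit G.next F x.1 (β x).1 := fun x => c.hit_of_next (by simp [β])
  rw [sc_iff_of_hit (σ := G.next) val_injective (fun x => x.2) β hβ]
  constructor
  · intro h
    have := sc_induct (sc_equiv β) c.onH.symm (fun x => by
      have := sc_apply β (c.onH.symm x)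
      simpa [β] using this) h
    simpa using this
  · intro h
    exact sc_induct (sc_equiv G'.next) c.onH (fun x => by
      have := sc_apply G'.next (c.onH x)
      simpa [β] using this) h

lemma inv_eq (hF : InvClosed F) (a : {a : G.H // a ∉ F}) :
    G'.inv (c.onH a) = c.onH ⟨G.inv a.1, hF.notMem a.2⟩ := c.inv_onH _ _ rfl

lemma inv_eq' (ha : a ∉ F) (ha' : G.inv a ∉ F) :
    G'.inv (c.onH ⟨a, ha⟩) = c.onH ⟨G.inv a, ha'⟩ := c.inv_onH _ _ rfl

include c in
lemma inv_leaf_notMem (hF : InvClosed F) (l : Fin n ⊕ Fin m) :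
    G.inv (G.leaf l) ∉ F := hF.notMem (c.leaf_notMem l)

lemma onH_inv_leaf (l h) : c.onH ⟨G.inv (G.leaf l), h⟩ = G'.inv (G'.leaf l) := by
  rw [← c.onH_leaf' l (c.leaf_notMem l), c.inv_eq' _ h]

lemma onH_eq_leaf_iff (l) (a : {a : G.H // a ∉ F}) : c.onH a = G'.leaf l ↔ a.1 = G.leaf l := by
  rw [← c.onH_leaf' l (c.leaf_notMem l), c.onH.injective.eq_iff, ext_iff]

lemma onH_eq_inv_leaf_iff (hF : InvClosed F) (l)
    (a : {a : G.H // a ∉ F}) : c.onH a = G'.inv (G'.leaf l) ↔ a.1 = G.inv (G.leaf l) := by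
  rw [← c.onH_inv_leaf l (c.inv_leaf_notMem hF l), c.onH.injective.eq_iff, ext_iff]

lemma mem_circle_iff (hF : InvClosed F) (i) (a : {a : G.H // a ∉ F}) :
    c.onH a ∈ G'.circle i ↔ a.1 ∈ G.circle i := by
  simp only [ClosedFatGraph.circle, mem_ofPred_eq, ne_eq, c.onH_eq_leaf_iff,
    c.onH_eq_inv_leaf_iff hF]
  rw [← c.onH_leaf' _ (c.leaf_notMem _), c.sameCycle_iff]

lemma mem_adm (hF : InvClosed F) (a : {a : G.H // a ∉ F}) :
    c.onH a ∈ G'.admissibleEdges ↔ a.1 ∈ G.admissibleEdges := by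
  simp only [ClosedFatGraph.admissibleEdges, mem_ofPred_eq, c.inv_eq hF, c.mem_circle_iff hF]

lemma mem_leaves_iff (hF : InvClosed F) (a : {a : G.H // a ∉ F}) :
    c.onH a ∈ G'.leafEdges ↔ a.1 ∈ G.leafEdges := by
  simp only [ClosedFatGraph.leafEdges, mem_ofPred_eq, c.onH_eq_leaf_iff, c.onH_eq_inv_leaf_iff hF]

include c in
lemma notMem_leaves (hF : InvClosed F) (ha : a ∈ F) : a ∉ G.leafEdges := by
  rintro ⟨l, rfl | rfl⟩
  · exact c.leaf_notMem l ha
  · exact c.inv_leaf_notMem hF l ha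

/-- The half edges collapsed when first `F` and then `F'` is collapsed. -/
def pull (F' : Set G'.H) : Set G.H := {a | ∀ h : a ∉ F, c.onH ⟨a, h⟩ ∈ F'}

lemma subset_pull (F') : F ⊆ c.pull F' := fun _ ha h => absurd ha h

lemma mem_pull_iff (a : {a : G.H // a ∉ F}) : a.1 ∈ c.pull F' ↔ c.onH a ∈ F' :=
  ⟨fun h => h a.2, fun h _ => h⟩

lemma notMem_of_notMem_pull (h : a ∉ c.pull F') : a ∉ F := fun h' => h (c.subset_pull F' h')

lemma reach_iff (hF : InvClosed F) (F' : Set G'.H) {v w : G.V} :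
    G'.Reach F' (c.onV v) (c.onV w) ↔ G.Reach (c.pull F') v w := by
  constructor
  · intro h
    have key : ∀ v' w', G'.Reach F' v' w' → ∀ v w, c.onV v = v' → c.onV w = w' →
        G.Reach (c.pull F') v w := by
      have hE := G.reach_equiv (c.pull F')
      have h0 : ∀ v w, c.onV v = c.onV w → G.Reach (c.pull F') v w := fun v w h =>
        ((c.onV_eq_iff v w).1 h).mono (c.subset_pull F')
      intro v' w' h
      induction h with
      | rel v' w' h =>
        obtain ⟨b, hb, rfl, rfl⟩ := h
        obtain ⟨a, rfl⟩ := c.ex_onH b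
        intro v w hv hw
        rw [c.inv_eq hF, c.src_onH] at hw
        rw [c.src_onH] at hv
        exact hE.trans (h0 _ _ hv) (hE.trans
          (FatGraph.Reach.of_mem ((c.mem_pull_iff a).2 hb)) (hE.symm (h0 _ _ hw)))
      | refl v' => exact fun v w hv hw => h0 v w (hv.trans hw.symm)
      | symm v' w' _ ih => exact fun v w hv hw => hE.symm (ih w v hw hv)
      | trans v' u' w' _ _ ih1 ih2 =>
        intro v w hv hw
        obtain ⟨u, rfl⟩ := c.onV_surjective u'
        exact hE.trans (ih1 v u hv rfl) (ih2 u w rfl hw)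
    exact key _ _ h v w rfl rfl
  · refine FatGraph.Reach.induct (G'.reach_equiv F') c.onV fun a ha => ?_
    by_cases haF : a ∈ F
    · rw [(c.onV_eq_iff _ _).2 (FatGraph.Reach.of_mem haF)]
      exact (G'.reach_equiv F').refl _
    · have := FatGraph.Reach.of_mem (G := G'.toFatGraph) (ha haF)
      rwa [c.inv_eq hF, c.src_onH, c.src_onH] at this

lemma hit_expand (h : Hit G'.next F' (c.onH a) (c.onH b)) : Hit G.next (c.pull F') a.1 b.1 := by
  suffices H : ∀ y, Hit G'.next F' (c.onH a) y → ∀ b, c.onH b = y →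
      Hit G.next (c.pull F') a.1 b.1 from H _ h b rfl
  intro y hy
  induction hy with
  | base => exact fun b hb => (c.hit_of_next hb.symm).mono (c.subset_pull F')
  | @step z _ hz ih =>
    intro b hb; obtain ⟨z, rfl⟩ := c.ex_onH z
    grind [Hit.trans, Collapse.mem_pull_iff, Hit.mono, Collapse.subset_pull, Collapse.hit_of_next]

/-- The bijection on half edges for a composition of collapses. -/
def compH {F' : Set G'.H} (d : Collapse G' G'' F') : {a : G.H // a ∉ c.pull F'} ≃ G''.H :=
  ofBijective (fun a => d.onH ⟨c.onH ⟨a.1, c.notMem_of_notMem_pull a.2⟩,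
      fun h => a.2 ((c.mem_pull_iff ⟨a.1, _⟩).2 h)⟩) (by
    constructor
    · intro a b h; have := c.onH.injective (ext_iff.1 (d.onH.injective h))
      exact Subtype.ext (Subtype.mk.inj this)
    · intro y; obtain ⟨⟨z, hz⟩, rfl⟩ := d.ex_onH y; obtain ⟨a, rfl⟩ := c.ex_onH z
      exact ⟨⟨a.1, fun h => hz ((c.mem_pull_iff a).1 h)⟩, rfl⟩)

lemma compH_apply (d : Collapse G' G'' F') (a : {a : G.H // a ∉ c.pull F'})
    (h1) (h2) : c.compH d a = d.onH ⟨c.onH ⟨a.1, h1⟩, h2⟩ := rfl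

/-- Composition of collapses. -/
def comp (hF : InvClosed F) {F' : Set G'.H} (d : Collapse G' G'' F')  :
    Collapse G G'' (c.pull F') where
  onV := d.onV ∘ c.onV
  onV_surjective := d.onV_surjective.comp c.onV_surjective
  onV_eq_iff v w := by rw [comp_apply, comp_apply, d.onV_eq_iff, c.reach_iff hF]
  onH := c.compH d
  src_onH a := by
    have h1 := c.notMem_of_notMem_pull a.2
    have h2 : c.onH ⟨a.1, h1⟩ ∉ F' := fun h => a.2 ((c.mem_pull_iff ⟨a.1, _⟩).2 h)
    rw [c.compH_apply d a h1 h2, d.src_onH, c.src_onH, comp_apply]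
  inv_onH a b h := d.inv_onH _ _ (c.inv_onH _ _ h)
  next_onH a b k h1 h2 := by
    have hit : Hit G.next (c.pull F') a.1 b.1 := Hit.iff_pow.2 ⟨k, h1, h2⟩
    have ha : c.onH ⟨a.1, c.notMem_of_notMem_pull a.2⟩ ∉ F' :=
      fun h => a.2 ((c.mem_pull_iff ⟨a.1, _⟩).2 h)
    obtain ⟨y, hy, hit'⟩ := Hit.exists G'.next ha
    obtain ⟨b', rfl⟩ := c.ex_onH y
    have h3 := c.hit_expand hit'
    have hb' : b'.1 ∉ c.pull F' := fun h => hy ((c.mem_pull_iff b').1 h)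
    have := hit.unique b.2 h3 hb'
    apply d.next_eq; grind
  onH_leaf l := by
    refine ⟨fun h => d.leaf_notMem l ?_, ?_⟩
    · rw [← c.onH_leaf' l (c.leaf_notMem l)]; exact h _
    · have : ∀ x hx, x = G'.leaf l → d.onH ⟨x, hx⟩ = G''.leaf l := by
        rintro x hx rfl; exact d.onH_leaf' l hx
      exact this _ _ (c.onH_leaf' l _)

/-- The image in `G'` of a set of half edges of `G` containing the collapsed ones. -/
def push (E : Set G.H) : Set G'.H := {y | (c.onH.symm y).1 ∈ E}

lemma mem_push_iff (a : {a : G.H // a ∉ F}) : c.onH a ∈ c.push E ↔ a.1 ∈ E := by simp [push]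

lemma pull_push (h : F ⊆ E) : c.pull (c.push E) = E := by
  ext a; by_cases ha : a ∈ F
  · exact ⟨fun _ => h ha, fun _ h' => absurd ha h'⟩
  · rw [c.mem_pull_iff ⟨a, ha⟩, c.mem_push_iff]

lemma ic_push (hF : InvClosed F) (hE : InvClosed E) : InvClosed (c.push E) := by
  intro y hy; obtain ⟨a, rfl⟩ := c.ex_onH y
  rw [c.inv_eq hF, c.mem_push_iff]; exact hE _ ((c.mem_push_iff a).1 hy)

lemma notMem_of_notMem_push (h : y ∉ c.push E) : (c.onH.symm y).1 ∉ E := h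

/-- The bijection on half edges for a collapse after a collapse. -/
def factorH {E : Set G.H} (d : Collapse G G'' E) (hFE : F ⊆ E) :
    {y : G'.H // y ∉ c.push E} ≃ G''.H :=
  ofBijective (fun y => d.onH ⟨(c.onH.symm y.1).1, c.notMem_of_notMem_push y.2⟩) (by
    constructor
    · intro a b h; have := congrArg Subtype.val (d.onH.injective h)
      exact Subtype.ext (c.onH.symm.injective (Subtype.ext this))
    · intro y; obtain ⟨a, rfl⟩ := d.ex_onH y; refine ⟨⟨c.onH ⟨a.1, fun h => a.2 (hFE h)⟩, ?_⟩, ?_⟩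
      · rw [c.mem_push_iff]; exact a.2
      · simp)

lemma factorH_apply (d : Collapse G G'' E) (hFE) (a : {a : G.H // a ∉ F})
    (h1) (h2) : c.factorH d hFE ⟨c.onH a, h1⟩ = d.onH ⟨a.1, h2⟩ := by
  have : ∀ x hx, x = a.1 → d.onH ⟨x, hx⟩ = d.onH ⟨a.1, h2⟩ := by rintro x hx rfl; rfl
  exact this _ _ (by simp)

/-- If `F ⊆ E` and both can be collapsed, then `E` can be collapsed after `F`. -/
def factor (hF : InvClosed F) {E : Set G.H} (d : Collapse G G'' E) (hFE : F ⊆ E) :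
    Collapse G' G'' (c.push E) where
  onV v := d.onV (surjInv c.onV_surjective v)
  onV_surjective w := by
    obtain ⟨v, rfl⟩ := d.onV_surjective w
    refine ⟨c.onV v, (d.onV_eq_iff _ _).2 (FatGraph.Reach.mono hFE ((c.onV_eq_iff _ _).1 ?_))⟩
    exact surjInv_eq _ _
  onV_eq_iff v w := by
    rw [d.onV_eq_iff]
    nth_rw 1 [← c.pull_push hFE]
    rw [← c.reach_iff hF, surjInv_eq c.onV_surjective, surjInv_eq c.onV_surjective]
  onH := c.factorH d hFE
  src_onH y := by
    obtain ⟨y, hy⟩ := y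
    obtain ⟨a, rfl⟩ := c.ex_onH y
    rw [c.factorH_apply d hFE a hy (by rwa [c.mem_push_iff] at hy), d.src_onH, c.src_onH]
    refine (d.onV_eq_iff _ _).2 (FatGraph.Reach.mono hFE ((c.onV_eq_iff _ _).1 ?_))
    exact (surjInv_eq _ _).symm
  inv_onH y z h := by
    obtain ⟨y, hy⟩ := y
    obtain ⟨a, rfl⟩ := c.ex_onH y
    obtain ⟨z, hz⟩ := z
    obtain ⟨b, rfl⟩ := c.ex_onH z
    rw [c.factorH_apply d hFE a hy (by rwa [c.mem_push_iff] at hy),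
      c.factorH_apply d hFE b hz (by rwa [c.mem_push_iff] at hz)]
    refine d.inv_onH _ _ ?_
    have h : G'.inv (c.onH a) = c.onH b := h
    rw [c.inv_eq hF] at h
    exact congrArg Subtype.val (c.onH.injective h)
  next_onH y z k h1 h2 := by
    have hit : Hit G'.next (c.push E) y.1 z.1 := Hit.iff_pow.2 ⟨k, h1, h2⟩
    obtain ⟨y, hy⟩ := y
    obtain ⟨a, rfl⟩ := c.ex_onH y
    obtain ⟨z, hz⟩ := z
    obtain ⟨b, rfl⟩ := c.ex_onH z
    rw [c.factorH_apply d hFE a hy (by rwa [c.mem_push_iff] at hy),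
      c.factorH_apply d hFE b hz (by rwa [c.mem_push_iff] at hz)]
    refine d.next_eq ?_
    have := c.hit_expand hit
    rwa [c.pull_push hFE] at this
  onH_leaf l := by
    have h : G'.leaf l ∉ c.push E := by
      rw [← c.onH_leaf' l (c.leaf_notMem l), c.mem_push_iff]; exact d.leaf_notMem l
    refine ⟨h, ?_⟩
    have : ∀ y (hy : y ∉ c.push E), y = c.onH ⟨G.leaf l, c.leaf_notMem l⟩ →
        c.factorH d hFE ⟨y, hy⟩ = G''.leaf l := by
      rintro y hy rfl
      rw [c.factorH_apply d hFE _ hy (d.leaf_notMem l), d.onH_leaf']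
    exact this _ _ (c.onH_leaf' l _).symm

lemma nonempty_of_equiv (e : G.H ≃ G'.H) (he_rot : ∀ a, G'.rot (e a) = e (G.rot a))
    (he_inv : ∀ a, G'.inv (e a) = e (G.inv a)) (he_leaf : ∀ l, e (G.leaf l) = G'.leaf l)
    (hs : Surjective G.src) (hs' : Surjective G'.src) :
    ∃ c : Collapse G G' ∅, ∀ a, c.onH a = e a.1 := by
  have hrot : ∀ a b, G'.src (e a) = G'.src (e b) ↔ G.src a = G.src b := by
    intro a b; rw [← G'.sameCycle_rot, ← G.sameCycle_rot]; constructor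
    · intro h
      have := sc_induct (sc_equiv G.rot) e.symm (fun x => by
        have := sc_apply G.rot (e.symm x)
        grind) h
      simpa using this
    · exact fun h => sc_induct (sc_equiv G'.rot) e (fun x => by
        rw [← he_rot]; exact sc_apply G'.rot (e x)) h
  have hV : ∀ a, G'.src (e (surjInv hs (G.src a))) = G'.src (e a) := fun a =>
    (hrot _ _).2 (surjInv_eq hs _)
  refine ⟨⟨fun v => G'.src (e (surjInv hs v)), ?_, ?_,
    ⟨fun a => e a.1, fun b => ⟨e.symm b, by simp⟩, fun a => by simp, fun b => by simp⟩,
    fun a => (hV _).symm, ?_, ?_, ?_⟩, fun a => rfl⟩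
  · intro v; obtain ⟨b, rfl⟩ := hs' v; exact ⟨G.src (e.symm b), (hV _).trans (by simp)⟩
  · intro v w; obtain ⟨a, rfl⟩ := hs v; obtain ⟨b, rfl⟩ := hs w; rw [hV, hV, hrot]
    exact ⟨fun h => h ▸ (G.reach_equiv ∅).refl _, FatGraph.Reach.empty⟩
  · intro a b h; simp [he_inv, h]
  · intro a b k h1 h2; rcases k with _ | k
    · have h3 : G.next a.1 = b.1 := by simpa using h1
      simp only [Equiv.coe_fn_mk, ← h3, FatGraph.next_apply, he_inv, he_rot]
    · exact (h2 0 (by omega)).elim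
  grind

lemma rot_eq (hF : InvClosed F)
    (h : Hit G.next F (G.inv a.1) b.1) : G'.rot (c.onH a) = c.onH b := by
  rw [FatGraph.rot_inv, c.inv_eq hF]; exact c.next_eq (a := ⟨G.inv a.1, _⟩) h

lemma rot_eq_of_rot (hF : InvClosed F) {a b : G.H} (ha : a ∉ F) (hb : b ∉ F)
    (h : G.rot a = b) : G'.rot (c.onH ⟨a, ha⟩) = c.onH ⟨b, hb⟩ :=
  c.rot_eq hF (Hit.of_eq (by rw [← FatGraph.rot_inv]; exact h))

end Collapse

abbrev AdmissibleFatGraph.Collapse {h n m : ℕ} (G G' : AdmissibleFatGraph h n m) :=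
  FatGraphs.Collapse G.toClosedFatGraph G'.toClosedFatGraph

lemma src_surjective (G : AdmissibleFatGraph h n m) : Surjective G.src := by
  intro v; by_cases hv : ∃ l, G.src (G.leaf l) = v
  · grind
  · push Not at hv; have := G.three_le_valence v hv
    have : 0 < Nat.card {a : G.H // G.src a = v} := by unfold FatGraph.valence at this; omega
    obtain ⟨a, ha⟩ := (Nat.card_pos_iff.1 this).1
    exact ⟨a, ha⟩

lemma InvClosed.sdiff_pair {G : FatGraph} {F : Set G.H} {a : G.H} (hF : InvClosed F) (ha : a ∈ F) :
    InvClosed (F \ G.pair a) ∧ (F \ G.pair a).ncard + 2 = F.ncard := by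
  refine ⟨fun b hb => ⟨hF b hb.1, fun h => hb.2 ?_⟩, ?_⟩
  · simpa [G.inv_inv] using ic_pair a _ h
  · rw [← ncard_pair (G.inv_ne a).symm]
    exact Set.ncard_sdiff_add_ncard_of_subset (by rintro b (rfl | rfl); exacts [ha, hF _ ha])

lemma card_quot_le {G : FatGraph} (F : Set G.H) (hF : InvClosed F) {V' : Type*} [Finite V']
    (f : G.V → V') (hf : ∀ v w, f v = f w → G.Reach F v w) :
    2 * Nat.card G.V ≤ 2 * Nat.card V' + F.ncard := by
  induction hk : F.ncard using strong_induction_on generalizing F V' with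
  | _ k ih =>
    rcases F.eq_empty_or_nonempty with rfl | ⟨a, ha⟩
    · have := Nat.card_le_card_of_injective f fun v w h => FatGraph.Reach.empty (hf v w h)
      omega
    obtain ⟨h1, h2⟩ := hF.sdiff_pair ha
    set K := F \ G.pair a
    have hE := G.reach_equiv K
    have hR := hE.refl
    have hS := @hE.symm
    have hT := @hE.trans
    have key : ∀ v w, G.Reach F v w → G.Reach K v w ∨
        (G.Reach K v (G.src a) ∨ G.Reach K v (G.src (G.inv a))) ∧
        (G.Reach K w (G.src a) ∨ G.Reach K w (G.src (G.inv a))) := by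
      intro v w h
      induction h with
      | rel v w h =>
        obtain ⟨b, hb, rfl, rfl⟩ := h
        by_cases hba : b ∈ G.pair a
        · rcases hba with rfl | rfl
          · grind
          · rw [G.inv_inv]; grind
        · exact .inl (FatGraph.Reach.of_mem ⟨hb, hba⟩)
      | refl v => exact .inl (hR _)
      | symm v w _ ih => grind
      | trans u v w _ _ ih1 ih2 => grind
    classical
    have h3 := ih K.ncard (by omega) K h1
      (fun v => if G.Reach K v (G.src a) then none else some (f v)) (fun v w h => by grind) rfl
    rw [Finite.card_option] at h3
    omega

lemma Collapse.isForest {h n m : ℕ} {G G' : AdmissibleFatGraph h n m} {F : Set G.H}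
    (c : G.Collapse G' F) (hF : InvClosed F) :
    G.IsForest F := by
  refine ⟨hF, fun a ha hr => ?_⟩
  have hE := G.reach_equiv (F \ G.pair a)
  obtain ⟨h1, h2⟩ := hF.sdiff_pair ha
  have h1 := card_quot_le _ h1 c.onV fun v w h => by
    refine FatGraph.Reach.induct hE id (fun b hb => ?_) ((c.onV_eq_iff v w).1 h)
    by_cases hba : b ∈ G.pair a
    · rcases hba with rfl | rfl
      · exact hr
      · rw [G.inv_inv]; exact hE.symm hr
    · exact FatGraph.Reach.of_mem ⟨hb, hba⟩
  have h3 : Nat.card G'.H + F.ncard = Nat.card G.H := by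
    rw [← Nat.card_congr c.onH, ← Set.ncard_add_ncard_compl F, add_comm]; rfl
  have := G.card_H
  have := G'.card_H
  omega

end FatGraphs

open FatGraphs.FatGraph (Reach.of_mem Reach.induct Reach.mono)

/-! # Contraction of an edge -/

namespace FatGraphs

open PermHit

namespace ClosedFatGraph

variable {n m : ℕ} (G : ClosedFatGraph n m)

lemma valence_eq_ncard (v) : G.valence v = {x | G.src x = v}.ncard := rfl

lemma src_ne_leaf {a : G.H} (ha : a ∉ G.leafEdges) (l) : G.src (G.leaf l) ≠ G.src a :=
  fun h => ha ⟨l, .inl (G.eq_leaf_of_src h.symm)⟩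

lemma rot_ne_self {a : G.H} (ha : ∀ l, G.src (G.leaf l) ≠ G.src a) : G.rot a ≠ a := by
  intro h; have h3 := G.three_le_valence _ ha
  rw [valence_eq_ncard] at h3
  have : {x | G.src x = G.src a} ⊆ {a} := fun x hx => by
    have hc : G.rot.SameCycle a x := (G.sameCycle_rot _ _).2 (Eq.symm hx)
    exact (hc.eq_of_left h).symm
  have := Set.ncard_le_ncard this (Set.finite_singleton a)
  rw [Set.ncard_singleton] at this; omega

/-- The vertices after the contraction of an edge issuing from `p`. -/
def mergeV {V : Type*} {p q : V} (hpq : p ≠ q) (v : V) : {v // v ≠ p} :=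
  open Classical in if h : v = p then ⟨q, hpq.symm⟩ else ⟨v, h⟩

lemma mergeV_eq_iff (hpq : p ≠ q) (v w) :
    mergeV hpq v = mergeV hpq w ↔ v = w ∨ (v = p ∧ w = q) ∨ (v = q ∧ w = p) := by
  unfold mergeV; grind

lemma mergeV_surjective (hpq : p ≠ q) :
    Surjective (mergeV hpq) := fun v => ⟨v.1, by simp [mergeV, v.2]⟩

variable {G} {a : G.H}

/-- The involution after the contraction of `a`. -/
def ctrInv (a : G.H) : Perm {x : G.H // x ∉ G.pair a} :=
  G.inv.subtypePerm fun x => not_congr ⟨fun h => by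
    have := ic_pair a _ h; rwa [G.inv_inv] at this, fun h => ic_pair a _ h⟩

section

variable (hne : G.src a ≠ G.src (G.inv a)) (hleaf : a ∉ G.leafEdges)
  (β : Perm {x : G.H // x ∉ G.pair a})
  (hβ : ∀ x, Hit G.next {a, G.inv a} x.1 (β x).1)

include hβ

lemma ctr_rot {x y : {x : G.H // x ∉ G.pair a}}
    (h : Hit G.next {a, G.inv a} (G.inv x.1) y.1) : (β * ctrInv a) x = y := by
  apply Subtype.ext; exact (hβ (ctrInv a x)).unique (β (ctrInv a x)).2 h y.2

lemma ctr_rot' {x y : {x : G.H // x ∉ G.pair a}} (h : G.rot x.1 = y.1) : (β * ctrInv a) x = y :=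
  ctr_rot β hβ (Hit.of_eq (by rw [← G.rot_inv, h]))

include hne hleaf

lemma ctr_sc (x y : {x : G.H // x ∉ G.pair a}) :
    (β * ctrInv a).SameCycle x y ↔ mergeV hne (G.src x.1) = mergeV hne (G.src y.1) := by
  have hleaf' : G.inv a ∉ G.leafEdges := G.ic_leaves.notMem hleaf
  have hra : G.rot a ∉ G.pair a := by
    grind [ClosedFatGraph.rot_ne_self, ClosedFatGraph.src_ne_leaf, FatGraph.src_rot]
  have hrb : G.rot (G.inv a) ∉ G.pair a := by
    grind [FatGraph.src_rot, ClosedFatGraph.rot_ne_self, ClosedFatGraph.src_ne_leaf]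
  set ρ := β * ctrInv a with hρ
  have hrota : ∀ x, G.rot x.1 = a → ρ x = ⟨G.rot (G.inv a), hrb⟩ := fun x hx =>
    ctr_rot β hβ (Hit.of_step (Hit.of_eq (by rw [← G.rot_inv, hx])) (.inl rfl) rfl)
  have hrotb : ∀ x, G.rot x.1 = (G.inv a) → ρ x = ⟨G.rot a, hra⟩ := fun x hx =>
    ctr_rot β hβ (Hit.of_step (Hit.of_eq (by rw [← G.rot_inv, hx])) (.inr rfl)
      (by rw [G.next_apply, G.inv_inv]))
  have hR := sc_equiv ρ
  constructor
  · refine sc_induct (R := Eq) eq_equivalence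
      (fun x : {x : G.H // x ∉ G.pair a} => mergeV hne (G.src x.1)) fun x => ?_
    rw [mergeV_eq_iff]; by_cases h1 : G.rot x.1 = a
    · grind [FatGraph.src_rot]
    by_cases h2 : G.rot x.1 = (G.inv a)
    · grind [FatGraph.src_rot]
    rw [show ρ x = ⟨G.rot x.1, by rintro (h | h); exacts [h1 h, h2 h]⟩ from
      ctr_rot' β hβ rfl, G.src_rot]
    exact .inl rfl
  · classical
    let f : G.H → {x : G.H // x ∉ ({a, (G.inv a)} : Set G.H)} := fun x =>
      if h : x ∉ ({a, (G.inv a)} : Set G.H) then ⟨x, h⟩ else if x = a then ⟨G.rot a, hra⟩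
      else ⟨G.rot (G.inv a), hrb⟩
    have hba : (G.inv a) ≠ a := G.inv_ne a
    have hf : ∀ x (h : x ∉ ({a, (G.inv a)} : Set G.H)), f x = ⟨x, h⟩ := fun x h => dif_pos h
    have hfa : f a = ⟨G.rot a, hra⟩ := by simp [f]
    have hfb : f (G.inv a) = ⟨G.rot (G.inv a), hrb⟩ := by simp [f, hba]
    have hstep : ∀ x, G.rot x ≠ a → G.rot x ≠ (G.inv a) → ρ.SameCycle (f x) (f (G.rot x)) := by
      intro x h1 h2; by_cases h3 : x = a
      · subst h3; rw [hfa, hf _ hra]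
      by_cases h4 : x = (G.inv a)
      · rw [h4, hfb, hf _ hrb]
      have hx : x ∉ ({a, (G.inv a)} : Set G.H) := by rintro (h | h); exacts [h3 h, h4 h]
      have hrx : G.rot x ∉ ({a, (G.inv a)} : Set G.H) := by rintro (h | h); exacts [h1 h, h2 h]
      rw [hf _ hx, hf _ hrx, ← show ρ ⟨x, hx⟩ = ⟨G.rot x, hrx⟩ from ctr_rot' β hβ rfl]
      exact sc_apply ρ _
    have hB : ∀ x, G.src x = G.src (G.inv a) → ρ.SameCycle (f (G.inv a)) (f x) := by
      intro x hx
      let g : G.H → {x : G.H // x ∉ ({a, (G.inv a)} : Set G.H)} := fun x =>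
        if G.src x = G.src (G.inv a) then f x else f (G.inv a)
      have hg : ∀ x, ρ.SameCycle (g x) (g (G.rot x)) := by
        refine step_of_forall_ne hR g (G.rot.symm (G.inv a)) fun x hxz => ?_
        simp only [g, G.src_rot]; split_ifs with h
        · refine hstep x (fun h' => hne ?_) fun h' => hxz ?_
          · rw [← h]; exact (G.src_rot x).symm.trans (congrArg G.src h') |>.symm
          · rw [← h']; simp
        · exact hR.refl _
      have := sc_induct hR g hg ((G.sameCycle_rot (G.inv a) x).2 hx.symm)
      simpa only [g, hx, if_true] using this
    have hab : ρ.SameCycle (f (G.inv a)) (f a) := by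
      have hz : G.rot.symm (G.inv a) ∉ ({a, (G.inv a)} : Set G.H) := by
        rintro (h | h)
        · have := congrArg G.rot h; rw [apply_symm_apply] at this
          exact hne (by rw [← G.src_rot a, ← this])
        · have h : G.rot.symm (G.inv a) = (G.inv a) := h; have := congrArg G.rot h
          rw [apply_symm_apply] at this; exact hrb (.inr this.symm)
      have h1 := hB (G.rot.symm (G.inv a)) (by rw [← G.src_rot]; simp)
      rw [hf _ hz] at h1; have h2 := sc_apply ρ ⟨_, hz⟩
      rw [hrotb ⟨_, hz⟩ (by simp), ← hfa] at h2; exact h1.trans h2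
    have hall : ∀ x, ρ.SameCycle (f x) (f (G.rot x)) := by
      intro x; by_cases h3 : x = a
      · subst h3; rw [hfa, hf _ hra]
      by_cases h4 : x = (G.inv a)
      · rw [h4, hfb, hf _ hrb]
      have hx : x ∉ ({a, (G.inv a)} : Set G.H) := by rintro (h | h); exacts [h3 h, h4 h]
      by_cases h1 : G.rot x = a
      · have := sc_apply ρ ⟨x, hx⟩; rw [hrota ⟨x, hx⟩ h1, ← hfb] at this; rw [hf _ hx, h1]
        exact this.trans hab
      by_cases h2 : G.rot x = (G.inv a)
      · have := sc_apply ρ ⟨x, hx⟩; rw [hrotb ⟨x, hx⟩ h2, ← hfa] at this; rw [hf _ hx, h2]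
        exact this.trans hab.symm
      exact hstep x h1 h2
    have hsrc : ∀ x y, G.src x = G.src y → ρ.SameCycle (f x) (f y) := fun x y h =>
      sc_induct hR f hall ((G.sameCycle_rot x y).2 h)
    intro h; have hx' : f x.1 = x := hf x.1 x.2
    have hy' : f y.1 = y := hf y.1 y.2
    rw [← hx', ← hy']; rcases (mergeV_eq_iff hne _ _).1 h with h | ⟨h1, h2⟩ | ⟨h1, h2⟩
    · exact hsrc _ _ h
    · exact (hsrc _ _ h1).trans (hab.symm.trans (hsrc _ _ h2.symm))
    · exact (hsrc _ _ h1).trans (hab.trans (hsrc _ _ h2.symm))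

/-- The fat graph obtained by contracting the edge `a`. -/
def ctrFatGraph : FatGraph where
  V := {v // v ≠ G.src a}
  H := {x : G.H // x ∉ G.pair a}
  finite_V := inferInstance
  finite_H := inferInstance
  src x := mergeV hne (G.src x.1)
  inv := ctrInv a
  inv_inv _ := Subtype.ext (G.inv_inv _)
  inv_ne x h := G.inv_ne x.1 (congrArg Subtype.val h)
  rot := β * ctrInv a
  sameCycle_rot := ctr_sc hne hleaf β hβ

lemma ctr_next : (ctrFatGraph hne hleaf β hβ).next = β := by
  ext x : 1; change β (ctrInv a (ctrInv a x)) = β x; congr 1; exact Subtype.ext (G.inv_inv _)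

lemma ctr_valence_eq (v) (h1 : v ≠ G.src a) (h2 : v ≠ G.src (G.inv a)) :
    (ctrFatGraph hne hleaf β hβ).valence (mergeV hne v) = G.valence v := by
  refine Nat.card_congr ⟨fun x => ⟨x.1.1, ?_⟩, fun x => ⟨⟨x.1, ?_⟩, ?_⟩, fun x => rfl, fun x => rfl⟩
  · have := (mergeV_eq_iff hne _ _).1 x.2
    tauto
  · rintro (h | h)
    · exact h1 (by rw [← x.2, h])
    · exact h2 (by rw [← x.2, h])
  · exact congrArg (mergeV hne) x.2

lemma ctr_three_le : 3 ≤ (ctrFatGraph hne hleaf β hβ).valence (mergeV hne (G.src (G.inv a))) := by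
  have ha := G.three_le_valence _ (G.src_ne_leaf hleaf)
  have hb := G.three_le_valence _ (G.src_ne_leaf (G.ic_leaves.notMem hleaf))
  rw [valence_eq_ncard] at ha hb
  set A := {x | G.src x = G.src a}
  set B := {x | G.src x = G.src (G.inv a)}
  have hAB : Disjoint A B := by
    rw [disjoint_left]
    intro x hx hx'
    exact hne (Eq.trans (Eq.symm hx) hx')
  have hpair : ({a, G.inv a} : Set G.H).ncard = 2 := ncard_pair (G.inv_ne a).symm
  have hsub : ({a, G.inv a} : Set G.H) ⊆ A ∪ B := by
    rintro b (rfl | rfl); exacts [.inl rfl, .inr rfl]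
  have h1 := Set.ncard_union_eq hAB
  have h2 := Set.ncard_sdiff_add_ncard_of_subset hsub
  have h3 : (ctrFatGraph hne hleaf β hβ).valence (mergeV hne (G.src (G.inv a))) =
      ((A ∪ B) \ {a, G.inv a}).ncard := by
    refine Nat.card_congr ⟨fun x => ⟨x.1.1, ?_, x.1.2⟩, fun x => ⟨⟨x.1, x.2.2⟩, ?_⟩,
      fun x => rfl, fun x => rfl⟩
    · have := (mergeV_eq_iff hne _ _).1 x.2
      rcases this with h | h | h
      · exact .inr h
      · exact .inl h.1
      · exact .inr h.1
    · refine (mergeV_eq_iff hne _ _).2 ?_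
      rcases x.2.1 with h | h
      · exact .inr (.inl ⟨h, rfl⟩)
      · exact .inl h
  omega

/-- The closed fat graph obtained by contracting the edge `a`. -/
def ctrClosed : ClosedFatGraph n m where
  toFatGraph := ctrFatGraph hne hleaf β hβ
  leaf l := ⟨G.leaf l, by
    rintro (h | h)
    · exact hleaf ⟨l, .inl h.symm⟩
    · exact G.ic_leaves.notMem hleaf ⟨l, .inl (Eq.symm h)⟩⟩
  valence_leaf l := by
    have := ctr_valence_eq hne hleaf β hβ _ (G.src_ne_leaf hleaf l)
      (G.src_ne_leaf (G.ic_leaves.notMem hleaf) l)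
    rw [G.valence_leaf] at this; exact this
  three_le_valence v hv := by
    obtain ⟨v, rfl⟩ := mergeV_surjective hne v
    by_cases h1 : v = G.src a
    · have h2 : mergeV hne v = mergeV hne (G.src (G.inv a)) :=
        (mergeV_eq_iff hne _ _).2 (.inr (.inl ⟨h1, rfl⟩))
      rw [h2]; exact ctr_three_le hne hleaf β hβ
    by_cases h2 : v = G.src (G.inv a)
    · rw [h2]; exact ctr_three_le hne hleaf β hβ
    have := ctr_valence_eq hne hleaf β hβ _ h1 h2
    rw [this]; exact G.three_le_valence v fun l hl => hv l (congrArg (mergeV hne) hl)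
  existsUnique_leaf x := by
    rw [ctr_next]
    have key := fun x y => sc_iff_of_hit (σ := G.next) val_injective
      (fun x => x.2) β hβ (x := x) (y := y)
    obtain ⟨l, hl, hu⟩ := G.existsUnique_leaf x.1
    exact ⟨l, (key ⟨G.leaf l, _⟩ x).1 hl, fun l' h => hu l' ((key ⟨G.leaf l', _⟩ x).2 h)⟩

/-- The collapse of the edge `a`. -/
def ctrCollapse : Collapse G (ctrClosed hne hleaf β hβ) {a, G.inv a} where
  onV := mergeV hne
  onV_surjective := mergeV_surjective hne
  onV_eq_iff v w := by
    have hE := G.reach_equiv {a, G.inv a}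
    constructor
    · intro h; have hr : G.Reach {a, G.inv a} (G.src a) (G.src (G.inv a)) := Reach.of_mem (.inl rfl)
      rcases (mergeV_eq_iff hne _ _).1 h with rfl | ⟨rfl, rfl⟩ | ⟨rfl, rfl⟩
      · exact hE.refl _
      · exact hr
      · exact hE.symm hr
    · refine Reach.induct eq_equivalence (mergeV hne) ?_; rintro x (rfl | rfl)
      · exact (mergeV_eq_iff hne _ _).2 (.inr (.inl ⟨rfl, rfl⟩))
      · exact (mergeV_eq_iff hne _ _).2 (.inr (.inr ⟨rfl, by rw [G.inv_inv]⟩))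
  onH := Equiv.refl _
  src_onH _ := rfl
  inv_onH _ _ h := Subtype.ext h
  next_onH x y k h1 h2 := by
    have : (ctrClosed hne hleaf β hβ).next = β := ctr_next hne hleaf β hβ
    rw [this]; exact Subtype.ext ((hβ x).unique (β x).2 (Hit.iff_pow.2 ⟨k, h1, h2⟩) y.2)
  onH_leaf l := ⟨_, rfl⟩

end

end ClosedFatGraph

open ClosedFatGraph in
lemma ex_ctr (G : AdmissibleFatGraph h n m) {a : G.H}
    (hne : G.src a ≠ G.src (G.inv a)) (hleaf : a ∉ G.leafEdges)
    (hC : ∀ i j x y, x ∈ G.circle i → y ∈ G.circle j → x ∉ G.pair a →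
      y ∉ G.pair a → G.src x = G.src a → G.src y = G.src (G.inv a) → False) :
    ∃ G' : AdmissibleFatGraph h n m, Nonempty (G.Collapse G' {a, G.inv a}) := by
  obtain ⟨β, hβ⟩ := ex_perm_hit (F := G.pair a) (att := Subtype.val)
    (val_injective (p := fun x => x ∉ G.pair a)) (by simp) G.next
  let c := ctrCollapse hne hleaf β hβ
  have hF := ic_pair (G := G.toFatGraph) a
  have hsrc : ∀ x y, (ctrClosed hne hleaf β hβ).src x = (ctrClosed hne hleaf β hβ).src y ↔
    _ := fun x y => mergeV_eq_iff hne (G.src x.1) (G.src y.1)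
  have hcirc : ∀ i x, x ∈ (ctrClosed hne hleaf β hβ).circle i ↔ x.1 ∈ G.circle i := fun i x =>
    c.mem_circle_iff hF i x
  refine ⟨{ toClosedFatGraph := ctrClosed hne hleaf β hβ
            circle_injOn := ?_, inv_notMem_circle := ?_, circle_disjoint := ?_,
            reach_incoming := ?_, card_H := ?_ }, ⟨c⟩⟩
  · intro i x hx y hy hxy; rw [hcirc] at hx hy; rcases (hsrc x y).1 hxy with h | h | h
    · exact Subtype.ext (G.circle_injOn i hx hy h)
    · exact (hC i i _ _ hx hy x.2 y.2 h.1 h.2).elim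
    · exact (hC i i _ _ hy hx y.2 x.2 h.2 h.1).elim
  · intro i x hx hx'; rw [hcirc] at hx hx'; exact G.inv_notMem_circle i _ hx hx'
  · intro i j hij x hx y hy hxy; rw [hcirc] at hx hy; rcases (hsrc x y).1 hxy with h | h | h
    · exact G.circle_disjoint i j hij _ hx _ hy h
    · exact (hC i j _ _ hx hy x.2 y.2 h.1 h.2).elim
    · exact (hC j i _ _ hy hx y.2 x.2 h.2 h.1).elim
  · intro v; obtain ⟨v, rfl⟩ := c.onV_surjective v; obtain ⟨i, hi⟩ := G.reach_incoming v
    refine ⟨i, (c.reach_iff hF Set.univ).2 (Reach.mono ?_ hi)⟩; exact fun x _ _ => trivial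
  · have h1 : Nat.card (ctrClosed hne hleaf β hβ).V + 1 = Nat.card G.V := by
      have := Set.ncard_add_ncard_compl ({G.src a} : Set G.V)
      rw [Set.ncard_singleton] at this; rw [← this, add_comm]; rfl
    have h2 : Nat.card (ctrClosed hne hleaf β hβ).H + 2 = Nat.card G.H := by
      have := Set.ncard_add_ncard_compl (G.pair a)
      rw [ncard_pair (G.inv_ne a).symm] at this; rw [← this, add_comm]; rfl
    have := G.card_H
    omega

end FatGraphs

/-! # Admissible cycles -/

namespace FatGraphs

open PermHit

namespace ClosedFatGraph

variable {n m : ℕ} (G : ClosedFatGraph n m)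

lemma next_circleEdge_succ (i k) : G.next (G.circleEdge i (k + 1)) = G.circleEdge i k := by
  unfold circleEdge; rw [show k + 1 + 2 = (k + 2) + 1 from rfl, pow_succ', mul_apply]
  exact apply_symm_apply _ _

lemma next_edge_zero (i) : G.next (G.circleEdge i 0) = G.inv (G.leaf (inl i)) := by
  unfold circleEdge; rw [zero_add, pow_succ', mul_apply, pow_one]
  refine (apply_symm_apply _ _).trans ?_; rw [inv_eq_iff_eq, G.next_inv_leaf]

/-- The number of edges of the `i`-th admissible cycle. -/
def cCard (i : Fin n) : ℕ := (G.circle i).ncard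

/-- The vertices of the `i`-th admissible cycle. -/
def cVtx (i : Fin n) (k : ℕ) : G.V := G.src (G.inv (G.circleEdge i k))

lemma rot_inv_edge_succ (i k) : G.rot (G.inv (G.circleEdge i (k + 1))) = G.circleEdge i k := by
  rw [← G.next_apply, G.next_circleEdge_succ]

lemma rot_inv_edge_zero (i) : G.rot (G.inv (G.circleEdge i 0)) = G.inv (G.leaf (inl i)) := by
  rw [← G.next_apply, G.next_edge_zero]

lemma src_edge (i k) : G.src (G.circleEdge i k) = G.cVtx i (k + 1) := by
  rw [cVtx, ← G.src_rot (G.inv _), G.rot_inv_edge_succ]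

lemma vtx_zero (i) : G.cVtx i 0 = G.src (G.inv (G.leaf (inl i))) := by
  rw [cVtx, ← G.src_rot, G.rot_inv_edge_zero]

lemma inv_leaf_ne (l l') : G.src (G.leaf l') ≠ G.src (G.inv (G.leaf l)) := fun h =>
  G.leaf_ne_inv_leaf l' l (G.eq_leaf_of_src h.symm).symm

lemma circle_aux (i) :
    0 < G.cCard i ∧ Set.BijOn (G.circleEdge i) (Set.Iio (G.cCard i)) (G.circle i) ∧
      G.circleEdge i (G.cCard i - 1) = G.next (G.leaf (inl i)) := by
  set σ := G.next⁻¹ with hσ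
  set x := G.leaf (inl i) with hx
  set P := Function.minimalPeriod σ x with hP
  have hper : 0 < P := by
    rw [hP, Function.minimalPeriod_pos_iff_mem_periodicPts]
    obtain ⟨N, hN, h1⟩ := (isOfFinOrder_of_finite σ).exists_pow_eq_one
    exact Function.mk_mem_periodicPts hN (by rw [Function.IsPeriodicPt, iterate_eq_pow, h1]; rfl)
  have hmod : ∀ k, (σ ^ (k % P)) x = (σ ^ k) x := fun k => by
    rw [← iterate_eq_pow, ← iterate_eq_pow, Function.iterate_mod_minimalPeriod_eq]
  have hinj : ∀ k l, k < P → l < P → (σ ^ k) x = (σ ^ l) x → k = l := fun k l hk hl h =>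
    Function.iterate_injOn_Iio_minimalPeriod (f := σ) (x := x) hk hl (by
      simpa [iterate_eq_pow] using h)
  have h1 : (σ ^ 1) x = G.inv x := by rw [pow_one, hσ, inv_eq_iff_eq, hx, G.next_inv_leaf]
  have hP0 : (σ ^ P) x = x := by rw [← hmod, mod_self]; rfl
  have hP3 : 3 ≤ P := by
    by_contra hlt
    have h2 : G.next x ≠ G.inv x := by
      rw [G.next_apply]; exact G.rot_ne_self (G.inv_leaf_ne _)
    have h3 : G.inv x ≠ x := G.inv_ne x
    rcases (by omega : P = 1 ∨ P = 2) with h | h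
    · rw [h, h1] at hP0; exact h3 hP0
    · rw [h, pow_succ', mul_apply, h1, hσ, inv_eq_iff_eq] at hP0; exact h2 hP0.symm
  have hbij : Set.BijOn (G.circleEdge i) (Set.Iio (P - 2)) (G.circle i) := by
    refine ⟨fun k hk => ⟨⟨-(k + 2 : ℤ), ?_⟩, ?_, ?_⟩, fun k hk l hl h => ?_, fun a ha => ?_⟩
    · rw [circleEdge, zpow_neg, ← inv_zpow]; norm_cast
    · intro h; have hk : k < P - 2 := hk
      have := hinj (k + 2) 0 (by omega) hper (by rw [pow_zero]; exact h)
      omega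
    · intro h; have hk : k < P - 2 := hk
      have := hinj (k + 2) 1 (by omega) (by omega) (by rw [h1]; exact h)
      omega
    · have hk : k < P - 2 := hk; have hl : l < P - 2 := hl
      have := hinj (k + 2) (l + 2) (by omega) (by omega) h
      omega
    · obtain ⟨h2, h3, h4⟩ := ha; obtain ⟨k, hk⟩ := (Equiv.Perm.sameCycle_inv.2 h2).exists_nat_pow_eq
      rw [← hmod] at hk; have hlt := mod_lt k hper
      set r := k % P
      rcases (by omega : r = 0 ∨ r = 1 ∨ 2 ≤ r) with h | h | h
      · rw [h] at hk; exact absurd hk.symm h3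
      · rw [h, h1] at hk; exact absurd hk.symm h4
      · refine ⟨r - 2, (by simp only [Set.mem_Iio]; omega), ?_⟩
        rw [circleEdge, Nat.sub_add_cancel h]; exact hk
  have hcard : G.cCard i = P - 2 := by
    rw [cCard, ← hbij.image_eq, hbij.injOn.ncard_image, ← coe_range,
      Set.ncard_coe_finset, card_range]
  rw [hcard]; refine ⟨by omega, hbij, ?_⟩; rw [circleEdge, show P - 2 - 1 + 2 = P - 1 by omega]
  apply (σ : G.H ≃ G.H).injective; rw [← mul_apply, ← pow_succ', Nat.sub_add_cancel hper, hP0]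
  exact (symm_apply_apply _ _).symm

lemma circleCard_pos (i) : 0 < G.cCard i := (G.circle_aux i).1

lemma bijOn_edge (i) :
    Set.BijOn (G.circleEdge i) (Set.Iio (G.cCard i)) (G.circle i) := (G.circle_aux i).2.1

lemma edge_last (i) :
    G.circleEdge i (G.cCard i - 1) = G.next (G.leaf (inl i)) := (G.circle_aux i).2.2

lemma edge_mem (hk : k < G.cCard i) : G.circleEdge i k ∈ G.circle i := (G.bijOn_edge i).mapsTo hk

lemma ex_edge (ha : a ∈ G.circle i) :
    ∃ k < G.cCard i, G.circleEdge i k = a := (G.bijOn_edge i).surjOn ha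

lemma rot_inv_leaf (i) : G.rot (G.inv (G.leaf (inl i))) = G.circleEdge i (G.cCard i - 1) := by
  rw [G.edge_last]; rfl

lemma src_edge' (i) (hk : k < G.cCard i) :
    G.src (G.circleEdge i k) = G.cVtx i ((k + 1) % G.cCard i) := by
  by_cases h : k + 1 = G.cCard i
  · rw [h, mod_self, vtx_zero, ← G.src_rot (G.inv _), G.rot_inv_leaf, ← h]; rfl
  · rw [mod_eq_of_lt (by omega), src_edge]

lemma edge_mem_adm (hk : k < G.cCard i) :
    G.circleEdge i k ∈ G.admissibleEdges := G.circle_subset i (G.edge_mem hk)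

lemma mem_adm : a ∈ G.admissibleEdges ↔
    ∃ i, ∃ k < G.cCard i, a = G.circleEdge i k ∨ a = G.inv (G.circleEdge i k) := by
  constructor
  · rintro ⟨i, h | h⟩
    · obtain ⟨k, hk, rfl⟩ := G.ex_edge h; exact ⟨i, k, hk, .inl rfl⟩
    · obtain ⟨k, hk, h⟩ := G.ex_edge h; exact ⟨i, k, hk, .inr (by rw [h, G.inv_inv])⟩
  · rintro ⟨i, k, hk, rfl | rfl⟩
    · exact G.edge_mem_adm hk
    · exact G.ic_adm _ (G.edge_mem_adm hk)

/-- The vertices on the admissible cycles. -/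
def OnCircle (v : G.V) : Prop := ∃ i, ∃ a ∈ G.circle i, G.src a = v

lemma onCircle_iff : G.OnCircle v ↔ ∃ i, ∃ k < G.cCard i, G.cVtx i k = v := by
  constructor
  · rintro ⟨i, a, ha, rfl⟩; obtain ⟨k, hk, rfl⟩ := G.ex_edge ha
    exact ⟨i, _, mod_lt _ (G.circleCard_pos i), (G.src_edge' i hk).symm⟩
  · rintro ⟨i, k, hk, rfl⟩; rcases k with _ | k
    · exact ⟨i, _, G.edge_mem (Nat.sub_lt (G.circleCard_pos i) one_pos),
        by rw [G.src_edge' i (Nat.sub_lt (G.circleCard_pos i) one_pos),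
          show G.cCard i - 1 + 1 = G.cCard i by have := G.circleCard_pos i; omega,
          mod_self]⟩
    · exact ⟨i, _, G.edge_mem (by omega : k < _), G.src_edge i k⟩

lemma onCircle_of_adm (ha : a ∈ G.admissibleEdges) : G.OnCircle (G.src a) := by
  obtain ⟨i, k, hk, rfl | rfl⟩ := G.mem_adm.1 ha
  · exact ⟨i, _, G.edge_mem hk, rfl⟩
  · exact G.onCircle_iff.2 ⟨i, k, hk, rfl⟩

lemma not_onCircle_leaf (l) : ¬ G.OnCircle (G.src (G.leaf l)) := by
  rintro ⟨i, a, ha, h⟩; rw [G.eq_leaf_of_src h] at ha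
  exact G.notMem_leaves_of_mem_circle ha ⟨l, .inl rfl⟩

end ClosedFatGraph

variable {h n m : ℕ} (G : AdmissibleFatGraph h n m)

lemma src_injOn_circles (ha : a ∈ G.circle i) (hb : b ∈ G.circle j)
    (hab : G.src a = G.src b) : a = b ∧ i = j := by
  by_cases hij : i = j
  · subst hij; exact ⟨G.circle_injOn i ha hb hab, rfl⟩
  · exact (G.circle_disjoint i j hij a ha b hb hab).elim

lemma vtx_inj (hk : k < G.cCard i)
    (hl : l < G.cCard j) (hv : G.cVtx i k = G.cVtx j l) : i = j ∧ k = l := by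
  have key : ∀ i k, k < G.cCard i → ∃ k' < G.cCard i, (k' + 1) % G.cCard i = k := by
    intro i k hk; rcases k with _ | k
    · exact ⟨G.cCard i - 1, by omega, by rw [Nat.sub_add_cancel (by omega), mod_self]⟩
    · exact ⟨k, by omega, mod_eq_of_lt hk⟩
  obtain ⟨k', hk', rfl⟩ := key i k hk
  obtain ⟨l', hl', rfl⟩ := key j l hl
  rw [← G.src_edge' i hk', ← G.src_edge' j hl'] at hv
  obtain ⟨h1, rfl⟩ := src_injOn_circles G (G.edge_mem hk') (G.edge_mem hl') hv
  exact ⟨rfl, by rw [(G.bijOn_edge i).injOn hk' hl' h1]⟩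

lemma edge_inj (hk : k < G.cCard i)
    (hl : l < G.cCard j) (hv : G.circleEdge i k = G.circleEdge j l) : i = j ∧ k = l :=
  vtx_inj G hk hl (by rw [ClosedFatGraph.cVtx, hv]; rfl)

lemma inv_edge_ne (hk : k < G.cCard i)
    (hl : l < G.cCard j) : G.inv (G.circleEdge i k) ≠ G.circleEdge j l := by
  intro hv; by_cases hij : i = j
  · subst hij; exact G.inv_notMem_circle i _ (G.edge_mem hk) (hv ▸ G.edge_mem hl)
  · have h1 := G.edge_mem hk; have h2 := G.edge_mem hl; have h3 := G.src_edge' j hl; rw [← hv] at h3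
    exact hij (vtx_inj G hk (mod_lt _ (G.circleCard_pos j)) h3).1

lemma Collapse.card_H {G G' : ClosedFatGraph n m} {F : Set G.H} (c : Collapse G G' F) :
    Nat.card G'.H + F.ncard = Nat.card G.H := by
  rw [← Nat.card_congr c.onH]; have := Set.ncard_add_ncard_compl F
  rw [← this, add_comm]; rfl

variable {G}

lemma ex_ctr_circle (ha : a ∈ G.circle i) (hcard : G.cCard i ≠ 1) : ∃ G' : AdmissibleFatGraph h n m,
      Nonempty (G.Collapse G' {a, G.inv a}) := by
  refine ex_ctr G ?_ (G.notMem_leaves_of_mem_circle ha) ?_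
  · obtain ⟨k, hk, rfl⟩ := G.ex_edge ha; rw [G.src_edge' i hk]; intro hv
    have := (vtx_inj G (mod_lt _ (G.circleCard_pos i)) hk hv).2
    by_cases h1 : k + 1 = G.cCard i
    · rw [h1, mod_self] at this; omega
    · rw [mod_eq_of_lt (by omega)] at this; omega
  · intro i' j' x y hx _ hxa _ hs _; exact hxa (.inl (src_injOn_circles G hx ha hs).1)

lemma ex_col_of_subset_adm (hZ : InvClosed Z)
    (hadm : Z ⊆ G.admissibleEdges) (hne : ∀ i, ∃ a ∈ G.circle i, a ∉ Z) :
    ∃ G' : AdmissibleFatGraph h n m, Nonempty (G.Collapse G' Z) := by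
  induction hk : Nat.card G.H using strong_induction_on generalizing G with
  | _ k ih =>
    by_cases hZe : Z = ∅
    · subst hZe
      obtain ⟨c, -⟩ := Collapse.nonempty_of_equiv (G := G.toClosedFatGraph)
        (G' := G.toClosedFatGraph) (Equiv.refl _) (fun _ => rfl) (fun _ => rfl) (fun _ => rfl)
        (src_surjective G) (src_surjective G)
      exact ⟨G, ⟨c⟩⟩
    obtain ⟨a, i, ha, haZ⟩ : ∃ a i, a ∈ G.circle i ∧ a ∈ Z := by
      obtain ⟨a, ha⟩ := Set.nonempty_iff_ne_empty.2 hZe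
      obtain ⟨i, hi | hi⟩ := hadm ha
      · exact ⟨a, i, hi, ha⟩
      · exact ⟨_, i, hi, hZ _ ha⟩
    have hcard : G.cCard i ≠ 1 := by
      intro h1
      obtain ⟨b, hb, hbZ⟩ := hne i
      obtain ⟨k, hk, rfl⟩ := G.ex_edge ha
      obtain ⟨l, hl, rfl⟩ := G.ex_edge hb
      rw [(by omega : l = k)] at hbZ
      exact hbZ haZ
    obtain ⟨G', ⟨c⟩⟩ := ex_ctr_circle ha hcard
    have hF := ic_pair (G := G.toFatGraph) a
    have hsub : (G.pair a) ⊆ Z := by rintro b (rfl | rfl); exacts [haZ, hZ _ haZ]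
    have hlt : Nat.card G'.H < k := by
      have := c.card_H
      rw [ncard_pair (G.inv_ne a).symm] at this
      have h2 : Nat.card G.H = k := hk
      omega
    obtain ⟨G'', ⟨d⟩⟩ := ih _ hlt (G := G') (Z := c.push Z) (c.ic_push hF hZ) (by
      intro y hy
      obtain ⟨x, rfl⟩ := c.ex_onH y
      rw [c.mem_push_iff] at hy
      exact (c.mem_adm hF x).2 (hadm hy)) (by
      intro j
      obtain ⟨b, hb, hbZ⟩ := hne j
      refine ⟨c.onH ⟨b, fun h' => hbZ (hsub h')⟩, (c.mem_circle_iff hF j _).2 hb, ?_⟩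
      rwa [c.mem_push_iff]) rfl
    have e := c.comp hF d
    rw [c.pull_push hsub] at e
    exact ⟨G'', ⟨e⟩⟩

lemma finsum_circle (f : G.H → ℝ) (i) :
    ∑ᶠ a ∈ G.circle i, f a = ∑ k ∈ range (G.cCard i), f (G.circleEdge i k) := by
  have hb : Set.BijOn (G.circleEdge i) (↑(range (G.cCard i))) (G.circle i) := by
    rw [coe_range]; exact G.bijOn_edge i
  rw [← finsum_mem_eq_of_bijOn (G.circleEdge i) hb (f := fun k => f (G.circleEdge i k))
    (fun _ _ => rfl), finsum_mem_coe_finset]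

lemma ex_lengthFunction (G : AdmissibleFatGraph h n m) (τ : Fin n → ℕ → ℝ)
    (hτ : ∀ i k, 0 ≤ τ i k) (hsum : ∀ i, ∑ k ∈ range (G.cCard i), τ i k = 1) :
    ∃ len : LengthFunction G, (∀ i, ∀ k < G.cCard i, len.1 (G.circleEdge i k) = τ i k) ∧
      ∀ a, a ∉ G.admissibleEdges → len.1 a = 1 := by
  classical
  let len : G.H → ℝ := fun a =>
    if h : ∃ p : Fin n × ℕ, p.2 < G.cCard p.1 ∧
      (a = G.circleEdge p.1 p.2 ∨ a = G.inv (G.circleEdge p.1 p.2)) then τ h.choose.1 h.choose.2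
    else 1
  have h1 : ∀ i k, k < G.cCard i → ∀ a, (a = G.circleEdge i k ∨ a = G.inv (G.circleEdge i k)) →
      len a = τ i k := by
    intro i k hk a ha
    have hex : ∃ p : Fin n × ℕ, p.2 < G.cCard p.1 ∧
      (a = G.circleEdge p.1 p.2 ∨ a = G.inv (G.circleEdge p.1 p.2)) := ⟨(i, k), hk, ha⟩
    have hlen : len a = τ hex.choose.1 hex.choose.2 := dif_pos hex
    obtain ⟨h2, h3⟩ := hex.choose_spec
    rw [hlen]
    have : i = hex.choose.1 ∧ k = hex.choose.2 := by
      rcases ha with rfl | rfl <;> rcases h3 with h3 | h3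
      · exact edge_inj G hk h2 h3
      · exact (inv_edge_ne G h2 hk h3.symm).elim
      · exact (inv_edge_ne G hk h2 h3).elim
      · exact edge_inj G hk h2 (G.inv.injective h3)
    rw [← this.1, ← this.2]
  have h2 : ∀ a, a ∉ G.admissibleEdges → len a = 1 := by
    intro a ha
    refine dif_neg ?_
    rintro ⟨p, hp, h⟩
    exact ha (G.mem_adm.2 ⟨_, _, hp, h⟩)
  have hle : ∀ i k, k < G.cCard i → τ i k ≤ 1 := fun i k hk => by
    rw [← hsum i]
    exact Finset.single_le_sum (fun k _ => hτ i k) (mem_range.2 hk)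
  have hcases : ∀ a, a ∈ G.admissibleEdges → ∃ i, ∃ k < G.cCard i, len a = τ i k ∧
      len (G.inv a) = τ i k := by
    intro a ha
    obtain ⟨i, k, hk, h⟩ := G.mem_adm.1 ha
    refine ⟨i, k, hk, h1 i k hk a h, h1 i k hk _ ?_⟩
    rcases h with rfl | rfl
    · exact .inr rfl
    · exact .inl (G.inv_inv _)
  have hinv : ∀ a, len (G.inv a) = len a := by
    intro a
    by_cases ha : a ∈ G.admissibleEdges
    · obtain ⟨i, k, -, h3, h4⟩ := hcases a ha
      rw [h3, h4]
    · rw [h2 a ha, h2]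
      exact G.ic_adm.notMem ha
  have hsum' : ∀ i, ∑ᶠ a ∈ G.circle i, len a = 1 := by
    intro i
    rw [finsum_circle, ← hsum i]
    exact sum_congr rfl fun k hk => h1 i k (mem_range.1 hk) _ (.inl rfl)
  have hZ : InvClosed {a | len a = 0} := fun a ha => (hinv a).trans ha
  obtain ⟨G', ⟨c⟩⟩ := ex_col_of_subset_adm hZ (by
    intro a ha
    by_contra h
    have ha : len a = 0 := ha
    rw [h2 a h] at ha
    exact one_ne_zero ha) (by
    intro i
    by_contra! hall
    have : ∑ᶠ a ∈ G.circle i, len a = 0 := by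
      rw [finsum_circle]
      exact Finset.sum_eq_zero fun k hk => hall _ (G.edge_mem (mem_range.1 hk))
    rw [hsum' i] at this
    exact one_ne_zero this)
  refine ⟨⟨len, ⟨fun a => ?_, hinv, fun a ha => ?_, c.isForest hZ, ⟨G', ⟨c⟩⟩, hsum'⟩⟩,
    fun i k hk => h1 i k hk _ (.inl rfl), h2⟩
  · by_cases ha : a ∈ G.admissibleEdges
    · obtain ⟨i, k, hk, h3, -⟩ := hcases a ha
      rw [h3]; exact ⟨hτ i k, hle i k hk⟩
    · rw [h2 a ha]; exact ⟨zero_le_one, le_refl _⟩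
  · exact h2 a fun h' => disjoint_left.1 G.disj_adm_leaves h' ha

end FatGraphs

/-! # Diagrams: the combinatorial data of the radial structure -/

namespace RadialSlit

open PermHit

/-- A permutation of the slits, extended by the identity on the parametrization points. -/
def exPerm {h m : ℕ} (p : Perm (Fin (2 * h))) : Perm (Mark h m) :=
  Equiv.sumCongr p (Equiv.refl (Fin m))

@[ext]
structure Diagram (h n m : ℕ) where
  /-- the slit pairing -/
  pairing : Perm (Fin (2 * h))
  /-- the successor permutation -/
  succ : Perm (Mark h m)
  /-- the annulus of a mark -/
  ann : Mark h m → Fin n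
  /-- the number of radial chambers, minus one -/
  deg : Fin n → ℕ
  /-- the number of the radial wall of a mark -/
  pos : Mark h m → ℕ
  /-- the number of times one crosses the positive real line before reaching the successor -/
  wrap : Mark h m → ℕ
  pairing_ne : ∀ i, pairing i ≠ i
  pairing_pairing : ∀ i, pairing (pairing i) = i
  sameCycle_iff : ∀ x y, succ.SameCycle x y ↔ ann x = ann y
  ex_ann : ∀ j, ∃ x, ann x = j
  pos_le : ∀ x, pos x ≤ deg (ann x)
  ex_pos : ∀ i k, 1 ≤ k → k ≤ deg i → ∃ x, ann x = i ∧ pos x = k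
  le_of_wrap_eq : ∀ x, wrap x = 0 → pos x ≤ pos (succ x)
  le_of_wrap_ne : ∀ x, wrap x ≠ 0 → pos (succ x) ≤ pos x
  sum_wrap : ∀ j, ∑ x ∈ Finset.univ.filter (fun x => ann x = j), wrap x = 1
  boundary : ∀ x, ∃! p : Fin m, (exPerm pairing * succ).SameCycle x (inr p)

lemma sum_annulus_succ [Fintype α] [DecidableEq β] {σ : Perm α} {ann : α → β}
    (hσ : ∀ x, ann (σ x) = ann x) (f : α → ℝ) (j : β) :
    ∑ x ∈ Finset.univ.filter (fun x => ann x = j), f (σ x) =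
      ∑ x ∈ Finset.univ.filter (fun x => ann x = j), f x := by
  refine Finset.sum_bij (fun x _ => σ x) (fun x hx => ?_) (fun x _ y _ h => σ.injective h)
    (fun y hy => ⟨σ.symm y, ?_, by simp⟩) (fun _ _ => rfl)
  · simpa [hσ] using hx
  grind

lemma card_filter_lt_image {φ : ℕ → ℝ} (hφ : ∀ a b, a < b → b < N → φ a < φ b)
    (hk : k < N) : (((range N).image φ).filter (· < φ k)).card = k := by
  have h1 : ((range N).image φ).filter (· < φ k) = (range k).image φ := by
    ext a; simp only [mem_filter, mem_image, mem_range]; constructor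
    · rintro ⟨⟨b, hb, rfl⟩, h⟩; refine ⟨b, ?_, rfl⟩; rcases lt_trichotomy b k with hbk | rfl | hbk
      · exact hbk
      · exact absurd h (lt_irrefl _)
      grind
    grind
  rw [h1, Finset.card_image_of_injOn, card_range]; intro a ha b hb hab
  simp only [coe_range, Set.mem_Iio] at ha hb; rcases lt_trichotomy a b with h | rfl | h
  · grind
  · rfl
  grind

lemma card_image_range {φ : ℕ → ℝ} (hφ : ∀ a b, a < b → b < N → φ a < φ b) :
    ((range N).image φ).card = N := by
  rw [Finset.card_image_of_injOn, card_range]; intro a ha b hb hab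
  simp only [coe_range, Set.mem_Iio] at ha hb; rcases lt_trichotomy a b with h | rfl | h
  · grind
  · rfl
  grind

lemma ex_card_filter_lt (s : Finset ℝ) (hk : k < s.card) :
    ∃ a ∈ s, (s.filter (· < a)).card = k := by
  let φ : ℕ → ℝ := fun k => if h : k < s.card then s.orderEmbOfFin rfl ⟨k, h⟩ else 0
  have hφ : ∀ a b, a < b → b < s.card → φ a < φ b := by
    intro a b hab hb; simp only [φ, hb, hab.trans hb, dif_pos]
    exact (s.orderEmbOfFin rfl).strictMono hab
  have hs : (range s.card).image φ = s := by
    refine Finset.eq_of_subset_of_card_le ?_ (card_image_range hφ).ge; intro a ha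
    obtain ⟨b, hb, rfl⟩ := mem_image.1 ha
    simp only [φ, mem_range.1 hb, dif_pos]; exact Finset.orderEmbOfFin_mem _ _ _
  refine ⟨φ k, ?_, ?_⟩
  · grind
  · have := card_filter_lt_image hφ hk; rwa [hs] at this

lemma angle_exp {r : ℝ} (hr : 0 < r) (θ : ℝ) :
    angle ((r : ℂ) * Complex.exp (θ * Complex.I)) = toIcoMod two_pi_pos 0 θ := by
  rw [PreConfig.angle_real_mul hr, angle, Complex.arg_exp_mul_I, toIcoMod_eq_toIcoMod]
  refine ⟨toIocDiv two_pi_pos (-pi) θ, ?_⟩; rw [self_sub_toIocMod]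

namespace PreConfig

variable {h n m : ℕ} (L : PreConfig h n m)

lemma ann_succ (x) : L.ann (L.succ x) = L.ann x :=
  ((L.sameCycle_iff _ _).1 (sc_apply L.succ x)).symm

lemma ang_nonneg (x) : 0 ≤ L.ang x := (angle_mem _).1

lemma ang_lt (x) : L.ang x < 2 * pi := (angle_mem _).2

lemma ang_mem_walls (x) : L.ang x ∈ L.walls (L.ann x) := by
  simp only [walls, mem_insert, mem_image, mem_filter, mem_univ, true_and]; exact .inr ⟨x, rfl, rfl⟩

lemma card_walls (i) : (L.walls i).card = L.radialDegree i + 1 := by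
  have : 0 < (L.walls i).card := Finset.card_pos.2 ⟨0, Finset.mem_insert_self _ _⟩
  unfold radialDegree; omega

lemma radialPos_lt_iff (hxy : L.ann x = L.ann y) :
    L.radialPos x < L.radialPos y ↔ L.ang x < L.ang y := by
  unfold radialPos; rw [← hxy]; constructor
  · intro hlt; by_contra hle; push Not at hle
    refine absurd hlt (not_lt.2 (card_le_card fun a ha => ?_)); grind
  · intro hlt; refine Finset.card_lt_card ⟨fun a ha => ?_, fun hsub => ?_⟩
    · grind
    · have := hsub (mem_filter.2 ⟨L.ang_mem_walls x, hlt⟩); grind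

lemma radialPos_le_iff (hxy : L.ann x = L.ann y) :
    L.radialPos x ≤ L.radialPos y ↔ L.ang x ≤ L.ang y := by
  rw [← not_lt, ← not_lt, L.radialPos_lt_iff hxy.symm]

/-- Whether one crosses the positive real line, or goes around once, from `x` to its successor. -/
def wrap (x : Mark h m) : ℕ :=
  if L.dist x ≠ 0 ∧ L.radialPos (L.succ x) ≤ L.radialPos x then 1 else 0

lemma dist_eq (x) : L.dist x = L.ang (L.succ x) - L.ang x + 2 * pi * L.wrap x := by
  have h1 := L.succ_ang x
  have h2 := self_sub_toIcoMod two_pi_pos 0 (L.ang x + L.dist x)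
  rw [← h1, zsmul_eq_mul] at h2; set k := toIcoDiv two_pi_pos 0 (L.ang x + L.dist x)
  have h3 := L.ang_nonneg x
  have h4 := L.ang_lt x
  have h5 := L.ang_nonneg (L.succ x)
  have h6 := L.ang_lt (L.succ x)
  have h7 := L.dist_nonneg x
  have h8 := L.dist_le x
  have hpi := Real.pi_pos
  have hk0 : -1 < k := by
    by_contra hk; have : (k : ℝ) ≤ -1 := by exact_mod_cast not_lt.1 hk
    nlinarith
  have hk2 : k < 2 := by
    by_contra hk; have : (2 : ℝ) ≤ k := by exact_mod_cast not_lt.1 hk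
    nlinarith
  unfold wrap; simp only [L.radialPos_le_iff (L.ann_succ x)]
  rcases (by omega : k = 0 ∨ k = 1) with hk | hk <;> rw [hk] at h2
  · rw [if_neg]
    · push_cast at h2 ⊢; linarith
    grind
  · rw [if_pos]
    · push_cast at h2 ⊢; linarith
    grind

/-- The radial combinatorial data of a preconfiguration. -/
def diagram : Diagram h n m where
  pairing := L.pairing
  succ := L.succ
  ann := L.ann
  deg := L.radialDegree
  pos := L.radialPos
  wrap := L.wrap
  pairing_ne := L.pairing_ne
  pairing_pairing := L.pairing_pairing
  sameCycle_iff := L.sameCycle_iff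
  ex_ann := L.annulus_nonempty
  pos_le x := by
    unfold radialPos; rw [← lt_succ_iff, ← Nat.add_one, ← L.card_walls]
    refine Finset.card_lt_card ⟨Finset.filter_subset _ _, fun hsub => ?_⟩
    exact lt_irrefl _ (mem_filter.1 (hsub (L.ang_mem_walls x))).2
  ex_pos i k h1 h2 := by
    obtain ⟨a, ha, hk⟩ := ex_card_filter_lt (L.walls i) (k := k) (by rw [L.card_walls]; omega)
    have ha' := ha
    simp only [walls, mem_insert, mem_image, mem_filter, mem_univ, true_and] at ha'
    rcases ha' with rfl | ⟨x, rfl, rfl⟩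
    · exfalso; rw [Finset.filter_eq_empty_iff.2, Finset.card_empty] at hk
      · omega
      · intro b hb; simp only [walls, mem_insert, mem_image] at hb; grind [PreConfig.ang_nonneg]
    · exact ⟨x, rfl, hk⟩
  le_of_wrap_eq x hx := by
    rw [L.radialPos_le_iff (L.ann_succ x).symm]; have h1 := L.dist_eq x
    have h2 := L.dist_nonneg x
    rw [hx] at h1
    push_cast at h1; linarith
  le_of_wrap_ne x hx := by
    unfold wrap at hx; grind
  sum_wrap j := by
    have h1 := L.dist_sum j
    simp only [L.dist_eq, sum_add_distrib, Finset.sum_sub_distrib, ← mul_sum] at h1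
    rw [sum_annulus_succ L.ann_succ, sub_self, zero_add] at h1
    have : (2 * pi) ≠ 0 := Real.two_pi_pos.ne'
    have h2 := mul_left_cancel₀ this (h1.trans (mul_one _).symm)
    exact_mod_cast h2
  boundary := L.boundary

end PreConfig

/-- Simplicial coordinates, as sequences, for simplices of dimensions `q i`. -/
structure Coord {n : ℕ} (q : Fin n → ℕ) (τ : Fin n → ℕ → ℝ) : Prop where
  nonneg : ∀ i k, 0 ≤ τ i k
  eq_zero : ∀ i k, q i < k → τ i k = 0
  sum_eq : ∀ i, ∑ k ∈ range (q i + 1), τ i k = 1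

lemma sum_coface (j) (t : ℕ → ℝ) (k) : ∑ l ∈ range k, coface j t l =
    ∑ l ∈ range (if k ≤ j then k else k - 1), t l := by
  induction k with
  | zero => simp
  | succ k ih =>
    rw [sum_range_succ, ih, coface]; rcases lt_trichotomy k j with hk | rfl | hk
    · rw [if_pos hk.le, if_pos hk, if_pos (by omega), sum_range_succ]
    · grind
    · rw [if_neg (by omega), if_neg (by omega), if_neg (by omega), if_neg (by omega),
        ← sum_range_succ]
      congr 2; omega

/-- The position of the `k`-th wall, as a fraction of a full turn. -/
def psum {n : ℕ} (τ : Fin n → ℕ → ℝ) (i : Fin n) (k : ℕ) : ℝ := ∑ l ∈ range k, τ i l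

namespace Coord

variable {n : ℕ} {q : Fin n → ℕ} {τ : Fin n → ℕ → ℝ} (H : Coord q τ)

include H

lemma psum_mono (i) (hkl : k ≤ l) : psum τ i k ≤ psum τ i l :=
  Finset.sum_le_sum_of_subset_of_nonneg (Finset.range_subset_range.2 hkl) fun a _ _ => H.nonneg i a

lemma psum_nonneg (i k) : 0 ≤ psum τ i k := Finset.sum_nonneg fun a _ => H.nonneg i a

lemma psum_le_one (i) (hk : k ≤ q i + 1) : psum τ i k ≤ 1 := by
  rw [← H.sum_eq i]; exact H.psum_mono i hk

lemma psum_lt (hpos : ∀ i k, k ≤ q i → 0 < τ i k) (i) (hkl : k < l)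
    (hl : l ≤ q i + 1) : psum τ i k < psum τ i l := by
  refine lt_of_lt_of_le ?_ (H.psum_mono i (show k + 1 ≤ l from hkl))
  rw [psum, psum, sum_range_succ]; linarith [hpos i k (by omega)]

lemma psum_lt_one (hpos : ∀ i k, k ≤ q i → 0 < τ i k) (i) (hk : k ≤ q i) : psum τ i k < 1 := by
  have : psum τ i (q i + 1) = 1 := H.sum_eq i
  rw [← this]; exact H.psum_lt hpos i (by omega) le_rfl

end Coord

namespace Diagram

variable {h n m : ℕ} (D : Diagram h n m)

lemma ann_succ (x) : D.ann (D.succ x) = D.ann x :=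
  ((D.sameCycle_iff _ _).1 (sc_apply D.succ x)).symm

/-- The mark `x` and its successor are on the same radial segment, and `x` is not the last mark on
this segment. -/
def IsZero (x : Mark h m) : Prop := D.wrap x = 0 ∧ D.pos (D.succ x) = D.pos x

lemma wrap_le_one (x) : D.wrap x ≤ 1 := by
  rw [← D.sum_wrap (D.ann x)]
  exact Finset.single_le_sum (f := D.wrap) (fun _ _ => Nat.zero_le _) (by simp)

lemma outerRadius_pos : 0 < outerRadius := by unfold outerRadius; positivity

/-- The unilevel point with given annulus and angle. -/
def point (τ : Fin n → ℕ → ℝ) (x : Mark h m) : Fin n × ℂ :=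
  (D.ann x, (outerRadius : ℂ) * Complex.exp ((2 * pi * psum τ (D.ann x) (D.pos x) : ℝ) * Complex.I))

lemma norm_point (τ : Fin n → ℕ → ℝ) (x) : ‖(D.point τ x).2‖ = outerRadius := by
  rw [point, norm_mul, Complex.norm_exp_ofReal_mul_I, mul_one, Complex.norm_real,
    Real.norm_of_nonneg outerRadius_pos.le]

/-- The unilevel preconfiguration data with given diagram and sizes of radial chambers. -/
def realData (τ : Fin n → ℕ → ℝ) : SlitData h n m where
  slit i := D.point τ (inl i)
  pairing := D.pairing
  succ := D.succ
  dist x := 2 * pi * (psum τ (D.ann x) (D.pos (D.succ x)) - psum τ (D.ann x) (D.pos x) + D.wrap x)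
  param p := D.point τ (inr p)

lemma xi_realData (τ : Fin n → ℕ → ℝ) (x) : (D.realData τ).xi x = D.point τ x := by
  rcases x with i | p <;> rfl

lemma ann_realData (τ : Fin n → ℕ → ℝ) (x) : (D.realData τ).ann x = D.ann x := by
  rw [SlitData.ann, xi_realData]; rfl

lemma ang_realData (τ : Fin n → ℕ → ℝ) (x : Mark h m) : (D.realData τ).ang x =
    toIcoMod two_pi_pos 0 (2 * pi * psum τ (D.ann x) (D.pos x)) := by
  rw [SlitData.ang, xi_realData, point]; exact angle_exp outerRadius_pos _

/-- The unilevel preconfiguration with given diagram and sizes of radial chambers. -/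
def real {τ : Fin n → ℕ → ℝ} (hτ : Coord D.deg τ) : PreConfig h n m where
  toSlitData := D.realData τ
  inner_le_slit i := by rw [realData, D.norm_point, innerRadius, outerRadius]; linarith
  slit_le_outer i := (D.norm_point τ _).le
  norm_param p := D.norm_point τ _
  pairing_ne := D.pairing_ne
  pairing_pairing := D.pairing_pairing
  norm_pairing i := by simp only [realData, D.norm_point]
  sameCycle_iff x y := by rw [ann_realData, ann_realData]; exact D.sameCycle_iff x y
  annulus_nonempty j := by simp only [ann_realData]; exact D.ex_ann j
  dist_nonneg x := by
    refine mul_nonneg Real.two_pi_pos.le ?_; rcases Nat.eq_zero_or_pos (D.wrap x) with hw | hw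
    · have := hτ.psum_mono (D.ann x) (D.le_of_wrap_eq x hw); rw [hw]; push_cast; linarith
    · have h1 : D.wrap x = 1 := le_antisymm (D.wrap_le_one x) hw
      have h2 := hτ.psum_nonneg (D.ann x) (D.pos (D.succ x))
      have h3 := hτ.psum_le_one (D.ann x) ((D.pos_le x).trans (Nat.le_succ _))
      rw [h1]; push_cast; linarith
  dist_le x := by
    refine mul_le_of_le_one_right Real.two_pi_pos.le ?_
    rcases Nat.eq_zero_or_pos (D.wrap x) with hw | hw
    · have h2 := hτ.psum_nonneg (D.ann x) (D.pos x)
      have h3 := hτ.psum_le_one (D.ann x) (k := D.pos (D.succ x)) (by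
        have := D.pos_le (D.succ x); rw [D.ann_succ] at this; omega)
      rw [hw]; push_cast; linarith
    · have h1 : D.wrap x = 1 := le_antisymm (D.wrap_le_one x) hw
      have := hτ.psum_mono (D.ann x) (D.le_of_wrap_ne x hw.ne')
      rw [h1]; push_cast; linarith
  succ_ang x := by
    rw [ang_realData, ang_realData, toIcoMod_eq_toIcoMod]
    have := self_sub_toIcoMod two_pi_pos 0 (2 * pi * psum τ (D.ann x) (D.pos x))
    refine ⟨D.wrap x - toIcoDiv two_pi_pos 0 (2 * pi * psum τ (D.ann x) (D.pos x)), ?_⟩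
    rw [zsmul_eq_mul] at this ⊢
    push_cast
    simp only [realData, D.ann_succ]
    linear_combination -this
  dist_sum j := by
    have h1 : ∀ x ∈ Finset.univ.filter (fun x => (D.realData τ).ann x = j), (D.realData τ).dist x =
        2 * pi * (psum τ j (D.pos (D.succ x)) - psum τ j (D.pos x) + D.wrap x) := by
      intro x hx; simp only [mem_filter, mem_univ, true_and, ann_realData] at hx; rw [← hx]; rfl
    rw [sum_congr rfl h1, ← mul_sum, sum_add_distrib, Finset.sum_sub_distrib]
    simp only [ann_realData]
    rw [sum_annulus_succ D.ann_succ (fun x => psum τ j (D.pos x)), sub_self, zero_add]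
    have := D.sum_wrap j
    rw [← Nat.cast_sum, this]; simp
  boundary := D.boundary

variable {τ : Fin n → ℕ → ℝ} (hτ : Coord D.deg τ)

lemma ann_real (x) : (D.real hτ).ann x = D.ann x := D.ann_realData τ x

lemma uni_real : (D.real hτ).Unilevel := fun _ => D.norm_point τ _

variable (hpos : ∀ i k, k ≤ D.deg i → 0 < τ i k)

include hpos in
lemma ang_real (x) : (D.real hτ).ang x = 2 * pi * psum τ (D.ann x) (D.pos x) := by
  refine (D.ang_realData τ x).trans ((toIcoMod_eq_self _).2 ⟨?_, ?_⟩)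
  · exact mul_nonneg Real.two_pi_pos.le (hτ.psum_nonneg _ _)
  · rw [zero_add]; exact mul_lt_of_lt_one_right two_pi_pos (hτ.psum_lt_one hpos _ (D.pos_le x))

include hpos in
lemma walls_real (i) : (D.real hτ).walls i =
    (range (D.deg i + 1)).image fun k => 2 * pi * psum τ i k := by
  ext a
  simp only [PreConfig.walls, mem_insert, mem_image, mem_filter,
    mem_univ, true_and, mem_range, D.ann_real hτ, D.ang_real hτ hpos]
  constructor
  · rintro (rfl | ⟨x, rfl, rfl⟩)
    · exact ⟨0, by omega, by simp [psum]⟩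
    · exact ⟨_, lt_succ_of_le (D.pos_le x), rfl⟩
  · rintro ⟨k, hk, rfl⟩; rcases Nat.eq_zero_or_pos k with rfl | hk0
    · left; simp [psum]
    · obtain ⟨x, rfl, rfl⟩ := D.ex_pos i k hk0 (by omega); exact .inr ⟨x, rfl, rfl⟩

include hτ hpos in
lemma psum_strictMono (i) : ∀ a b, a < b → b < D.deg i + 1 →
    2 * pi * psum τ i a < 2 * pi * psum τ i b := fun _ _ hab hb =>
  mul_lt_mul_of_pos_left (hτ.psum_lt hpos i hab hb.le) two_pi_pos

include hpos in
lemma deg_real (i : Fin n) : (D.real hτ).radialDegree i = D.deg i := by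
  rw [PreConfig.radialDegree, D.walls_real hτ hpos, card_image_range (D.psum_strictMono hτ hpos i)]
  rfl

include hpos in
lemma radialPos_real (x : Mark h m) : (D.real hτ).radialPos x = D.pos x := by
  rw [PreConfig.radialPos, D.walls_real hτ hpos, D.ang_real hτ hpos, D.ann_real hτ]
  exact card_filter_lt_image (D.psum_strictMono hτ hpos _) (lt_succ_of_le (D.pos_le x))

include hpos in
lemma wrap_real (x) : (D.real hτ).wrap x = D.wrap x := by
  have h1 := (D.real hτ).dist_eq x
  have h2 : (D.real hτ).dist x = 2 * pi * (psum τ (D.ann x) (D.pos (D.succ x)) -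
    psum τ (D.ann x) (D.pos x) + D.wrap x) := rfl
  rw [h2, D.ang_real hτ hpos, D.ang_real hτ hpos] at h1; have h3 : (D.real hτ).succ = D.succ := rfl
  rw [h3, D.ann_succ] at h1
  have h4 : 2 * pi * ((D.real hτ).wrap x : ℝ) = 2 * pi * (D.wrap x : ℝ) := by linear_combination -h1
  exact_mod_cast mul_left_cancel₀ Real.two_pi_pos.ne' h4

include hpos in
lemma dg_real : (D.real hτ).diagram = D := by
  ext1
  · rfl
  · rfl
  · exact funext (D.ann_real hτ)
  · exact funext (D.deg_real hτ hpos)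
  · exact funext (D.radialPos_real hτ hpos)
  · exact funext (D.wrap_real hτ hpos)

/-- Chambers of equal size. -/
def uniform (q : Fin n → ℕ) (i : Fin n) (k : ℕ) : ℝ := if k ≤ q i then 1 / (q i + 1) else 0

lemma uniform_pos (hk : k ≤ q i) : 0 < uniform q i k := by rw [uniform, if_pos hk]; positivity

lemma coord_uniform (q : Fin n → ℕ) : Coord q (uniform q) where
  nonneg i k := by unfold uniform; split_ifs <;> positivity
  eq_zero i k hk := if_neg (by omega)
  sum_eq i := by
    have : ∀ k ∈ range (q i + 1), uniform q i k = 1 / (q i + 1) := fun k hk =>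
      if_pos (by have := mem_range.1 hk; omega)
    rw [sum_congr rfl this, Finset.sum_const, card_range, nsmul_eq_mul]
    push_cast
    field_simp

/-- A unilevel preconfiguration with given diagram. -/
def standard : PreConfig h n m := D.real (coord_uniform D.deg)

lemma uni_std : D.standard.Unilevel := D.uni_real _

lemma dg_std : D.standard.diagram = D := D.dg_real _ fun _ _ hk => uniform_pos hk

/-- The unilevel type with given diagram. -/
def type : CombType h n m := CombType.mk D.standard

end Diagram

namespace PreConfig

variable {h n m : ℕ} {L L' : PreConfig h n m}

lemma dist_zero_iff (L : PreConfig h n m) (x : Mark h m) : L.dist x = 0 ↔ L.diagram.IsZero x := by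
  have h1 := L.dist_eq x
  have hpi := two_pi_pos
  have key : L.radialPos (L.succ x) = L.radialPos x ↔ L.ang (L.succ x) = L.ang x := by
    rw [le_antisymm_iff, le_antisymm_iff, L.radialPos_le_iff (L.ann_succ x),
      L.radialPos_le_iff (L.ann_succ x).symm]
  constructor
  · intro h0; have hw : L.wrap x = 0 := if_neg fun h' => h'.1 h0; refine ⟨hw, key.2 ?_⟩
    rw [h0, hw] at h1; push_cast at h1; linarith
  · rintro ⟨hw, hp⟩; have hw : L.wrap x = 0 := hw
    have hp : L.radialPos (L.succ x) = L.radialPos x := hp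
    rw [h1, hw, key.1 hp]; simp

lemma inner_lt_outer : innerRadius < outerRadius := by unfold innerRadius outerRadius; linarith

lemma Unilevel.circles_eq (H : L.Unilevel) : L.circles = {innerRadius, outerRadius} := by
  unfold circles; rw [Finset.union_eq_left]; intro a ha; obtain ⟨i, -, rfl⟩ := mem_image.1 ha
  have : L.modulus (inl i) = outerRadius := H i
  simp [this]

lemma Unilevel.annularDegree_eq (H : L.Unilevel) : L.annularDegree = 0 := by
  rw [annularDegree, H.circles_eq, card_pair inner_lt_outer.ne]

lemma Unilevel.level_eq (H : L.Unilevel) (i : Fin (2 * h)) : L.level i = 1 := by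
  have : L.modulus (inl i) = outerRadius := H i
  rw [level, H.circles_eq, this, Finset.filter_insert, if_pos inner_lt_outer,
    Finset.filter_singleton, if_neg (lt_irrefl _)]
  rfl

lemma sameType_of_dg_eq (H : L'.diagram = L.diagram) (h1 : L'.annularDegree = L.annularDegree)
    (h2 : ∀ k, L'.level k = L.level k) : SameType L L' := by
  refine ⟨⟨congrArg Diagram.pairing H, congrArg Diagram.succ H, congrFun (congrArg Diagram.ann H)⟩,
    congrFun (congrArg Diagram.deg H), congrFun (congrArg Diagram.pos H), fun x => ?_, h1, h2⟩
  rw [dist_zero_iff, dist_zero_iff, H]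

lemma mk_eq_of_dg_eq (h1 : L.Unilevel) (h2 : L'.Unilevel) (H : L'.diagram = L.diagram) :
    CombType.mk L = CombType.mk L' :=
  Quot.sound (.inr (.inr (sameType_of_dg_eq H (h2.annularDegree_eq.trans h1.annularDegree_eq.symm)
    fun k => (h2.level_eq k).trans (h1.level_eq k).symm)))

lemma Unilevel.mk_eq_type (H : L.Unilevel) : CombType.mk L = L.diagram.type :=
  mk_eq_of_dg_eq H L.diagram.uni_std L.diagram.dg_std

lemma dg_eq (h1 : SameFrame L L') (h2 : ∀ i, L'.radialDegree i = L.radialDegree i)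
    (h3 : ∀ x, L'.radialPos x = L.radialPos x) (h4 : ∀ x, L'.dist x = 0 ↔ L.dist x = 0) :
    L'.diagram = L.diagram := by
  ext1
  · exact h1.1
  · exact h1.2.1
  · exact funext h1.2.2
  · exact funext h2
  · exact funext h3
  · funext x; simp only [diagram, wrap, h1.2.1, h3, ne_eq, h4]

lemma SameType.dg_eq (H : SameType L L') : L'.diagram = L.diagram :=
  PreConfig.dg_eq H.1 H.2.1 H.2.2.1 H.2.2.2.1

lemma AnnularCollapse.dg_eq {j : ℕ} (H : AnnularCollapse j L L') : L'.diagram = L.diagram :=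
  PreConfig.dg_eq H.1 H.2.1 H.2.2.1 H.2.2.2.1

end PreConfig

end RadialSlit

/-! # Jumps, relabelings and collapses of diagrams -/

namespace RadialSlit

open PermHit

section MoveAfter

variable {α : Type*} [DecidableEq α] {ω : Perm α} {x y z : α}

lemma mvA_apply (z) : moveAfter ω x y z = ω (swap x (ω⁻¹ x) (swap x y z)) := rfl

lemma mvA_target : moveAfter ω x y y = x := by
  rw [mvA_apply, Equiv.swap_apply_right, Equiv.swap_apply_left]; exact apply_symm_apply _ _

lemma inv_apply_eq (hz : ω z = x) : ω⁻¹ x = z := by rw [inv_eq_iff_eq, hz]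

lemma mvA_self (hyx : y ≠ x) (h : ω y ≠ x) : moveAfter ω x y x = ω y := by
  rw [mvA_apply, Equiv.swap_apply_left, swap_apply_of_ne_of_ne hyx]; rintro rfl
  exact h (apply_symm_apply _ _)

lemma mvA_pred (hz : ω z = x) (hzx : z ≠ x) (hzy : z ≠ y) : moveAfter ω x y z = ω x := by
  grind [mvA_apply, inv_apply_eq]

lemma mvA_of_ne (hz : ω z ≠ x) (hzx : z ≠ x) (hzy : z ≠ y) : moveAfter ω x y z = ω z := by
  rw [mvA_apply, swap_apply_of_ne_of_ne hzx hzy, swap_apply_of_ne_of_ne hzx]; rintro rfl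
  exact hz (apply_symm_apply _ _)

lemma mvA_eq_self (h : ω y = x) : moveAfter ω x y = ω := by grind [inv_apply_eq, mvA_apply]

end MoveAfter

namespace Diagram

variable {h n m : ℕ} (D : Diagram h n m)

lemma wrap_eq (x) : D.wrap x =
    open Classical in if D.IsZero x then 0 else if D.pos (D.succ x) ≤ D.pos x then 1 else 0 := by
  have h1 := D.wrap_le_one x
  have h2 := D.le_of_wrap_eq x
  have h3 := D.le_of_wrap_ne x
  unfold IsZero; split_ifs <;> omega

lemma ext_isZero {D D' : Diagram h n m} (h1 : D.pairing = D'.pairing) (h2 : D.succ = D'.succ)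
    (h3 : D.ann = D'.ann) (h4 : D.deg = D'.deg) (h5 : D.pos = D'.pos)
    (h6 : ∀ x, D.IsZero x ↔ D'.IsZero x) : D = D' := by
  grind [Diagram.ext, Diagram.wrap_eq]

/-! ### Relabeling -/

lemma exPerm_mul_conj (p τ σ)
    (x) : (exPerm (τ⁻¹ * p * τ) * ((exPerm τ)⁻¹ * σ * exPerm τ) : Perm (Mark h m)) x =
      (exPerm τ)⁻¹ ((exPerm p * σ : Perm (Mark h m)) (exPerm τ x)) := by
  have h1 : ∀ z : Mark h m, exPerm (τ⁻¹ * p * τ) z =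
      (exPerm τ)⁻¹ (exPerm p (exPerm τ z)) := by rintro (i | q) <;> rfl
  have h2 : ∀ z : Mark h m, exPerm τ ((exPerm τ)⁻¹ z) = z := fun z => apply_symm_apply _ _
  simp only [mul_apply, h1, h2]

lemma sc_conj {e σ σ' : Perm X} (H : ∀ x, e (σ' x) = σ (e x)) (x y : X) :
    σ'.SameCycle x y ↔ σ.SameCycle (e x) (e y) := by
  have : σ' = e⁻¹ * σ * e := by
    ext x; simp only [mul_apply, ← H]; exact (symm_apply_apply _ _).symm
  rw [this]; have := Equiv.Perm.sameCycle_conj (f := σ) (g := e⁻¹) (x := x) (y := y)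
  simpa using this

/-- The diagram with the slits relabeled. -/
def relabel (τ : Perm (Fin (2 * h))) : Diagram h n m where
  pairing := τ⁻¹ * D.pairing * τ
  succ := (exPerm τ)⁻¹ * D.succ * exPerm τ
  ann x := D.ann (exPerm τ x)
  deg := D.deg
  pos x := D.pos (exPerm τ x)
  wrap x := D.wrap (exPerm τ x)
  pairing_ne i h' := D.pairing_ne (τ i) ((inv_eq_iff_eq).1 h')
  pairing_pairing i := by simp [D.pairing_pairing]
  sameCycle_iff x y := by
    rw [sc_conj (e := exPerm τ) (σ := D.succ) (fun x => by simp), D.sameCycle_iff]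
  ex_ann j := by
    obtain ⟨x, hx⟩ := D.ex_ann j
    exact ⟨(exPerm τ)⁻¹ x, by simpa using hx⟩
  pos_le x := D.pos_le _
  ex_pos i k h1 h2 := by
    obtain ⟨x, hx⟩ := D.ex_pos i k h1 h2
    exact ⟨(exPerm τ)⁻¹ x, by simpa using hx⟩
  le_of_wrap_eq x hx := by simpa using D.le_of_wrap_eq _ hx
  le_of_wrap_ne x hx := by simpa using D.le_of_wrap_ne _ hx
  sum_wrap j := by
    rw [← D.sum_wrap j, sum_filter, sum_filter]
    exact Equiv.sum_comp (exPerm τ) (fun x => if D.ann x = j then D.wrap x else 0)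
  boundary x := by
    have key : ∀ p : Fin m, (exPerm (τ⁻¹ * D.pairing * τ) *
        ((exPerm τ)⁻¹ * D.succ * exPerm τ) : Perm (Mark h m)).SameCycle x (inr p) ↔
        (exPerm D.pairing * D.succ).SameCycle (exPerm τ x) (inr p) := fun p =>
      sc_conj (e := exPerm τ) (fun x => by
        rw [exPerm_mul_conj]; exact apply_symm_apply _ _) x (inr p)
    simp only [key]; exact D.boundary _

lemma relabel_real (τ') (hτ : Coord D.deg τ) :
    PreConfig.Relabel (D.real hτ) ((D.relabel τ').real hτ) := by
  refine ⟨τ', fun i => rfl, fun i => ?_, fun x => ?_, fun x => ?_, rfl⟩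
  · exact apply_symm_apply _ _
  · exact apply_symm_apply _ _
  · show _ = _; simp only [real, realData, relabel, mul_apply]
    have : ∀ z : Mark h m, exPerm τ' ((exPerm τ')⁻¹ z) = z := fun z => apply_symm_apply _ _
    simp only [this]; rfl

lemma type_relabel (τ) : (D.relabel τ).type = D.type := by
  have : PreConfig.TypeStep D.standard (D.relabel τ).standard := .inl (D.relabel_real τ _)
  exact (Quot.sound this).symm

end Diagram

lemma PreConfig.Relabel.dg_eq (H : Relabel L L') : ∃ τ, L'.diagram = L.diagram.relabel τ := by
  have hw := H.walls_eq
  obtain ⟨τ, h1, h2, h3, h4, h5⟩ := H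
  have hxi : ∀ x, L'.xi x = L.xi (exPerm τ x) := by
    rintro (i | p)
    · exact h1 i
    · exact congrFun h5 p
  have hann : ∀ x, L'.ann x = L.ann (exPerm τ x) := fun x => by simp only [SlitData.ann, hxi]
  have hang : ∀ x, L'.ang x = L.ang (exPerm τ x) := fun x => by simp only [SlitData.ang, hxi]
  have hpos : ∀ x, L'.radialPos x = L.radialPos (exPerm τ x) := fun x => by
    simp only [radialPos, hw, hann, hang]
  have hsucc : ∀ x, exPerm τ (L'.succ x) = L.succ (exPerm τ x) := h3
  refine ⟨τ, ?_⟩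
  ext1
  · ext1 i; exact Equiv.injective τ ((h2 i).trans (apply_symm_apply _ _).symm)
  · ext1 x; exact Equiv.injective (exPerm τ) ((hsucc x).trans (apply_symm_apply _ _).symm)
  · exact funext hann
  · funext i; simp only [diagram, radialDegree, hw, Diagram.relabel]
  · exact funext hpos
  · funext x; show L'.wrap x = L.wrap (exPerm τ x)
    have h4' : L'.dist x = L.dist (exPerm τ x) := h4 x
    simp only [wrap, hpos, hsucc, h4']

namespace Diagram

variable {h n m : ℕ} (D : Diagram h n m)

/-! ### Jumps -/

/-- The mark `x` can jump over the slit `j`. -/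
structure CanJump (x : Mark h m) (j : Fin (2 * h)) : Prop where
  succ_eq : D.succ x = inl j
  isZero : D.IsZero x
  ne : x ≠ inl j
  ne_pairing : x ≠ inl (D.pairing j)

variable {D} {x : Mark h m} {j : Fin (2 * h)} (H : D.CanJump x j)

namespace CanJump

include H

lemma pos_eq : D.pos (inl j) = D.pos x := by rw [← H.succ_eq]; exact H.isZero.2

lemma ann_eq : D.ann (inl j) = D.ann x := by rw [← H.succ_eq, D.ann_succ]

lemma cases (z) : (z = inl (D.pairing j) ∧ moveAfter D.succ x (inl (D.pairing j)) z = x) ∨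
    (z = x ∧ D.succ (inl (D.pairing j)) ≠ x ∧
      moveAfter D.succ x (inl (D.pairing j)) z = D.succ (inl (D.pairing j))) ∨
    (z = x ∧ D.succ (inl (D.pairing j)) = x ∧ moveAfter D.succ x (inl (D.pairing j)) z = inl j) ∨
    (z ≠ x ∧ z ≠ inl (D.pairing j) ∧ D.succ z = x ∧
      moveAfter D.succ x (inl (D.pairing j)) z = inl j) ∨
    (z ≠ x ∧ z ≠ inl (D.pairing j) ∧ D.succ z ≠ x ∧
      moveAfter D.succ x (inl (D.pairing j)) z = D.succ z) := by
  by_cases h1 : z = inl (D.pairing j)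
  · subst h1; exact .inl ⟨rfl, mvA_target⟩
  by_cases h2 : z = x
  · grind [mvA_eq_self, Diagram.CanJump.succ_eq, mvA_self, Diagram.CanJump.ne_pairing]
  grind [mvA_pred, Diagram.CanJump.succ_eq, mvA_of_ne]

lemma boundary_iff (ha : a ≠ inl (D.pairing j)) (hb : b ≠ inl (D.pairing j)) :
    (exPerm D.pairing * moveAfter D.succ x (inl (D.pairing j))).SameCycle a b ↔
      (exPerm D.pairing * D.succ).SameCycle a b := by
  by_cases hs : D.succ (inl (D.pairing j)) = x
  · rw [mvA_eq_self hs]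
  set y : Mark h m := inl (D.pairing j) with hy
  set ω' := moveAfter D.succ x y with hω'
  set e : Perm (Mark h m) := exPerm D.pairing with he
  have hej : e (inl j) = y := rfl
  have hB : ∀ σ : Perm (Mark h m), ∀ u, (e * σ).SameCycle u (e (σ u)) := fun σ u =>
    sc_apply (e * σ) u
  have hex : e x ≠ y := fun h' => H.ne (e.injective (h'.trans hej.symm))
  have hne : e (D.succ y) ≠ y := fun h' => H.ne_pairing (by
    rw [← hy]; apply D.succ.injective; rw [H.succ_eq]; exact (e.injective (h'.trans hej.symm)).symm)
  have hnez : ∀ z, z ≠ x → e (D.succ z) ≠ y := fun z hz h' => hz (by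
    apply D.succ.injective; rw [H.succ_eq]; exact e.injective (h'.trans hej.symm))
  constructor
  · intro hab
    obtain ⟨g, hgy, hg⟩ : ∃ g : Mark h m → Mark h m, g y = e x ∧ ∀ c, c ≠ y → g c = c :=
      ⟨fun c => if c = y then e x else c, if_pos rfl, fun c hc => if_neg hc⟩
    have hstep : ∀ z, (e * D.succ).SameCycle (g z) (g (e (ω' z))) := fun z => by
      rcases H.cases z with ⟨h1, h2⟩ | ⟨h1, h2, h3⟩ | ⟨h1, h2, h3⟩ | ⟨h1, h2, h3, h4⟩ |
        ⟨h1, h2, h3, h4⟩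
      · rw [← hy, ← hω'] at h2; rw [h2, hg _ hex, h1, hgy]
      · rw [← hy, ← hω'] at h3; rw [h3, h1, hg _ H.ne_pairing, hg _ hne]; have h5 := hB D.succ x
        rw [H.succ_eq, hej] at h5; exact h5.trans (hB D.succ y)
      · exact absurd h2 hs
      · grind
      grind
    have := sc_induct (sc_equiv (e * D.succ)) g hstep hab
    rwa [hg a ha, hg b hb] at this
  · intro hab
    obtain ⟨g, hgy, hg⟩ : ∃ g : Mark h m → Mark h m, g y = e (D.succ y) ∧ ∀ c, c ≠ y → g c = c :=
      ⟨fun c => if c = y then e (D.succ y) else c, if_pos rfl, fun c hc => if_neg hc⟩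
    have hx' : ω' x = D.succ y := mvA_self H.ne_pairing.symm hs
    have hy' : ω' y = x := mvA_target
    have hstep : ∀ z, (e * ω').SameCycle (g z) (g (e (D.succ z))) := fun z => by
      by_cases h1 : z = y
      · rw [h1, hgy, hg _ hne]
      by_cases h2 : z = x
      · rw [h2, hg _ H.ne_pairing, H.succ_eq, hej, hgy, ← hx']; exact hB ω' x
      rw [hg _ h1, hg _ (hnez z h2)]; by_cases h3 : D.succ z = x
      · rw [h3]; have h4 : ω' z = inl j := (mvA_pred h3 h2 h1).trans H.succ_eq; have h5 := hB ω' z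
        rw [h4, hej] at h5; refine h5.trans ?_; have := hB ω' y
        rwa [hy'] at this
      · have := hB ω' z; rwa [show ω' z = D.succ z from mvA_of_ne h3 h2 h1] at this
    have := sc_induct (sc_equiv (e * ω')) g hstep hab
    rwa [hg a ha, hg b hb] at this

end CanJump

/-- The diagram after a jump. -/
def jump : Diagram h n m where
  pairing := D.pairing
  succ := moveAfter D.succ x (inl (D.pairing j))
  ann := update D.ann x (D.ann (inl (D.pairing j)))
  deg := D.deg
  pos := update D.pos x (D.pos (inl (D.pairing j)))
  wrap := update (update D.wrap (inl (D.pairing j)) 0) x (D.wrap (inl (D.pairing j)))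
  pairing_ne := D.pairing_ne
  pairing_pairing := D.pairing_pairing
  sameCycle_iff a b := by
    set y : Mark h m := inl (D.pairing j) with hy
    set ω' := moveAfter D.succ x y with hω'
    set ann' := update D.ann x (D.ann y)
    have hx' : ann' x = D.ann y := update_self ..
    have ho : ∀ z, z ≠ x → ann' z = D.ann z := fun z hz => update_of_ne hz ..
    have hyx : y ≠ x := H.ne_pairing.symm
    have hB : ∀ u, ω'.SameCycle u (ω' u) := fun u => sc_apply ω' u
    have hxy : ω'.SameCycle y x := by have := hB y; rwa [hω', mvA_target] at this
    constructor
    · refine sc_induct eq_equivalence ann' fun z => ?_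
      rcases H.cases z with ⟨h1, h2⟩ | ⟨h1, h2, h3⟩ | ⟨h1, h2, h3⟩ | ⟨h1, h2, h3, h4⟩ |
        ⟨h1, h2, h3, h4⟩
      · grind
      · rw [← hy, ← hω'] at h3; rw [h3, h1, hx', ho _ h2, D.ann_succ]
      · grind [Diagram.CanJump.ne, Diagram.CanJump.ann_eq, Diagram.ann_succ]
      · grind [Diagram.CanJump.ne, Diagram.CanJump.ann_eq, Diagram.ann_succ]
      · rw [← hy, ← hω'] at h4; rw [h4, ho _ h1, ho _ h3, D.ann_succ]
    · have key : ∀ u v, u ≠ x → v ≠ x → D.ann u = D.ann v → ω'.SameCycle u v := by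
        intro u v hu hv huv
        obtain ⟨g, hgx, hg⟩ : ∃ g : Mark h m → Mark h m, g x = inl j ∧ ∀ c, c ≠ x → g c = c :=
          ⟨fun c => if c = x then inl j else c, if_pos rfl, fun c hc => if_neg hc⟩
        have hstep : ∀ z, ω'.SameCycle (g z) (g (D.succ z)) := fun z => by
          have hBz := hB z
          rcases H.cases z with ⟨h1, h2⟩ | ⟨h1, h2, h3⟩ | ⟨h1, h2, h3⟩ | ⟨h1, h2, h3, h4⟩ |
            ⟨h1, h2, h3, h4⟩
          · have hx := hB x; rw [h1, ← hy, hg _ hyx]; by_cases h3 : D.succ y = x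
            · rw [h3, hgx]; rw [hω', mvA_eq_self h3, H.succ_eq, ← mvA_eq_self h3, ← hω'] at hx
              exact hxy.trans hx
            · rw [hg _ h3]; rw [hω', mvA_self hyx h3, ← hω'] at hx; exact hxy.trans hx
          · rw [h1, hgx, H.succ_eq, hg _ H.ne.symm]
          · rw [h1, hgx, H.succ_eq, hg _ H.ne.symm]
          · grind
          grind
        have := sc_induct (sc_equiv ω') g hstep ((D.sameCycle_iff u v).2 huv)
        rwa [hg _ hu, hg _ hv] at this
      intro hab; by_cases ha : a = x <;> by_cases hb : b = x
      · rw [ha, hb]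
      · subst ha; rw [hx', ho _ hb] at hab; exact hxy.symm.trans (key _ _ hyx hb hab)
      · subst hb; rw [hx', ho _ ha] at hab; exact (key _ _ ha hyx hab).trans hxy
      grind
  ex_ann i := by
    obtain ⟨z, hz⟩ := D.ex_ann i
    by_cases hzx : z = x
    · exact ⟨inl j, by rw [update_of_ne H.ne.symm, H.ann_eq, ← hzx, hz]⟩
    · exact ⟨z, by rw [update_of_ne hzx, hz]⟩
  pos_le z := by grind [Diagram.pos_le]
  ex_pos i k h1 h2 := by
    obtain ⟨z, hz, hk⟩ := D.ex_pos i k h1 h2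
    by_cases hzx : z = x
    · exact ⟨inl j, by rw [update_of_ne H.ne.symm, H.ann_eq, ← hzx, hz],
        by rw [update_of_ne H.ne.symm, H.pos_eq, ← hzx, hk]⟩
    · exact ⟨z, by rw [update_of_ne hzx, hz], by rw [update_of_ne hzx, hk]⟩
  le_of_wrap_eq z hz := by
    rcases H.cases z with ⟨h1, h2⟩ | ⟨h1, h2, h3⟩ | ⟨h1, h2, h3⟩ | ⟨h1, h2, h3, h4⟩ |
      ⟨h1, h2, h3, h4⟩
    · grind
    · grind [Diagram.le_of_wrap_eq]
    · grind [Diagram.CanJump.ne, Diagram.CanJump.pos_eq, Diagram.le_of_wrap_eq]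
    · grind [Diagram.CanJump.ne, Diagram.CanJump.pos_eq, Diagram.le_of_wrap_eq]
    grind [Diagram.le_of_wrap_eq]
  le_of_wrap_ne z hz := by
    rcases H.cases z with ⟨h1, h2⟩ | ⟨h1, h2, h3⟩ | ⟨h1, h2, h3⟩ | ⟨h1, h2, h3, h4⟩ |
      ⟨h1, h2, h3, h4⟩
    · grind
    · grind [Diagram.le_of_wrap_ne]
    · grind [Diagram.CanJump.ne, Diagram.CanJump.pos_eq, Diagram.le_of_wrap_ne]
    · grind [Diagram.CanJump.ne, Diagram.CanJump.pos_eq, Diagram.le_of_wrap_ne]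
    grind [Diagram.le_of_wrap_ne]
  sum_wrap i := by
    rw [← D.sum_wrap i, sum_filter, sum_filter, ← Equiv.sum_comp (swap x (inl (D.pairing j)))]
    refine sum_congr rfl fun z _ => ?_; have hyx := H.ne_pairing.symm
    by_cases h1 : z = x
    · subst h1
      rw [Equiv.swap_apply_left, update_of_ne hyx (β := fun _ => ℕ), update_self,
        H.isZero.1, ite_self, ite_self]
    grind
  boundary z := by
    by_cases hz : z = inl (D.pairing j)
    · have hne : exPerm D.pairing x ≠ inl (D.pairing j) := fun h' =>
        H.ne ((exPerm D.pairing).injective h')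
      have h1 := sc_apply (exPerm D.pairing * moveAfter D.succ x (inl (D.pairing j))) z
      rw [mul_apply, hz, mvA_target] at h1
      have h2 : ∀ p : Fin m, (exPerm D.pairing * moveAfter D.succ x (inl (D.pairing j))).SameCycle z
            (inr p) ↔ (exPerm D.pairing * D.succ).SameCycle (exPerm D.pairing x)
            (inr p) := fun p => by
        rw [← H.boundary_iff hne (by simp), hz]; exact ⟨h1.symm.trans, h1.trans⟩
      simp only [h2]; exact D.boundary _
    · have h2 : ∀ p : Fin m, (exPerm D.pairing * moveAfter D.succ x (inl (D.pairing j))).SameCycle z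
            (inr p) ↔ (exPerm D.pairing * D.succ).SameCycle z (inr p) := fun p =>
        H.boundary_iff hz (by simp)
      simp only [h2]; exact D.boundary _

end Diagram

end RadialSlit

namespace RadialSlit

open PermHit

namespace Diagram

variable {h n m : ℕ} {D : Diagram h n m} {x : Mark h m} {j : Fin (2 * h)} (H : D.CanJump x j)

lemma jump_pos_of_ne (hz : z ≠ x) : (jump H).pos z = D.pos z := update_of_ne hz ..

lemma jump_ann_of_ne (hz : z ≠ x) : (jump H).ann z = D.ann z := update_of_ne hz ..

lemma jump_pos_self : (jump H).pos x = D.pos (inl (D.pairing j)) := update_self ..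

lemma jump_ann_self : (jump H).ann x = D.ann (inl (D.pairing j)) := update_self ..

lemma jump_wrap_self : (jump H).wrap x = D.wrap (inl (D.pairing j)) := update_self ..

lemma jump_wrap_target : (jump H).wrap (inl (D.pairing j)) = 0 :=
  (update_of_ne H.ne_pairing.symm ..).trans (update_self ..)

lemma jump_wrap_of_ne (hz : z ≠ x) (hz' : z ≠ inl (D.pairing j)) : (jump H).wrap z = D.wrap z :=
  (update_of_ne hz ..).trans (update_of_ne hz' ..)

lemma jump_succ_target : (jump H).succ (inl (D.pairing j)) = x := mvA_target

lemma jump_pos_succ_target : (jump H).pos ((jump H).succ (inl (D.pairing j))) =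
    D.pos (inl (D.pairing j)) := by rw [jump_succ_target, jump_pos_self]

lemma jump_pos_succ_self : (jump H).pos ((jump H).succ x) = D.pos (D.succ (inl (D.pairing j))) := by
  rcases H.cases x with ⟨h1, h2⟩ | ⟨h1, h2, h3⟩ | ⟨h1, h2, h3⟩ | ⟨h1, h2, h3, h4⟩ | ⟨h1, h2, h3, h4⟩
  · exact absurd h1 H.ne_pairing
  · rw [show (jump H).succ x = _ from h3, jump_pos_of_ne H h2]
  · rw [show (jump H).succ x = _ from h3, jump_pos_of_ne H H.ne.symm, H.pos_eq, h2]
  · exact absurd rfl h1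
  · exact absurd rfl h1

lemma jump_pos_succ_of_ne (hz : z ≠ x) (hz' : z ≠ inl (D.pairing j)) :
    (jump H).pos ((jump H).succ z) = D.pos (D.succ z) := by
  rcases H.cases z with ⟨h1, h2⟩ | ⟨h1, h2, h3⟩ | ⟨h1, h2, h3⟩ | ⟨h1, h2, h3, h4⟩ | ⟨h1, h2, h3, h4⟩
  · exact absurd h1 hz'
  · exact absurd h1 hz
  · exact absurd h1 hz
  · rw [show (jump H).succ z = _ from h4, jump_pos_of_ne H H.ne.symm, H.pos_eq, h3]
  · rw [show (jump H).succ z = _ from h4, jump_pos_of_ne H h3]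

lemma jump_isZero_target : (jump H).IsZero (inl (D.pairing j)) :=
  ⟨jump_wrap_target H, by rw [jump_pos_succ_target, jump_pos_of_ne H H.ne_pairing.symm]⟩

lemma jump_isZero_self : (jump H).IsZero x ↔ D.IsZero (inl (D.pairing j)) := by
  unfold IsZero; rw [jump_pos_succ_self, jump_wrap_self, jump_pos_self]

lemma jump_isZero_of_ne (hz : z ≠ x) (hz' : z ≠ inl (D.pairing j)) :
    (jump H).IsZero z ↔ D.IsZero z := by
  unfold IsZero; rw [jump_pos_succ_of_ne H hz hz', jump_wrap_of_ne H hz hz', jump_pos_of_ne H hz]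

lemma jump_real (hτ : Coord D.deg τ) (hτ' : Coord (jump H).deg τ) :
    PreConfig.Jump (D.real hτ) ((jump H).real hτ') := by
  have hmod : ∀ z, (D.real hτ).modulus z = outerRadius := fun z => by
    show ‖((D.realData τ).xi z).2‖ = _
    rw [D.xi_realData, D.norm_point]
  have hdist : ∀ z, (D.real hτ).dist z = 2 * pi * (psum τ (D.ann z) (D.pos (D.succ z)) -
    psum τ (D.ann z) (D.pos z) + D.wrap z) := fun z => rfl
  have hdist' : ∀ z, ((jump H).real hτ').dist z = 2 * pi *
    (psum τ ((jump H).ann z) ((jump H).pos ((jump H).succ z)) -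
    psum τ ((jump H).ann z) ((jump H).pos z) + (jump H).wrap z) := fun z => rfl
  refine ⟨x, j, H.succ_eq, ?_, ?_, H.ne, H.ne_pairing, rfl, rfl, fun y hy => ?_, ?_, ?_, ?_,
    fun y hy hy' => ?_⟩
  · rw [hdist, H.isZero.1, H.isZero.2]; simp
  · rw [hmod, hmod]
  · refine ((jump H).xi_realData τ y).trans (Eq.trans ?_ (D.xi_realData τ y).symm)
    simp only [point, jump_ann_of_ne H hy, jump_pos_of_ne H hy]
  · rw [hmod, hmod, div_self outerRadius_pos.ne']; refine ((jump H).xi_realData τ x).trans ?_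
    simp only [point, jump_ann_self H, jump_pos_self H, Complex.ofReal_one, one_mul]; rfl
  · rw [hdist', jump_pos_succ_self, jump_ann_self, jump_pos_self, jump_wrap_self]; rfl
  · show ((jump H).real hτ').dist (inl (D.pairing j)) = 0
    rw [hdist', jump_pos_succ_target, jump_pos_of_ne H H.ne_pairing.symm, jump_wrap_target]; simp
  · have hy' : y ≠ inl (D.pairing j) := hy'
    grind [Diagram.jump_pos_succ_of_ne, Diagram.jump_wrap_of_ne, Diagram.jump_pos_of_ne, Diagram.jump_ann_of_ne]

lemma type_jump : (jump H).type = D.type := by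
  have : PreConfig.TypeStep D.standard (jump H).standard := .inr (.inl (jump_real H _ _))
  exact (Quot.sound this).symm

end Diagram

lemma PreConfig.Jump.dg_eq {h n m : ℕ} {L L' : PreConfig h n m} (J : Jump L L') :
    ∃ (x : Mark h m) (j : Fin (2 * h)) (H : L.diagram.CanJump x j),
      L'.diagram = Diagram.jump H := by
  have hw := J.walls_eq
  obtain ⟨x, j, h1, h2, -, h4, h5, h6, h7, h8, h9, h10, h11, h12⟩ := J
  have H : L.diagram.CanJump x j := ⟨h1, (L.dist_zero_iff x).1 h2, h4, h5⟩
  have hann : L'.ann x = L.ann (inl (L.pairing j)) := by simp only [SlitData.ann, h9]; rfl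
  have hang : L'.ang x = L.ang (inl (L.pairing j)) := by
    simp only [SlitData.ang, h9]
    rw [angle_real_mul (div_pos (L.modulus_pos _) (L.modulus_pos _))]; rfl
  refine ⟨x, j, H, Diagram.ext_isZero h6 h7 ?_ ?_ ?_ fun z => ?_⟩
  · funext z; by_cases hz : z = x
    · subst hz; exact hann.trans (Diagram.jump_ann_self H).symm
    · refine Eq.trans ?_ (Diagram.jump_ann_of_ne H hz).symm; show (L'.xi z).1 = (L.xi z).1
      rw [h8 z hz]
  · funext i; simp only [diagram, radialDegree, hw, Diagram.jump]
  · funext z; by_cases hz : z = x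
    · subst hz; refine Eq.trans ?_ (Diagram.jump_pos_self H).symm
      show L'.radialPos z = L.radialPos _
      simp only [radialPos, hw, hann, hang]; rfl
    · refine Eq.trans ?_ (Diagram.jump_pos_of_ne H hz).symm; show L'.radialPos z = L.radialPos _
      have e1 : L'.ann z = L.ann z := by simp only [SlitData.ann, h8 z hz]
      have e2 : L'.ang z = L.ang z := by simp only [SlitData.ang, h8 z hz]
      simp only [radialPos, hw, e1, e2]
  · rw [← dist_zero_iff]; by_cases hz : z = x
    · subst hz; rw [Diagram.jump_isZero_self H, h10, dist_zero_iff]; rfl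
    by_cases hz' : z = inl (L.pairing j)
    · subst hz'; exact iff_of_true h11 (Diagram.jump_isZero_target H)
    · rw [h12 z hz hz', dist_zero_iff, Diagram.jump_isZero_of_ne H hz hz']

namespace Diagram

variable {h n m : ℕ} (D : Diagram h n m)

/-! ### Collapse of a radial chamber -/

/-- The new number of the `k`-th wall. -/
def cpos (q j k : ℕ) : ℕ := (if k ≤ j then k else k - 1) % q

lemma cpos_of_lt (hj : j < q) (hk : k ≤ q) : cpos q j k = if k ≤ j then k else k - 1 := by
  unfold cpos; rw [mod_eq_of_lt]; split_ifs <;> omega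

lemma cpos_self (hk : k ≤ q) : cpos q q k = if k = q then 0 else k := by
  unfold cpos; rw [if_pos hk]; split_ifs with h
  · rw [h, mod_self]
  · rw [mod_eq_of_lt (by omega)]

/-- Whether the mark is on a wall which is moved to the positive real line by the collapse. -/
def crs (i : Fin n) (j : ℕ) (x : Mark h m) : ℕ :=
  if D.ann x = i ∧ D.pos x = j ∧ j = D.deg i then 1 else 0

/-- The diagram after the collapse of the `j`-th radial chamber on the `i`-th annulus. -/
def colFun (i : Fin n) (j : ℕ) (x : Mark h m) : ℕ :=
  if D.ann x = i then cpos (D.deg i) j (D.pos x) else D.pos x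

lemma col_wrap_aux (i j) (hd : 1 ≤ D.deg i) (hj : j ≤ D.deg i)
    (x) : D.crs i j x ≤ D.wrap x + D.crs i j (D.succ x) ∧
    (D.wrap x + D.crs i j (D.succ x) = D.crs i j x → D.colFun i j x ≤ D.colFun i j (D.succ x)) ∧
    (D.wrap x + D.crs i j (D.succ x) ≠ D.crs i j x → D.colFun i j (D.succ x) ≤ D.colFun i j x) ∧
    (D.wrap x + D.crs i j (D.succ x) = D.crs i j x ∧ D.colFun i j (D.succ x) = D.colFun i j x ↔
      D.IsZero x ∨ (D.ann x = i ∧ D.pos x = j ∧ D.pos (D.succ x) = (j + 1) % (D.deg i + 1))) := by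
  have h1 : D.wrap x = 0 ∧ D.pos x ≤ D.pos (D.succ x) ∨ D.wrap x = 1 ∧ D.pos (D.succ x) ≤ D.pos x := by
    grind [Diagram.le_of_wrap_eq, Diagram.wrap_le_one, Diagram.le_of_wrap_ne]
  have h4 := D.pos_le x
  have h5 := D.pos_le (D.succ x)
  have hann := D.ann_succ x
  unfold crs colFun IsZero; rw [hann] at h5 ⊢
  generalize D.pos x = p at *
  generalize D.pos (D.succ x) = p' at *
  generalize D.wrap x = w at *
  by_cases hx : D.ann x = i
  · subst hx
    generalize D.deg (D.ann x) = q at *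
    simp only [if_true, true_and]; rcases hj.lt_or_eq with hj | hj
    · have hne : j ≠ q := hj.ne
      simp only [hne, and_false, if_false, cpos_of_lt hj h4, cpos_of_lt hj h5]
      rw [mod_eq_of_lt (by omega)]; grind
    · subst hj; simp only [and_true, cpos_self h4, cpos_self h5, mod_self]; grind
  grind

/-- The diagram after the collapse of the `j`-th radial chamber on the `i`-th annulus. -/
def collapse (i : Fin n) (j : ℕ) (hd : 1 ≤ D.deg i) (hj : j ≤ D.deg i) : Diagram h n m where
  pairing := D.pairing
  succ := D.succ
  ann := D.ann
  deg := update D.deg i (D.deg i - 1)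
  pos := D.colFun i j
  wrap x := D.wrap x + D.crs i j (D.succ x) - D.crs i j x
  pairing_ne := D.pairing_ne
  pairing_pairing := D.pairing_pairing
  sameCycle_iff := D.sameCycle_iff
  ex_ann := D.ex_ann
  pos_le x := by
    unfold colFun
    by_cases hx : D.ann x = i
    · subst hx
      rw [if_pos rfl, update_self]
      have := mod_lt (if D.pos x ≤ j then D.pos x else D.pos x - 1) (show 0 < D.deg (D.ann x) from hd)
      unfold cpos; omega
    · rw [if_neg hx, update_of_ne hx]; exact D.pos_le x
  ex_pos i' k h1 h2 := by
    by_cases hi : i' = i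
    · subst hi
      rw [update_self] at h2
      obtain ⟨x, hx, hk⟩ := D.ex_pos i' (if k ≤ j then k else k + 1) (by split_ifs <;> omega)
        (by split_ifs <;> omega)
      refine ⟨x, hx, ?_⟩
      rw [colFun, if_pos hx, hk]
      unfold cpos
      split_ifs <;> first | omega | (rw [mod_eq_of_lt] <;> omega)
    · rw [update_of_ne hi] at h2
      obtain ⟨x, hx, hk⟩ := D.ex_pos i' k h1 h2
      exact ⟨x, hx, by rw [colFun, if_neg (hx ▸ hi), hk]⟩
  le_of_wrap_eq x hx := by
    have := D.col_wrap_aux i j hd hj x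
    exact this.2.1 (by omega)
  le_of_wrap_ne x hx := by
    have := D.col_wrap_aux i j hd hj x
    exact this.2.2.1 (by omega)
  sum_wrap i' := by
    have h1 : ∀ x, ((D.wrap x + D.crs i j (D.succ x) - D.crs i j x : ℕ) : ℝ) =
        D.wrap x + D.crs i j (D.succ x) - D.crs i j x := fun x => by
      rw [Nat.cast_sub (D.col_wrap_aux i j hd hj x).1]; push_cast; ring
    have h2 : ((∑ x ∈ Finset.univ.filter (fun x => D.ann x = i'),
        (D.wrap x + D.crs i j (D.succ x) - D.crs i j x) : ℕ) : ℝ) = 1 := by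
      rw [Nat.cast_sum]
      simp only [h1]
      rw [Finset.sum_sub_distrib, sum_add_distrib,
        sum_annulus_succ D.ann_succ (fun x => (D.crs i j x : ℝ)), add_sub_cancel_right,
        ← Nat.cast_sum, D.sum_wrap, Nat.cast_one]
    exact_mod_cast h2
  boundary := D.boundary

variable {D} {i : Fin n} {j : ℕ} (hd : 1 ≤ D.deg i) (hj : j ≤ D.deg i)

lemma col_isZero_iff (x) : (D.collapse i j hd hj).IsZero x ↔
    D.IsZero x ∨ (D.ann x = i ∧ D.pos x = j ∧ D.pos (D.succ x) = (j + 1) % (D.deg i + 1)) := by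
  rw [← (D.col_wrap_aux i j hd hj x).2.2.2]; refine and_congr ?_ Iff.rfl
  have := (D.col_wrap_aux i j hd hj x).1
  simp only [collapse]; omega

end Diagram

lemma PreConfig.RadialCollapse.dg_eq
    (H : RadialCollapse i j L L') : ∃ (hd : 1 ≤ L.diagram.deg i) (hj : j ≤ L.diagram.deg i),
      L'.diagram = L.diagram.collapse i j hd hj := by
  obtain ⟨h1, h2, h3, h4, h5, h6, h7, -, -⟩ := H
  have hd : 1 ≤ L.diagram.deg i := by show 1 ≤ L.radialDegree i; omega
  refine ⟨hd, h2, Diagram.ext_isZero h1.1 h1.2.1 (funext h1.2.2) ?_ ?_ fun x => ?_⟩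
  · funext k; by_cases hk : k = i
    · subst hk; show L'.radialDegree k = update L.radialDegree k (L.radialDegree k - 1) k
      rw [update_self]; omega
    · show L'.radialDegree k = update L.radialDegree i (L.radialDegree i - 1) k
      rw [update_of_ne hk, h4 k hk]
  · funext x; show L'.radialPos x = if L.ann x = i then _ else L.radialPos x; split_ifs with hx
    · exact h6 x hx
    · exact h5 x hx
  · rw [← dist_zero_iff]
    refine (h7 x).trans (Iff.trans ?_ (Diagram.col_isZero_iff (D := L.diagram) hd h2 x).symm)
    rw [← dist_zero_iff]; rfl

namespace Diagram

variable {h n m : ℕ} {D : Diagram h n m} {i : Fin n} {j : ℕ} (hd : 1 ≤ D.deg i) (hj : j ≤ D.deg i)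

lemma radialCollapse_std :
    PreConfig.RadialCollapse i j D.standard (D.collapse i j hd hj).standard := by
  have e1 := D.dg_std
  have e2 := (D.collapse i j hd hj).dg_std
  have r1 : ∀ k, D.standard.radialDegree k = D.deg k := congrFun (congrArg deg e1)
  have r2 : ∀ k, (D.collapse i j hd hj).standard.radialDegree k = (D.collapse i j hd hj).deg k :=
    congrFun (congrArg deg e2)
  have p1 : ∀ k, D.standard.radialPos k = D.pos k := congrFun (congrArg pos e1)
  have p2 : ∀ k, (D.collapse i j hd hj).standard.radialPos k = D.colFun i j k :=
    congrFun (congrArg pos e2)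
  have a1 : ∀ k, D.standard.ann k = D.ann k := congrFun (congrArg ann e1)
  have a2 : ∀ k, (D.collapse i j hd hj).standard.ann k = D.ann k := congrFun (congrArg ann e2)
  have s1 : D.standard.succ = D.succ := rfl
  refine ⟨⟨rfl, rfl, fun x => (a2 x).trans (a1 x).symm⟩, ?_, ?_, fun k hk => ?_, fun x hx => ?_,
    fun x hx => ?_, fun x => ?_, ?_, fun k => ?_⟩
  · rwa [r1]
  · rw [r1, r2]; show update D.deg i (D.deg i - 1) i + 1 = _; rw [update_self]; omega
  · rw [r1, r2]; exact update_of_ne hk ..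
  · rw [p1, p2]; rw [a1] at hx; exact if_neg hx
  · rw [p1, p2, r1]; rw [a1] at hx; exact if_pos hx
  · grind [PreConfig.dist_zero_iff, Diagram.col_isZero_iff]
  · grind [PreConfig.Unilevel.annularDegree_eq, Diagram.uni_std]
  grind [PreConfig.Unilevel.level_eq, Diagram.uni_std]

lemma isRadialFace_type : CombType.IsRadialFace i j D.type (D.collapse i j hd hj).type :=
  ⟨_, _, rfl, rfl, radialCollapse_std hd hj⟩

lemma real_eq_of_coface (hτ : Coord D.deg τ)
    (hτ' : Coord (D.collapse i j hd hj).deg τ') (h1 : τ i = coface j (τ' i))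
    (h2 : ∀ k, k ≠ i → τ k = τ' k) : D.real hτ = (D.collapse i j hd hj).real hτ' := by
  have hS0 : ∀ k, psum τ i k = psum τ' i (if k ≤ j then k else k - 1) := fun k => by
    rw [psum, h1]; exact sum_coface j _ k
  have hS : ∀ x, psum τ (D.ann x) (D.pos x) = psum τ' (D.ann x) (D.colFun i j x) + D.crs i j x := by
    intro x; unfold colFun crs; by_cases hx : D.ann x = i
    · have hp := D.pos_le x; rw [hx] at hp; simp only [hx, if_true, true_and]; rw [hS0]
      rcases hj.lt_or_eq with hj | hj
      · rw [cpos_of_lt hj hp, if_neg (fun h' : _ ∧ _ => hj.ne h'.2)]; simp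
      · subst hj; rw [cpos_self hp, if_pos hp]; simp only [and_true]; split_ifs with h3
        · have h4 := hτ'.sum_eq i
          have h5 : (D.collapse i (D.deg i) hd hj).deg i + 1 = D.deg i := by
            show update D.deg i (D.deg i - 1) i + 1 = _
            rw [update_self]; omega
          rw [h5] at h4; rw [h3, psum, h4]; simp [psum]
        · simp
    · simp only [hx, if_false, false_and]; rw [psum, psum, h2 _ hx]; simp
  have hpt : ∀ x, D.point τ x = (D.collapse i j hd hj).point τ' x := by
    intro x; have h3 := hS x
    have h4 : Complex.exp ((2 * pi * (D.crs i j x : ℝ) : ℝ) * Complex.I) = 1 := by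
      rw [Complex.exp_eq_one_iff]; exact ⟨D.crs i j x, by push_cast; ring⟩
    simp only [point]; refine Prod.ext rfl ?_
    show (outerRadius : ℂ) * _ = (outerRadius : ℂ) *
      Complex.exp ((2 * pi * psum τ' (D.ann x) (D.colFun i j x) : ℝ) * Complex.I)
    congr 1; rw [h3, mul_add, Complex.ofReal_add, add_mul, Complex.exp_add, h4, mul_one]
  have hdata : D.realData τ = (D.collapse i j hd hj).realData τ' := by
    simp only [realData, hpt]; congr 1; funext x; have h3 := hS x
    have h4 := hS (D.succ x)
    rw [D.ann_succ] at h4; rw [h3, h4]; congr 1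
    show _ = psum τ' (D.ann x) (D.colFun i j (D.succ x)) - psum τ' (D.ann x) (D.colFun i j x) +
      ((D.wrap x + D.crs i j (D.succ x) - D.crs i j x : ℕ) : ℝ)
    rw [Nat.cast_sub (D.col_wrap_aux i j hd hj x).1]
    push_cast; ring
  have : ∀ (L L' : PreConfig h n m), L.toSlitData = L'.toSlitData → L = L' := by
    rintro ⟨⟩ ⟨⟩ rfl; rfl
  exact this _ _ hdata

end Diagram

end RadialSlit

namespace RadialSlit

open PermHit

namespace Diagram

variable {h n m : ℕ} (D : Diagram h n m)

/-! ### The cyclic order -/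

/-- `b` is the successor of `a`, without crs the positive real line. -/
def Step (a b : Mark h m) : Prop := D.wrap a = 0 ∧ D.succ a = b

lemma ex_wrap (i) : ∃ z, D.ann z = i ∧ D.wrap z = 1 := by
  by_contra! H; have := D.sum_wrap i; rw [Finset.sum_eq_zero] at this
  · exact zero_ne_one this
  grind [Diagram.wrap_le_one]

lemma wrap_unique (hann : D.ann x = D.ann y) (hx : D.wrap x ≠ 0) (hy : D.wrap y ≠ 0) : x = y := by
  by_contra hne; have h1 := D.sum_wrap (D.ann x)
  have h2 : ∑ z ∈ ({x, y} : Finset (Mark h m)), D.wrap z ≤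
      ∑ z ∈ Finset.univ.filter (fun z => D.ann z = D.ann x), D.wrap z := by
    refine Finset.sum_le_sum_of_subset fun z hz => ?_; grind
  rw [Finset.sum_pair hne, h1] at h2; omega

lemma step_total (hann : D.ann x = D.ann y) :
    Relation.ReflTransGen D.Step x y ∨ Relation.ReflTransGen D.Step y x := by
  obtain ⟨z, hz, hw⟩ := D.ex_wrap (D.ann x)
  have key : ∀ b, D.ann b = D.ann x → Relation.ReflTransGen D.Step (D.succ z) b := by
    intro b hb
    have hs : D.succ.SameCycle (D.succ z) b := by rw [D.sameCycle_iff, D.ann_succ, hz, hb]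
    obtain ⟨k, rfl⟩ := hs.exists_nat_pow_eq
    clear hs hb
    induction k with
    | zero => exact .refl
    | succ k ih =>
      rw [pow_succ', mul_apply]; by_cases h0 : D.wrap ((D.succ ^ k) (D.succ z)) = 0
      · exact ih.tail ⟨h0, rfl⟩
      · have : (D.succ ^ k) (D.succ z) = z := by
          refine D.wrap_unique ?_ h0 (by omega)
          have : D.succ.SameCycle (D.succ z) ((D.succ ^ k) (D.succ z)) := ⟨k, by simp⟩
          rw [D.sameCycle_iff, D.ann_succ] at this; exact this.symm
        rw [this]
  exact Relation.ReflTransGen.total_of_right_unique (fun a b c h1 h2 => h1.2.symm.trans h2.2)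
    (key x rfl) (key y hann.symm)

variable {D}

lemma pos_le_of_step (H : Relation.ReflTransGen D.Step x y) : D.pos x ≤ D.pos y := by
  induction H with
  | refl => rfl
  | tail _ h ih => exact ih.trans (h.2 ▸ D.le_of_wrap_eq _ h.1)

/-- `x` is the first mark on its radial segment. -/
def IsFirst (D : Diagram h n m) (x : Mark h m) : Prop := ∀ z, D.succ z = x → ¬ D.IsZero z

lemma wrap_ne_of_last (hx : ¬ D.IsZero x) (hp : D.pos x = D.deg (D.ann x)) :
    D.wrap x ≠ 0 := fun hw => hx ⟨hw, by
  grind [Diagram.le_of_wrap_eq, Diagram.pos_le, Diagram.ann_succ]⟩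

lemma last_unique {x y : Mark h m} (hx : ¬ D.IsZero x) (hy : ¬ D.IsZero y)
    (hann : D.ann x = D.ann y) (hp : D.pos x = D.pos y) : x = y := by
  by_cases hd : D.pos x = D.deg (D.ann x)
  · grind [Diagram.wrap_unique, Diagram.wrap_ne_of_last]
  · wlog hs : Relation.ReflTransGen D.Step x y generalizing x y
    · grind [Diagram.step_total]
    rcases hs.cases_head with h | ⟨c, h1, h2⟩
    · exact h
    · refine absurd ⟨h1.1, ?_⟩ hx; have h3 := pos_le_of_step h2; have h4 := D.le_of_wrap_eq x h1.1
      rw [h1.2] at h4 ⊢; omega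

lemma succ_eq_of_last_of_first (hx : ¬ D.IsZero x) (hy : D.IsFirst y)
    (hann : D.ann y = D.ann x) (hp : D.pos y = (D.pos x + 1) % (D.deg (D.ann x) + 1)) :
    D.succ x = y := by
  have hle := D.pos_le x
  obtain ⟨z, rfl⟩ := D.succ.surjective y
  have hz := hy z rfl
  by_cases hd : D.pos x = D.deg (D.ann x)
  · rw [hd, mod_self] at hp
    have h1 : D.wrap z ≠ 0 := fun hw => hz ⟨hw, by have := D.le_of_wrap_eq z hw; omega⟩
    rw [D.ann_succ] at hann; rw [D.wrap_unique hann h1 (wrap_ne_of_last hx hd)]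
  · rw [mod_eq_of_lt (by omega)] at hp
    have hs : Relation.ReflTransGen D.Step x (D.succ z) :=
      (D.step_total hann.symm).resolve_right fun h' => by have := pos_le_of_step h'; omega
    rcases hs.cases_head with h | ⟨c, h1, h2⟩
    · rw [h] at hp; omega
    · have h4 := D.le_of_wrap_eq x h1.1
      have h5 : D.pos (D.succ x) ≠ D.pos x := fun h' => hx ⟨h1.1, h'⟩
      rw [← h1.2] at h2; rcases h2.cases_tail with h | ⟨e, h6, h7⟩
      · exact h.symm
      · obtain rfl := D.succ.injective h7.2; have h8 := pos_le_of_step h6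
        have h9 := D.le_of_wrap_eq e h7.1
        exact absurd ⟨h7.1, by omega⟩ hz

lemma ex_isFirst (x) : ∃ y, D.IsFirst y ∧ D.ann y = D.ann x ∧ D.pos y = D.pos x := by
  by_contra! H
  have h1 : ∀ y, D.ann y = D.ann x → D.pos y = D.pos x →
      D.IsZero (D.succ⁻¹ y) ∧ D.pos (D.succ⁻¹ y) = D.pos x ∧ D.ann (D.succ⁻¹ y) = D.ann x := by
    intro y h2 h3; have h4 : ¬ D.IsFirst y := fun h' => H y h' h2 h3
    unfold IsFirst at h4; push Not at h4; obtain ⟨z, rfl, hz⟩ := h4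
    have e : D.succ⁻¹ (D.succ z) = z := symm_apply_apply _ _
    rw [e]; exact ⟨hz, hz.2 ▸ h3, by rwa [D.ann_succ] at h2⟩
  obtain ⟨z, hz, hw⟩ := D.ex_wrap (D.ann x)
  have hs : D.succ⁻¹.SameCycle x (D.succ z) := by
    rw [Equiv.Perm.sameCycle_inv, D.sameCycle_iff, D.ann_succ, hz]
  obtain ⟨k, hk⟩ := hs.exists_nat_pow_eq
  have h2 : ∀ k : ℕ, D.ann ((D.succ⁻¹ ^ k) x) = D.ann x ∧ D.pos ((D.succ⁻¹ ^ k) x) = D.pos x := by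
    intro k
    induction k with
    | zero => exact ⟨rfl, rfl⟩
    | succ k ih =>
      rw [pow_succ', mul_apply]; grind
  have h3 := h2 k
  rw [hk] at h3; have h4 := (h1 _ h3.1 h3.2).1
  have e : D.succ⁻¹ (D.succ z) = z := symm_apply_apply _ _
  rw [e] at h4; rw [h4.1] at hw; exact zero_ne_one hw

end Diagram

end RadialSlit

/-! # Unfolded graphs -/

namespace FatGraphs

open PermHit RadialSlit

variable {h n m : ℕ}

/-- The half edges `att x` of `G` are attached at the marks of the diagram `D`. -/
structure Attachment (D : Diagram h n m) (G : AdmissibleFatGraph h n m) (att : Mark h m → G.H) :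
    Prop where
  card : ∀ i, G.cCard i = D.deg i + 1
  inj : Injective att
  notMem : ∀ x, att x ∉ G.admissibleEdges
  cover : ∀ a, a ∈ G.admissibleEdges ∨ a ∈ G.leafEdges ∨ a ∈ Set.range att
  inv_slit : ∀ i, G.inv (att (inl i)) = att (inl (D.pairing i))
  inv_param : ∀ p, G.inv (att (inr p)) = G.leaf (inr p)
  src_eq : ∀ x, G.src (att x) = G.cVtx (D.ann x) (D.pos x)
  rot_of_isZero : ∀ x, D.IsZero x → G.rot (att x) = att (D.succ x)
  rot_of_not_isZero : ∀ x, ¬ D.IsZero x → G.rot (att x) = G.inv (G.circleEdge (D.ann x) (D.pos x))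

/-- `G` is the unfolded graph of the diagram `D`. -/
def Unf (D : Diagram h n m) (G : AdmissibleFatGraph h n m) : Prop := ∃ att, Attachment D G att

lemma unfGraph_iff (L : PreConfig h n m) (G : AdmissibleFatGraph h n m) :
    IsUnfoldedGraph L G ↔ Unf L.diagram G := by
  constructor
  · rintro ⟨h1, att, h2, h3, h4, h5, h6, h7, h8, h9⟩
    exact ⟨att, h1, h2, h3, h4, h5, h6, h7, fun x hx => h8 x ((L.dist_zero_iff x).2 hx),
      fun x hx => h9 x fun h' => hx ((L.dist_zero_iff x).1 h')⟩
  · rintro ⟨att, h1, h2, h3, h4, h5, h6, h7, h8, h9⟩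
    exact ⟨h1, att, h2, h3, h4, h5, h6, h7, fun x hx => h8 x ((L.dist_zero_iff x).1 hx),
      fun x hx => h9 x fun h' => hx ((L.dist_zero_iff x).2 h')⟩

namespace Attachment

variable {D : Diagram h n m} {G : AdmissibleFatGraph h n m} {att : Mark h m → G.H}
  (A : Attachment D G att)

include A

lemma pos_lt (x) : D.pos x < G.cCard (D.ann x) := by rw [A.card]; exact lt_succ_of_le (D.pos_le x)

lemma onCircle (x) : G.OnCircle (G.src (att x)) :=
  G.onCircle_iff.2 ⟨_, _, A.pos_lt x, (A.src_eq x).symm⟩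

lemma att_ne_leaf (x l) : att x ≠ G.leaf l := fun h' => G.not_onCircle_leaf l (h' ▸ A.onCircle x)

lemma inv_leaf_param (p) : G.inv (G.leaf (inr p)) = att (inr p) := by rw [← A.inv_param, G.inv_inv]

lemma att_ne_inv_leaf (x i) : att x ≠ G.inv (G.leaf (inl i)) := by
  intro h'; have h2 : G.inv (att x) = G.leaf (inl i) := by rw [h', G.inv_inv]
  rcases x with k | p
  · rw [A.inv_slit] at h2; exact A.att_ne_leaf _ _ h2
  · rw [A.inv_param] at h2; exact absurd (G.leaf_injective h2) (by simp)

lemma slit_notMem_leaves (i) : att (inl i) ∉ G.leafEdges := by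
  rintro ⟨l, h' | h'⟩
  · exact A.att_ne_leaf _ _ h'
  · rcases l with k | p
    · exact A.att_ne_inv_leaf _ _ h'
    · rw [A.inv_leaf_param] at h'; exact absurd (A.inj h') (by simp)

lemma onCircle_or (a) : G.OnCircle (G.src a) ∨ ∃ l, a = G.leaf l := by
  rcases A.cover a with h1 | ⟨l, h1 | h1⟩ | ⟨x, rfl⟩
  · exact .inl (G.onCircle_of_adm h1)
  · exact .inr ⟨l, h1⟩
  · left; rcases l with i | p
    · rw [h1, ← G.vtx_zero]; exact G.onCircle_iff.2 ⟨i, 0, G.circleCard_pos i, rfl⟩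
    · rw [h1, A.inv_leaf_param]; exact A.onCircle _
  · exact .inl (A.onCircle x)

lemma rot_edge_of_isFirst (hk : k < G.cCard i)
    (hy : D.IsFirst y) (hann : D.ann y = i) (hp : D.pos y = (k + 1) % G.cCard i) :
    G.rot (G.circleEdge i k) = att y := by
  obtain ⟨a, ha⟩ := G.rot.surjective (att y)
  have hsrc : G.src a = G.cVtx i ((k + 1) % G.cCard i) := by
    rw [← G.src_rot a, ha, A.src_eq, hann, hp]
  rw [← G.src_edge' i hk] at hsrc; rcases A.cover a with h1 | ⟨l, h1 | h1⟩ | ⟨x, rfl⟩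
  · obtain ⟨i', k', hk', rfl | rfl⟩ := G.mem_adm.1 h1
    · rw [← ha, (src_injOn_circles G (G.edge_mem hk') (G.edge_mem hk) hsrc).1]
    · exfalso; rcases k' with _ | k'
      · rw [G.rot_inv_edge_zero] at ha; exact A.att_ne_inv_leaf _ _ ha.symm
      · rw [G.rot_inv_edge_succ] at ha; exact A.notMem y (ha ▸ G.edge_mem_adm (by omega))
  · rw [h1, G.rot_leaf] at ha; exact (A.att_ne_leaf _ _ ha.symm).elim
  · rcases l with i' | p
    · rw [h1, G.rot_inv_leaf] at ha
      exact (A.notMem y (ha ▸ G.edge_mem_adm (Nat.sub_lt (G.circleCard_pos i') one_pos))).elim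
    · rw [h1, A.inv_leaf_param] at ha; by_cases hz : D.IsZero (inr p)
      · rw [A.rot_of_isZero _ hz] at ha; exact (hy _ (A.inj ha) hz).elim
      · rw [A.rot_of_not_isZero _ hz] at ha
        exact (A.notMem y (ha ▸ G.ic_adm _ (G.edge_mem_adm (A.pos_lt _)))).elim
  · by_cases hz : D.IsZero x
    · rw [A.rot_of_isZero _ hz] at ha; exact (hy _ (A.inj ha) hz).elim
    · rw [A.rot_of_not_isZero _ hz] at ha
      exact (A.notMem y (ha ▸ G.ic_adm _ (G.edge_mem_adm (A.pos_lt _)))).elim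

lemma rot_edge {i : Fin n} {k : ℕ} (hk : k < G.cCard i) :
    (∃ y, D.IsFirst y ∧ D.ann y = i ∧ D.pos y = (k + 1) % G.cCard i ∧
      G.rot (G.circleEdge i k) = att y) ∨
    (∀ y, D.ann y = i → D.pos y ≠ (k + 1) % G.cCard i) ∧
      G.rot (G.circleEdge i k) = G.inv (G.circleEdge i ((k + 1) % G.cCard i)) := by
  by_cases hex : ∃ y, D.ann y = i ∧ D.pos y = (k + 1) % G.cCard i
  · obtain ⟨x, hx, hxp⟩ := hex; obtain ⟨y, h1, h2, h3⟩ := D.ex_isFirst x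
    grind [Attachment.rot_edge_of_isFirst]
  · push Not at hex; refine .inr ⟨hex, ?_⟩; set a := G.rot (G.circleEdge i k) with ha
    have hsrc : G.src a = G.cVtx i ((k + 1) % G.cCard i) := by rw [ha, G.src_rot, G.src_edge' i hk]
    have hlt := mod_lt (k + 1) (G.circleCard_pos i)
    rcases A.cover a with h1 | ⟨l, h1 | h1⟩ | ⟨x, hx⟩
    · obtain ⟨i', k', hk', h1 | h1⟩ := G.mem_adm.1 h1
      · exfalso
        have h2 : a = G.circleEdge i k := by
          rw [h1]; rw [h1, ← G.src_edge' i hk] at hsrc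
          exact (src_injOn_circles G (G.edge_mem hk') (G.edge_mem hk) hsrc).1
        rw [ha] at h2
        exact G.rot_ne_self (G.src_ne_leaf (G.notMem_leaves_of_mem_circle (G.edge_mem hk))) h2
      · rw [h1] at hsrc ⊢; obtain ⟨rfl, h2⟩ := vtx_inj G hk' hlt hsrc; rw [h2]
    · grind [ClosedFatGraph.not_onCircle_leaf, ClosedFatGraph.onCircle_iff]
    · exfalso; rcases l with i' | p
      · have h2 : G.rot (G.inv (G.circleEdge i' 0)) = G.rot (G.circleEdge i k) := by
          rw [G.rot_inv_edge_zero, ← h1]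
        exact inv_edge_ne G (G.circleCard_pos i') hk (G.rot.injective h2)
      · rw [h1, A.inv_leaf_param, A.src_eq] at hsrc
        obtain ⟨h2, h3⟩ := vtx_inj G (A.pos_lt _) hlt hsrc
        exact hex _ h2 h3
    · exfalso; rw [← hx, A.src_eq] at hsrc; obtain ⟨h2, h3⟩ := vtx_inj G (A.pos_lt _) hlt hsrc
      exact hex _ h2 h3

end Attachment

end FatGraphs

namespace FatGraphs

open PermHit RadialSlit

variable {h n m : ℕ}

lemma _root_.RadialSlit.Diagram.succ_eq_of_last_of_first' {D : Diagram h n m}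
    (hx : ¬ D.IsZero x) (hd : D.pos x = D.deg (D.ann x)) (hy : D.IsFirst y)
    (hann : D.ann y = D.ann x) (hp : D.pos y = 1) (h0 : ∀ z, D.ann z = D.ann x → D.pos z ≠ 0) :
    D.succ x = y := by
  obtain ⟨z, rfl⟩ := D.succ.surjective y
  have hz := hy z rfl
  rw [D.ann_succ] at hann
  have h1 : D.wrap z ≠ 0 := fun hw => hz ⟨hw, by
    have := D.le_of_wrap_eq z hw
    have := h0 z hann
    omega⟩
  rw [D.wrap_unique hann h1 (Diagram.wrap_ne_of_last hx hd)]

/-- The half edges of an unfolded graph of a diagram. -/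
inductive Code (D : Diagram h n m) : Type
  | att (x : Mark h m)
  | edge (i : Fin n) (k : Fin (D.deg i + 1))
  | invEdge (i : Fin n) (k : Fin (D.deg i + 1))
  | leaf (l : Fin n ⊕ Fin m)
  | root (i : Fin n)

namespace Attachment

variable {D : Diagram h n m} {G : AdmissibleFatGraph h n m} {att : Mark h m → G.H}

/-- The half edge with a given code. -/
def interp (_ : Attachment D G att) : Code D → G.H
  | .att x => att x
  | .edge i k => G.circleEdge i k
  | .invEdge i k => G.inv (G.circleEdge i k)
  | .leaf l => G.leaf l
  | .root i => G.inv (G.leaf (inl i))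

variable (A : Attachment D G att)

include A in
lemma lt_card {i : Fin n} (k : Fin (D.deg i + 1)) : k.1 < G.cCard i := by rw [A.card]; exact k.2

lemma interp_bijective : Function.Bijective A.interp := by
  have hadm : ∀ i (k : Fin (D.deg i + 1)), G.circleEdge i k ∈ G.admissibleEdges := fun i k =>
    G.edge_mem_adm (A.lt_card k)
  have hadm' : ∀ i (k : Fin (D.deg i + 1)), G.inv (G.circleEdge i k) ∈ G.admissibleEdges :=
    fun i k => G.ic_adm _ (hadm i k)
  have hleaf : ∀ l, G.leaf l ∉ G.admissibleEdges := fun l h' =>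
    disjoint_left.1 G.disj_adm_leaves h' ⟨l, .inl rfl⟩
  have hroot : ∀ l, G.inv (G.leaf l) ∉ G.admissibleEdges := fun l h' =>
    disjoint_left.1 G.disj_adm_leaves h' ⟨l, .inr rfl⟩
  constructor
  · rintro (x | ⟨i, k⟩ | ⟨i, k⟩ | l | i) (y | ⟨j, l'⟩ | ⟨j, l'⟩ | l' | j) hab <;>
      simp only [interp] at hab
    · rw [A.inj hab]
    · exact (A.notMem x (hab ▸ hadm _ _)).elim
    · exact (A.notMem x (hab ▸ hadm' _ _)).elim
    · exact (A.att_ne_leaf _ _ hab).elim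
    · exact (A.att_ne_inv_leaf _ _ hab).elim
    · exact (A.notMem y (hab ▸ hadm _ _)).elim
    · obtain ⟨rfl, h1⟩ := edge_inj G (A.lt_card k) (A.lt_card l') hab; rw [Fin.ext h1]
    · exact (inv_edge_ne G (A.lt_card l') (A.lt_card k) hab.symm).elim
    · exact (hleaf _ (hab ▸ hadm _ _)).elim
    · exact (hroot _ (hab ▸ hadm _ _)).elim
    · exact (A.notMem y (hab ▸ hadm' _ _)).elim
    · exact (inv_edge_ne G (A.lt_card k) (A.lt_card l') hab).elim
    · obtain ⟨rfl, h1⟩ := edge_inj G (A.lt_card k) (A.lt_card l') (G.inv.injective hab)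
      rw [Fin.ext h1]
    · exact (hleaf _ (hab ▸ hadm' _ _)).elim
    · exact (hroot _ (hab ▸ hadm' _ _)).elim
    · exact (A.att_ne_leaf _ _ hab.symm).elim
    · exact (hleaf _ (hab ▸ hadm _ _)).elim
    · exact (hleaf _ (hab ▸ hadm' _ _)).elim
    · rw [G.leaf_injective hab]
    · exact (G.leaf_ne_inv_leaf _ _ hab).elim
    · exact (A.att_ne_inv_leaf _ _ hab.symm).elim
    · exact (hroot _ (hab ▸ hadm _ _)).elim
    · exact (hroot _ (hab ▸ hadm' _ _)).elim
    · exact (G.leaf_ne_inv_leaf _ _ hab.symm).elim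
    · rw [inl_injective (G.leaf_injective (G.inv.injective hab))]
  · intro a; rcases A.cover a with h1 | ⟨l, h1 | h1⟩ | ⟨x, hx⟩
    · obtain ⟨i, k, hk, h1 | h1⟩ := G.mem_adm.1 h1
      · exact ⟨.edge i ⟨k, by rwa [A.card] at hk⟩, h1.symm⟩
      · exact ⟨.invEdge i ⟨k, by rwa [A.card] at hk⟩, h1.symm⟩
    · exact ⟨.leaf l, h1.symm⟩
    · rcases l with i | p
      · exact ⟨.root i, h1.symm⟩
      · exact ⟨.att (inr p), by rw [h1, A.inv_leaf_param]; rfl⟩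
    · exact ⟨.att x, hx⟩

lemma rot_interp (A' : Attachment D G' att') (c : Code D) : ∃ c', G.rot (A.interp c) = A.interp c' ∧
      G'.rot (A'.interp c) = A'.interp c' := by
  rcases c with x | ⟨i, k⟩ | ⟨i, k⟩ | l | i
  · by_cases hx : D.IsZero x
    · exact ⟨.att (D.succ x), A.rot_of_isZero x hx, A'.rot_of_isZero x hx⟩
    · exact ⟨.invEdge (D.ann x) ⟨D.pos x, lt_succ_of_le (D.pos_le x)⟩,
        A.rot_of_not_isZero x hx, A'.rot_of_not_isZero x hx⟩
  · have hlt : (k.1 + 1) % G.cCard i < D.deg i + 1 := by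
      rw [A.card]; exact mod_lt _ (Nat.succ_pos _)
    have hc : G'.cCard i = G.cCard i := by rw [A.card, A'.card]
    rcases A.rot_edge (A.lt_card k) with ⟨y, h1, h2, h3, h4⟩ | ⟨h1, h2⟩
    · exact ⟨.att y, h4, A'.rot_edge_of_isFirst (A'.lt_card k) h1 h2 (by rw [hc, h3])⟩
    · refine ⟨.invEdge i ⟨_, hlt⟩, h2, ?_⟩
      rcases A'.rot_edge (A'.lt_card k) with ⟨y, h4, h5, h6, h7⟩ | ⟨h4, h5⟩
      · exact (h1 y h5 (by rw [h6, hc])).elim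
      · rw [hc] at h5; exact h5
  · obtain ⟨k, hk⟩ := k; rcases k with _ | k
    · exact ⟨.root i, G.rot_inv_edge_zero i, G'.rot_inv_edge_zero i⟩
    · exact ⟨.edge i ⟨k, by omega⟩, G.rot_inv_edge_succ i k, G'.rot_inv_edge_succ i k⟩
  · exact ⟨.leaf l, G.rot_leaf l, G'.rot_leaf l⟩
  · refine ⟨.edge i ⟨D.deg i, by omega⟩, ?_, ?_⟩
    · have := G.rot_inv_leaf i; rwa [A.card] at this
    · have := G'.rot_inv_leaf i; rwa [A'.card] at this

lemma inv_interp (A' : Attachment D G' att') (c : Code D) : ∃ c', G.inv (A.interp c) = A.interp c' ∧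
      G'.inv (A'.interp c) = A'.interp c' := by
  rcases c with (x | p) | ⟨i, k⟩ | ⟨i, k⟩ | (l | p) | i
  · exact ⟨.att (inl (D.pairing x)), A.inv_slit x, A'.inv_slit x⟩
  · exact ⟨.leaf (inr p), A.inv_param p, A'.inv_param p⟩
  · exact ⟨.invEdge i k, rfl, rfl⟩
  · exact ⟨.edge i k, G.inv_inv _, G'.inv_inv _⟩
  · exact ⟨.root l, rfl, rfl⟩
  · exact ⟨.att (inr p), A.inv_leaf_param p, A'.inv_leaf_param p⟩
  · exact ⟨.leaf (inl i), G.inv_inv _, G'.inv_inv _⟩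

include A in
lemma nonempty_iso (A' : Attachment D G' att') : Nonempty (G.Collapse G' ∅) := by
  let e1 := ofBijective _ A.interp_bijective
  let e2 := ofBijective _ A'.interp_bijective
  have he : ∀ c, (e1.symm.trans e2) (A.interp c) = A'.interp c := fun c => by
    show e2 (e1.symm (e1 c)) = _
    rw [e1.symm_apply_apply]; rfl
  have h1 : ∀ a, G'.rot ((e1.symm.trans e2) a) = (e1.symm.trans e2) (G.rot a) := fun a => by
    obtain ⟨c, rfl⟩ := A.interp_bijective.2 a
    obtain ⟨c', h1, h2⟩ := A.rot_interp A' c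
    rw [h1, he, he, h2]
  have h2 : ∀ a, G'.inv ((e1.symm.trans e2) a) = (e1.symm.trans e2) (G.inv a) := fun a => by
    obtain ⟨c, rfl⟩ := A.interp_bijective.2 a
    obtain ⟨c', h1, h2⟩ := A.inv_interp A' c
    rw [h1, he, he, h2]
  obtain ⟨c, -⟩ := Collapse.nonempty_of_equiv (G := G.toClosedFatGraph)
    (G' := G'.toClosedFatGraph) (e1.symm.trans e2) h1 h2
    (fun l => he (.leaf l)) (src_surjective G) (src_surjective G')
  exact ⟨c⟩

include A in
lemma hit_next (x : Mark h m) : Hit G.next G.admissibleEdges (G.inv (att x)) (att (D.succ x)) := by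
  by_cases hx : D.IsZero x
  · exact Hit.of_eq (by rw [← G.rot_inv]; exact A.rot_of_isZero x hx)
  have hr : G.next (G.inv (att x)) = G.inv (G.circleEdge (D.ann x) (D.pos x)) := by
    rw [← G.rot_inv]; exact A.rot_of_not_isZero x hx
  have hm : ∀ {i k}, k < G.cCard i → G.inv (G.circleEdge i k) ∈ G.admissibleEdges := fun hk =>
    G.ic_adm _ (G.edge_mem_adm hk)
  have hn : ∀ i k, G.next (G.inv (G.circleEdge i k)) = G.rot (G.circleEdge i k) := fun i k => by
    rw [← G.rot_inv]
  have h1 : Hit G.next G.admissibleEdges (G.inv (att x)) (G.rot (G.circleEdge (D.ann x) (D.pos x))) :=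
    (Hit.of_eq hr).of_step (hm (A.pos_lt x)) (hn _ _)
  rcases A.rot_edge (A.pos_lt x) with ⟨y, h2, h3, h4, h5⟩ | ⟨h2, h3⟩
  · grind [Diagram.succ_eq_of_last_of_first, Attachment.card]
  · have hle := D.pos_le x
    have hd : D.pos x = D.deg (D.ann x) := by
      by_contra hne; obtain ⟨y, hy, hyp⟩ := D.ex_pos (D.ann x) (D.pos x + 1) (by omega) (by omega)
      refine h2 y hy ?_; rw [A.card, hyp, mod_eq_of_lt (by omega)]
    have h0 : (D.pos x + 1) % G.cCard (D.ann x) = 0 := by rw [A.card, hd, mod_self]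
    rw [h0] at h2 h3; rw [h3] at h1; have hpos := G.circleCard_pos (D.ann x)
    have hd1 : 1 ≤ D.deg (D.ann x) := by
      have := h2 x rfl
      omega
    have h4 := (h1.of_step (hm hpos) (hn _ _))
    rcases A.rot_edge hpos with ⟨y, h5, h6, h7, h8⟩ | ⟨h5, h6⟩
    · rw [A.card, mod_eq_of_lt (by omega)] at h7
      rw [Diagram.succ_eq_of_last_of_first' hx hd h5 h6 h7 h2, ← h8]; exact h4
    · obtain ⟨y, hy, hyp⟩ := D.ex_pos (D.ann x) 1 le_rfl hd1
      exact (h5 y hy (by rw [A.card, hyp, mod_eq_of_lt (by omega)])).elim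

include A in
lemma isZero_iff (x) : D.IsZero x ↔ G.rot (att x) ∉ G.admissibleEdges := by
  constructor
  · intro hx; rw [A.rot_of_isZero x hx]; exact A.notMem _
  · intro h'; by_contra hx; rw [A.rot_of_not_isZero x hx] at h'
    exact h' (G.ic_adm _ (G.edge_mem_adm (A.pos_lt x)))

include A in
lemma relabel (τ) : Attachment (D.relabel τ) G (att ∘ exPerm τ) where
  card := A.card
  inj := A.inj.comp (exPerm τ).injective
  notMem x := A.notMem _
  cover a := by rw [Function.Surjective.range_comp (exPerm τ).surjective]; exact A.cover a
  inv_slit i := (A.inv_slit (τ i)).trans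
    (congrArg (fun k => att (inl k)) (apply_symm_apply τ (D.pairing (τ i))).symm)
  inv_param p := A.inv_param p
  src_eq x := A.src_eq _
  rot_of_isZero x hx := by
    have e : exPerm τ ((exPerm τ)⁻¹ (D.succ (exPerm τ x))) = D.succ (exPerm τ x) :=
      apply_symm_apply _ _
    refine (A.rot_of_isZero (exPerm τ x) ⟨hx.1, ?_⟩).trans (congrArg att e.symm); have := hx.2
    simp only [Diagram.relabel, mul_apply, e] at this; exact this
  rot_of_not_isZero x hx := by
    refine A.rot_of_not_isZero (exPerm τ x) fun h' => hx ⟨h'.1, ?_⟩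
    have e : exPerm τ ((exPerm τ)⁻¹ (D.succ (exPerm τ x))) = D.succ (exPerm τ x) :=
      apply_symm_apply _ _
    simp only [Diagram.relabel, mul_apply, e]; exact h'.2

include A in
lemma dg_unique (A' : Attachment D' G att') : ∃ τ, D' = D.relabel τ := by
  have key : ∀ {D D' : Diagram h n m} {att att' : Mark h m → G.H} (_ : Attachment D G att)
      (_ : Attachment D' G att') (i : Fin (2 * h)), ∃ k, att' (inl i) = att (inl k) := by
    intro D D' att att' A A' i; rcases A.cover (att' (inl i)) with h1 | h1 | ⟨x | p, hx⟩
    · exact (A'.notMem _ h1).elim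
    · exact (A'.slit_notMem_leaves _ h1).elim
    · exact ⟨x, hx.symm⟩
    · exfalso
      have : att' (inl i) = att' (inr p) := by rw [← hx, ← A.inv_leaf_param, A'.inv_leaf_param]
      exact absurd (A'.inj this) (by simp)
  choose f hf using key A A'
  have hfinj : Injective f := fun a b hab => by
    have := A'.inj ((hf a).trans ((congrArg (fun k => att (inl k)) hab).trans (hf b).symm))
    simpa using this
  let τ : Perm (Fin (2 * h)) := ofBijective f (Finite.injective_iff_bijective.1 hfinj)
  have hatt : ∀ x, att' x = att (exPerm τ x) := by
    rintro (i | p)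
    · exact hf i
    · rw [← A'.inv_leaf_param, A.inv_leaf_param]; rfl
  have B := A.relabel τ
  have hattB : att' = att ∘ exPerm τ := funext hatt
  have hpos : ∀ x, D'.ann x = (D.relabel τ).ann x ∧ D'.pos x = (D.relabel τ).pos x := fun x => by
    have h1 := A'.src_eq x
    rw [hattB, B.src_eq] at h1; have := vtx_inj G (B.pos_lt x) (A'.pos_lt x) h1
    exact ⟨this.1.symm, this.2.symm⟩
  refine ⟨τ, Diagram.ext_isZero ?_ ?_ (funext fun x => (hpos x).1) ?_ (funext fun x => (hpos x).2)
    fun x => ?_⟩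
  · ext1 i
    have h1 := A'.inv_slit i
    rw [hattB, B.inv_slit] at h1; simpa using (B.inj h1).symm
  · ext1 x
    have h1 := A'.hit_next x
    rw [hattB] at h1; exact B.inj (h1.unique (B.notMem _) (B.hit_next x) (B.notMem _))
  · funext i; have h1 := A'.card i; have h2 := B.card i; omega
  · rw [A'.isZero_iff, B.isZero_iff, hattB]

end Attachment

/-! ### Admissible cycles under collapses -/

namespace Collapse

variable {G G' : AdmissibleFatGraph h n m} {F : Set G.H} (c : G.Collapse G' F)

include c in
lemma card_eq (hF : InvClosed F) (i) : G'.cCard i = (G.circle i \ F).ncard := by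
  have : G'.circle i = (fun a : {a : G.H // a ∉ F} => c.onH a) '' {a | a.1 ∈ G.circle i} := by
    ext y; obtain ⟨a, rfl⟩ := c.ex_onH y
    grind [Collapse.mem_circle_iff]
  rw [ClosedFatGraph.cCard, this, c.onH.injective.injOn.ncard_image,
    ← Subtype.val_injective.injOn.ncard_image]
  congr 1; ext a; constructor
  · rintro ⟨b, hb, rfl⟩; exact ⟨hb, b.2⟩
  · rintro ⟨h1, h2⟩; exact ⟨⟨a, h2⟩, h1, rfl⟩

lemma onH_edge (i) (φ : ℕ → ℕ) (N) (hφ : ∀ k < N, G.circleEdge i (φ k) ∉ F)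
    (h0 : 0 < N → Hit G.next F (G.circleEdge i (φ 0)) (G.inv (G.leaf (inl i))))
    (hs : ∀ k, k + 1 < N → Hit G.next F (G.circleEdge i (φ (k + 1))) (G.circleEdge i (φ k)))
    (hF : InvClosed F) (k) (hk : k < N) :
    G'.circleEdge i k = c.onH ⟨G.circleEdge i (φ k), hφ k hk⟩ := by
  apply G'.next.injective
  induction k with
  | zero =>
    rw [G'.next_edge_zero, ← c.onH_inv_leaf _ (c.inv_leaf_notMem hF _)]
    exact (c.next_eq (h0 hk)).symm
  | succ k ih =>
    rw [G'.next_circleEdge_succ, G'.next.injective (ih (by omega))]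
    exact (c.next_eq (hs k hk)).symm

lemma edge_eq (hF : InvClosed F) {i : Fin n} (hd) (hk : k < G.cCard i) :
    G'.circleEdge i k = c.onH ⟨G.circleEdge i k, fun h' => disjoint_left.1 hd h' (G.edge_mem hk)⟩ :=
  c.onH_edge i id (G.cCard i) (fun k hk h' => disjoint_left.1 hd h' (G.edge_mem hk))
    (fun _ => Hit.of_eq (G.next_edge_zero i))
    (fun k _ => Hit.of_eq (G.next_circleEdge_succ i k)) hF k hk

include c in
lemma card_eq_of_disj (hF : InvClosed F) {i : Fin n}
    (hd : Disjoint F (G.circle i)) : G'.cCard i = G.cCard i := by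
  rw [c.card_eq hF, hd.symm.sdiff_eq_left]; rfl

end Collapse

/-- The number before the collapse of the `j`-th edge of the edge with number `k` afterwards. -/
def shift (j k : ℕ) : ℕ := if k < j then k else k + 1

section

variable {G G' : AdmissibleFatGraph h n m} {i : Fin n} {j : ℕ} (hj : j < G.cCard i)
  (c : G.Collapse G' (G.pair (G.circleEdge i j)))

include hj

lemma edge_notMem_pair (hk : k < G.cCard i') (hne : i' = i → k ≠ j) :
    G.circleEdge i' k ∉ G.pair (G.circleEdge i j) := by
  grind [edge_inj, inv_edge_ne]

include c in
lemma card_col_self : G'.cCard i + 1 = G.cCard i := by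
  rw [c.card_eq (ic_pair _)]
  have : G.circle i \ (G.pair (G.circleEdge i j)) = G.circle i \ {G.circleEdge i j} := by
    grind [AdmissibleFatGraph.inv_notMem_circle, ClosedFatGraph.edge_mem]
  rw [this]; exact Set.ncard_sdiff_singleton_add_one (G.edge_mem hj)

lemma disj_pair_circle (hne : i' ≠ i) : Disjoint (G.pair (G.circleEdge i j)) (G.circle i') := by
  grind [ClosedFatGraph.ex_edge, edge_notMem_pair]

include c in
lemma card_col_of_ne {i' : Fin n} (hne : i' ≠ i) : G'.cCard i' = G.cCard i' :=
  c.card_eq_of_disj (ic_pair _) (disj_pair_circle hj hne)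

lemma edge_col_of_ne (hne : i' ≠ i) (hk : k < G.cCard i') :
    G'.circleEdge i' k = c.onH ⟨G.circleEdge i' k,
      edge_notMem_pair hj hk fun h' => (hne h').elim⟩ :=
  c.edge_eq (ic_pair _) (disj_pair_circle hj hne) hk

lemma edge_col_self (hk : k + 1 < G.cCard i) :
    G'.circleEdge i k = c.onH ⟨G.circleEdge i (shift j k),
      edge_notMem_pair hj (by unfold shift; split_ifs <;> omega)
        fun _ => by unfold shift; split_ifs <;> omega⟩ := by
  refine c.onH_edge i (shift j) (G.cCard i - 1) (fun k hk => edge_notMem_pair hj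
    (by unfold shift; split_ifs <;> omega) fun _ => by unfold shift; split_ifs <;> omega)
    (fun _ => ?_) (fun k hk => ?_) (ic_pair _) k (by omega)
  · rcases Nat.eq_zero_or_pos j with rfl | hj0
    · exact (Hit.of_eq (G.next_circleEdge_succ i 0)).of_step (.inl rfl) (G.next_edge_zero i)
    · rw [shift, if_pos hj0]; exact Hit.of_eq (G.next_edge_zero i)
  · unfold shift; rcases lt_trichotomy (k + 1) j with h1 | h1 | h1
    · grind [Hit.of_eq, ClosedFatGraph.next_circleEdge_succ]
    · rw [if_neg (by omega), if_pos (by omega)]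
      exact (Hit.of_eq (G.next_circleEdge_succ i _)).of_step (.inl (by rw [h1]))
        (G.next_circleEdge_succ i k)
    grind [Hit.of_eq, ClosedFatGraph.next_circleEdge_succ]

end

lemma shift_cpos {q j p : ℕ} (hq : 1 ≤ q) (hj : j ≤ q) (hp : p ≤ q) :
    shift j (Diagram.cpos q j p) = if p = j then (j + 1) % (q + 1) else p := by
  rcases hj.lt_or_eq with hj | rfl
  · rw [Diagram.cpos_of_lt hj hp, mod_eq_of_lt (by omega)]; unfold shift; split_ifs <;> omega
  · rw [Diagram.cpos_self hp, mod_self]; unfold shift; split_ifs <;> omega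

lemma Attachment.collapse (A : Attachment D G att) {i : Fin n} {j : ℕ} (hd : 1 ≤ D.deg i)
    (hj : j ≤ D.deg i) (c : G.Collapse G'
      (G.pair (G.circleEdge i j))) : Unf (D.collapse i j hd hj) G' := by
  have hjN : j < G.cCard i := by rw [A.card]; omega
  have hF := ic_pair (G := G.toFatGraph) (G.circleEdge i j)
  have hFadm : ∀ a ∈ G.pair (G.circleEdge i j), a ∈ G.admissibleEdges := by
    rintro a (rfl | rfl)
    · exact G.edge_mem_adm hjN
    · exact G.ic_adm _ (G.edge_mem_adm hjN)
  have hatt : ∀ x, att x ∉ G.pair (G.circleEdge i j) := fun x h' => A.notMem x (hFadm _ h')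
  have hedge : ∀ x, ∃ (k : ℕ) (hk : G.circleEdge (D.ann x) k ∉ (G.pair (G.circleEdge i j))),
      G'.circleEdge (D.ann x) (D.colFun i j x) = c.onH ⟨G.circleEdge (D.ann x) k, hk⟩ ∧
      k = if D.ann x = i ∧ D.pos x = j then (j + 1) % (D.deg i + 1) else D.pos x := by
    intro x; have hp := D.pos_le x
    by_cases hx : D.ann x = i
    · rw [hx] at hp; have h1 := shift_cpos hd hj hp
      have hlt : Diagram.cpos (D.deg i) j (D.pos x) < D.deg i := mod_lt _ hd
      have h2 := edge_col_self hjN c (k := Diagram.cpos (D.deg i) j (D.pos x))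
        (by rw [A.card]; omega)
      unfold Diagram.colFun; grind
    · unfold Diagram.colFun; grind [edge_notMem_pair, Attachment.pos_lt, edge_col_of_ne]
  refine ⟨fun x => c.onH ⟨att x, hatt x⟩, fun i' => ?_, fun x y hxy => ?_, fun x => ?_, fun y => ?_,
    fun k => ?_, fun p => ?_, fun x => ?_, fun x hx => ?_, fun x hx => ?_⟩
  · show G'.cCard i' = update D.deg i (D.deg i - 1) i' + 1; by_cases hi : i' = i
    · subst hi; have := card_col_self hjN c; rw [A.card] at this; rw [update_self]; omega
    · rw [update_of_ne hi, card_col_of_ne hjN c hi, A.card]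
  · exact A.inj (Subtype.mk.inj (c.onH.injective hxy))
  · rw [c.mem_adm hF]; exact A.notMem x
  · obtain ⟨a, rfl⟩ := c.ex_onH y; rw [c.mem_adm hF, c.mem_leaves_iff hF]
    refine (A.cover a.1).imp_right (Or.imp_right ?_); grind
  · exact c.inv_onH _ _ (A.inv_slit k)
  · rw [← c.onH_leaf' _ (c.leaf_notMem _)]; exact c.inv_onH _ _ (A.inv_param p)
  · obtain ⟨k, hk, h1, h2⟩ := hedge x
    show G'.src _ = G'.src (G'.inv (G'.circleEdge (D.ann x) (D.colFun i j x)))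
    rw [h1, c.inv_eq hF, c.src_onH, c.src_onH, A.src_eq]; show _ = c.onV (G.cVtx (D.ann x) k)
    rw [h2]; split_ifs with h3
    · rw [h3.1, h3.2]; have h4 := G.src_edge' i hjN; rw [A.card] at h4
      have h5 : c.onV (G.src (G.circleEdge i j)) = c.onV (G.src (G.inv (G.circleEdge i j))) :=
        (c.onV_eq_iff _ _).2 (Reach.of_mem (.inl rfl))
      rw [h4] at h5; exact h5.symm
    · rfl
  · rw [Diagram.col_isZero_iff] at hx; by_cases hx0 : D.IsZero x
    · exact c.rot_eq_of_rot hF _ _ (A.rot_of_isZero x hx0)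
    · obtain ⟨h1, h2, h3⟩ := hx.resolve_left hx0; refine c.rot_eq hF ?_
      have h4 : G.next (G.inv (att x)) = G.inv (G.circleEdge i j) := by
        rw [← G.rot_inv, A.rot_of_not_isZero x hx0, h1, h2]
      refine (Hit.of_eq h4).of_step (.inr rfl) ?_; rw [← G.rot_inv]
      refine A.rot_edge_of_isFirst hjN (fun z hz hz0 => ?_) ?_ ?_
      · rw [D.succ.injective hz] at hz0; exact hx0 hz0
      · show D.ann (D.succ x) = i; rw [D.ann_succ, h1]
      · rw [A.card]; exact h3
  · rw [Diagram.col_isZero_iff] at hx; push Not at hx; obtain ⟨hx0, hx1⟩ := hx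
    obtain ⟨k, hk, h1, h2⟩ := hedge x
    show G'.rot _ = G'.inv (G'.circleEdge (D.ann x) (D.colFun i j x))
    rw [h1, c.inv_eq hF]
    have h4 : G.next (G.inv (att x)) = G.inv (G.circleEdge (D.ann x) (D.pos x)) := by
      rw [← G.rot_inv, A.rot_of_not_isZero x hx0]
    refine c.rot_eq hF ?_; by_cases h3 : D.ann x = i ∧ D.pos x = j
    · rw [if_pos h3] at h2; refine (Hit.of_eq h4).of_step (.inr (by rw [h3.1, h3.2]; rfl)) ?_
      show G.next _ = G.inv (G.circleEdge (D.ann x) k)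
      rw [← G.rot_inv, h2]; rcases A.rot_edge (A.pos_lt x) with ⟨y, h5, h6, h7, h8⟩ | ⟨h5, h6⟩
      · grind [Diagram.succ_eq_of_last_of_first, Attachment.card]
      · rw [h6, A.card, h3.1, h3.2]
    · rw [if_neg h3] at h2; subst h2; exact Hit.of_eq h4

end FatGraphs

/-! # Jumps as slides -/

namespace FatGraphs

open PermHit RadialSlit

variable {h n m : ℕ}

lemma Attachment.transport (A : Attachment D G att) (c : G.Collapse G' ∅) :
    Attachment D G' fun x => c.onH ⟨att x, Set.notMem_empty _⟩ := by
  have hF : InvClosed (G := G.toFatGraph) ∅ := fun _ h' => h'.elim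
  have hE : ∀ {i k}, k < G.cCard i →
      G'.circleEdge i k = c.onH ⟨G.circleEdge i k, Set.notMem_empty _⟩ :=
    fun hk => c.edge_eq hF (Set.empty_disjoint _) hk
  refine ⟨fun i => ?_, fun x y hxy => ?_, fun x => ?_, fun y => ?_, fun i => ?_, fun p => ?_,
    fun x => ?_, fun x hx => ?_, fun x hx => ?_⟩
  · rw [c.card_eq_of_disj hF (Set.empty_disjoint _), A.card]
  · exact A.inj (Subtype.mk.inj (c.onH.injective hxy))
  · rw [c.mem_adm hF]; exact A.notMem x
  · obtain ⟨a, rfl⟩ := c.ex_onH y; rw [c.mem_adm hF, c.mem_leaves_iff hF]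
    refine (A.cover a.1).imp_right (Or.imp_right ?_); grind
  · exact c.inv_onH _ _ (A.inv_slit i)
  · rw [← c.onH_leaf' _ (c.leaf_notMem _)]; exact c.inv_onH _ _ (A.inv_param p)
  · show _ = G'.src (G'.inv (G'.circleEdge _ _))
    rw [hE (A.pos_lt x), c.inv_eq hF, c.src_onH, c.src_onH]; exact congrArg c.onV (A.src_eq x)
  · exact c.rot_eq_of_rot hF _ _ (A.rot_of_isZero x hx)
  · rw [hE (A.pos_lt x), c.inv_eq hF]; exact c.rot_eq_of_rot hF _ _ (A.rot_of_not_isZero x hx)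

lemma Unf.transport {D : Diagram h n m} {G G' : AdmissibleFatGraph h n m}
    (H : Unf D G) (c : G.Collapse G' ∅) :
    Unf D G' := by
  obtain ⟨att, A⟩ := H
  exact ⟨_, A.transport c⟩

lemma Unf.type_eq (H : Unf D G) (H' : Unf D' G) : D.type = D'.type := by
  obtain ⟨att, A⟩ := H
  obtain ⟨att', A'⟩ := H'
  obtain ⟨τ, rfl⟩ := A.dg_unique A'
  exact (D.type_relabel τ).symm

/-- The half edges `g`, `x`, `j` are, in this order, those of a trivalent vertex. -/
structure IsTripod (G : FatGraph) (g x j : G.H) : Prop where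
  rot_g : G.rot g = x
  rot_x : G.rot x = j
  rot_j : G.rot j = g

namespace IsTripod

variable {G : FatGraph} {g x j : G.H} (T : IsTripod G g x j)

include T

lemma src_x : G.src x = G.src g := by rw [← T.rot_g, G.src_rot]

lemma src_j : G.src j = G.src g := by rw [← T.rot_x, G.src_rot, T.src_x]

lemma eq_or (ha : G.src a = G.src g) : a = g ∨ a = x ∨ a = j := by
  obtain ⟨k, rfl⟩ := ((G.sameCycle_rot g a).2 ha.symm).exists_nat_pow_eq
  clear ha
  induction k with
  | zero => exact .inl rfl
  | succ k ih =>
    rw [pow_succ', mul_apply]; grind [IsTripod.rot_g, IsTripod.rot_x, IsTripod.rot_j]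

end IsTripod

lemma Collapse.onV_eq_of_pair
    (c : Collapse G G' {g, G.inv g}) (hpq : c.onV p = c.onV q) (hp : p ≠ G.src g)
    (hq : q ≠ G.src g) : p = q := by
  classical
  have := Reach.induct eq_equivalence
    (fun v => if v = G.src g then G.src (G.inv g) else v) (fun a ha => ?_)
    ((c.onV_eq_iff p q).1 hpq)
  · simpa [hp, hq] using this
  · rcases ha with rfl | rfl
    · simp
    · rw [G.inv_inv]; simp

set_option maxHeartbeats 2000000 in
lemma Attachment.jump {D : Diagram h n m} {G G1 G2 : AdmissibleFatGraph h n m}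
    {att : Mark h m → G1.H} (A : Attachment D G1 att) {g x j : G.H}
    (T : IsTripod G.toFatGraph g x j)
    (c1 : G.Collapse G1 {g, G.inv g})
    (c2 : G.Collapse G2 {j, G.inv j})
    (hg : g ∉ G.admissibleEdges) (hsg : G.src (G.inv g) ≠ G.src g)
    (hsj : G.src (G.inv j) ≠ G.src g)
    {X : Mark h m} {J : Fin (2 * h)} (hx : x ∉ G.pair g)
    (hj : j ∉ G.pair g)
    (hX : att X = c1.onH ⟨x, hx⟩) (hJ : att (inl J) = c1.onH ⟨j, hj⟩) :
    ∃ H : D.CanJump X J, Unf (Diagram.jump H) G2 := by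
  have hF1 := ic_pair (G := G.toFatGraph) g
  have hF2 := ic_pair (G := G.toFatGraph) j
  have hgg := G.inv_ne g
  have hjj := G.inv_ne j
  have hTj := T.rot_j
  have hTx := T.rot_x
  have hxj : x ≠ j := by grind
  have hj' : G.inv j ∉ G.pair g := hF1.notMem hj
  have hxj' : x ≠ G.inv j := fun h' => hsj (h' ▸ T.src_x)
  have hxF2 : x ∉ G.pair j := by grind
  have hii := G.inv_inv
  have hgF2 : g ∉ G.pair j := by grind
  have hgF2' : G.inv g ∉ G.pair j := hF2.notMem hgF2
  have hex : ∀ y, ∃ a : {a : G.H // a ∉ G.pair g}, att y = c1.onH a := fun y => by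
    obtain ⟨a, ha⟩ := c1.ex_onH (att y); exact ⟨a, ha.symm⟩
  choose a1 ha1 using hex
  have ha1inj : ∀ {y z}, (a1 y).1 = (a1 z).1 → y = z := fun {y z} h' =>
    A.inj (by rw [ha1, ha1, Subtype.ext h'])
  have ha1X : (a1 X).1 = x := ext_iff.1 (c1.onH.injective ((ha1 X).symm.trans hX))
  have ha1J : (a1 (inl J)).1 = j := ext_iff.1 (c1.onH.injective ((ha1 _).symm.trans hJ))
  have ha1J' : (a1 (inl (D.pairing J))).1 = G.inv j := by
    have h1 := A.inv_slit J
    rw [hJ, c1.inv_eq hF1, ha1] at h1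
    exact (ext_iff.1 (c1.onH.injective h1)).symm
  have hadm1 : ∀ y, (a1 y).1 ∉ G.admissibleEdges := fun y => by
    rw [← c1.mem_adm hF1, ← ha1]; exact A.notMem y
  have hxadm : x ∉ G.admissibleEdges := ha1X ▸ hadm1 X
  have hjadm : j ∉ G.admissibleEdges := ha1J ▸ hadm1 _
  have hgadm' : G.inv g ∉ G.admissibleEdges := G.ic_adm.notMem hg
  have hrotX : G1.rot (att X) = att (inl J) := by
    rw [hX, hJ]; exact c1.rot_eq_of_rot hF1 _ _ T.rot_x
  have hzX : D.IsZero X := by rw [A.isZero_iff, hrotX]; exact A.notMem _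
  have H : D.CanJump X J := by
    refine ⟨A.inj ?_, hzX, fun h' => ?_, fun h' => ?_⟩
    · rw [← A.rot_of_isZero X hzX, hrotX]
    · exact hxj (by rw [← ha1X, ← ha1J, h'])
    · exact hxj' (by rw [← ha1X, ← ha1J', h'])
  refine ⟨H, ?_⟩
  set J' : Mark h m := inl (D.pairing J) with hJ'def
  have hJJ' : (inl J : Mark h m) ≠ J' := fun h' => D.pairing_ne J (inl_injective h').symm
  have hXJ : X ≠ inl J := H.ne
  have hXJ' : X ≠ J' := H.ne_pairing
  have hd1 : ∀ i, Disjoint (G.pair g) (G.circle i) := fun i => by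
    grind [ClosedFatGraph.circle_subset]
  have hjadm' := G.ic_adm.notMem hjadm
  have hd2 : ∀ i, Disjoint (G.pair j) (G.circle i) := fun i => by
    grind [ClosedFatGraph.circle_subset]
  have hE1 : ∀ {i k} (hk : k < G.cCard i), G1.circleEdge i k = c1.onH ⟨G.circleEdge i k,
      fun h' => disjoint_left.1 (hd1 i) h' (G.edge_mem hk)⟩ :=
    fun hk => c1.edge_eq hF1 (hd1 _) hk
  have hE2 : ∀ {i k} (hk : k < G.cCard i), G2.circleEdge i k = c2.onH ⟨G.circleEdge i k,
      fun h' => disjoint_left.1 (hd2 i) h' (G.edge_mem hk)⟩ :=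
    fun hk => c2.edge_eq hF2 (hd2 _) hk
  have hC1 : ∀ i, G1.cCard i = G.cCard i := fun i => c1.card_eq_of_disj hF1 (hd1 i)
  have hC2 : ∀ i, G2.cCard i = G.cCard i := fun i => c2.card_eq_of_disj hF2 (hd2 i)
  have hpos : ∀ y, D.pos y < G.cCard (D.ann y) := fun y => hC1 _ ▸ A.pos_lt y
  have hv : ∀ {i k}, k < G.cCard i → G.cVtx i k ≠ G.src g := by
    intro i k hk h'
    obtain ⟨i', a, ha, h2⟩ := G.onCircle_iff.2 ⟨i, k, hk, h'⟩
    have := G.circle_subset i' ha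
    rcases T.eq_or h2 with rfl | rfl | rfl
    exacts [hg this, hxadm this, hjadm this]
  have hsrc1 : ∀ y, G.src (a1 y).1 ≠ G.src g → G.src (a1 y).1 = G.cVtx (D.ann y) (D.pos y) := by
    intro y hy
    refine c1.onV_eq_of_pair ?_ hy (hv (hpos y))
    rw [← c1.src_onH, ← ha1, A.src_eq]
    show G1.src (G1.inv (G1.circleEdge _ _)) = _
    rw [hE1 (hpos y), c1.inv_eq hF1, c1.src_onH]; rfl
  have hleafg : g ∉ G.leafEdges := c1.notMem_leaves hF1 (.inl rfl)
  have hleafj : j ∉ G.leafEdges := c2.notMem_leaves hF2 (.inl rfl)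
  have hrg : G.rot (G.inv g) ≠ G.inv g := G.rot_ne_self (G.src_ne_leaf (G.ic_leaves.notMem hleafg))
  have hrj : G.rot (G.inv j) ≠ G.inv j := G.rot_ne_self (G.src_ne_leaf (G.ic_leaves.notMem hleafj))
  have hrotg : ∀ {a}, G.rot a = g → a = j := fun h' => G.rot.injective (h'.trans T.rot_j.symm)
  have hrotj : ∀ {a}, G.rot a = j → a = x := fun h' => G.rot.injective (h'.trans T.rot_x.symm)
  have hrotx : ∀ {a}, G.rot a = x → a = g := fun h' => G.rot.injective (h'.trans T.rot_g.symm)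
  have hwall : ∀ y, G.inv (G.circleEdge (D.ann y) (D.pos y)) ∈ G.admissibleEdges := fun y =>
    G.ic_adm _ (G.edge_mem_adm (hpos y))
  have hw1 : ∀ y, G.inv (G.circleEdge (D.ann y) (D.pos y)) ∉ G.pair g := by grind
  have hw2 : ∀ y, G.inv (G.circleEdge (D.ann y) (D.pos y)) ∉ G.pair j := by grind
  have ht : ∀ y (b : {a : G.H // a ∉ G.pair g}),
      G1.rot (att y) = c1.onH b → (D.IsZero y ∧ b.1 = (a1 (D.succ y)).1) ∨
      (¬ D.IsZero y ∧ b.1 = G.inv (G.circleEdge (D.ann y) (D.pos y))) := by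
    intro y b hb
    by_cases hy : D.IsZero y
    · rw [A.rot_of_isZero y hy, ha1] at hb
      exact .inl ⟨hy, (ext_iff.1 (c1.onH.injective hb)).symm⟩
    · rw [A.rot_of_not_isZero y hy, hE1 (hpos y), c1.inv_eq hF1] at hb
      exact .inr ⟨hy, (ext_iff.1 (c1.onH.injective hb)).symm⟩
  have hinv1 : ∀ a, G.rot a = G.next (G.inv a) := fun a => G.rot_inv a
  have hrot1 : ∀ y b, G.rot (a1 y).1 = b → (hb : b ∉ G.pair g) →
      G1.rot (att y) = c1.onH ⟨b, hb⟩ := fun y b h1 hb => by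
    rw [ha1]; exact c1.rot_eq_of_rot hF1 _ hb h1
  classical
  let α : Mark h m → G.H := fun y => if y = inl J then G.inv g else if y = J' then g else (a1 y).1
  have hαJ : α (inl J) = G.inv g := if_pos rfl
  have hαJ' : α J' = g := (if_neg hJJ'.symm).trans (if_pos rfl)
  have hα : ∀ y, y ≠ inl J → y ≠ J' → α y = (a1 y).1 := fun y h1 h2 => (if_neg h1).trans (if_neg h2)
  have hαX : α X = x := (hα X hXJ hXJ').trans ha1X
  have hαF2 : ∀ y, α y ∉ G.pair j := fun y => by
    clear * - hα hαJ hαJ' ha1inj ha1J ha1J' hgF2 hgF2'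
    clear_value α
    by_cases h1 : y = inl J <;> by_cases h2 : y = J' <;> grind
  have hαadm : ∀ y, α y ∉ G.admissibleEdges := fun y => by
    clear * - hα hαJ hαJ' hg hgadm' hadm1
    clear_value α
    by_cases h1 : y = inl J <;> by_cases h2 : y = J' <;> grind
  have hαinj : Injective α := fun y z hyz => by
    have h1 := (a1 y).2
    have h2 := (a1 z).2
    clear * - hα hαJ hαJ' ha1inj hgg h1 h2 hyz
    clear_value α
    by_cases h3 : y = inl J <;> by_cases h4 : y = J' <;> by_cases h5 : z = inl J <;>
      by_cases h6 : z = J' <;> grind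
  have hrot2 : ∀ {y z}, G.rot (α y) = α z → G2.rot (c2.onH ⟨α y, hαF2 y⟩) = c2.onH ⟨α z, hαF2 z⟩ :=
    fun h' => c2.rot_eq_of_rot hF2 _ _ h'
  have hrot2' : ∀ {y}, G.rot (α y) = G.inv j →
      G2.rot (c2.onH ⟨α y, hαF2 y⟩) = c2.onH ⟨α J', hαF2 J'⟩ := fun {y} h' => by
    refine c2.rot_eq hF2 ((Hit.of_eq ((hinv1 _).symm.trans h')).of_step (.inr rfl) ?_)
    show G.next (G.inv j) = α J'
    rw [← hinv1, T.rot_j, hαJ']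
  have hrot2w : ∀ {y z}, G.rot (α y) = G.inv (G.circleEdge (D.ann z) (D.pos z)) →
      G2.rot (c2.onH ⟨α y, hαF2 y⟩) = G2.inv (G2.circleEdge (D.ann z) (D.pos z)) :=
    fun {y z} h' => by
      rw [hE2 (hpos z), c2.inv_eq hF2]
      exact c2.rot_eq_of_rot hF2 _ _ h'
  have hnext_j : G.next j = G.rot (G.inv j) := rfl
  have hrotXz : ∀ {z}, G.rot (G.inv j) = α z →
      G2.rot (c2.onH ⟨α X, hαF2 X⟩) = c2.onH ⟨α z, hαF2 z⟩ := fun {z} h' => by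
    refine c2.rot_eq hF2 ((Hit.of_eq (b := j) ?_).of_step (.inl rfl) (hnext_j.trans h'))
    rw [← hinv1]; show G.rot (α X) = j
    rw [hαX, T.rot_x]
  have hrotXw : ∀ {z}, G.rot (G.inv j) = G.inv (G.circleEdge (D.ann z) (D.pos z)) →
      G2.rot (c2.onH ⟨α X, hαF2 X⟩) = G2.inv (G2.circleEdge (D.ann z) (D.pos z)) := fun {z} h' => by
    rw [hE2 (hpos z), c2.inv_eq hF2]
    refine c2.rot_eq hF2 ((Hit.of_eq (b := j) ?_).of_step (.inl rfl) (hnext_j.trans h'))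
    rw [← hinv1]; show G.rot (α X) = j
    rw [hαX, T.rot_x]
  have hTs := T.src_x
  have hz : ∀ y, G.rot (a1 y).1 = G.inv g → D.succ y = X ∧ D.IsZero y := fun y h1 => by
    have h2 : G1.rot (att y) = c1.onH ⟨x, hx⟩ := by
      rw [ha1]
      refine c1.rot_eq hF1 ((Hit.of_eq (b := G.inv g) ?_).of_step (.inr rfl) ?_)
      · rw [← hinv1, h1]
      · rw [← hinv1, T.rot_g]
    have := ht y _ h2
    grind
  have keyX : (D.succ J' = X ∧ D.IsZero J' ∧ G.rot (G.inv j) = G.inv g) ∨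
      (D.IsZero J' ∧ D.succ J' ≠ X ∧ G.rot (G.inv j) = α (D.succ J')) ∨
      (¬ D.IsZero J' ∧ G.rot (G.inv j) = G.inv (G.circleEdge (D.ann J') (D.pos J'))) := by
    by_cases h1 : G.rot (G.inv j) = G.inv g
    · grind
    · have h2 := hrot1 J' _ (by rw [ha1J']) (by grind : G.rot (G.inv j) ∉ G.pair g)
      have h3 := ht J' _ h2
      have h4 := G.src_rot (G.inv j)
      have h5 := hα (D.succ J')
      have h6 := H.succ_eq
      have h7 := D.succ.injective
      grind
  have keyJ : (D.IsZero (inl J) ∧ D.succ (inl J) = J' ∧ G.rot (G.inv g) = G.inv j) ∨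
      (D.IsZero (inl J) ∧ D.succ (inl J) ≠ X ∧ G.rot (G.inv g) = α (D.succ (inl J))) ∨
      (¬ D.IsZero (inl J) ∧
        G.rot (G.inv g) = G.inv (G.circleEdge (D.ann (inl J)) (D.pos (inl J)))) := by
    have hb : G.rot (G.inv g) ∉ G.pair g := by grind
    have h2 : G1.rot (att (inl J)) = c1.onH ⟨_, hb⟩ := by
      rw [ha1]
      refine c1.rot_eq hF1 ((Hit.of_eq (b := g) ?_).of_step (.inl rfl) rfl)
      rw [← hinv1, ha1J, T.rot_j]
    have h3 := ht _ _ h2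
    have h4 := G.src_rot (G.inv g)
    have h5 := hα (D.succ (inl J))
    have h6 := H.succ_eq
    have h7 := D.succ.injective
    grind
  have keyO : ∀ y, y ≠ X → y ≠ inl J → y ≠ J' →
      (D.IsZero y ∧ D.succ y = X ∧ G.rot (α y) = G.inv g) ∨
      (D.IsZero y ∧ D.succ y = J' ∧ G.rot (α y) = G.inv j) ∨
      (D.IsZero y ∧ D.succ y ≠ X ∧ G.rot (α y) = α (D.succ y)) ∨
      (¬ D.IsZero y ∧ G.rot (α y) = G.inv (G.circleEdge (D.ann y) (D.pos y))) := by
    intro y hyX hyJ hyJ'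
    rw [hα y hyJ hyJ']
    by_cases h1 : G.rot (a1 y).1 = G.inv g
    · grind
    · have h3 := ht y _ (hrot1 y _ rfl (by grind : G.rot (a1 y).1 ∉ G.pair g))
      have h4 := hα (D.succ y)
      have h6 := H.succ_eq
      have h7 := D.succ.injective
      have h8 := (a1 y).2
      grind
  have hjann : ∀ {z}, z ≠ X → (Diagram.jump H).ann z = D.ann z := fun hz =>
    Diagram.jump_ann_of_ne H hz
  have hjpos : ∀ {z}, z ≠ X → (Diagram.jump H).pos z = D.pos z := fun hz =>
    Diagram.jump_pos_of_ne H hz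
  have hsV : G2.src (c2.onH ⟨x, hxF2⟩) = G2.src (G2.inv (G2.circleEdge (D.ann J') (D.pos J'))) := by
    have h1 := hsrc1 J' (by rw [ha1J']; exact hsj)
    have h2 : c2.onV (G.src j) = c2.onV (G.src (G.inv j)) :=
      (c2.onV_eq_iff _ _).2 (Reach.of_mem (.inl rfl))
    rw [ha1J'] at h1
    rw [hE2 (hpos J'), c2.inv_eq hF2, c2.src_onH, c2.src_onH]
    show c2.onV (G.src x) = c2.onV (G.cVtx _ _)
    rw [← h1, ← h2, T.src_x, T.src_j]
  refine ⟨fun y => c2.onH ⟨α y, hαF2 y⟩, fun i => ?_, fun y z hyz => ?_, fun y => ?_, fun b => ?_,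
    fun i => ?_, fun p => ?_, fun y => ?_, fun y hy => ?_, fun y hy => ?_⟩
  · rw [hC2, ← hC1, A.card]; rfl
  · exact hαinj (Subtype.mk.inj (c2.onH.injective hyz))
  · rw [c2.mem_adm hF2]; exact hαadm y
  · obtain ⟨b, rfl⟩ := c2.ex_onH b
    rw [c2.mem_adm hF2, c2.mem_leaves_iff hF2]
    by_cases hb : b.1 ∈ G.pair g
    · right; right
      rcases hb with hb | hb
      · exact ⟨J', congrArg c2.onH (Subtype.ext (hαJ'.trans hb.symm))⟩
      · exact ⟨inl J, congrArg c2.onH (Subtype.ext (hαJ.trans hb.symm))⟩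
    · have := A.cover (c1.onH ⟨b.1, hb⟩)
      rw [c1.mem_adm hF1, c1.mem_leaves_iff hF1] at this
      refine this.imp_right (Or.imp_right ?_)
      rintro ⟨y, hy⟩
      have h1 : (a1 y).1 = b.1 := by
        rw [ha1] at hy
        exact ext_iff.1 (c1.onH.injective hy)
      have h2 : y ≠ inl J := by rintro rfl; exact b.2 (.inl (h1.symm.trans ha1J))
      have h3 : y ≠ J' := by rintro rfl; exact b.2 (.inr (h1.symm.trans ha1J'))
      exact ⟨y, congrArg c2.onH (Subtype.ext ((hα y h2 h3).trans h1))⟩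
  · refine c2.inv_onH _ _ ?_
    show G.inv (α (inl i)) = α (inl (D.pairing i))
    by_cases h1 : i = J
    · subst h1
      rw [hαJ, G.inv_inv, ← hJ'def, hαJ']
    by_cases h2 : i = D.pairing J
    · subst h2
      rw [D.pairing_pairing, hαJ, ← hJ'def, hαJ']
    · have h3 : (inl i : Mark h m) ≠ inl J := fun h' => h1 (inl_injective h')
      have h4 : (inl i : Mark h m) ≠ J' := fun h' => h2 (inl_injective h')
      have h5 : (inl (D.pairing i) : Mark h m) ≠ inl J := fun h' => h2 (by
        rw [← inl_injective h', D.pairing_pairing])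
      have h6 : (inl (D.pairing i) : Mark h m) ≠ J' := fun h' =>
        h1 (D.pairing.injective (inl_injective h'))
      rw [hα _ h3 h4, hα _ h5 h6]
      have h7 := A.inv_slit i
      rw [ha1, ha1, c1.inv_eq hF1] at h7
      exact ext_iff.1 (c1.onH.injective h7)
  · rw [← c2.onH_leaf' _ (c2.leaf_notMem _)]
    refine c2.inv_onH _ _ ?_
    show G.inv (α (inr p)) = _
    rw [hα _ (by simp) (by simp [hJ'def])]
    have h7 := A.inv_param p
    rw [ha1, c1.inv_eq hF1, ← c1.onH_leaf' _ (c1.leaf_notMem _)] at h7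
    exact ext_iff.1 (c1.onH.injective h7)
  · show _ = G2.src (G2.inv (G2.circleEdge _ _))
    by_cases hyX : y = X
    · subst hyX
      rw [Diagram.jump_ann_self, Diagram.jump_pos_self, ← hJ'def, ← hsV]
      congr 3
    rw [hjann hyX, hjpos hyX]
    by_cases hyJ' : y = J'
    · rw [hyJ', ← hsV, c2.src_onH, c2.src_onH]
      show c2.onV (G.src (α J')) = c2.onV (G.src x)
      rw [hαJ', T.src_x]
    rw [hE2 (hpos y), c2.inv_eq hF2, c2.src_onH, c2.src_onH]
    show c2.onV (G.src (α y)) = c2.onV (G.cVtx (D.ann y) (D.pos y))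
    congr 1
    by_cases hyJ : y = inl J
    · subst hyJ
      rw [hαJ]
      refine c1.onV_eq_of_pair ?_ hsg (hv (hpos _))
      have h1 : c1.onV (G.src g) = c1.onV (G.src (G.inv g)) :=
        (c1.onV_eq_iff _ _).2 (Reach.of_mem (.inl rfl))
      have h2 := A.src_eq (inl J)
      rw [hJ, c1.src_onH] at h2
      rw [← h1, ← T.src_j]
      refine h2.trans ?_
      show G1.src (G1.inv (G1.circleEdge _ _)) = _
      rw [hE1 (hpos _), c1.inv_eq hF1, c1.src_onH]; rfl
    · rw [hα y hyJ hyJ']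
      refine hsrc1 y fun h' => ?_
      rcases T.eq_or h' with h1 | h1 | h1
      · exact (a1 y).2 (.inl h1)
      · exact hyX (ha1inj (h1.trans ha1X.symm))
      · exact hyJ (ha1inj (h1.trans ha1J.symm))
  · have h0 := fun (h1 : y ≠ X) h2 => Diagram.jump_isZero_of_ne H h1 h2
    have h00 := Diagram.jump_isZero_self H
    have hr2 := @hrot2
    have hr2' := @hrot2'
    have hrX := @hrotXz
    have hTg := T.rot_g
    rcases H.cases y with ⟨h1, h2⟩ | ⟨h1, h2, h3⟩ | ⟨h1, h2, h3⟩ | ⟨h1, h2, h3, h4⟩ |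
      ⟨h1, h2, h3, h4⟩ <;> simp only [Diagram.jump]
    · grind
    · grind
    · grind
    · grind
    · grind
  · have h0 := fun (h1 : y ≠ X) h2 => Diagram.jump_isZero_of_ne H h1 h2
    by_cases hyX : y = X
    · grind [Diagram.jump_isZero_self H, Diagram.jump_ann_self H, Diagram.jump_pos_self H]
    rw [hjann hyX, hjpos hyX]
    have h5 : y ≠ J' := fun h' => hy (h' ▸ Diagram.jump_isZero_target H)
    rw [h0 hyX h5] at hy
    apply hrot2w
    by_cases hyJ : y = inl J
    · subst hyJ; rw [hαJ]; tauto
    · have := keyO y hyX hyJ h5; tauto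

end FatGraphs

/-! # Existence of unfolded graphs -/

namespace FatGraphs

open PermHit RadialSlit

namespace Code

variable {h n m : ℕ} {D : Diagram h n m}

variable (D) in
/-- The vertices of the unfolded graph: the ends of the radial walls, and the leaves. -/
abbrev Vert : Type := (Σ i : Fin n, Fin (D.deg i + 1)) ⊕ (Fin n ⊕ Fin m)

variable (D) in
/-- The wall of a mark. -/
def wall (x : Mark h m) : Fin (D.deg (D.ann x) + 1) := ⟨D.pos x, lt_succ_of_le (D.pos_le x)⟩

/-- The source map of the unfolded graph. -/
def src : Code D → Vert D
  | .att x => inl ⟨D.ann x, wall D x⟩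
  | .edge i k => inl ⟨i, k + 1⟩
  | .invEdge i k => inl ⟨i, k⟩
  | .leaf l => inr l
  | .root i => inl ⟨i, 0⟩

lemma inl_eq_iff : (inl ⟨i, k⟩ : Vert D) = inl ⟨j, l⟩ ↔ i = j ∧ k.1 = l.1 := by
  constructor
  · grind
  · rintro ⟨rfl, h2⟩; rw [Fin.ext h2]

/-- The edge pairing of the unfolded graph. -/
def invFun : Code D → Code D
  | .att (inl i) => .att (inl (D.pairing i))
  | .att (inr p) => .leaf (inr p)
  | .edge i k => .invEdge i k
  | .invEdge i k => .edge i k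
  | .leaf (inl i) => .root i
  | .leaf (inr p) => .att (inr p)
  | .root i => .leaf (inl i)

lemma invFun_invFun (c : Code D) : invFun (invFun c) = c := by
  rcases c with (x | p) | ⟨i, k⟩ | ⟨i, k⟩ | (i | p) | i <;> simp [invFun, D.pairing_pairing]

lemma invFun_ne (c : Code D) : invFun c ≠ c := by
  rcases c with (x | p) | ⟨i, k⟩ | ⟨i, k⟩ | (i | p) | i <;> simp [invFun, D.pairing_ne]

open Classical in
/-- The cyclic orderings of the unfolded graph. -/
def rotFun : Code D → Code D
  | .att x => if D.IsZero x then .att (D.succ x) else .invEdge (D.ann x) (wall D x)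
  | .edge i k => if H : ∃ y, D.IsFirst y ∧ src (D := D) (.att y) = inl ⟨i, k + 1⟩ then
      .att H.choose else .invEdge i (k + 1)
  | .invEdge i k => if k = 0 then .root i else .edge i (k - 1)
  | .leaf l => .leaf l
  | .root i => .edge i (-1)

lemma rotFun_att_of_isZero (hx : D.IsZero x) :
    rotFun (D := D) (.att x) = .att (D.succ x) := if_pos hx

lemma rotFun_att (hx : ¬ D.IsZero x) :
    rotFun (D := D) (.att x) = .invEdge (D.ann x) (wall D x) := if_neg hx

lemma rotFun_edge (i k) : (∃ y, D.IsFirst y ∧ src (D := D) (.att y) = inl ⟨i, k + 1⟩ ∧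
      rotFun (D := D) (.edge i k) = .att y) ∨
    (∀ y, src (D := D) (.att y) ≠ inl ⟨i, k + 1⟩) ∧
      rotFun (D := D) (.edge i k) = .invEdge i (k + 1) := by
  by_cases H : ∃ y, D.IsFirst y ∧ src (D := D) (.att y) = inl ⟨i, k + 1⟩
  · exact .inl ⟨H.choose, H.choose_spec.1, H.choose_spec.2, dif_pos H⟩
  · refine .inr ⟨fun y hy => ?_, dif_neg H⟩; obtain ⟨z, h1, h2, h3⟩ := D.ex_isFirst y
    exact H ⟨z, h1, by rw [← hy]; exact inl_eq_iff.2 ⟨h2, h3⟩⟩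

lemma rotFun_invEdge_zero (i) : rotFun (D := D) (.invEdge i 0) = .root i := by simp [rotFun]

lemma rotFun_invEdge (i : Fin n) {k : Fin (D.deg i + 1)} (hk : k ≠ 0) :
    rotFun (D := D) (.invEdge i k) = .edge i (k - 1) := if_neg hk

lemma rotFun_invEdge_cases (i k) : (k = 0 ∧ rotFun (D := D) (.invEdge i k) = .root i) ∨
    (k ≠ 0 ∧ rotFun (D := D) (.invEdge i k) = .edge i (k - 1)) := by
  by_cases hk : k = 0
  · exact .inl ⟨hk, if_pos hk⟩
  · exact .inr ⟨hk, if_neg hk⟩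

lemma src_rotFun (c : Code D) : src (rotFun c) = src c := by
  rcases c with x | ⟨i, k⟩ | ⟨i, k⟩ | l | i
  · by_cases hx : D.IsZero x
    · rw [rotFun_att_of_isZero hx]; exact inl_eq_iff.2 ⟨D.ann_succ x, hx.2⟩
    · rw [rotFun_att hx]; rfl
  · rcases rotFun_edge i k with ⟨y, -, h2, h3⟩ | ⟨-, h2⟩
    · rw [h3, h2]; rfl
    · rw [h2]; rfl
  · rcases rotFun_invEdge_cases i k with ⟨hk, h1⟩ | ⟨-, h1⟩ <;> rw [h1]
    · rw [hk]; rfl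
    · simp [src]
  · rfl
  · simp [rotFun, src]

lemma rotFun_injective : Injective (rotFun (D := D)) := by
  have key : ∀ c c' : Code D, src c = src c' → rotFun c = rotFun c' → c.ctorIdx ≤ c'.ctorIdx →
      c = c' := by
    intro c c' hs hr hle; rcases c with x | ⟨i, k⟩ | ⟨i, k⟩ | l | i
    · by_cases hx : D.IsZero x
      · rw [rotFun_att_of_isZero hx] at hr; rcases c' with y | ⟨j, l⟩ | ⟨j, l⟩ | l | j
        · by_cases hy : D.IsZero y
          · rw [rotFun_att_of_isZero hy] at hr; rw [D.succ.injective (Code.att.inj hr)]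
          · rw [rotFun_att hy] at hr; cases hr
        · rcases rotFun_edge j l with ⟨y, h1, -, h3⟩ | ⟨-, h2⟩
          · rw [h3] at hr; exact (h1 x (Code.att.inj hr) hx).elim
          · rw [h2] at hr; cases hr
        · grind [Code.rotFun_invEdge_cases]
        · cases hr
        · cases hr
      · rw [rotFun_att hx] at hr; rcases c' with y | ⟨j, l⟩ | ⟨j, l⟩ | l | j
        · by_cases hy : D.IsZero y
          · rw [rotFun_att_of_isZero hy] at hr; cases hr
          · have := inl_eq_iff.1 hs; rw [D.last_unique hx hy this.1 this.2]
        · rcases rotFun_edge j l with ⟨y, -, -, h3⟩ | ⟨h1, -⟩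
          · rw [h3] at hr; cases hr
          · exact (h1 x hs).elim
        · grind [Code.rotFun_invEdge_cases]
        · cases hr
        · cases hr
    · rcases c' with y | ⟨j, l⟩ | ⟨j, l⟩ | l | j
      · cases hle
      · obtain ⟨rfl, h2⟩ := inl_eq_iff.1 hs; rw [add_right_cancel (Fin.ext h2)]
      · rcases rotFun_edge i k with ⟨y, -, -, h3⟩ | ⟨-, h3⟩ <;>
          rcases rotFun_invEdge_cases j l with ⟨-, h1⟩ | ⟨-, h1⟩ <;> rw [h1, h3] at hr <;> cases hr
      all_goals rcases rotFun_edge i k with ⟨y, -, -, h3⟩ | ⟨-, h3⟩ <;> rw [h3] at hr <;> cases hr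
    · rcases c' with y | ⟨j, l⟩ | ⟨j, l⟩ | l | j
      · cases hle
      · exact absurd hle (by simp [Code.ctorIdx])
      · obtain ⟨rfl, h2⟩ := inl_eq_iff.1 hs; rw [Fin.ext h2]
      · cases hs
      · obtain ⟨rfl, h2⟩ := inl_eq_iff.1 hs; have h3 : k = 0 := Fin.ext h2
        rw [h3, rotFun_invEdge_zero] at hr; cases hr
    · rcases c' with y | ⟨j, l⟩ | ⟨j, l⟩ | l | j <;> cases hs; rfl
    · rcases c' with y | ⟨j, l⟩ | ⟨j, l⟩ | l | j
      · cases hle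
      · exact absurd hle (by simp [Code.ctorIdx])
      · exact absurd hle (by simp [Code.ctorIdx])
      · cases hs
      · obtain ⟨rfl, -⟩ := inl_eq_iff.1 hs; rfl
  intro c c' hr; grind [Code.src_rotFun]

variable (D) in
/-- The half edges as a disjoint union. -/
def equivSum : Code D ≃ ((Mark h m ⊕ (Fin n ⊕ Fin m)) ⊕ Fin n) ⊕
    ((Σ i : Fin n, Fin (D.deg i + 1)) ⊕ (Σ i : Fin n, Fin (D.deg i + 1))) where
  toFun
    | .att x => inl (inl (inl x))
    | .edge i k => inr (inl ⟨i, k⟩)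
    | .invEdge i k => inr (inr ⟨i, k⟩)
    | .leaf l => inl (inl (inr l))
    | .root i => inl (inr i)
  invFun
    | inl (inl (inl x)) => .att x
    | inr (inl k) => .edge k.1 k.2
    | inr (inr k) => .invEdge k.1 k.2
    | inl (inl (inr l)) => .leaf l
    | inl (inr i) => .root i
  left_inv c := by cases c <;> rfl
  right_inv c := by rcases c with ((x | l) | i) | k | k <;> rfl

instance : Finite (Code D) := Finite.of_equiv _ (equivSum D).symm

/-- The edge pairing as a permutation. -/
def inv : Perm (Code D) := ⟨invFun, invFun, invFun_invFun, invFun_invFun⟩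

/-- The cyclic orderings as a permutation. -/
def rot : Perm (Code D) := ofBijective rotFun (Finite.injective_iff_bijective.1 rotFun_injective)

lemma rot_apply (c : Code D) : rot c = rotFun c := rfl

lemma sc_att (x : Mark h m) :
    (rot (D := D)).SameCycle (.att x) (.invEdge (D.ann x) (wall D x)) := by
  obtain ⟨z, hz, hw⟩ := D.ex_wrap (D.ann x)
  obtain ⟨k, hk⟩ := ((D.sameCycle_iff x z).2 hz.symm).exists_nat_pow_eq
  clear hz
  induction k generalizing x with
  | zero =>
    obtain rfl : x = z := hk
    refine (sc_apply _ _).trans ?_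
    rw [rot_apply, rotFun_att fun h' => by rw [h'.1] at hw; exact zero_ne_one hw]
  | succ k ih =>
    by_cases hx : D.IsZero x
    · rw [pow_succ, mul_apply] at hk
      have h1 : (.invEdge (D.ann x) (wall D x) : Code D) =
          .invEdge (D.ann (D.succ x)) (wall D (D.succ x)) := by
        have h2 : (⟨D.ann x, wall D x⟩ : Σ i, Fin (D.deg i + 1)) =
            ⟨D.ann (D.succ x), wall D (D.succ x)⟩ :=
          inl_injective (inl_eq_iff.2 ⟨(D.ann_succ x).symm, hx.2.symm⟩ : (_ : Vert D) = _)
        grind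
      rw [h1]; refine (sc_apply _ _).trans ?_; rw [rot_apply, rotFun_att_of_isZero hx]
      exact ih _ hk
    · refine (sc_apply _ _).trans ?_; rw [rot_apply, rotFun_att hx]

lemma sc_edge (i : Fin n) (k : Fin (D.deg i + 1)) :
    (rot (D := D)).SameCycle (.edge i k) (.invEdge i (k + 1)) := by
  refine (sc_apply _ _).trans ?_; rw [rot_apply]
  rcases rotFun_edge i k with ⟨y, -, h2, h3⟩ | ⟨-, h3⟩
  · rw [h3]; have h4 := sc_att (D := D) y; have h2' := inl_injective h2; grind
  · rw [h3]

lemma sc_of_src {c : Code D} {k : Fin (D.deg i + 1)}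
    (hc : src c = inl ⟨i, k⟩) : (rot (D := D)).SameCycle c (.invEdge i k) := by
  rcases c with x | ⟨j, l⟩ | ⟨j, l⟩ | l | j
  · have := inl_injective hc; grind [Code.sc_att]
  · obtain ⟨rfl, h2⟩ := inl_eq_iff.1 hc; rw [← Fin.ext h2]; exact sc_edge _ _
  · obtain ⟨rfl, h2⟩ := inl_eq_iff.1 hc; rw [Fin.ext h2]
  · cases hc
  · obtain ⟨rfl, h2⟩ := inl_eq_iff.1 hc; refine (sc_apply _ _).trans ?_
    rw [rot_apply, show rotFun (.root j : Code D) = .edge j (-1) from rfl]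
    have := sc_edge (D := D) j (-1)
    rw [neg_add_cancel] at this; grind

lemma sameCycle_rot (c c' : Code D) : rot.SameCycle c c' ↔ src c = src c' := by
  constructor
  · exact sc_induct eq_equivalence src fun c => (src_rotFun c).symm
  · intro hs; rcases h1 : src c with ⟨i, k⟩ | l
    · exact (sc_of_src h1).trans (sc_of_src (hs ▸ h1)).symm
    · have h2 := hs ▸ h1
      have key : ∀ {c : Code D}, src c = inr l → c = .leaf l := by
        rintro (x | ⟨j, l⟩ | ⟨j, l⟩ | l | j) h' <;> cases h'; rfl
      rw [key h1, key h2]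

variable (D) in
/-- The unfolded graph of a diagram, as a fat graph. -/
def fatGraph : FatGraph where
  V := Vert D
  H := Code D
  finite_V := inferInstance
  finite_H := inferInstance
  src := src
  inv := inv
  inv_inv := invFun_invFun
  inv_ne := invFun_ne
  rot := rot
  sameCycle_rot := sameCycle_rot

/-- The permutation whose cycles are the boundary cycles. -/
def next : Perm (Code D) := rot * inv

lemma next_apply (c : Code D) : next c = rotFun (invFun c) := rfl

/-- The incoming boundary cycle of a half edge. -/
def incoming : Code D → Option (Fin n)
  | .edge i _ => some i
  | .leaf (inl i) => some i
  | .root i => some i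
  | _ => none

lemma incoming_next (c : Code D) : incoming (next c) = incoming c := by
  have hatt : ∀ x, incoming (rotFun (D := D) (.att x)) = none := fun x => by
    by_cases hx : D.IsZero x
    · rw [rotFun_att_of_isZero hx]; rfl
    · rw [rotFun_att hx]; rfl
  rw [next_apply]; rcases c with (x | p) | ⟨i, k⟩ | ⟨i, k⟩ | (i | p) | i
  · exact hatt _
  · rfl
  · show incoming (rotFun (.invEdge i k)) = _
    rcases rotFun_invEdge_cases i k with ⟨-, h1⟩ | ⟨-, h1⟩ <;> rw [h1] <;> rfl
  · show incoming (rotFun (.edge i k)) = _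
    rcases rotFun_edge i k with ⟨y, -, -, h3⟩ | ⟨-, h3⟩ <;> rw [h3] <;> rfl
  · rfl
  · exact hatt _
  · rfl

lemma next_edge_succ (i : Fin n) (hk : k + 1 < D.deg i + 1) :
    next (.edge i ⟨k + 1, hk⟩ : Code D) = .edge i ⟨k, by omega⟩ := by
  have h1 : (⟨k + 1, hk⟩ : Fin (D.deg i + 1)) ≠ 0 := fun h' => by
    have := congrArg Fin.val h'; simp at this
  refine (rotFun_invEdge i h1).trans ?_; congr 1; rw [sub_eq_iff_eq_add]; ext; rw [Fin.val_add]
  simp [mod_eq_of_lt hk]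

lemma sc_incoming {c : Code D} (hc : incoming c = some i) : next.SameCycle (.leaf (inl i)) c := by
  have hedge : ∀ (k : ℕ) (hk : k < D.deg i + 1),
      next.SameCycle (.edge i ⟨k, hk⟩ : Code D) (.root i) := by
    intro k
    induction k with
    | zero => exact fun hk => rotFun_invEdge_zero (D := D) i ▸ sc_apply next _
    | succ k ih =>
      intro hk; refine (sc_apply _ _).trans ?_; rw [next_edge_succ i hk]; exact ih _
  have hroot : next.SameCycle (.root i : Code D) (.leaf (inl i)) := sc_apply next _
  rcases c with x | ⟨j, k⟩ | ⟨j, k⟩ | (j | p) | j <;> simp only [incoming] at hc <;> cases hc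
  · exact ((hedge k.1 k.2).trans hroot).symm
  · exact SameCycle.refl _ _
  · exact hroot.symm

/-- The half edges which are not attached at marks. -/
def unmarked (D : Diagram h n m) : Set (Code D) := {c | ∀ x, c ≠ .att x}

lemma att_notMem (x) : (.att x : Code D) ∉ unmarked D := fun h' => h' x rfl

lemma val_add_one (k : Fin (d + 1)) : (k + 1).1 = (k.1 + 1) % (d + 1) := by rw [Fin.val_add]; simp

lemma hit_invEdge (i k) :
    ∃ y, Hit next (unmarked D) (.invEdge i k) (.att y : Code D) ∧ D.IsFirst y ∧ D.ann y = i ∧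
      (D.pos y = (k.1 + 1) % (D.deg i + 1) ∨
        (k = D.deg i ∧ D.pos y = 1 ∧ ∀ z, D.ann z = i → D.pos z ≠ 0)) := by
  have hn : ∀ k, next (.invEdge i k : Code D) = rotFun (.edge i k) := fun _ => rfl
  rcases rotFun_edge i k with ⟨y, h1, h2, h3⟩ | ⟨h1, h3⟩
  · have h4 := inl_eq_iff.1 h2
    exact ⟨y, Hit.of_eq h3, h1, h4.1, .inl (by rw [← val_add_one]; exact h4.2)⟩
  · have h1' : ∀ y, D.ann y = i → D.pos y ≠ (k.1 + 1) % (D.deg i + 1) := fun y hy hp =>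
      h1 y (inl_eq_iff.2 ⟨hy, by rw [val_add_one]; exact hp⟩)
    have hk : k.1 = D.deg i := by
      by_contra hne; have := k.2
      obtain ⟨y, hy, hp⟩ := D.ex_pos i (k.1 + 1) (by omega) (by omega)
      exact h1' y hy (by rw [hp, mod_eq_of_lt (by omega)])
    rw [hk, mod_self] at h1'
    have hk1 : k + 1 = 0 := Fin.ext (by rw [val_add_one, hk, mod_self]; rfl)
    have hd : 1 ≤ D.deg i := by
      obtain ⟨y, hy⟩ := D.ex_ann i
      have h5 := D.pos_le y
      grind
    have h4 : Hit next (unmarked D) (.invEdge i k) (rotFun (.edge i 0) : Code D) := by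
      refine (Hit.of_eq h3).of_step (fun x h' => by cases h') ?_; rw [hk1]; rfl
    have h0 : ((0 : Fin (D.deg i + 1)) + 1).1 = 1 := by
      rw [val_add_one]; exact mod_eq_of_lt (by simp; omega)
    rcases rotFun_edge i 0 with ⟨y, h5, h6, h7⟩ | ⟨h5, -⟩
    · have h8 := inl_eq_iff.1 h6; exact ⟨y, h7 ▸ h4, h5, h8.1, .inr ⟨hk, h8.2.trans h0, h1'⟩⟩
    · obtain ⟨y, hy, hp⟩ := D.ex_pos i 1 le_rfl hd
      exact (h5 y (inl_eq_iff.2 ⟨hy, hp.trans h0.symm⟩)).elim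

lemma hit_inv_att (x) : Hit next (unmarked D) (invFun (.att x)) (.att (D.succ x) : Code D) := by
  have h1 : next (invFun (.att x) : Code D) = rotFun (.att x) := by rw [next_apply, invFun_invFun]
  by_cases hx : D.IsZero x
  · exact Hit.of_eq (h1.trans (rotFun_att_of_isZero hx))
  · rw [rotFun_att hx] at h1; refine (Hit.of_eq h1).trans (fun x h' => by cases h') ?_
    obtain ⟨y, h2, h3, h4, h5 | ⟨h5, h6, h7⟩⟩ := hit_invEdge (D.ann x) (wall D x)
    · rwa [Diagram.succ_eq_of_last_of_first hx h3 h4 h5]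
    · rwa [Diagram.succ_eq_of_last_of_first' hx h5 h3 h4 h6 h7]

lemma hit_att (x) : Hit next (unmarked D) (.att x)
    (.att ((D.succ * exPerm D.pairing : Perm (Mark h m)) x) : Code D) := by
  rcases x with i | p
  · have := hit_inv_att (D := D) (inl (D.pairing i))
    rwa [show invFun (.att (inl (D.pairing i)) : Code D) = .att (inl i) by
      simp [invFun, D.pairing_pairing]] at this
  · exact (Hit.of_eq (σ := next) (F := unmarked D) (b := (.leaf (inr p) : Code D)) rfl).trans
      (fun x h' => by cases h') (hit_inv_att (inr p))

lemma existsUnique_leaf (c : Code D) : ∃! l, next.SameCycle (.leaf l) c := by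
  have hinc : ∀ {c c' : Code D}, next.SameCycle c c' → incoming c = incoming c' := fun h' =>
    sc_induct eq_equivalence incoming (fun c => (incoming_next c).symm) h'
  rcases hc : incoming c with _ | i
  · have hp : ∀ p, next.SameCycle (.att (inr p) : Code D) (.leaf (inr p)) := fun p =>
      sc_apply next _
    obtain ⟨x, hx⟩ : ∃ x, next.SameCycle (.att x) c := by
      rcases c with x | ⟨j, k⟩ | ⟨j, k⟩ | (j | p) | j <;> cases hc
      · exact ⟨x, SameCycle.refl _ _⟩
      · obtain ⟨y, hy, -⟩ := hit_invEdge j k; exact ⟨y, hy.sameCycle.symm⟩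
      · exact ⟨_, hp p⟩
    have hiff : ∀ p, next.SameCycle (.leaf (inr p)) c ↔
        (exPerm D.pairing * D.succ).SameCycle (exPerm D.pairing x) (inr p) := by
      intro p
      rw [show (inr p : Mark h m) = exPerm D.pairing (inr p) from rfl,
        ← Diagram.sc_conj (e := exPerm D.pairing) (σ := exPerm D.pairing * D.succ)
          (σ' := D.succ * exPerm D.pairing) (fun _ => rfl) x (inr p),
        ← sc_iff_of_hit (att := Code.att) (fun _ _ h' => Code.att.inj h') att_notMem _ hit_att]
      exact ⟨fun h' => hx.trans (h'.symm.trans (hp p).symm), fun h' =>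
        (hp p).symm.trans (h'.symm.trans hx)⟩
    obtain ⟨p, h1, h2⟩ := D.boundary (exPerm D.pairing x)
    refine ⟨inr p, (hiff p).2 h1, ?_⟩; rintro (i | p') h'
    · have := hinc h'; rw [hc] at this; cases this
    · rw [h2 p' ((hiff p').1 h')]
  · refine ⟨inl i, sc_incoming hc, ?_⟩; rintro (j | p) h'
    · have := hinc h'; rw [hc] at this; cases this; rfl
    · have := hinc h'; rw [hc] at this; cases this

variable (D) in
/-- The unfolded graph of a diagram, as a closed fat graph. -/
def closedFatGraph : ClosedFatGraph n m where
  toFatGraph := fatGraph D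
  leaf := Code.leaf
  valence_leaf l := by
    refine Nat.card_eq_one_iff_exists.2 ⟨⟨Code.leaf l, rfl⟩, ?_⟩
    rintro ⟨x | ⟨j, k⟩ | ⟨j, k⟩ | l' | j, h'⟩ <;> cases h'; rfl
  three_le_valence v hv := by
    rcases v with ⟨i, k⟩ | l
    · refine Set.two_lt_ncard_iff (toFinite {c : Code D | src c = inl ⟨i, k⟩}) |>.2 ?_
      have h1 : src (.edge i (k - 1) : Code D) = inl ⟨i, k⟩ := by simp [src]
      by_cases hk : k = 0
      · exact ⟨.edge i (k - 1), .invEdge i k, .root i, h1, rfl, by rw [hk]; rfl, nofun, nofun, nofun⟩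
      · have := k.2; have h2 : k.1 ≠ 0 := fun h' => hk (Fin.ext h')
        obtain ⟨x, hx, hp⟩ := D.ex_pos i k.1 (by omega) (by omega)
        exact ⟨.edge i (k - 1), .invEdge i k, .att x, h1, rfl, inl_eq_iff.2 ⟨hx, hp⟩,
          nofun, nofun, nofun⟩
    · exact (hv l rfl).elim
  existsUnique_leaf := existsUnique_leaf

lemma mem_circle_iff {c : Code D} : c ∈ (closedFatGraph D).circle i ↔ ∃ k, c = .edge i k := by
  constructor
  · rintro ⟨h1, h2, h3⟩
    have h4 : incoming c = some i :=
      (sc_induct eq_equivalence incoming (fun c => (incoming_next c).symm) h1).symm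
    rcases c with x | ⟨j, k⟩ | ⟨j, k⟩ | (j | p) | j <;> cases h4
    · exact ⟨k, rfl⟩
    · exact (h2 rfl).elim
    · exact (h3 rfl).elim
  · rintro ⟨k, rfl⟩; exact ⟨sc_incoming rfl, nofun, nofun⟩

variable (D) in
/-- The unfolded graph of a diagram. -/
def graph : AdmissibleFatGraph h n m where
  toClosedFatGraph := closedFatGraph D
  circle_injOn i a ha b hb hab := by
    obtain ⟨k, rfl⟩ := mem_circle_iff.1 ha
    obtain ⟨l, rfl⟩ := mem_circle_iff.1 hb
    have := inl_eq_iff.1 hab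
    rw [add_right_cancel (Fin.ext this.2)]
  inv_notMem_circle i a ha ha' := by
    obtain ⟨k, rfl⟩ := mem_circle_iff.1 ha
    obtain ⟨l, h'⟩ := mem_circle_iff.1 ha'
    cases h'
  circle_disjoint i j hij a ha b hb hab := by
    obtain ⟨k, rfl⟩ := mem_circle_iff.1 ha
    obtain ⟨l, rfl⟩ := mem_circle_iff.1 hb
    exact hij (inl_eq_iff.1 hab).1
  reach_incoming v := by
    have hE := (fatGraph D).reach_equiv Set.univ
    have h0 : ∀ i, (fatGraph D).Reach Set.univ (inr (inl i)) (inl ⟨i, 0⟩) := fun i =>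
      Reach.of_mem (G := fatGraph D) (F := Set.univ) (a := (.leaf (inl i) : Code D)) trivial
    have h1 : ∀ i (k : ℕ) (hk : k < D.deg i + 1),
        (fatGraph D).Reach Set.univ (inr (inl i)) (inl ⟨i, ⟨k, hk⟩⟩) := by
      intro i k
      induction k with
      | zero => exact fun _ => h0 i
      | succ k ih =>
        intro hk; refine hE.trans (ih (by omega)) ?_
        have : (inl ⟨i, ⟨k + 1, hk⟩⟩ : Vert D) = inl ⟨i, ⟨k, by omega⟩ + 1⟩ :=
          inl_eq_iff.2 ⟨rfl, by rw [val_add_one, mod_eq_of_lt hk]⟩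
        rw [this]
        exact Reach.of_mem (G := fatGraph D) (F := Set.univ)
          (a := (.invEdge i ⟨k, by omega⟩ : Code D)) trivial
    rcases v with ⟨i, k⟩ | (i | p)
    · exact ⟨i, h1 i k.1 k.2⟩
    · exact ⟨i, hE.refl _⟩
    · refine ⟨D.ann (inr p), hE.trans (h1 _ _ (wall D (inr p)).2) ?_⟩
      exact Reach.of_mem (G := fatGraph D) (F := Set.univ) (a := (.att (inr p) : Code D)) trivial
  card_H := by
    show Nat.card (Code D) = 2 * (Nat.card (Vert D) + h)
    rw [Nat.card_congr (equivSum D)]; simp only [Nat.card_sum, Nat.card_fin, Vert]; omega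

lemma edge_graph (i k) (hk : k < D.deg i + 1) :
    (graph D).circleEdge i k = (.edge i ⟨k, hk⟩ : Code D) := by
  induction k with
  | zero =>
    have h1 := (graph D).next_edge_zero i
    have h2 : next (.edge i ⟨0, hk⟩ : Code D) = .root i := rotFun_invEdge_zero i
    exact (next (D := D)).injective (h1.trans h2.symm)
  | succ k ih =>
    have h1 := (graph D).next_circleEdge_succ i k
    rw [ih (by omega)] at h1; exact (next (D := D)).injective (h1.trans (next_edge_succ i hk).symm)

variable (D) in
lemma attachment : Attachment D (graph D) Code.att where
  card i := by
    have h1 : (graph D).circle i = Set.range fun k : Fin (D.deg i + 1) => (.edge i k : Code D) := by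
      ext c; exact mem_circle_iff.trans ⟨fun ⟨k, hk⟩ => ⟨k, hk.symm⟩, fun ⟨k, hk⟩ => ⟨k, hk.symm⟩⟩
    show ((graph D).circle i).ncard = _
    rw [h1]
    refine (Nat.card_range_of_injective (f := fun k : Fin (D.deg i + 1) => (.edge i k : Code D))
      fun k l h' => ?_).trans (Nat.card_fin _)
    cases h'; rfl
  inj _ _ h' := Code.att.inj h'
  notMem x := by
    rintro ⟨i, h' | h'⟩ <;> obtain ⟨k, h2⟩ := mem_circle_iff.1 h'
    · cases h2
    · rcases x with j | p <;> cases h2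
  cover c := by
    rcases c with x | ⟨j, k⟩ | ⟨j, k⟩ | l | j
    · exact .inr (.inr ⟨x, rfl⟩)
    · exact .inl ⟨j, .inl (mem_circle_iff.2 ⟨k, rfl⟩)⟩
    · exact .inl ⟨j, .inr (mem_circle_iff.2 ⟨k, rfl⟩)⟩
    · exact .inr (.inl ⟨l, .inl rfl⟩)
    · exact .inr (.inl ⟨inl j, .inr rfl⟩)
  inv_slit _ := rfl
  inv_param _ := rfl
  src_eq x := by
    exact congrArg (fun c => (graph D).src ((graph D).inv c)) (edge_graph _ _ (wall D x).2).symm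
  rot_of_isZero x hx := rotFun_att_of_isZero hx
  rot_of_not_isZero x hx := by
    exact (rotFun_att hx).trans (congrArg (graph D).inv (edge_graph _ _ (wall D x).2).symm)

end Code

end FatGraphs

/-! # Graphs without internal vertices are unfolded graphs -/

namespace FatGraphs

open PermHit RadialSlit

variable {h n m : ℕ}

lemma FatGraph.mem_of_rot_closed {G : FatGraph} {S : Set G.H} (hS : ∀ a ∈ S, G.rot a ∈ S)
    {a b : G.H} (ha : a ∈ S) (hab : G.src b = G.src a) : b ∈ S := by
  obtain ⟨k, rfl⟩ := ((G.sameCycle_rot a b).2 hab.symm).exists_nat_pow_eq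
  clear hab
  induction k with
  | zero => exact ha
  | succ k ih =>
    rw [pow_succ', mul_apply]; exact hS _ ih

lemma ClosedFatGraph.eq_of_rot_edge (G : ClosedFatGraph n m) {i : Fin n} {k : ℕ}
    (h1 : G.rot (G.circleEdge i k) = G.inv (G.circleEdge i (k + 1))) {b : G.H}
    (hb : G.src b = G.src (G.circleEdge i k)) :
    b ∈ ({G.circleEdge i k, G.inv (G.circleEdge i (k + 1))} : Set G.H) := by
  refine FatGraph.mem_of_rot_closed ?_ (.inl rfl) hb; grind [ClosedFatGraph.rot_inv_edge_succ]

/-- All vertices are on the admissible cycles or leaves. -/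
def NoInt (G : AdmissibleFatGraph h n m) : Prop := ∀ v, G.OnCircle v ∨ ∃ l, G.src (G.leaf l) = v

/-- The half edges away from the admissible cycles and the incoming leaves are enumerated by
`att`, and are attached at the circle vertices given by `ann` and `pos`. -/
structure Marking (G : AdmissibleFatGraph h n m) (pairing : Perm (Fin (2 * h)))
    (att : Mark h m → G.H) (ann : Mark h m → Fin n) (pos : Mark h m → ℕ) : Prop where
  inj : Injective att
  notMem : ∀ x, att x ∉ G.admissibleEdges
  ne_root : ∀ x i, att x ≠ G.inv (G.leaf (inl i))
  cover : ∀ a, a ∈ G.admissibleEdges ∨ a ∈ G.leafEdges ∨ a ∈ Set.range att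
  inv_slit : ∀ i, G.inv (att (inl i)) = att (inl (pairing i))
  inv_param : ∀ p, G.inv (att (inr p)) = G.leaf (inr p)
  pos_lt : ∀ x, pos x < G.cCard (ann x)
  src_eq : ∀ x, G.src (att x) = G.cVtx (ann x) (pos x)

lemma NoInt.ncard_slits {G : AdmissibleFatGraph h n m} (H : NoInt G) :
    {a | a ∉ G.admissibleEdges ∧ a ∉ G.leafEdges}.ncard = 2 * h := by
  let W := Σ i : Fin n, Fin (G.cCard i)
  have hV : Nat.card G.V = Nat.card W + Nat.card (Fin n ⊕ Fin m) := by
    rw [← Nat.card_sum]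
    refine (Nat.card_congr (ofBijective
      (elim (fun w : W => G.cVtx w.1 w.2) fun l => G.src (G.leaf l)) ⟨?_, ?_⟩)).symm
    · rintro (⟨i, k⟩ | l) (⟨j, k'⟩ | l') hab
      · obtain ⟨rfl, h2⟩ := vtx_inj G k.2 k'.2 hab; rw [Fin.ext h2]
      · exact (G.not_onCircle_leaf l' (G.onCircle_iff.2 ⟨i, k, k.2, hab⟩)).elim
      · grind [ClosedFatGraph.not_onCircle_leaf, ClosedFatGraph.onCircle_iff]
      · rw [G.leaf_injective (G.eq_leaf_of_src hab)]
    · intro v; rcases H v with hv | ⟨l, hl⟩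
      · obtain ⟨i, k, hk, hv⟩ := G.onCircle_iff.1 hv; exact ⟨inl ⟨i, k, hk⟩, hv⟩
      · exact ⟨inr l, hl⟩
  have hpair : ∀ {α : Type} [Finite α] (f : α → G.H), Injective f →
      (∀ x y, G.inv (f x) ≠ f y) → ∀ S : Set G.H, (∀ a, a ∈ S ↔ ∃ x, a = f x ∨ a = G.inv (f x)) →
      S.ncard = 2 * Nat.card α := by
    intro α _ f hf hne S hS; have h1 : S = Set.range f ∪ G.inv '' Set.range f := by grind
    rw [h1, Set.ncard_union_eq, Set.ncard_image_of_injective _ G.inv.injective, two_mul]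
    · exact congrArg₂ _ (Nat.card_range_of_injective hf) (Nat.card_range_of_injective hf)
    grind
  have hA : G.admissibleEdges.ncard = 2 * Nat.card W := by
    refine hpair (fun w : W => G.circleEdge w.1 w.2) ?_
      (fun x y => inv_edge_ne G x.2.2 y.2.2) _ fun a => ?_
    · rintro ⟨i, k⟩ ⟨j, k'⟩ hab; obtain ⟨rfl, h2⟩ := edge_inj G k.2 k'.2 hab; rw [Fin.ext h2]
    · rw [G.mem_adm]
      exact ⟨fun ⟨i, k, hk, h'⟩ => ⟨⟨i, k, hk⟩, h'⟩, fun ⟨w, h'⟩ => ⟨w.1, w.2, w.2.2, h'⟩⟩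
  have hL : G.leafEdges.ncard = 2 * Nat.card (Fin n ⊕ Fin m) :=
    hpair G.leaf G.leaf_injective (fun x y h' => G.leaf_ne_inv_leaf y x h'.symm) _ fun a => Iff.rfl
  have h1 : {a | a ∉ G.admissibleEdges ∧ a ∉ G.leafEdges} = (G.admissibleEdges ∪ G.leafEdges)ᶜ := by
    ext a; exact not_or.symm
  have h2 := Set.ncard_add_ncard_compl (G.admissibleEdges ∪ G.leafEdges)
  rw [← h1, Set.ncard_union_eq G.disj_adm_leaves, G.card_H, hA, hL, hV] at h2; omega

lemma NoInt.ex_marking {G : AdmissibleFatGraph h n m} (H : NoInt G) :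
    ∃ pairing att ann pos, Marking G pairing att ann pos := by
  set S := {a | a ∉ G.admissibleEdges ∧ a ∉ G.leafEdges} with hS
  let e : Fin (2 * h) ≃ S := (Finite.equivFinOfCardEq H.ncard_slits).symm
  have hinv : ∀ i, G.inv (e i) ∈ S := fun i =>
    ⟨G.ic_adm.notMem (e i).2.1, G.ic_leaves.notMem (e i).2.2⟩
  let pairing : Fin (2 * h) → Fin (2 * h) := fun i => e.symm ⟨_, hinv i⟩
  have hpp : Function.Involutive pairing := fun i => by
    simp only [pairing, apply_symm_apply, G.inv_inv, Subtype.coe_eta, symm_apply_apply]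
  let att : Mark h m → G.H := elim (fun i => (e i).1) fun p => G.inv (G.leaf (inr p))
  have hcov : ∀ a, a ∈ G.admissibleEdges ∨ a ∈ G.leafEdges ∨ a ∈ Set.range att := fun a => by
    by_contra! h'; exact h'.2.2 ⟨inl (e.symm ⟨a, h'.1, h'.2.1⟩), by simp [att]⟩
  have hloc : ∀ x, ∃ i k, k < G.cCard i ∧ G.src (att x) = G.cVtx i k := by
    intro x; rcases H (G.src (att x)) with h1 | ⟨l, hl⟩
    · grind [ClosedFatGraph.onCircle_iff]
    · have := G.eq_leaf_of_src hl.symm; rcases x with i | p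
      · exact ((e i).2.2 ⟨l, .inl this⟩).elim
      · exact (G.leaf_ne_inv_leaf _ _ this.symm).elim
  choose ann pos hpos hsrc using hloc
  refine ⟨hpp.toPerm pairing, att, ann, pos, ?_, fun x => ?_, fun x i h' => ?_, hcov, fun i => ?_,
    fun p => G.inv_inv _, hpos, hsrc⟩
  · rintro (i | p) (j | q) hab
    · rw [e.injective (Subtype.ext hab)]
    · exact ((e i).2.2 ⟨_, .inr hab⟩).elim
    · exact ((e j).2.2 ⟨_, .inr hab.symm⟩).elim
    · exact congrArg inr (Sum.inr_injective (G.leaf_injective (G.inv.injective hab)))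
  · rcases x with i | p
    · exact (e i).2.1
    · exact fun h' => disjoint_left.1 G.disj_adm_leaves h' ⟨_, .inr rfl⟩
  · rcases x with j | p
    · exact (e j).2.2 ⟨_, .inr h'⟩
    · exact absurd (G.leaf_injective (G.inv.injective h')) (by simp)
  · show _ = (e (pairing i)).1; simp [pairing, att]

namespace Marking

variable {G : AdmissibleFatGraph h n m} {pairing : Perm (Fin (2 * h))}
  {att : Mark h m → G.H} {ann : Mark h m → Fin n} {pos : Mark h m → ℕ}
  (M : Marking G pairing att ann pos)

include M

lemma cases_of_vtx (hk : k < G.cCard i) (ha : G.src a = G.cVtx i k) :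
    (∃ k' < G.cCard i, a = G.circleEdge i k' ∧ (k' + 1) % G.cCard i = k) ∨
    a = G.inv (G.circleEdge i k) ∨ (k = 0 ∧ a = G.inv (G.leaf (inl i))) ∨
    ∃ y, a = att y ∧ ann y = i ∧ pos y = k := by
  rcases M.cover a with h1 | ⟨l, h1 | h1⟩ | ⟨y, rfl⟩
  · obtain ⟨i', k', hk', rfl | rfl⟩ := G.mem_adm.1 h1
    · rw [G.src_edge' i' hk'] at ha
      obtain ⟨rfl, h2⟩ := vtx_inj G (mod_lt _ (G.circleCard_pos i')) hk ha
      exact .inl ⟨k', hk', rfl, h2⟩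
    · obtain ⟨rfl, rfl⟩ := vtx_inj G hk' hk ha; exact .inr (.inl rfl)
  · grind [ClosedFatGraph.not_onCircle_leaf, ClosedFatGraph.onCircle_iff]
  · rcases l with i' | p
    · rw [h1, ← G.vtx_zero] at ha; obtain ⟨rfl, rfl⟩ := vtx_inj G (G.circleCard_pos i') hk ha
      exact .inr (.inr (.inl ⟨rfl, h1⟩))
    · have h2 : att (inr p) = a := by rw [h1, ← M.inv_param, G.inv_inv]
      rw [← h2, M.src_eq] at ha; obtain ⟨h3, h4⟩ := vtx_inj G (M.pos_lt _) hk ha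
      grind
  · rw [M.src_eq] at ha; obtain ⟨h3, h4⟩ := vtx_inj G (M.pos_lt _) hk ha; grind

lemma rot_cases (hk : k < G.cCard i)
    (ha : G.src a = G.cVtx i k) (h1 : ∀ l < G.cCard i, a ≠ G.inv (G.circleEdge i l))
    (h2 : a ≠ G.inv (G.leaf (inl i))) :
    G.rot a = G.inv (G.circleEdge i k) ∨ ∃ y, G.rot a = att y ∧ ann y = i ∧ pos y = k := by
  rcases M.cases_of_vtx hk ((G.src_rot a).trans ha) with ⟨k', hk', h3, -⟩ | h3 | ⟨-, h3⟩ | h3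
  · by_cases h4 : k' + 1 = G.cCard i
    · refine (h2 (G.rot.injective ?_)).elim; rw [h3, G.rot_inv_leaf, ← h4]; rfl
    · refine (h1 (k' + 1) (by omega) (G.rot.injective ?_)).elim; rw [h3, G.rot_inv_edge_succ]
  · exact .inl h3
  · exact (h1 0 (G.circleCard_pos i) (G.rot.injective (by rw [h3, G.rot_inv_edge_zero]))).elim
  · exact .inr h3

lemma rot_att (x) : G.rot (att x) = G.inv (G.circleEdge (ann x) (pos x)) ∨
    ∃ y, G.rot (att x) = att y ∧ ann y = ann x ∧ pos y = pos x := by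
  exact M.rot_cases (M.pos_lt x) (M.src_eq x) (fun l hl h' => M.notMem x
    (h' ▸ G.ic_adm _ (G.edge_mem_adm hl))) (M.ne_root x _)

lemma att_ne_wall (x) (hk : k < G.cCard i) : att x ≠ G.inv (G.circleEdge i k) := fun h' =>
  M.notMem x (h' ▸ G.ic_adm _ (G.edge_mem_adm hk))

lemma rot_edge {i : Fin n} {k : ℕ} (hk : k < G.cCard i) :
    (G.rot (G.circleEdge i k) = G.inv (G.circleEdge i ((k + 1) % G.cCard i)) ∧
      ∀ x, ann x = i → pos x ≠ (k + 1) % G.cCard i) ∨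
    ∃ y, G.rot (G.circleEdge i k) = att y ∧ ann y = i ∧ pos y = (k + 1) % G.cCard i := by
  have hlt := mod_lt (k + 1) (G.circleCard_pos i)
  refine (M.rot_cases hlt (G.src_edge' i hk) (fun l hl h' => inv_edge_ne G hl hk h'.symm)
    (fun h' => G.notMem_leaves_of_mem_circle (G.edge_mem hk) ⟨_, .inr h'⟩)).imp_left
    fun h1 => ⟨h1, fun x hx hp => ?_⟩
  have h2 : att x ∈ ({G.circleEdge i k, G.inv (G.circleEdge i ((k + 1) % G.cCard i)),
      G.inv (G.leaf (inl i))} : Set G.H) := by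
    have hsx : G.src (att x) = G.src (G.circleEdge i k) :=
      (M.src_eq x).trans (by rw [hx, hp, G.src_edge' i hk])
    by_cases h3 : k + 1 = G.cCard i
    · refine FatGraph.mem_of_rot_closed ?_ (.inl rfl) hsx; rw [h3, mod_self] at h1 ⊢
      grind [ClosedFatGraph.rot_inv_edge_zero, ClosedFatGraph.rot_inv_leaf]
    · rw [mod_eq_of_lt (by omega)] at h1 ⊢; exact (G.eq_of_rot_edge h1 hsx).imp_right .inl
  rcases h2 with h2 | h2 | h2
  · exact M.notMem x (h2 ▸ G.edge_mem_adm hk)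
  · exact M.att_ne_wall x hlt h2
  · exact M.ne_root x _ h2

lemma ex_pos {i : Fin n} {k : ℕ} (hk : k + 1 < G.cCard i) :
    ∃ y, G.rot (G.circleEdge i k) = att y ∧ ann y = i ∧ pos y = k + 1 := by
  rcases M.rot_edge (Nat.lt_of_succ_lt hk) with ⟨h1, h2⟩ | h2
  · rw [mod_eq_of_lt hk] at h1 h2; exfalso
    have h6 := G.three_le_valence (G.src (G.circleEdge i k)) fun l h' =>
      G.not_onCircle_leaf l ⟨i, _, G.edge_mem (Nat.lt_of_succ_lt hk), h'.symm⟩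
    have h7 : {x | G.src x = G.src (G.circleEdge i k)} ⊆
        ({G.circleEdge i k, G.inv (G.circleEdge i (k + 1))} : Set G.H) := fun b hb =>
      G.eq_of_rot_edge h1 hb
    have h8 := Set.ncard_le_ncard h7 (toFinite _)
    have h9 := Set.ncard_insert_le (G.circleEdge i k) {G.inv (G.circleEdge i (k + 1))}
    rw [Set.ncard_singleton] at h9; rw [G.valence_eq_ncard] at h6; omega
  · rwa [mod_eq_of_lt hk] at h2

lemma ex_ann (i) : ∃ x, ann x = i := by
  by_cases hN : G.cCard i = 1
  · have h0 := G.circleCard_pos i; rcases M.rot_edge h0 with ⟨h1, -⟩ | ⟨y, -, h2, -⟩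
    · exfalso; rw [hN, mod_self] at h1
      have h2 : G.next (G.inv (G.circleEdge i 0)) = G.inv (G.circleEdge i 0) := by
        rw [← G.rot_inv, h1]
      obtain ⟨l, hl, -⟩ := G.existsUnique_leaf (G.inv (G.circleEdge i 0))
      exact disjoint_left.1 G.disj_adm_leaves (G.ic_adm _ (G.edge_mem_adm h0))
        ⟨l, .inl (hl.symm.eq_of_left h2)⟩
    · exact ⟨y, h2⟩
  · have := G.circleCard_pos i; obtain ⟨y, -, h2, -⟩ := M.ex_pos (i := i) (k := 0) (by omega)
    exact ⟨y, h2⟩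

lemma ex_last (i) : ∃ x, ann x = i ∧ G.rot (att x) = G.inv (G.circleEdge i (G.cCard i - 1)) := by
  have h0 := G.circleCard_pos i
  have hlt : G.cCard i - 1 < G.cCard i := by omega
  obtain ⟨x, hx, hp⟩ : ∃ x, ann x = i ∧ pos x = G.cCard i - 1 := by
    by_cases hN : G.cCard i = 1
    · obtain ⟨x, hx⟩ := M.ex_ann i; have := M.pos_lt x; grind
    · obtain ⟨y, -, h2, h3⟩ := M.ex_pos (i := i) (k := G.cCard i - 2) (by omega)
      exact ⟨y, h2, by omega⟩
  obtain ⟨a, ha⟩ := G.rot.surjective (G.inv (G.circleEdge i (G.cCard i - 1)))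
  have hsrc : G.src a = G.cVtx i (G.cCard i - 1) := by rw [← G.src_rot, ha]; rfl
  rcases M.cases_of_vtx hlt hsrc with ⟨k', hk', rfl, h3⟩ | rfl | ⟨-, rfl⟩ | ⟨y, rfl, h3, -⟩
  · rcases M.rot_edge hk' with ⟨-, h2⟩ | ⟨y, h2, -⟩
    · exact (h2 x hx (hp.trans h3.symm)).elim
    · exact (M.att_ne_wall y hlt (h2.symm.trans ha)).elim
  · have h2 : G.next (G.circleEdge i (G.cCard i - 1)) = G.inv (G.circleEdge i (G.cCard i - 1)) := ha
    rcases hN : G.cCard i - 1 with _ | k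
    · rw [hN, G.next_edge_zero] at h2
      exact (G.notMem_leaves_of_mem_circle (G.edge_mem h0) ⟨_, .inl (G.inv.injective h2).symm⟩).elim
    grind [inv_edge_ne, ClosedFatGraph.next_circleEdge_succ]
  · rw [G.rot_inv_leaf] at ha; exact (inv_edge_ne G hlt hlt ha.symm).elim
  · exact ⟨y, h3, ha⟩

lemma ex_succ (x) : ∃ y, ann y = ann x ∧
    (∀ (σ : Perm G.H) (a : G.H), σ a = G.rot (att x) → (∀ i k, k < G.cCard i →
      σ (G.inv (G.circleEdge i k)) = G.rot (G.circleEdge i k)) →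
      Hit σ (Set.range att)ᶜ a (att y)) ∧
    ((G.rot (att x) = att y ∧ pos y = pos x) ∨
      G.rot (att x) = G.inv (G.circleEdge (ann x) (pos x)) ∧
        (pos y = pos x + 1 ∨ pos x + 1 = G.cCard (ann x))) := by
  have hF : ∀ {i k}, k < G.cCard i → G.inv (G.circleEdge i k) ∈ (Set.range att)ᶜ := by
    rintro i k hk ⟨x, hx⟩; exact M.att_ne_wall x hk hx
  rcases M.rot_att x with h1 | ⟨y, h1, h2, h3⟩
  · have hx := M.pos_lt x; by_cases hlast : pos x + 1 = G.cCard (ann x)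
    · rcases M.rot_edge hx with ⟨h2, h3⟩ | ⟨y, h2, h3, h4⟩
      · rw [hlast, mod_self] at h2 h3; have h0 := h3 x rfl
        obtain ⟨y, h4, h5, h6⟩ := M.ex_pos (i := ann x) (k := 0) (by omega)
        refine ⟨y, h5, fun σ a ha hσ => ?_, .inr ⟨h1, .inr hlast⟩⟩
        exact ((Hit.of_eq (ha.trans h1)).of_step (hF hx) ((hσ _ _ hx).trans h2)).of_step
          (hF (G.circleCard_pos _)) ((hσ _ _ (G.circleCard_pos _)).trans h4)
      · exact ⟨y, h3, fun σ a ha hσ => (Hit.of_eq (ha.trans h1)).of_step (hF hx)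
          ((hσ _ _ hx).trans h2), .inr ⟨h1, .inr hlast⟩⟩
    · obtain ⟨y, h2, h3, h4⟩ := M.ex_pos (i := ann x) (k := pos x) (by omega)
      exact ⟨y, h3, fun σ a ha hσ => (Hit.of_eq (ha.trans h1)).of_step (hF hx)
          ((hσ _ _ hx).trans h2), .inr ⟨h1, .inl h4⟩⟩
  grind [Hit.of_eq]

lemma sc_wall {σ : Perm G.H} (h1 : ∀ x, σ (att x) = G.rot (att x)) (h2 : ∀ i k, k < G.cCard i →
      σ (G.inv (G.circleEdge i k)) = G.rot (G.circleEdge i k)) (x : Mark h m) :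
    σ.SameCycle (att x) (G.inv (G.circleEdge (ann x) 0)) := by
  classical
  have key : ∀ {i k}, (hk : k < G.cCard i) → (∀ x, ann x = i → pos x = (k + 1) % G.cCard i →
        σ.SameCycle (att x) (G.inv (G.circleEdge i ((k + 1) % G.cCard i)))) ∧
      σ.SameCycle (G.inv (G.circleEdge i ((k + 1) % G.cCard i))) (G.inv (G.circleEdge i k)) := by
    intro i k hk; set l := (k + 1) % G.cCard i with hl
    have hlt : l < G.cCard i := mod_lt _ (G.circleCard_pos i)
    set w := G.inv (G.circleEdge i l) with hw
    let f : G.H → G.H := fun a => if ∃ x, a = att x ∧ ann x = i ∧ pos x = l then a else w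
    have hf1 : ∀ x, ann x = i → pos x = l → f (att x) = att x := fun x hx hp =>
      if_pos ⟨x, rfl, hx, hp⟩
    have hf2 : ∀ {a}, (∀ x, a ≠ att x) → f a = w := fun ha => if_neg fun ⟨x, hx, _⟩ => ha x hx
    have hf3 : ∀ {a}, G.src a ≠ G.cVtx i l → f a = w := fun ha =>
      if_neg fun ⟨x, hx, h3, h4⟩ => ha (by rw [hx, M.src_eq, h3, h4])
    have hedge : ∀ {k}, k < G.cCard i → f (G.circleEdge i k) = w := fun hk =>
      hf2 fun x hx => M.notMem x (hx ▸ G.edge_mem_adm hk)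
    have hwall : f w = w := hf2 fun x hx => M.att_ne_wall x hlt hx.symm
    have hroot : f (G.inv (G.leaf (inl i))) = w := hf2 fun x hx => M.ne_root x _ hx.symm
    have hstep : ∀ a, σ.SameCycle (f a) (f (G.rot a)) := by
      refine step_of_forall_ne (sc_equiv σ) f (G.circleEdge i k) fun a ha => ?_
      by_cases hv : G.src a = G.cVtx i l
      · rcases M.cases_of_vtx hlt hv with ⟨k', hk', rfl, h4⟩ | rfl | ⟨-, rfl⟩ | ⟨y, rfl, h4, h5⟩
        · refine (ha ?_).elim
          exact G.circle_injOn i (G.edge_mem hk') (G.edge_mem hk) (hv.trans (G.src_edge' i hk).symm)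
        · rw [← hw, hwall, hw]; rcases hl' : l with _ | l'
          · rw [G.rot_inv_edge_zero, hroot, hw, hl']
          · rw [G.rot_inv_edge_succ, hedge (by omega), hw, hl']
        · rw [hroot, G.rot_inv_leaf, hedge (Nat.sub_lt (G.circleCard_pos i) one_pos)]
        · rw [hf1 y h4 h5]
          have h6 : f (G.rot (att y)) = G.rot (att y) := by
            rcases M.rot_att y with h7 | ⟨z, h7, h8, h9⟩
            · rw [h7, h4, h5, hwall]
            · rw [h7, hf1 z (h8.trans h4) (h9.trans h5)]
          rw [h6, ← h1]; exact sc_apply _ _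
      · rw [hf3 hv, hf3 (by rwa [G.src_rot])]
    constructor
    · intro x hx hp
      have h3 : G.rot.SameCycle (att x) w := (G.sameCycle_rot _ _).2 (by rw [M.src_eq, hx, hp]; rfl)
      have h4 := sc_induct (sc_equiv σ) f hstep h3
      rwa [hf1 x hx hp, hwall] at h4
    · have h4 := hstep (G.circleEdge i k); rw [hedge hk] at h4
      have h5 : f (G.rot (G.circleEdge i k)) = G.rot (G.circleEdge i k) := by
        rcases M.rot_edge hk with ⟨h6, -⟩ | ⟨y, h6, h7, h8⟩
        · rw [h6, hwall]
        · rw [h6, hf1 y h7 h8]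
      rw [h5, ← h2 i k hk] at h4; exact h4.trans (sc_apply _ _).symm
  have hw0 : ∀ i k, k < G.cCard i →
      σ.SameCycle (G.inv (G.circleEdge i k)) (G.inv (G.circleEdge i 0)) := by
    intro i k
    induction k with
    | zero => exact fun _ => SameCycle.refl _ _
    | succ k ih =>
      intro hk; have := (key (i := i) (k := k) (by omega)).2
      rw [mod_eq_of_lt hk] at this; exact this.trans (ih (by omega))
  have hx := M.pos_lt x
  obtain ⟨k, hk, hkx⟩ : ∃ k < G.cCard (ann x), (k + 1) % G.cCard (ann x) = pos x := by
    rcases hp : pos x with _ | k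
    · exact ⟨_, Nat.sub_lt (G.circleCard_pos _) one_pos, by
        rw [show G.cCard (ann x) - 1 + 1 = G.cCard (ann x) by omega, mod_self]⟩
    · exact ⟨k, by omega, mod_eq_of_lt (by omega)⟩
  have := (key hk).1 x rfl hkx.symm
  rw [hkx] at this; exact this.trans (hw0 _ _ hx)

lemma ex_outer : ∃ σ : Perm G.H, (∀ x, σ (att x) = G.rot (att x)) ∧
    ∀ i k, k < G.cCard i → σ (G.inv (G.circleEdge i k)) = G.rot (G.circleEdge i k) := by
  classical
  have hs : Function.Involutive fun a => if a ∈ G.admissibleEdges then G.inv a else a := fun a => by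
    by_cases ha : a ∈ G.admissibleEdges
    · simp [ha, G.ic_adm _ ha, G.inv_inv]
    · simp [ha]
  refine ⟨G.rot * hs.toPerm _, fun x => ?_, fun i k hk => ?_⟩
  · simp [M.notMem x]
  · simp [G.ic_adm _ (G.edge_mem_adm hk), G.inv_inv]

lemma ex_unfolded : ∃ D : Diagram h n m, Unf D G := by
  classical
  obtain ⟨σ, hσ1, hσ2⟩ := M.ex_outer
  have hF : ∀ a, a ∉ (Set.range att)ᶜ ↔ a ∈ Set.range att := fun a => not_not
  have hF' : ∀ x, att x ∉ (Set.range att)ᶜ := fun x => not_not.2 ⟨x, rfl⟩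
  obtain ⟨succ, hsucc⟩ := ex_perm_hit M.inj hF σ
  have hnext : ∀ x, ann (succ x) = ann x ∧
      Hit G.next (Set.range att)ᶜ (G.inv (att x)) (att (succ x)) ∧
      ((G.rot (att x) = att (succ x) ∧ pos (succ x) = pos x) ∨
        G.rot (att x) = G.inv (G.circleEdge (ann x) (pos x)) ∧
          (pos (succ x) = pos x + 1 ∨ pos x + 1 = G.cCard (ann x))) := fun x => by
    obtain ⟨y, h1, h2, h3⟩ := M.ex_succ x
    obtain rfl : succ x = y := M.inj ((hsucc x).unique (hF' _) (h2 σ _ (hσ1 x) hσ2) (hF' _))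
    grind [FatGraph.rot_inv]
  have hann : ∀ {x y}, succ.SameCycle x y ↔ ann x = ann y := fun {x y} => by
    constructor
    · exact sc_induct eq_equivalence ann fun x => (hnext x).1.symm
    · intro hxy
      rw [← sc_iff_of_hit M.inj hF' succ hsucc]
      refine (M.sc_wall hσ1 hσ2 x).trans ?_
      rw [hxy]
      exact (M.sc_wall hσ1 hσ2 y).symm
  let wrap : Mark h m → ℕ := fun x =>
    if G.rot (att x) = G.inv (G.circleEdge (ann x) (G.cCard (ann x) - 1)) then 1 else 0
  have hwrap0 : ∀ {x}, G.rot (att x) = att (succ x) → wrap x = 0 := fun {x} hx =>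
    if_neg fun h' => M.att_ne_wall (succ x) (Nat.sub_lt (G.circleCard_pos _) one_pos) (hx ▸ h')
  have hwrap1 : ∀ {x}, G.rot (att x) = G.inv (G.circleEdge (ann x) (pos x)) →
      (wrap x = 0 ∧ pos x + 1 ≠ G.cCard (ann x)) ∨
      (wrap x = 1 ∧ pos x + 1 = G.cCard (ann x)) := fun {x} hx => by
    have h0 := M.pos_lt x
    by_cases h1 : pos x + 1 = G.cCard (ann x)
    · grind
    · refine .inl ⟨if_neg fun h' => h1 ?_, h1⟩
      have := (edge_inj G h0 (Nat.sub_lt (G.circleCard_pos _) one_pos)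
        (G.inv.injective (hx.symm.trans h'))).2
      omega
  let D : Diagram h n m :=
    { pairing := pairing, succ := succ, ann := ann, deg := fun i => G.cCard i - 1, pos := pos
      wrap := wrap
      pairing_ne := fun i h' => G.inv_ne _ ((M.inv_slit i).trans (by rw [h']))
      pairing_pairing := fun i => inl_injective (M.inj (by
        rw [← M.inv_slit, ← M.inv_slit, G.inv_inv]))
      sameCycle_iff := fun x y => hann
      ex_ann := M.ex_ann
      pos_le := fun x => Nat.le_sub_one_of_lt (M.pos_lt x)
      ex_pos := fun i k h1 h2 => by
        obtain ⟨y, -, h3, h4⟩ := M.ex_pos (i := i) (k := k - 1) (by omega)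
        exact ⟨y, h3, by omega⟩
      le_of_wrap_eq := fun x hx => by grind
      le_of_wrap_ne := fun x hx => by
        rcases (hnext x).2.2 with ⟨h1, -⟩ | ⟨h1, h2⟩
        · exact (hx (hwrap0 h1)).elim
        · have h4 := M.pos_lt (succ x)
          grind
      sum_wrap := fun j => by
        obtain ⟨x, hx, h1⟩ := M.ex_last j
        rw [Finset.sum_eq_single x]
        · exact if_pos (by rw [h1, hx])
        · intro y hy hne
          refine if_neg fun h' => hne (M.inj (G.rot.injective ?_))
          rw [h', h1, (mem_filter.1 hy).2]
        · exact fun h' => (h' (by simp [hx])).elim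
      boundary := fun x => by
        have hit : ∀ x, Hit G.next (Set.range att)ᶜ (att x)
            (att ((succ * exPerm pairing : Perm (Mark h m)) x)) := by
          rintro (i | p)
          · have := (hnext (inl (pairing i))).2.1
            rwa [← M.inv_slit, G.inv_inv] at this
          · have h1 := (hnext (inr p)).2.1
            have h2 : G.next (att (inr p)) = G.inv (att (inr p)) := by
              rw [M.inv_param, G.next_apply, M.inv_param, G.rot_leaf]
            refine (Hit.of_eq h2).trans ?_ h1
            rintro ⟨y, hy⟩
            rw [M.inv_param] at hy
            exact G.not_onCircle_leaf _ (hy ▸ G.onCircle_iff.2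
              ⟨_, _, M.pos_lt y, (M.src_eq y).symm⟩)
        obtain ⟨y, rfl⟩ := (exPerm pairing).surjective x
        have hiff : ∀ p, G.next.SameCycle (G.leaf (inr p)) (att y) ↔
            (exPerm pairing * succ).SameCycle (exPerm pairing y) (inr p) := by
          intro p
          have h1 : G.leaf (inr p) = G.next (att (inr p)) := by
            rw [G.next_apply, M.inv_param, G.rot_leaf]
          rw [show (inr p : Mark h m) = exPerm pairing (inr p) from rfl,
            ← Diagram.sc_conj (e := exPerm pairing) (σ := exPerm pairing * succ)
              (σ' := succ * exPerm pairing) (fun _ => rfl) y (inr p),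
            ← sc_iff_of_hit M.inj hF' _ hit, h1, Equiv.Perm.sameCycle_apply_left]
          exact ⟨fun h' => h'.symm, fun h' => h'.symm⟩
        obtain ⟨l, h1, h2⟩ := G.existsUnique_leaf (att y)
        rcases l with i | p
        · refine (M.notMem y (G.circle_subset i ⟨h1, fun h' => ?_, M.ne_root y i⟩)).elim
          exact G.not_onCircle_leaf _ (h' ▸ G.onCircle_iff.2 ⟨_, _, M.pos_lt y, (M.src_eq y).symm⟩)
        · refine ⟨p, (hiff p).1 h1, fun q hq => ?_⟩
          grind }
  refine ⟨D, att, fun i => (Nat.sub_add_cancel (G.circleCard_pos i)).symm, M.inj, M.notMem,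
    M.cover, M.inv_slit, M.inv_param, M.src_eq, fun x hx => ?_, fun x hx => ?_⟩
  · obtain ⟨hx1, hx2⟩ : wrap x = 0 ∧ pos (succ x) = pos x := hx
    grind
  · rcases (hnext x).2.2 with ⟨h1, h2⟩ | ⟨h1, -⟩
    · exact (hx ⟨hwrap0 h1, h2⟩).elim
    · exact h1

end Marking

lemma NoInt.ex_unfolded (H : NoInt G) : ∃ D : Diagram h n m, Unf D G := by
  obtain ⟨_, _, _, _, M⟩ := H.ex_marking
  exact M.ex_unfolded

lemma Unf.noInt (H : Unf D G) : NoInt G := by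
  obtain ⟨att, A⟩ := H
  intro v; obtain ⟨a, rfl⟩ := src_surjective G v
  exact (A.onCircle_or a).imp_right fun ⟨l, hl⟩ => ⟨l, by rw [hl]⟩

end FatGraphs

/-! # Expansion of a vertex -/

namespace FatGraphs

open PermHit RadialSlit

variable {h n m : ℕ}

lemma FatGraph.two_lt_valence_iff {G : FatGraph} {v : G.V} : 3 ≤ G.valence v ↔
    ∃ a b c, G.src a = v ∧ G.src b = v ∧ G.src c = v ∧ a ≠ b ∧ a ≠ c ∧ b ≠ c := by
  exact Set.two_lt_ncard_iff (toFinite {a | G.src a = v})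

namespace Expand

variable {G : FatGraph} (x : G.H)

open Classical in
/-- The source map after `x` and the half edge following it are moved to a new vertex, which is
joined to the old one by a new edge. -/
def src : G.H ⊕ Bool → Option G.V
  | inl a => if a = x ∨ a = G.rot x then none else some (G.src a)
  | inr b => if b then none else some (G.src x)

variable (G) in
/-- The edge pairing after the expansion. -/
def inv : Perm (G.H ⊕ Bool) := Equiv.sumCongr G.inv Equiv.boolNot

open Classical in
/-- The cyclic orderings after the expansion. -/
def rot : Perm (G.H ⊕ Bool) := swap (inl x) (inr true) * swap (inl x) (inl (G.rot (G.rot x))) *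
    swap (inl x) (inr false) * Equiv.sumCongr G.rot (Equiv.refl Bool)

variable {x}

lemma src_of_ne (h1 : a ≠ x) (h2 : a ≠ G.rot x) :
    src x (inl a) = some (G.src a) := if_neg (by tauto)

lemma src_x : src x (inl x) = none := if_pos (.inl rfl)

lemma src_y : src x (inl (G.rot x)) = none := if_pos (.inr rfl)

lemma rot_of_eq (h1 : G.rot a = x) : rot x (inl a) = inr false := by
  simp [rot, h1, swap_apply_of_ne_of_ne]

lemma rot_true : rot x (inr true) = inl x := by simp [rot, swap_apply_of_ne_of_ne]

lemma rot_of_ne (h1 : G.rot a ≠ x) (h2 : a ≠ G.rot x) : rot x (inl a) = inl (G.rot a) := by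
  have h3 : G.rot a ≠ G.rot (G.rot x) := fun h' => h2 (G.rot.injective h')
  simp [rot, h1, h3, swap_apply_of_ne_of_ne]

variable (x) in
/-- The permutation whose cycles are the boundary cycles. -/
abbrev next : Perm (G.H ⊕ Bool) := rot x * inv G

lemma next_false : next x (inr false) = inl x := rot_true

variable (hz : G.rot (G.rot x) ≠ x)

include hz

lemma rot_y : rot x (inl (G.rot x)) = inr true := by simp [rot, hz, swap_apply_of_ne_of_ne]

lemma rot_false : rot x (inr false) = inl (G.rot (G.rot x)) := by
  simp [rot, hz, swap_apply_of_ne_of_ne]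

lemma rot_ne : G.rot x ≠ x := fun h' => hz (by rw [h', h'])

lemma src_rot (a) : src x (rot x a) = src x a := by
  have hy := rot_ne hz
  have hzy : G.rot (G.rot x) ≠ G.rot x := fun h' => hy (G.rot.injective h')
  rcases a with a | b | b
  · by_cases h1 : G.rot a = x
    · have h2 : a ≠ x := fun h' => hy (h' ▸ h1); have h3 : a ≠ G.rot x := fun h' => hz (h' ▸ h1)
      rw [rot_of_eq h1, src_of_ne h2 h3, ← G.src_rot a, h1]; rfl
    by_cases h2 : a = G.rot x
    · rw [h2, rot_y hz, src_y]; rfl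
    rw [rot_of_ne h1 h2]; by_cases h3 : a = x
    · rw [h3, src_x, src_y]
    · rw [src_of_ne h1 (fun h' => h3 (G.rot.injective h')), src_of_ne h3 h2, G.src_rot]
  · rw [rot_false hz, src_of_ne hz hzy, G.src_rot, G.src_rot]; rfl
  · rw [rot_true, src_x]; rfl

lemma sameCycle_rot (a b) : (rot x).SameCycle a b ↔ src x a = src x b := by
  classical
  constructor
  · exact sc_induct eq_equivalence _ fun a => (src_rot hz a).symm
  have hy := rot_ne hz
  have hzy : G.rot (G.rot x) ≠ G.rot x := fun h' => hy (G.rot.injective h')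
  have hs := sc_apply (rot x)
  have hnone : ∀ {a}, src x a = none → (rot x).SameCycle a (inl x) := by
    have h1 : (rot x).SameCycle (inr true) (inl x) := rot_true (G := G) ▸ hs _
    rintro (a | b | b) ha
    · by_cases h2 : a = x
      · rw [h2]
      by_cases h3 : a = G.rot x
      · rw [h3]
        exact (rot_y hz ▸ hs (inl (G.rot x))).trans h1
      · rw [src_of_ne h2 h3] at ha; cases ha
    · cases ha
    · exact h1
  let φ : G.H → G.H ⊕ Bool := fun a => if a = x ∨ a = G.rot x then inr false else inl a
  have hφx : φ x = inr false := if_pos (.inl rfl)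
  have hφy : φ (G.rot x) = inr false := if_pos (.inr rfl)
  have hφ : ∀ {a}, a ≠ x → a ≠ G.rot x → φ a = inl a := fun h1 h2 => if_neg (by tauto)
  have hstep : ∀ a, (rot x).SameCycle (φ a) (φ (G.rot a)) := by
    intro a
    by_cases h2 : a = x
    · rw [h2, hφx, hφy]
    by_cases h3 : a = G.rot x
    · rw [h3, hφy, hφ hz hzy, ← rot_false hz]; exact hs _
    rw [hφ h2 h3]
    by_cases h1 : G.rot a = x
    · rw [h1, hφx, ← rot_of_eq h1]; exact hs _
    · rw [hφ h1 (fun h' => h2 (G.rot.injective h')), ← rot_of_ne h1 h3]; exact hs _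
  have hsome : ∀ {a v}, src x a = some v → ∃ a', φ a' = a ∧ G.src a' = v := by
    rintro (a | b | b) v ha
    · grind [Expand.src_x, Expand.src_y, Expand.src_of_ne]
    · exact ⟨x, hφx, Option.some.inj ha⟩
    · cases ha
  intro hab
  rcases hv : src x a with _ | v
  · exact (hnone hv).trans (hnone (hab ▸ hv)).symm
  · obtain ⟨a', rfl, ha⟩ := hsome hv
    obtain ⟨b', rfl, hb⟩ := hsome (hab ▸ hv)
    exact sc_induct (sc_equiv _) φ hstep ((G.sameCycle_rot _ _).2 (ha.trans hb.symm))

/-- The expanded graph, as a fat graph. -/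
def fatGraph : FatGraph where
  V := Option G.V
  H := G.H ⊕ Bool
  finite_V := inferInstance
  finite_H := inferInstance
  src := src x
  inv := inv G
  inv_inv := by rintro (a | b) <;> simp [inv, G.inv_inv]
  inv_ne := by rintro (a | b | b) <;> simp [inv, G.inv_ne]
  rot := rot x
  sameCycle_rot := sameCycle_rot hz

lemma next_true : next x (inr true) = inl (G.next (G.inv (G.rot x))) := by
  rw [← G.rot_inv]; exact rot_false hz

lemma hit_next (a) :
    Hit (next x) {inr true, inr false} (inl a) (inl (G.next a) : G.H ⊕ Bool) := by
  have hn : next x (inl a) = rot x (inl (G.inv a)) := rfl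
  by_cases h1 : G.rot (G.inv a) = x
  · rw [G.next_apply, h1]
    exact (Hit.of_eq (hn.trans (rot_of_eq h1))).of_step (.inr rfl) (next_false)
  by_cases h2 : G.inv a = G.rot x
  · rw [h2, rot_y hz] at hn; refine (Hit.of_eq hn).of_step (.inl rfl) ?_
    rw [next_true hz, ← h2, G.inv_inv]
  · exact Hit.of_eq (hn.trans (rot_of_ne h1 h2))

lemma sc_next (a b) : (next x).SameCycle (inl a) (inl b) ↔ G.next.SameCycle a b := by
  exact sc_iff_of_hit (F := {inr true, inr false}) inl_injective
    (by rintro a (h' | h') <;> cases h') G.next (hit_next hz)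

end Expand

open Expand

lemma ex_expand (G : AdmissibleFatGraph h n m) (x : G.H) (hval : 4 ≤ G.valence (G.src x))
    (hx : x ∉ G.admissibleEdges) (hy : G.rot x ∉ G.admissibleEdges)
    (hxr : ∀ i, x ≠ G.inv (G.leaf (inl i))) (hyr : ∀ i, G.rot x ≠ G.inv (G.leaf (inl i))) :
    ∃ (G' : AdmissibleFatGraph h n m) (g x' y' : G'.H) (c : G'.Collapse G {g, G'.inv g})
      (hx' : x' ∉ G'.pair g) (hy' : y' ∉ G'.pair g),
      g ∉ G'.admissibleEdges ∧ G'.src (G'.inv g) ≠ G'.src g ∧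
      G'.valence (G'.src (G'.inv g)) < G.valence (G.src x) ∧
      IsTripod G'.toFatGraph g x' y' ∧ c.onH ⟨x', hx'⟩ = x ∧ c.onH ⟨y', hy'⟩ = G.rot x := by
  have hleafv : ∀ l, G.src (G.leaf l) ≠ G.src x := fun l h' => by
    have := G.valence_leaf l
    rw [h'] at this; omega
  have hleafx : ∀ l, G.leaf l ≠ x := fun l h' => hleafv l (by rw [h'])
  have hleafy : ∀ l, G.leaf l ≠ G.rot x := fun l h' => hleafv l (by rw [h', G.src_rot])
  have hz : G.rot (G.rot x) ≠ x := by
    intro h'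
    have h1 : {a | G.src a = G.src x} ⊆ ({x, G.rot x} : Set G.H) := fun b hb => by
      refine FatGraph.mem_of_rot_closed ?_ (.inl rfl) hb; grind
    have h2 := Set.ncard_le_ncard h1 (toFinite _)
    have h3 := Set.ncard_insert_le x {G.rot x}
    rw [Set.ncard_singleton] at h3; rw [G.valence_eq_ncard] at hval; omega
  have hcard : ({a | G.src a = G.src x} \ {x, G.rot x}).ncard + 2 = G.valence (G.src x) := by
    rw [G.valence_eq_ncard, ← Set.ncard_sdiff_add_ncard_of_subset (s := {x, G.rot x})
      (t := {a | G.src a = G.src x}) (by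
        rintro a (rfl | rfl); exacts [rfl, G.src_rot _]) (toFinite _), ncard_pair (rot_ne hz).symm]
  have hin : ∀ {a}, (∀ i, a ≠ G.leaf (inl i)) → a ∉ G.admissibleEdges →
      (∀ i, a ≠ G.inv (G.leaf (inl i))) → ∀ i, ¬ G.next.SameCycle (G.leaf (inl i)) a :=
    fun h1 h2 h3 i h' => h2 (G.circle_subset i ⟨h', h1 _, h3 i⟩)
  have hinx := hin (fun i => (hleafx _).symm) hx hxr
  have hiny := hin (a := G.inv (G.rot x)) (fun i h' => hyr i (by rw [← h', G.inv_inv]))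
    (G.ic_adm.notMem hy) (fun i h' => hleafy _ (G.inv.injective h').symm)
  have hsrc : ∀ {a}, a ∉ ({x, G.rot x} : Set G.H) →
      src x (inl a) = some (G.src a) := fun ha =>
    src_of_ne (fun h' => ha (.inl h')) fun h' => ha (.inr h')
  have hout : ∀ {a}, G.src a ≠ G.src x → a ∉ ({x, G.rot x} : Set G.H) := by
    rintro a ha (h' | h'); exacts [ha (by rw [h']), ha (by rw [h', G.src_rot])]
  have hsleaf : ∀ l, src x (inl (G.leaf l)) = some (G.src (G.leaf l)) := fun l =>
    hsrc (hout (hleafv l))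
  have hfalse : (next x).SameCycle (inr false) (inl x) :=
    (next_false (G := G.toFatGraph)) ▸ sc_apply (next x) (inr false)
  have htrue : (next x).SameCycle (inr true) (inl (G.inv (G.rot x))) := by
    have h1 := sc_apply (next x) (inr true)
    rw [next_true hz] at h1; exact h1.trans ((sc_next hz _ _).2 (sc_apply _ _).symm)
  let G1 : ClosedFatGraph n m :=
    { toFatGraph := fatGraph hz, leaf := fun l => inl (G.leaf l), valence_leaf := fun l => by
        have h1 : {a | src x a = src x (inl (G.leaf l))} =
            {inl (G.leaf l)} := by
          refine Set.eq_singleton_iff_unique_mem.2 ⟨rfl, ?_⟩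
          rintro (a | b | b) ha <;> rw [mem_ofPred_eq, hsleaf] at ha
          · by_cases h2 : a ∈ ({x, G.rot x} : Set G.H)
            · rw [show src x (inl a) = none from if_pos h2] at ha; cases ha
            · rw [hsrc h2] at ha; rw [G.eq_leaf_of_src (Option.some.inj ha)]
          · exact (hleafv l (Option.some.inj ha).symm).elim
          · cases ha
        exact (congrArg Set.ncard h1).trans (Set.ncard_singleton _)
      three_le_valence := fun v hv => by
        rcases v with _ | v
        · exact FatGraph.two_lt_valence_iff.2 ⟨inl x, inl (G.rot x), inr true, src_x,
            src_y, rfl, fun h' => rot_ne hz (inl_injective h').symm, nofun, nofun⟩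
        by_cases h1 : v = G.src x
        · have h2 : 2 ≤ ({a | G.src a = G.src x} \ {x, G.rot x}).ncard := by omega
          obtain ⟨a, b, ha, hb, hab⟩ := (Set.one_lt_ncard_iff (toFinite _)).1 h2
          exact FatGraph.two_lt_valence_iff.2 ⟨inl a, inl b, inr false,
            (hsrc ha.2).trans (by rw [h1, ha.1]), (hsrc hb.2).trans (by rw [h1, hb.1]),
            by rw [h1]; rfl, fun h' => hab (inl_injective h'), nofun, nofun⟩
        · obtain ⟨a, b, c, ha, hb, hc, hab, hac, hbc⟩ := FatGraph.two_lt_valence_iff.1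
            (G.three_le_valence v fun l h' => hv l ((hsleaf l).trans (congrArg some h')))
          exact FatGraph.two_lt_valence_iff.2 ⟨inl a, inl b, inl c,
            (hsrc (hout (ha ▸ h1))).trans (congrArg some ha),
            (hsrc (hout (hb ▸ h1))).trans (congrArg some hb),
            (hsrc (hout (hc ▸ h1))).trans (congrArg some hc),
            fun h' => hab (inl_injective h'), fun h' => hac (inl_injective h'),
            fun h' => hbc (inl_injective h')⟩
      existsUnique_leaf := fun a => by
        obtain ⟨b, hb⟩ : ∃ b, (next x).SameCycle (inl b) a := by
          rcases a with a | b | b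
          exacts [⟨a, SameCycle.refl _ _⟩, ⟨_, hfalse.symm⟩, ⟨_, htrue.symm⟩]
        obtain ⟨l, h1, h2⟩ := G.existsUnique_leaf b
        exact ⟨l, ((sc_next hz _ _).2 h1).trans hb, fun l' h' =>
          h2 l' ((sc_next hz _ _).1 (SameCycle.trans h' hb.symm))⟩ }
  have hcirc : ∀ {i} {a : G.H ⊕ Bool}, a ∈ G1.circle i → ∃ b ∈ G.circle i, a = inl b := by
    rintro i (a | b | b) ⟨h1, h2, h3⟩
    · exact ⟨a, ⟨(sc_next hz _ _).1 h1, fun h' => h2 (congrArg inl h'),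
        fun h' => h3 (congrArg inl h')⟩, rfl⟩
    · exact (hinx i ((sc_next hz _ _).1 (SameCycle.trans h1 hfalse))).elim
    · exact (hiny i ((sc_next hz _ _).1 (SameCycle.trans h1 htrue))).elim
  have hcsrc : ∀ {i b}, b ∈ G.circle i → src x (inl b) = some (G.src b) := by
    grind [ClosedFatGraph.circle_subset]
  have hR := G1.reach_equiv {inr true, inr false}
  have hnew : G1.Reach {inr true, inr false} none (some (G.src x)) :=
    Reach.of_mem (G := G1.toFatGraph) (a := (inr true : G.H ⊕ Bool)) (.inl rfl)
  have hsome : ∀ a, G1.Reach {inr true, inr false} (src x (inl a))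
      (some (G.src a)) := fun a => by
    by_cases h2 : a ∈ ({x, G.rot x} : Set G.H)
    · rw [show src x (inl a) = none from if_pos h2]; grind
    · rw [hsrc h2]; exact hR.refl _
  let G' : AdmissibleFatGraph h n m :=
    { toClosedFatGraph := G1, circle_injOn := fun i a ha b hb hab => by
        obtain ⟨a, ha1, rfl⟩ := hcirc ha
        obtain ⟨b, hb1, rfl⟩ := hcirc hb
        have h1 := ((hcsrc ha1).symm.trans hab).trans (hcsrc hb1)
        rw [G.circle_injOn i ha1 hb1 (Option.some.inj h1)]
      inv_notMem_circle := fun i a ha ha' => by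
        obtain ⟨a, ha1, rfl⟩ := hcirc ha
        obtain ⟨b, hb, h1⟩ := hcirc ha'
        exact G.inv_notMem_circle i a ha1 (inl_injective h1 ▸ hb)
      circle_disjoint := fun i j hij a ha b hb hab => by
        obtain ⟨a, ha1, rfl⟩ := hcirc ha
        obtain ⟨b, hb1, rfl⟩ := hcirc hb
        have h1 := ((hcsrc ha1).symm.trans hab).trans (hcsrc hb1)
        exact G.circle_disjoint i j hij a ha1 b hb1 (Option.some.inj h1)
      reach_incoming := fun v => by
        have hU := G1.reach_equiv Set.univ
        have h1 : ∀ v w, G.Reach Set.univ v w → G1.Reach Set.univ (some v) (some w) := fun v w h' =>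
          Reach.induct hU some (fun a _ => hU.trans (hU.symm ((hsome a).mono (Set.subset_univ _)))
              (hU.trans (Reach.of_mem (G := G1.toFatGraph) (F := Set.univ)
                (a := (inl a : G.H ⊕ Bool)) trivial)
                ((hsome (G.inv a)).mono (Set.subset_univ _)))) h'
        rcases v with _ | v
        · obtain ⟨i, hi⟩ := G.reach_incoming (G.src x)
          exact ⟨i, hU.trans ((hsome _).mono (Set.subset_univ _)) (hU.trans (h1 _ _ hi)
            (hU.symm (hnew.mono (Set.subset_univ _))))⟩
        · obtain ⟨i, hi⟩ := G.reach_incoming v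
          exact ⟨i, hU.trans ((hsome _).mono (Set.subset_univ _)) (h1 _ _ hi)⟩
      card_H := by
        show Nat.card (G.H ⊕ Bool) = 2 * (Nat.card (Option G.V) + h)
        rw [Nat.card_sum, Finite.card_option, G.card_H, Nat.card_eq_fintype_card (α := Bool),
          Fintype.card_bool]
        ring }
  have hmem : ∀ a : G.H, (inl a : G.H ⊕ Bool) ∉
      ({inr true, inr false} : Set (G.H ⊕ Bool)) := by rintro a (h' | h') <;> cases h'
  let e : G.H ≃ {a : G.H ⊕ Bool // a ∉ ({inr true, inr false} : Set (G.H ⊕ Bool))} :=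
    ofBijective (fun a => ⟨inl a, hmem a⟩) ⟨fun a b hab => inl_injective (ext_iff.1 hab), by
        rintro ⟨a | b | b, hb⟩; exacts [⟨a, rfl⟩, (hb (.inr rfl)).elim, (hb (.inl rfl)).elim]⟩
  have he : ∀ a ha, e.symm ⟨inl a, ha⟩ = a := fun a ha => e.symm_apply_apply a
  have hv : ∀ v : Option G.V, G1.Reach {inr true, inr false} v (some (v.getD (G.src x))) := by
    rintro (_ | v); exacts [hnew, hR.refl _]
  have hgetD : ∀ a : G.H ⊕ Bool, (src x a).getD (G.src x) =
      elim G.src (fun _ => G.src x) a := by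
    rintro (a | b | b)
    · by_cases h2 : a ∈ ({x, G.rot x} : Set G.H)
      · rw [show src x (inl a) = none from if_pos h2]; grind
      · rw [hsrc h2]; rfl
    · rfl
    · rfl
  let c : Collapse G1 G.toClosedFatGraph {inr true, inr false} :=
    { onV := fun v => Option.getD v (G.src x), onV_surjective := fun v => ⟨some v, rfl⟩
      onV_eq_iff := fun v w => by
        constructor
        · intro hvw; have h1 := hv v; rw [hvw] at h1; exact hR.trans h1 (hR.symm (hv w))
        · refine Reach.induct (G := G1.toFatGraph) eq_equivalence
            (fun v => Option.getD v (G.src x)) ?_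
          rintro a (rfl | rfl)
          exacts [(hgetD (inr true)).trans (hgetD (inr false)).symm,
            (hgetD (inr false)).trans (hgetD (inr true)).symm]
      onH := e.symm
      src_onH := by
        rintro ⟨a, ha⟩; obtain ⟨b, hb⟩ := e.surjective ⟨a, ha⟩
        obtain rfl : inl b = a := ext_iff.1 hb
        exact (congrArg G.src (he b ha)).trans (hgetD (inl b)).symm
      inv_onH := by
        intro a b hab; obtain ⟨a, rfl⟩ := e.surjective a
        obtain ⟨b, rfl⟩ := e.surjective b
        exact ((congrArg G.inv (he a (hmem a))).trans (inl_injective hab)).trans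
          (he b (hmem b)).symm
      next_onH := by
        intro a b k hk hF; obtain ⟨a, rfl⟩ := e.surjective a
        obtain ⟨b, rfl⟩ := e.surjective b
        exact ((congrArg G.next (he a (hmem a))).trans (inl_injective ((hit_next hz a).unique
          (hmem _) (Hit.iff_pow.2 ⟨k, hk, hF⟩) (hmem b)))).trans (he b (hmem b)).symm
      onH_leaf := fun l => ⟨hmem _, he _ _⟩ }
  have hgc : ∀ b i, (inr b : G.H ⊕ Bool) ∉ G1.circle i := fun b i h' => by grind
  refine ⟨G', (inr true : G.H ⊕ Bool), (inl x : G.H ⊕ Bool), (inl (G.rot x) : G.H ⊕ Bool),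
    c, hmem _, hmem _, ?_, ?_, ?_, ⟨rot_true, ?_, rot_y hz⟩, he _ _, he _ _⟩
  · rintro ⟨i, h' | h'⟩; exacts [hgc _ i h', hgc _ i h']
  · exact Option.some_ne_none _
  · have h1 : {a | src x a = some (G.src x)} ⊆
        insert (inr false) (inl '' ({a | G.src a = G.src x} \ {x, G.rot x})) := by
      rintro (a | b | b) ha
      · refine .inr ⟨a, ?_, rfl⟩; by_cases h2 : a ∈ ({x, G.rot x} : Set G.H)
        · cases (show src x (inl a) = none from if_pos h2).symm.trans ha
        grind
      · exact .inl rfl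
      · cases ha
    have h2 := (Set.ncard_le_ncard h1 (toFinite _)).trans (Set.ncard_insert_le _ _)
    rw [Set.ncard_image_of_injective _ inl_injective] at h2
    have h3 : G'.valence (some (G.src x)) = {a | src x a = some (G.src x)}.ncard := rfl
    show G'.valence (some (G.src x)) < _
    omega
  · exact rot_of_ne (rot_ne hz) (rot_ne hz).symm

end FatGraphs

/-! # The combinatorial type of an admissible fat graph -/

namespace FatGraphs

open PermHit RadialSlit

variable {h n m : ℕ}

section Contr

variable (G : AdmissibleFatGraph h n m)

/-- Equality of vertices up to identification of all vertices on admissible cycles. -/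
def Tied (v w : G.V) : Prop := v = w ∨ G.OnCircle v ∧ G.OnCircle w

/-- The equivalence relation generated by `Tied` and a pair of vertices. -/
def TiedBy (s t v w : G.V) : Prop := Tied G v w ∨ Tied G v s ∧ Tied G t w ∨ Tied G v t ∧ Tied G s w

/-- The edges away from the admissible cycles which can be collapsed. -/
def Contr (e : G.H) : Prop := e ∉ G.leafEdges ∧ ¬ Tied G (G.src e) (G.src (G.inv e))

variable {G}

lemma Tied.symm : Tied G v w → Tied G w v := by unfold Tied; grind

lemma Tied.trans : Tied G u v → Tied G v w → Tied G u w := by unfold Tied; grind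

lemma tiedBy_equivalence (s t) : Equivalence (TiedBy G s t) where
  refl _ := .inl (.inl rfl)
  symm := by unfold TiedBy Tied; grind
  trans := by unfold TiedBy Tied; grind

lemma TiedBy.exchange (h1 : TiedBy G s t x y) (h2 : ¬ Tied G x y)
    (H : TiedBy G x y p q) : TiedBy G s t p q := by
  unfold TiedBy at *; unfold Tied at *; grind

lemma TiedBy.swap (h1 : TiedBy G s t x y) (h2 : ¬ Tied G x y) : TiedBy G x y s t := by
  unfold TiedBy at *; unfold Tied at *; grind

lemma Contr.inv (H : Contr G e) : Contr G (G.inv e) :=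
  ⟨G.ic_leaves.notMem H.1, fun h' => H.2 (by rw [G.inv_inv] at h'; exact h'.symm)⟩

lemma Contr.notMem_adm (H : Contr G e) :
    e ∉ G.admissibleEdges := fun h' => H.2 (.inr ⟨G.onCircle_of_adm h',
      G.onCircle_of_adm (G.ic_adm _ h')⟩)

lemma Contr.ex_col (H : Contr G e) :
    ∃ G' : AdmissibleFatGraph h n m, Nonempty (G.Collapse G' {e, G.inv e}) :=
  ex_ctr G (fun h' => H.2 (.inl h')) H.1 fun i j x y hx hy _ _ h1 h2 =>
    H.2 (.inr ⟨⟨i, x, hx, h1⟩, ⟨j, y, hy, h2⟩⟩)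

end Contr

section Collapse

variable {G G' G2 : AdmissibleFatGraph h n m} {e : G.H}

lemma notMem_pair_of_mem_circle (he : e ∉ G.admissibleEdges)
    (ha : a ∈ G.circle i) : a ∉ G.pair e := by
  grind [ClosedFatGraph.circle_subset, InvClosed.notMem, ClosedFatGraph.ic_adm]

namespace Collapse

variable (c : G.Collapse G' {e, G.inv e})

include c in
lemma card_lt : Nat.card G'.H < Nat.card G.H := by
  have h1 := c.card_H
  have h2 : 0 < ({e, G.inv e} : Set G.H).ncard := (Set.ncard_pos (toFinite _)).2 ⟨e, .inl rfl⟩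
  omega

lemma onV_pair : c.onV (G.src e) = c.onV (G.src (G.inv e)) :=
  (c.onV_eq_iff _ _).2 (Reach.of_mem (.inl rfl))

lemma onV_leaf (l) : c.onV (G.src (G.leaf l)) = G'.src (G'.leaf l) := by
  rw [← c.onH_leaf' l (c.leaf_notMem l), c.src_onH]

lemma ex_onCircle : G'.OnCircle w → ∃ v, G.OnCircle v ∧ c.onV v = w := by
  rintro ⟨i, a, ha, rfl⟩; obtain ⟨a, rfl⟩ := c.ex_onH a
  exact ⟨_, ⟨i, a.1, (c.mem_circle_iff (ic_pair e) i a).1 ha, rfl⟩, (c.src_onH a).symm⟩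

lemma onCircle_iff (he : e ∉ G.admissibleEdges) :
    G'.OnCircle w ↔ ∃ v, G.OnCircle v ∧ c.onV v = w := by
  refine ⟨c.ex_onCircle, ?_⟩
  · rintro ⟨_, ⟨i, a, ha, rfl⟩, rfl⟩
    exact ⟨i, c.onH ⟨a, notMem_pair_of_mem_circle he ha⟩,
      (c.mem_circle_iff (ic_pair e) i _).2 ha, c.src_onH _⟩

lemma contr_of_mem (c : G.Collapse G' F)
    (hF : InvClosed F) (hd : Disjoint F G.admissibleEdges) (he : e ∈ F) :
    Contr G e := by
  have hn : ∀ {i a}, a ∈ G.circle i → a ∉ F := fun ha h' =>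
    hd.notMem_of_mem_left h' (G.circle_subset _ ha)
  have hR := G.reach_equiv (F \ {e, G.inv e})
  refine ⟨c.notMem_leaves hF he, ?_⟩; rintro (h' | ⟨⟨i, a, ha, h1⟩, ⟨j, b, hb, h2⟩⟩)
  · exact (c.isForest hF).2 e he (h' ▸ hR.refl _)
  · have h3 := src_injOn_circles G' ((c.mem_circle_iff hF i ⟨a, hn ha⟩).2 ha)
      ((c.mem_circle_iff hF j ⟨b, hn hb⟩).2 hb) (by
        grind [Collapse.src_onH, Collapse.onV_eq_iff, Reach.of_mem])
    have h4 : a = b := ext_iff.1 (c.onH.injective h3.1)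
    refine (c.isForest hF).2 e he ?_; rw [← h1, ← h2, h4]; exact hR.refl _

lemma tied_iff (he : e ∉ G.admissibleEdges) :
    Tied G' (c.onV p) (c.onV q) ↔ TiedBy G (G.src e) (G.src (G.inv e)) p q := by
  have hR := tiedBy_equivalence (G := G) (G.src e) (G.src (G.inv e))
  have key : ∀ {p q}, c.onV p = c.onV q → TiedBy G (G.src e) (G.src (G.inv e)) p q := by
    intro p q hpq; refine Reach.induct hR id ?_ ((c.onV_eq_iff _ _).1 hpq); rintro a (rfl | rfl)
    · exact .inr (.inl ⟨.inl rfl, .inl rfl⟩)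
    · exact .inr (.inr ⟨.inl rfl, .inl (by rw [id, G.inv_inv])⟩)
  have key2 : ∀ {p q}, Tied G p q → Tied G' (c.onV p) (c.onV q) := by
    rintro p q (rfl | ⟨h1, h2⟩)
    · exact .inl rfl
    · exact .inr ⟨(c.onCircle_iff he).2 ⟨_, h1, rfl⟩, (c.onCircle_iff he).2 ⟨_, h2, rfl⟩⟩
  constructor
  · rintro (h' | ⟨h1, h2⟩)
    · exact key h'
    · obtain ⟨p', hp, hp'⟩ := (c.onCircle_iff he).1 h1
      obtain ⟨q', hq, hq'⟩ := (c.onCircle_iff he).1 h2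
      exact hR.trans (hR.symm (key hp')) (hR.trans (.inl (.inr ⟨hp, hq⟩)) (key hq'))
  · rintro (h' | ⟨h1, h2⟩ | ⟨h1, h2⟩)
    · exact key2 h'
    · exact (key2 h1).trans (Tied.trans (.inl c.onV_pair) (key2 h2))
    · exact (key2 h1).trans (Tied.trans (.inl c.onV_pair.symm) (key2 h2))

lemma contr_iff (he : e ∉ G.admissibleEdges) (f : {a : G.H // a ∉ ({e, G.inv e} : Set _)}) :
    Contr G' (c.onH f) ↔ f.1 ∉ G.leafEdges ∧
      ¬ TiedBy G (G.src e) (G.src (G.inv e)) (G.src f.1) (G.src (G.inv f.1)) := by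
  unfold Contr
  rw [c.mem_leaves_iff (ic_pair e), c.inv_eq (ic_pair e), c.src_onH, c.src_onH, c.tied_iff he]

lemma contr_of (he : e ∉ G.admissibleEdges) (H : Contr G' (c.onH f)) : Contr G f.1 :=
  ((c.contr_iff he f).1 H).imp_right fun h1 h2 => h1 (.inl h2)

lemma push_pair (hF : InvClosed F) (c : G.Collapse G' F) (f : {a : G.H // a ∉ F}) :
    c.push {f.1, G.inv f.1} = {c.onH f, G'.inv (c.onH f)} := by
  ext y; obtain ⟨a, rfl⟩ := c.ex_onH y
  grind [Collapse.mem_push_iff, InvClosed.notMem, Collapse.inv_eq]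

lemma pull_pair (hF : InvClosed {e, G.inv e}) (f : {a : G.H // a ∉ ({e, G.inv e} : Set _)}) :
    c.pull {c.onH f, G'.inv (c.onH f)} = {e, G.inv e} ∪ {f.1, G.inv f.1} := by
  rw [← push_pair hF, ← c.pull_push (Set.subset_union_left (t := {f.1, G.inv f.1}))]
  congr 1; ext y; obtain ⟨a, rfl⟩ := c.ex_onH y
  simp only [c.mem_push_iff, Set.mem_union, a.2, false_or]

lemma notMem_pair_symm (hf : f ∉ G.pair e) : e ∉ G.pair f := by grind [FatGraph.inv_inv]

lemma commute (hf : f ∉ G.pair e) (d : G.Collapse G2 {f, G.inv f})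
    (c' : G'.Collapse G3 {c.onH ⟨f, hf⟩, G'.inv (c.onH ⟨f, hf⟩)}) :
    Nonempty (G2.Collapse G3
      {d.onH ⟨e, notMem_pair_symm hf⟩, G2.inv (d.onH ⟨e, notMem_pair_symm hf⟩)}) := by
  have h1 := c.comp (ic_pair e) c'
  rw [c.pull_pair (ic_pair e), Set.union_comm, ← d.pull_pair (ic_pair f)
    ⟨e, notMem_pair_symm hf⟩] at h1
  have h2 := d.factor (ic_pair f) h1 (d.subset_pull _)
  rw [d.pull_pair (ic_pair f) ⟨e, notMem_pair_symm hf⟩] at h2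
  have h3 : d.push ({f, G.inv f} ∪ {e, G.inv e}) = d.push {e, G.inv e} := by
    ext y; obtain ⟨a, rfl⟩ := d.ex_onH y
    simp only [d.mem_push_iff, Set.mem_union, a.2, false_or]
  rw [h3, push_pair (ic_pair f) d ⟨e, notMem_pair_symm hf⟩] at h2; exact ⟨h2⟩

end Collapse

end Collapse

lemma noInt_iff (G : AdmissibleFatGraph h n m) : NoInt G ↔ ∀ e, ¬ Contr G e := by
  constructor
  · intro H e he
    have hC : ∀ {a}, a ∉ G.leafEdges → G.OnCircle (G.src a) := fun ha =>
      (H _).resolve_right fun ⟨l, hl⟩ => G.src_ne_leaf ha l hl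
    exact he.2 (.inr ⟨hC he.1, hC (G.ic_leaves.notMem he.1)⟩)
  · intro H v
    classical
    by_cases hv : ∃ l, G.src (G.leaf l) = v
    · exact .inr hv
    let f : G.V → G.V := fun v =>
      if hv : ∃ l, G.src (G.leaf l) = v then G.src (G.inv (G.leaf hv.choose)) else v
    have hf : ∀ l, f (G.src (G.leaf l)) = G.src (G.inv (G.leaf l)) := fun l => by
      have hl : ∃ l', G.src (G.leaf l') = G.src (G.leaf l) := ⟨l, rfl⟩
      rw [show f _ = _ from dif_pos hl, G.eq_leaf_of_src hl.choose_spec]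
    have hf' : ∀ {v}, (¬ ∃ l, G.src (G.leaf l) = v) → f v = v := fun h' => dif_neg h'
    have hf2 : ∀ l, f (G.src (G.inv (G.leaf l))) = G.src (G.inv (G.leaf l)) := fun l =>
      hf' fun ⟨l', h'⟩ => G.leaf_ne_inv_leaf l' l (G.eq_leaf_of_src h'.symm).symm
    have hR : Equivalence (Tied G) := ⟨fun _ => .inl rfl, Tied.symm, Tied.trans⟩
    obtain ⟨i, hi⟩ := G.reach_incoming v
    have := Reach.induct hR f (fun a _ => ?_) hi
    · rw [hf, hf' hv] at this
      have hi0 : G.OnCircle (G.src (G.inv (G.leaf (inl i)))) :=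
        (G.onCircle_iff).2 ⟨i, 0, G.circleCard_pos i, G.vtx_zero i⟩
      exact .inl (this.elim (fun h' => h' ▸ hi0) fun h' => h'.2)
    · by_cases ha : a ∈ G.leafEdges
      · obtain ⟨l, rfl | rfl⟩ := ha
        · rw [hf, hf2]; exact hR.refl _
        · rw [G.inv_inv, hf, hf2]; exact hR.refl _
      · rw [hf' fun ⟨l, h'⟩ => G.src_ne_leaf ha l h',
          hf' fun ⟨l, h'⟩ => G.src_ne_leaf (G.ic_leaves.notMem ha) l h']
        by_contra h'
        exact H a ⟨ha, h'⟩

/-- The edge `e` joins the only vertex which is neither a leaf nor on an admissible cycle to an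
admissible cycle. -/
structure IsStar (G : AdmissibleFatGraph h n m) (e : G.H) : Prop where
  notMem_leaves : e ∉ G.leafEdges
  not_circle : ¬ G.OnCircle (G.src e)
  circle : G.OnCircle (G.src (G.inv e))
  eq_or : ∀ w, w = G.src e ∨ G.OnCircle w ∨ ∃ l, G.src (G.leaf l) = w

section Star

variable {G G' : AdmissibleFatGraph h n m} {a b : G.H}

lemma contr_of_circle (h1 : a ∉ G.leafEdges) (h2 : ¬ G.OnCircle (G.src a))
    (h3 : G.OnCircle (G.src (G.inv a))) : Contr G a :=
  ⟨h1, fun h' => h'.elim (fun h' => h2 (h' ▸ h3)) fun h' => h2 h'.1⟩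

lemma IsStar.contractible (H : IsStar G a) : Contr G a := contr_of_circle H.1 H.2 H.3

lemma IsStar.noInt (H : IsStar G a) (c : G.Collapse G' {a, G.inv a}) : NoInt G' := by
  have ha := H.contractible.notMem_adm
  intro w; obtain ⟨v, rfl⟩ := c.onV_surjective w
  rcases H.eq_or v with rfl | hv | ⟨l, rfl⟩
  · exact .inl ((c.onCircle_iff ha).2 ⟨_, H.circle, c.onV_pair.symm⟩)
  · exact .inl ((c.onCircle_iff ha).2 ⟨_, hv, rfl⟩)
  · exact .inr ⟨l, (c.onV_leaf l).symm⟩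

lemma IsStar.src_eq (H : IsStar G a) (H' : IsStar G f) : G.src f = G.src a :=
  (H.eq_or _).resolve_right fun h' => h'.elim H'.not_circle fun ⟨l, hl⟩ => G.src_ne_leaf H'.1 l hl

lemma Collapse.isStar (c : G.Collapse G' {a, G.inv a})
    (h1 : ¬ G.OnCircle (G.src a)) (h2 : G.OnCircle (G.src (G.inv a)))
    (h3 : G.src b ≠ G.src a) (h4 : ¬ G.OnCircle (G.src b)) (h5 : b ∉ G.leafEdges)
    (h6 : G.OnCircle (G.src (G.inv b)) ∨ G.src (G.inv b) = G.src a)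
    (h7 : ∀ w, w = G.src a ∨ w = G.src b ∨ G.OnCircle w ∨ ∃ l, G.src (G.leaf l) = w)
    (hb : b ∉ G.pair a) :
    IsStar G' (c.onH ⟨b, hb⟩) ∧ G'.valence (G'.src (c.onH ⟨b, hb⟩)) ≤ G.valence (G.src b) := by
  have ha : a ∉ G.admissibleEdges := fun h' => h1 (G.onCircle_of_adm h')
  have hC : ∀ {p}, c.onV p = c.onV (G.src b) → p ≠ G.src a → p = G.src b := fun hp hp' =>
    c.onV_eq_of_pair hp hp' h3
  have h8 : G'.OnCircle (c.onV (G.src a)) := (c.onCircle_iff ha).2 ⟨_, h2, c.onV_pair.symm⟩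
  have h9 : ¬ G'.OnCircle (c.onV (G.src b)) := fun h' => by
    obtain ⟨p, hp, hpb⟩ := (c.onCircle_iff ha).1 h'
    exact h4 (hC hpb (fun h' => h1 (h' ▸ hp)) ▸ hp)
  refine ⟨⟨fun h' => h5 ((c.mem_leaves_iff (ic_pair a) _).1 h'), ?_, ?_, ?_⟩, ?_⟩
  · rwa [c.src_onH]
  · rw [c.inv_eq (ic_pair a), c.src_onH]; rcases h6 with h6 | h6
    · exact (c.onCircle_iff ha).2 ⟨_, h6, rfl⟩
    · exact h6 ▸ h8
  · intro w; obtain ⟨v, rfl⟩ := c.onV_surjective w; rw [c.src_onH]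
    rcases h7 v with rfl | rfl | hv | ⟨l, rfl⟩
    · exact .inr (.inl h8)
    · exact .inl rfl
    · exact .inr (.inl ((c.onCircle_iff ha).2 ⟨_, hv, rfl⟩))
    · exact .inr (.inr ⟨l, (c.onV_leaf l).symm⟩)
  · have := G.finite_H; rw [FatGraph.valence, FatGraph.valence]
    have hs : ∀ y : G'.H, G'.src y = G'.src (c.onH ⟨b, hb⟩) → G.src (c.onH.symm y).1 = G.src b := by
      intro y hy; obtain ⟨y, rfl⟩ := c.ex_onH y
      grind [Collapse.src_onH]
    exact Nat.card_le_card_of_injective (fun y : {y // G'.src y = G'.src (c.onH ⟨b, hb⟩)} =>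
        (⟨(c.onH.symm y.1).1, hs y.1 y.2⟩ : {y // G.src y = G.src b}))
      fun y z hyz => Subtype.ext (c.onH.symm.injective (Subtype.ext (Subtype.mk.inj hyz)))

end Star

end FatGraphs

namespace FatGraphs

open PermHit RadialSlit

variable {h n m : ℕ}

lemma Unf.type_eq_of_iso (H : Unf D G) (H' : Unf D' G') (hF : F = ∅)
    (c : G.Collapse G' F) : D.type = D'.type := by
  subst hF; exact (H.transport c).type_eq H'

lemma Collapse.push_self (c : Collapse G G' F) : c.push F = ∅ := by
  ext y; exact ⟨fun hy => (c.onH.symm y).2 hy, fun hy => hy.elim⟩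

section Exchange

variable {G G1 G2 : AdmissibleFatGraph h n m} {e f : G.H} {D1 D2 : Diagram h n m}

lemma type_eq_of_tripod (T : IsTripod G.toFatGraph f y e) (He : IsStar G e) (Hf : IsStar G f)
    (c1 : G.Collapse G1 {e, G.inv e}) (H1 : Unf D1 G1)
    (c2 : G.Collapse G2 {f, G.inv f}) (H2 : Unf D2 G2) :
    D1.type = D2.type := by
  have hF := ic_pair (G := G.toFatGraph) f
  have hne : ∀ {w}, G.OnCircle w → w ≠ G.src f := fun hw h' => Hf.not_circle (h' ▸ hw)
  have hleaf := G.src_ne_leaf Hf.notMem_leaves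
  have hrot : ∀ {a}, G.src a = G.src f → G.rot a ≠ a := fun ha =>
    G.rot_ne_self fun l => ha ▸ hleaf l
  have hpair : ∀ {a}, G.src a = G.src f → a ≠ f → a ∉ G.pair f := by
    rintro a h1 h2 (h3 | h3); exacts [h2 h3, hne Hf.circle (h3 ▸ h1)]
  have hy : y ∉ G.pair f := hpair T.src_x fun h' => hrot rfl (T.rot_g.trans h')
  have he : e ∉ G.pair f := hpair T.src_j fun h' => hrot T.src_j (T.rot_j.trans h'.symm)
  obtain ⟨att, A⟩ := H2
  have hatt : ∀ a (ha : a ∉ G.pair f), G.src a = G.src f → ∃ X, att X = c2.onH ⟨a, ha⟩ := by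
    intro a ha hs; rcases A.cover (c2.onH ⟨a, ha⟩) with h1 | h1 | h1
    · rw [c2.mem_adm hF] at h1; exact (hne (G.onCircle_of_adm h1) hs).elim
    · rw [c2.mem_leaves_iff hF] at h1; obtain ⟨l, hl | hl⟩ := h1
      · grind
      have hl : a = G.inv (G.leaf l) := hl
      subst hl; rcases l with i | p
      · exact (hne (G.onCircle_iff.2 ⟨i, 0, G.circleCard_pos i, G.vtx_zero i⟩) hs).elim
      · exact ⟨inr p, by rw [← A.inv_leaf_param, c2.onH_inv_leaf]⟩
    · exact h1
  obtain ⟨X, hX⟩ := hatt y hy T.src_x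
  obtain ⟨J | p, hJ⟩ := hatt e he T.src_j
  · obtain ⟨H, H3⟩ := A.jump T c2 c1 Hf.contractible.notMem_adm (hne Hf.circle)
      (hne He.circle) hy he hX hJ
    rw [H1.type_eq H3, Diagram.type_jump]
  · refine (He.notMem_leaves ((c2.mem_leaves_iff hF ⟨e, he⟩).1 ?_)).elim
    rw [← hJ, ← A.inv_leaf_param]; exact ⟨_, .inr rfl⟩

lemma isTripod_of_valence (hval : G.valence (G.src f) ≤ 3) (hs : G.src e = G.src f)
    (hef : e ≠ f) (hr : G.rot f ≠ e) (hf : G.rot f ≠ f) :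
    IsTripod G.toFatGraph f (G.rot f) e := by
  have h1 : ({f, G.rot f, e} : Set G.H) = {a | G.src a = G.src f} := by
    refine Set.eq_of_subset_of_ncard_le ?_ ?_ (toFinite _)
    · rintro a (rfl | rfl | rfl); exacts [rfl, G.src_rot _, hs]
    · rw [G.valence_eq_ncard] at hval
      rw [Set.ncard_eq_three.2 ⟨f, G.rot f, e, hf.symm, hef.symm, hr, rfl⟩]; exact hval
  have h2 : ∀ {a}, G.src a = G.src f → a = f ∨ a = G.rot f ∨ a = e := fun ha => by
    simpa using h1.symm.subset ha
  have h3 : G.rot (G.rot f) = e := by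
    rcases h2 (a := G.rot (G.rot f)) (by rw [G.src_rot, G.src_rot]) with h' | h' | h'
    · have : e ∈ ({f, G.rot f} : Set G.H) := FatGraph.mem_of_rot_closed (by grind) (.inl rfl) hs
      grind
    · exact (hf (G.rot.injective h')).elim
    · exact h'
  refine ⟨rfl, h3, ?_⟩; rcases h2 (a := G.rot e) (by rw [G.src_rot, hs]) with h' | h' | h'
  · exact h'
  · exact (hef (G.rot.injective h')).elim
  · exact (hr (G.rot.injective (h3.trans h'.symm))).elim

lemma IsStar.type_eq (hN : G.valence (G.src f) ≤ N) (He : IsStar G e) (Hf : IsStar G f)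
    (c1 : G.Collapse G1 {e, G.inv e}) (H1 : Unf D1 G1)
    (c2 : G.Collapse G2 {f, G.inv f}) (H2 : Unf D2 G2) :
    D1.type = D2.type := by
  induction N generalizing G G1 G2 D1 D2 with
  | zero =>
    have := G.three_le_valence (G.src f) (G.src_ne_leaf Hf.notMem_leaves)
    omega
  | succ N ih =>
  have hs := Hf.src_eq He
  by_cases hef : e = f
  · subst hef; exact H1.type_eq_of_iso H2 c1.push_self (c1.factor (ic_pair e) c2 subset_rfl)
  have hrot := G.rot_ne_self (G.src_ne_leaf Hf.notMem_leaves)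
  have hrot' := G.rot_ne_self (G.src_ne_leaf He.notMem_leaves)
  wlog hr : G.rot f ≠ e generalizing e f G1 G2 D1 D2
  · rw [not_not] at hr
    refine (this (hs ▸ hN) Hf He c2 H2 c1 H1 hs.symm (Ne.symm hef) hrot' hrot fun h' => ?_).symm
    obtain ⟨a, b, d, ha, hb, hd, h1, h2, h3⟩ := FatGraph.two_lt_valence_iff.1
      (G.three_le_valence (G.src f) (G.src_ne_leaf Hf.notMem_leaves))
    have h4 : ∀ {a}, G.src a = G.src f → a = f ∨ a = e := fun ha =>
      FatGraph.mem_of_rot_closed (S := {f, e}) (by grind) (.inl rfl) ha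
    grind
  by_cases hval : G.valence (G.src f) ≤ 3
  · exact type_eq_of_tripod (isTripod_of_valence hval hs hef hr hrot) He Hf c1 H1 c2 H2
  have hcirc : ∀ {a}, G.OnCircle (G.src a) → G.src a ≠ G.src f := fun ha h' =>
    Hf.not_circle (h' ▸ ha)
  have hadm : ∀ {a}, G.src a = G.src f → a ∉ G.admissibleEdges := fun ha h' =>
    hcirc (G.onCircle_of_adm h') ha
  have hroot : ∀ {a}, G.src a = G.src f → ∀ i, a ≠ G.inv (G.leaf (inl i)) := by
    rintro a ha i rfl; exact hcirc (G.onCircle_iff.2 ⟨i, 0, G.circleCard_pos i, G.vtx_zero i⟩) ha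
  obtain ⟨G0, g, x, y, c, hx, hy, hg, hsg, hv, T, hcx, hcy⟩ := ex_expand G f (by omega)
    (hadm rfl) (hadm (G.src_rot f)) (hroot rfl) (hroot (G.src_rot f))
  have hP := ic_pair (G := G0.toFatGraph) g
  obtain ⟨⟨e', he'⟩, hce⟩ := c.ex_onH e
  have hug : c.onV (G0.src g) = G.src f := by rw [← T.src_x, ← hcx, c.src_onH]
  have hvg : c.onV (G0.src (G0.inv g)) = G.src f := c.onV_pair ▸ hug
  have hC : ∀ {p}, G.OnCircle (c.onV p) → G0.OnCircle p := by
    intro p hp; obtain ⟨q, hq, hqp⟩ := (c.onCircle_iff hg).1 hp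
    have hne : ∀ {r}, G.OnCircle (c.onV r) → r ≠ G0.src g := fun hr h' =>
      Hf.not_circle (by rw [← hug, ← h']; exact hr)
    exact c.onV_eq_of_pair hqp (hne (hqp ▸ hp)) (hne hp) ▸ hq
  have hC' : ∀ {p}, c.onV p = G.src f → ¬ G0.OnCircle p := fun hp h' =>
    Hf.not_circle (hp ▸ (c.onCircle_iff hg).2 ⟨_, h', rfl⟩)
  have hse : G0.src e' = G0.src (G0.inv g) := by
    grind [Collapse.onV_eq_of_pair, Collapse.src_onH, IsTripod.eq_or]
  have hxl : x ∉ G0.leafEdges := fun h' => Hf.1 (hcx ▸ (c.mem_leaves_iff hP ⟨x, hx⟩).2 h')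
  have hel : e' ∉ G0.leafEdges := fun h' => He.1 (hce ▸ (c.mem_leaves_iff hP ⟨e', he'⟩).2 h')
  have hgl := c.notMem_leaves hP (.inl rfl)
  have hxC : G0.OnCircle (G0.src (G0.inv x)) := hC (by
    have := Hf.circle
    rwa [← hcx, c.inv_eq hP, c.src_onH] at this)
  have heC : G0.OnCircle (G0.src (G0.inv e')) := hC (by
    have := He.circle
    rwa [← hce, c.inv_eq hP, c.src_onH] at this)
  have hxn : ¬ G0.OnCircle (G0.src x) := hC' (T.src_x ▸ hug)
  have hen : ¬ G0.OnCircle (G0.src e') := hC' (hse ▸ hvg)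
  have hex : G0.src e' ≠ G0.src x := by rw [hse, T.src_x]; exact hsg
  have hall : ∀ w, w = G0.src x ∨ w = G0.src e' ∨ G0.OnCircle w ∨ ∃ l, G0.src (G0.leaf l) = w := by
    intro w; rw [T.src_x, hse]; by_cases hw : w = G0.src g
    · exact .inl hw
    rcases Hf.eq_or (c.onV w) with h' | h' | ⟨l, h'⟩
    · exact .inr (.inl (c.onV_eq_of_pair (h'.trans hvg.symm) hw hsg))
    · exact .inr (.inr (.inl (hC h')))
    · exact .inr (.inr (.inr ⟨l, c.onV_eq_of_pair ((c.onV_leaf l).trans h')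
        (G0.src_ne_leaf hgl l) hw⟩))
  have hpair : ∀ {a b : G0.H}, G0.src a ≠ G0.src b → G0.src a ≠ G0.src (G0.inv b) →
      a ∉ G0.pair b := by
    grind
  have hne : ∀ {a b : G0.H}, ¬ G0.OnCircle (G0.src a) → G0.OnCircle (G0.src b) →
      G0.src a ≠ G0.src b := fun h1 h2 h' => h1 (h' ▸ h2)
  have hgn : ¬ G0.OnCircle (G0.src g) := T.src_x ▸ hxn
  have hgn' : ¬ G0.OnCircle (G0.src (G0.inv g)) := hse ▸ hen
  have hex1 : e' ∉ G0.pair x := hpair hex (hne hen hxC)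
  have hgx : G0.inv g ∉ G0.pair x := hpair (by rw [T.src_x]; exact hsg) (hne hgn' hxC)
  have hgx1 : g ∉ G0.pair x := fun h' => hgx (ic_pair x _ h')
  have hge : g ∉ G0.pair e' := hpair (by rw [hse]; exact hsg.symm) (hne hgn heC)
  have hxe : x ∉ G0.pair e' := hpair hex.symm (hne hxn heC)
  obtain ⟨Gf, ⟨cf⟩⟩ := (contr_of_circle hxl hxn hxC).ex_col
  obtain ⟨Ge, ⟨ce⟩⟩ := (contr_of_circle hel hen heC).ex_col
  have S1 := cf.isStar hxn hxC hex hen hel (.inl heC) hall hex1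
  have S2 := cf.isStar hxn hxC (hse ▸ hex) hgn' (G0.ic_leaves.notMem hgl)
    (.inr (by rw [G0.inv_inv, T.src_x])) (hse ▸ hall) hgx
  have hall' : ∀ w, w = G0.src e' ∨ w = G0.src x ∨ G0.OnCircle w ∨
      ∃ l, G0.src (G0.leaf l) = w := fun w => by have := hall w; tauto
  have S3 := ce.isStar hen heC hex.symm hxn hxl (.inl hxC) hall' hxe
  have S4 := ce.isStar hen heC (T.src_x ▸ hex.symm) hgn hgl (.inr hse.symm) (T.src_x ▸ hall') hge
  obtain ⟨G3, ⟨d1⟩⟩ := S1.1.contractible.ex_col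
  obtain ⟨D3, H3⟩ := (S1.1.noInt d1).ex_unfolded
  obtain ⟨d3⟩ := cf.commute hex1 ce d1
  subst hcx hce; obtain ⟨d2⟩ := c.commute hx cf c2
  obtain ⟨d4⟩ := c.commute he' ce c1
  have hvT : G0.valence (G0.src g) ≤ 3 := by
    have h1 : {a | G0.src a = G0.src g} ⊆ ({g, x, y} : Set G0.H) := fun a ha => T.eq_or ha
    rw [G0.valence_eq_ncard]; refine (Set.ncard_le_ncard h1 (toFinite _)).trans ?_
    exact (Set.ncard_insert_le _ _).trans (Nat.succ_le_succ
      ((Set.ncard_insert_le _ _).trans (by rw [Set.ncard_singleton])))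
  have E1 : D3.type = D2.type := by
    refine ih (G := Gf) (f := cf.onH ⟨G0.inv g, hgx⟩) (by have := S2.2; omega) S1.1 S2.1 d1 H3 ?_ H2
    have h5 : ({cf.onH ⟨G0.inv g, hgx⟩, Gf.inv (cf.onH ⟨G0.inv g, hgx⟩)} : Set Gf.H) =
        {cf.onH ⟨g, hgx1⟩, Gf.inv (cf.onH ⟨g, hgx1⟩)} := by
      rw [cf.inv_eq' hgx1 hgx, ← cf.inv_eq' hgx1 hgx, Gf.inv_inv, Set.pair_comm]
    exact h5 ▸ d2
  have E2 : D1.type = D3.type :=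
    ih (G := Ge) (f := ce.onH ⟨x, hxe⟩) (by have := S3.2; rw [T.src_x] at this; omega) S4.1 S3.1
      d4 H1 d3 H3
  exact E2.trans E1

end Exchange

end FatGraphs

namespace FatGraphs

open PermHit RadialSlit

variable {h n m : ℕ}

/-- The edges away from the admissible cycles can be collapsed one after the other, with an unfolded
graph of type `T` as the result. -/
inductive HasType : AdmissibleFatGraph h n m → CombType h n m → Prop
  | base {D : Diagram h n m} {G : AdmissibleFatGraph h n m} (H : Unf D G) : HasType G D.type
  | step {G G' : AdmissibleFatGraph h n m} {T : CombType h n m} {e : G.H} (he : Contr G e)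
      (c : G.Collapse G' {e, G.inv e}) (H : HasType G' T) :
      HasType G T

lemma disj_pair {G : AdmissibleFatGraph h n m} {e : G.H} (he : e ∉ G.admissibleEdges) :
    Disjoint (G.pair e) G.admissibleEdges := by
  rw [disjoint_left]; rintro a (rfl | rfl); exacts [he, G.ic_adm.notMem he]

lemma HasType.exists (G : AdmissibleFatGraph h n m) : ∃ T, HasType G T := by
  induction hk : Nat.card G.H using strong_induction_on generalizing G with
  | _ k ih =>
    by_cases hG : NoInt G
    · obtain ⟨D, hD⟩ := hG.ex_unfolded; exact ⟨_, .base hD⟩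
    · rw [noInt_iff] at hG; push Not at hG; obtain ⟨e, he⟩ := hG; obtain ⟨G', ⟨c⟩⟩ := he.ex_col
      obtain ⟨T, hT⟩ := ih _ (hk ▸ c.card_lt) G' rfl
      exact ⟨T, .step he c hT⟩

lemma HasType.transport {G G' : AdmissibleFatGraph h n m} {T : CombType h n m} (H : HasType G T)
    {F : Set G.H} (hF : F = ∅) (c : G.Collapse G' F) :
    HasType G' T := by
  subst hF; have hF0 : InvClosed (G := G.toFatGraph) ∅ := fun _ h' => h'
  cases H with
  | base H => exact .base (H.transport c)
  | @step _ G1 _ e he d H =>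
    have hd := c.factor hF0 d (Set.empty_subset _)
    rw [Collapse.push_pair hF0 c ⟨e, id⟩] at hd
    refine .step (hd.contr_of_mem (ic_pair _) (disj_pair fun h' =>
      he.notMem_adm ((c.mem_adm hF0 _).1 h')) (.inl rfl)) hd H

lemma type_eq_of_noInt {G G1 G2 : AdmissibleFatGraph h n m} {e f : G.H}
    {D1 D2 : Diagram h n m} (he : Contr G e) (hf : Contr G f)
    (c1 : G.Collapse G1 {e, G.inv e}) (H1 : Unf D1 G1)
    (c2 : G.Collapse G2 {f, G.inv f}) (H2 : Unf D2 G2) :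
    D1.type = D2.type := by
  have key : ∀ {G' : AdmissibleFatGraph h n m} {e : G.H}, Contr G e →
      G.Collapse G' {e, G.inv e} → NoInt G' →
      ∃ e', ({e', G.inv e'} : Set G.H) = {e, G.inv e} ∧ IsStar G e' := by
    intro G' e he c H
    have hn := he.notMem_adm
    have h1 : ∀ w, ¬ G.OnCircle w → (∃ l, G.src (G.leaf l) = w) ∨
        w = G.src e ∧ G.OnCircle (G.src (G.inv e)) ∨
        w = G.src (G.inv e) ∧ G.OnCircle (G.src e) := by
      intro w hw
      rcases H (c.onV w) with h' | ⟨l, hl⟩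
      · obtain ⟨p, hp, hpw⟩ := (c.onCircle_iff hn).1 h'
        have h2 := (c.tied_iff hn).1 (.inl hpw)
        unfold TiedBy Tied at h2
        grind
      · refine .inl ⟨l, ?_⟩
        have h2 : c.onV w = c.onV (G.src (G.leaf l)) := by rw [c.onV_leaf, hl]
        by_cases hw1 : w = G.src e
        · subst hw1
          by_cases h3 : G.src (G.leaf l) = G.src (G.inv e)
          · exact (G.src_ne_leaf (G.ic_leaves.notMem he.1) l h3).elim
          · have h4 := (c.tied_iff hn).1 (.inl h2)
            have h5 := G.not_onCircle_leaf l
            have h6 := G.src_ne_leaf he.1 l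
            unfold TiedBy Tied at h4
            grind
        · exact (c.onV_eq_of_pair h2 hw1 (G.src_ne_leaf he.1 l)).symm
    have h3 := G.src_ne_leaf he.1
    have h4 := G.src_ne_leaf (G.ic_leaves.notMem he.1)
    by_cases h2 : G.OnCircle (G.src e)
    · have h5 : ¬ G.OnCircle (G.src (G.inv e)) := fun h' => he.2 (.inr ⟨h2, h'⟩)
      refine ⟨G.inv e, by rw [G.inv_inv, Set.pair_comm], G.ic_leaves.notMem he.1, h5,
        by rwa [G.inv_inv], fun w => ?_⟩
      by_cases hw : G.OnCircle w
      · exact .inr (.inl hw)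
      rcases h1 w hw with h' | h' | h'
      exacts [.inr (.inr h'), (h5 h'.2).elim, .inl h'.1]
    · have h5 : G.OnCircle (G.src (G.inv e)) := by
        rcases h1 _ h2 with ⟨l, h'⟩ | h' | h'
        exacts [(h3 l h').elim, h'.2, (h2 h'.2).elim]
      refine ⟨e, rfl, he.1, h2, h5, fun w => ?_⟩
      by_cases hw : G.OnCircle w
      · exact .inr (.inl hw)
      rcases h1 w hw with h' | h' | h'
      exacts [.inr (.inr h'), .inl h'.1, (h2 h'.2).elim]
  obtain ⟨e', he', Se⟩ := key he c1 H1.noInt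
  obtain ⟨f', hf', Sf⟩ := key hf c2 H2.noInt
  exact Se.type_eq le_rfl Sf (he' ▸ c1) H1 (hf' ▸ c2) H2

lemma HasType.unique {G : AdmissibleFatGraph h n m} {T T' : CombType h n m} (H : HasType G T)
    (H' : HasType G T') : T = T' := by
  induction hk : Nat.card G.H using strong_induction_on generalizing G T T' with
  | _ k ih =>
  subst hk
  have ih' : ∀ {G' : AdmissibleFatGraph h n m} {e : G.H} {T T' : CombType h n m},
      G.Collapse G' {e, G.inv e} → HasType G' T → HasType G' T' →
      T = T' := fun c H H' => ih _ c.card_lt H H' rfl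
  have diamond : ∀ {G1 G2 : AdmissibleFatGraph h n m} {e f : G.H} {T1 T2 : CombType h n m}
      (c1 : G.Collapse G1 {e, G.inv e})
      (c2 : G.Collapse G2 {f, G.inv f}),
      HasType G1 T1 → HasType G2 T2 → Contr G e → Contr G f →
      ∀ hf : f ∉ ({e, G.inv e} : Set G.H), Contr G1 (c1.onH ⟨f, hf⟩) → T1 = T2 := by
    intro G1 G2 e f T1 T2 c1 c2 H1 H2 he hf hfe hc
    obtain ⟨G3, ⟨d1⟩⟩ := hc.ex_col
    obtain ⟨d2⟩ := c1.commute hfe c2 d1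
    obtain ⟨T3, H3⟩ := HasType.exists G3
    have hc2 := d2.contr_of_mem (ic_pair _) (disj_pair fun h' =>
      he.notMem_adm ((c2.mem_adm (ic_pair _) _).1 h')) (.inl rfl)
    rw [ih' c1 H1 (.step hc d1 H3), ih' c2 H2 (.step hc2 d2 H3)]
  cases H with
  | base H =>
    cases H' with
    | base H' => exact H.type_eq H'
    | step he c H' => exact ((noInt_iff G).1 H.noInt _ he).elim
  | @step _ G1 _ e he c1 H1 =>
    cases H' with
    | base H' => exact ((noInt_iff G).1 H'.noInt _ he).elim
    | @step _ G2 _ f hf c2 H2 =>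
      have hne := he.notMem_adm
      have hnf := hf.notMem_adm
      by_cases hfe : f ∈ ({e, G.inv e} : Set G.H)
      · have h1 : ({f, G.inv f} : Set G.H) = {e, G.inv e} := by
          rcases hfe with rfl | rfl
          exacts [rfl, by rw [G.inv_inv, Set.pair_comm]]
        have c3 := c1.factor (ic_pair e) c2 h1.symm.subset
        exact ih' c2 (H1.transport (by rw [h1, c1.push_self]) c3) H2
      by_cases hc : Contr G1 (c1.onH ⟨f, hfe⟩)
      · exact diamond c1 c2 H1 H2 he hf hfe hc
      have hJ : TiedBy G (G.src e) (G.src (G.inv e)) (G.src f) (G.src (G.inv f)) := by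
        rw [c1.contr_iff hne] at hc
        by_contra h'
        exact hc ⟨hf.1, h'⟩
      have hJ' := hJ.swap hf.2
      have hc' : ∀ {g} (hg : g ∉ ({e, G.inv e} : Set G.H)), Contr G1 (c1.onH ⟨g, hg⟩) →
          g ∉ ({f, G.inv f} : Set G.H) := by
        rintro g hg hgc (rfl | rfl)
        · exact hc hgc
        · refine hc ?_
          have := hgc.inv
          rw [c1.inv_eq (ic_pair e)] at this
          simpa only [G.inv_inv] using this
      by_cases hG : NoInt G1
      · have hG2 : NoInt G2 := by
          rw [noInt_iff] at hG ⊢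
          intro g hg
          obtain ⟨⟨g, hgf⟩, rfl⟩ := c2.ex_onH g
          rw [c2.contr_iff hnf] at hg
          have hge : g ∉ ({e, G.inv e} : Set G.H) := by
            rintro (rfl | rfl)
            · exact hg.2 hJ'
            · refine hg.2 ?_
              rw [G.inv_inv]
              exact (tiedBy_equivalence _ _).symm hJ'
          exact hG _ ((c1.contr_iff hne ⟨g, hge⟩).2 ⟨hg.1, fun h' => hg.2 (hJ'.exchange he.2 h')⟩)
        obtain ⟨D1, U1⟩ := hG.ex_unfolded
        obtain ⟨D2, U2⟩ := hG2.ex_unfolded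
        rw [ih' c1 H1 (.base U1), ih' c2 H2 (.base U2)]
        exact type_eq_of_noInt he hf c1 U1 c2 U2
      · rw [noInt_iff] at hG
        push Not at hG
        obtain ⟨g, hg⟩ := hG
        obtain ⟨⟨g, hge⟩, rfl⟩ := c1.ex_onH g
        have hgf := hc' hge hg
        have hgG := c1.contr_of hne hg
        obtain ⟨G3, ⟨c3⟩⟩ := hgG.ex_col
        obtain ⟨T3, H3⟩ := HasType.exists G3
        rw [diamond c1 c3 H1 H3 he hgG hge hg, diamond c2 c3 H2 H3 hf hgG hgf]
        rw [c2.contr_iff hnf]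
        have h3 := (c1.contr_iff hne _).1 hg
        exact ⟨h3.1, fun h' => h3.2 (hJ.exchange hf.2 h')⟩

/-- The combinatorial type of an admissible fat graph. -/
def cType (G : AdmissibleFatGraph h n m) : CombType h n m := (HasType.exists G).choose

variable {G G' : AdmissibleFatGraph h n m}

lemma hasType_cType (G : AdmissibleFatGraph h n m) : HasType G (cType G) :=
  (HasType.exists G).choose_spec

lemma HasType.cType_eq (H : HasType G T) : cType G = T := (hasType_cType G).unique H

lemma Unf.cType_eq {D : Diagram h n m} (H : Unf D G) : cType G = D.type := (HasType.base H).cType_eq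

lemma Collapse.cType_eq {F : Set G.H} (c : G.Collapse G' F)
    (hF : InvClosed F) (hd : Disjoint F G.admissibleEdges) :
    cType G = cType G' := by
  induction hk : Nat.card G.H using strong_induction_on generalizing G with
  | _ k ih =>
    by_cases hF0 : F = ∅
    · exact ((hasType_cType G).transport hF0 c).cType_eq.symm
    obtain ⟨e, he⟩ := Set.nonempty_iff_ne_empty.2 hF0
    have hc := c.contr_of_mem hF hd he
    obtain ⟨G1, ⟨c1⟩⟩ := hc.ex_col
    have hsub : (G.pair e) ⊆ F := by
      rintro a (rfl | rfl); exacts [he, hF _ he]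
    rw [(HasType.step hc c1 (hasType_cType G1)).cType_eq]
    refine ih _ (hk ▸ c1.card_lt) (c1.factor (ic_pair e) c hsub) (c1.ic_push (ic_pair e) hF) ?_ rfl
    rw [disjoint_left] at hd ⊢; intro a ha ha'; obtain ⟨a, rfl⟩ := c1.ex_onH a
    exact hd ((c1.mem_push_iff a).1 ha) ((c1.mem_adm (ic_pair e) a).1 ha')

lemma isRadialFace_cType {i : Fin n} {j : ℕ} (hj : j < G.cCard i)
    (c : G.Collapse G' (G.pair (G.circleEdge i j))) :
    CombType.IsRadialFace i j (cType G) (cType G') := by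
  induction hk : Nat.card G.H using strong_induction_on generalizing G G' with
  | _ k ih =>
  have ha := G.edge_mem_adm hj
  by_cases hG : NoInt G
  · obtain ⟨D, att, A⟩ := hG.ex_unfolded; have hc := A.card i; have hc' := card_col_self hj c
    have hp := G'.circleCard_pos i
    have hd : 1 ≤ D.deg i := by omega
    rw [Unf.cType_eq ⟨att, A⟩, (A.collapse hd (by omega : j ≤ D.deg i) c).cType_eq]
    exact Diagram.isRadialFace_type _ _
  · rw [noInt_iff] at hG; push Not at hG; obtain ⟨e, he⟩ := hG; have hn := he.notMem_adm
    have hea : e ∉ G.pair (G.circleEdge i j) := by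
      rintro (rfl | rfl); exacts [hn ha, hn (G.ic_adm _ ha)]
    have hC1 := G.onCircle_of_adm ha
    have hC2 := G.onCircle_of_adm (G.ic_adm _ ha)
    have hR : Equivalence (Tied G) := ⟨fun _ => .inl rfl, Tied.symm, Tied.trans⟩
    have key : ∀ {p q}, c.onV p = c.onV q → Tied G p q := fun hpq => Reach.induct hR id (by
        rintro b (rfl | rfl)
        exacts [.inr ⟨hC1, hC2⟩, .inr ⟨hC2, by rwa [id, G.inv_inv]⟩]) ((c.onV_eq_iff _ _).1 hpq)
    have hce : Contr G' (c.onH ⟨e, hea⟩) := by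
      refine ⟨fun h' => he.1 ((c.mem_leaves_iff (ic_pair _) _).1 h'), fun h' => he.2 ?_⟩
      rw [c.inv_eq (ic_pair _), c.src_onH, c.src_onH] at h'; rcases h' with h' | ⟨h1, h2⟩
      · exact key h'
      · obtain ⟨p, hp, hp'⟩ := c.ex_onCircle h1; obtain ⟨q, hq, hq'⟩ := c.ex_onCircle h2
        exact (key hp').symm.trans (Tied.trans (.inr ⟨hp, hq⟩) (key hq'))
    obtain ⟨Ge, ⟨ce⟩⟩ := he.ex_col
    obtain ⟨G2, ⟨d⟩⟩ := hce.ex_col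
    obtain ⟨d2⟩ := c.commute hea ce d
    have hdj : Disjoint (G.pair e) (G.circle i) := (disj_pair hn).mono_right (G.circle_subset i)
    rw [← ce.edge_eq (ic_pair e) hdj hj] at d2
    rw [ce.cType_eq (ic_pair e) (disj_pair hn), d.cType_eq (ic_pair _) (disj_pair hce.notMem_adm)]
    exact ih _ (hk ▸ ce.card_lt) (by rwa [ce.card_eq_of_disj (ic_pair e) hdj]) d2 rfl

end FatGraphs

/-! # From fat graphs to radial slit configurations -/

namespace RadialSlit

variable {h n m : ℕ}

lemma coord_of_lt (t) (ha : a < k) : coord t a = t.1 ⟨a, ha⟩ := dif_pos ha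

lemma coord_injective (H : coord t = coord t') : t = t' := by
  ext a; have := congrFun H a
  rwa [coord_of_lt _ a.2, coord_of_lt _ a.2] at this

lemma sum_coord (t : stdSimplex ℝ (Fin k)) : ∑ a ∈ range k, coord t a = 1 := by
  rw [← t.2.2, sum_range]; exact sum_congr rfl fun a _ => coord_of_lt _ a.2

lemma coord_coord {q : Fin n → ℕ} (t : ∀ i, stdSimplex ℝ (Fin (q i + 1))) :
    Coord q fun i => coord (t i) where
  nonneg i k := by
    unfold coord; split_ifs with h'; exacts [(t i).2.1 _, le_rfl]
  eq_zero i k hk := dif_neg (by omega)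
  sum_eq i := sum_coord _

/-- The point of a product of simplices with given coordinates. -/
def Coord.toSimplex {q : Fin n → ℕ} {τ : Fin n → ℕ → ℝ} (H : Coord q τ) (i : Fin n) :
    stdSimplex ℝ (Fin (q i + 1)) :=
  ⟨fun k => τ i k, fun _ => H.nonneg _ _, by rw [← H.sum_eq i, sum_range]⟩

lemma Coord.coord_toSimplex (H : Coord q τ) (i) : coord (H.toSimplex i) = τ i := by
  funext k; by_cases hk : k < q i + 1
  · exact coord_of_lt _ hk
  · exact (dif_neg hk).trans (H.eq_zero i k (by omega)).symm

/-- The coordinates of the innermost vertex of a simplex. -/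
def vCoord : ℕ → ℝ := Pi.single 0 1

lemma coord_vertex (p) : Coord (fun _ : Fin 1 => p) fun _ => vCoord where
  nonneg _ k := by unfold vCoord; by_cases hk : k = 0 <;> simp [hk]
  eq_zero _ k hk := Pi.single_eq_of_ne (by omega) _
  sum_eq _ := by simp [vCoord, Pi.single_apply]

namespace Rad

/-- The point of the harmonic compactification with given type and coordinates. -/
def point (T : CombType h n m) {τ : Fin n → ℕ → ℝ} {σ : ℕ → ℝ} (hτ : Coord T.radialDegree τ)
    (hσ : Coord (fun _ : Fin 1 => T.annularDegree) fun _ => σ) : Rad h n m :=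
  mk T ⟨hτ.toSimplex, hσ.toSimplex 0⟩

lemma mk_eq_point {T : CombType h n m} {t : T.Cell} {σ : ℕ → ℝ}
    (hτ : Coord T.radialDegree τ) (hσ : Coord (fun _ : Fin 1 => T.annularDegree) fun _ => σ)
    (h1 : ∀ i, coord (t.1 i) = τ i) (h2 : coord t.2 = σ) : mk T t = point T hτ hσ := by
  unfold point; congr 1; refine Prod.ext (funext fun i => coord_injective ?_) (coord_injective ?_)
  · rw [h1, hτ.coord_toSimplex]
  · rw [h2, hσ.coord_toSimplex]

lemma point_congr {T T' : CombType h n m} {σ σ' : ℕ → ℝ}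
    (hτ : Coord T.radialDegree τ) (hσ : Coord (fun _ : Fin 1 => T.annularDegree) fun _ => σ)
    (hτ' : Coord T'.radialDegree τ')
    (hσ' : Coord (fun _ : Fin 1 => T'.annularDegree) fun _ => σ')
    (h1 : T = T') (h2 : τ = τ') (h3 : σ = σ') : point T hτ hσ = point T' hτ' hσ' := by
  subst h1 h2 h3; rfl

lemma point_radialFace {T T' : CombType h n m} {σ σ' : ℕ → ℝ}
    (hτ : Coord T.radialDegree τ) (hσ : Coord (fun _ : Fin 1 => T.annularDegree) fun _ => σ)
    (hτ' : Coord T'.radialDegree τ')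
    (hσ' : Coord (fun _ : Fin 1 => T'.annularDegree) fun _ => σ')
    (H : CombType.IsRadialFace i j T T') (h1 : τ i = coface j (τ' i))
    (h2 : ∀ k, k ≠ i → τ k = τ' k) (h3 : σ = σ') : point T hτ hσ = point T' hτ' hσ' := by
  refine Quot.sound (.inl ⟨i, j, H, ?_, fun k hk => ?_, ?_⟩)
  · grind [Coord.coord_toSimplex]
  · grind [Coord.coord_toSimplex]
  · exact (hσ.coord_toSimplex 0).trans (h3.trans (hσ'.coord_toSimplex 0).symm)

lemma point_annularFace {T T' : CombType h n m} {σ σ' : ℕ → ℝ}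
    (hτ : Coord T.radialDegree τ) (hσ : Coord (fun _ : Fin 1 => T.annularDegree) fun _ => σ)
    (hτ' : Coord T'.radialDegree τ')
    (hσ' : Coord (fun _ : Fin 1 => T'.annularDegree) fun _ => σ')
    (H : CombType.IsAnnularFace j T T') (h0 : τ = τ')
    (h1 : σ = coface j σ') :
    point T hτ hσ = point T' hτ' hσ' := by
  refine Quot.sound (.inr ⟨j, H, fun k => ?_, ?_⟩)
  · grind [Coord.coord_toSimplex]
  grind [Coord.coord_toSimplex]

lemma continuous_point [TopologicalSpace X] (T : CombType h n m)
    {τ : X → Fin n → ℕ → ℝ} {σ : X → ℕ → ℝ} (hτ : ∀ x, Coord T.radialDegree (τ x))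
    (hσ : ∀ x, Coord (fun _ : Fin 1 => T.annularDegree) fun _ => σ x)
    (h1 : ∀ i k, Continuous fun x => τ x i k) (h2 : ∀ k, Continuous fun x => σ x k) :
    Continuous fun x => point T (hτ x) (hσ x) :=
  (continuous_quot_mk.comp continuous_sigmaMk).comp
    (Continuous.prodMk (continuous_pi fun i => Continuous.subtype_mk
      (continuous_pi fun k : Fin (T.radialDegree i + 1) => h1 i k) _) (Continuous.subtype_mk
      (continuous_pi fun k : Fin (T.annularDegree + 1) => h2 k) _))

end Rad

lemma Diagram.uni_type (D : Diagram h n m) : D.type.Unilevel := ⟨_, D.uni_std, rfl⟩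

lemma Diagram.deg_type (D : Diagram h n m) (i : Fin n) : D.type.radialDegree i = D.deg i :=
  congrFun (congrArg Diagram.deg D.dg_std) i

lemma CombType.Unilevel.annularDegree_eq {T : CombType h n m} (H : T.Unilevel) :
    T.annularDegree = 0 := by
  obtain ⟨L, hL, rfl⟩ := H
  exact hL.annularDegree_eq

lemma CombType.Unilevel.ex_dg (H : T.Unilevel) : ∃ D : Diagram h n m, D.type = T := by
  obtain ⟨L, hL, rfl⟩ := H
  exact ⟨_, hL.mk_eq_type.symm⟩

lemma coord_of_eq_one (t : stdSimplex ℝ (Fin k)) (hk : k = 1) : coord t = vCoord := by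
  subst hk; funext a; rcases a with _ | a
  · have := sum_coord t; rw [Finset.sum_range_one] at this; rw [this]; rfl
  · exact dif_neg (by omega)

end RadialSlit

namespace FatGraphs

open PermHit RadialSlit

variable {h n m : ℕ} {G G' : AdmissibleFatGraph h n m}

/-- The values of a function on the edges of the admissible cycles. -/
def cCoord (G : AdmissibleFatGraph h n m) (f : G.H → ℝ) (i : Fin n) (k : ℕ) : ℝ :=
  if k < G.cCard i then f (G.circleEdge i k) else 0

lemma uni_cType (G : AdmissibleFatGraph h n m) : (cType G).Unilevel := by
  have := hasType_cType G
  revert this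
  generalize cType G = T
  intro H
  induction H with
  | base H => exact Diagram.uni_type _
  | step _ _ _ ih => exact ih

lemma disj_pair_circle' (he : e ∉ G.admissibleEdges) (i) : Disjoint (G.pair e) (G.circle i) :=
  (disj_pair he).mono_right (G.circle_subset i)

lemma deg_cType (G : AdmissibleFatGraph h n m) (i : Fin n) :
    (cType G).radialDegree i + 1 = G.cCard i := by
  have := hasType_cType G
  revert this
  generalize cType G = T
  intro H
  induction H with
  | base H => rw [Diagram.deg_type, H.choose_spec.card]
  | step he c _ ih => rw [ih, c.card_eq_of_disj (ic_pair _) (disj_pair_circle' he.notMem_adm i)]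

lemma coord_cCoord_iff {f : G.H → ℝ} :
    Coord (cType G).radialDegree (cCoord G f) ↔ (∀ i k, 0 ≤ cCoord G f i k) ∧
      ∀ i, ∑ k ∈ range (G.cCard i), cCoord G f i k = 1 := by
  simp only [← deg_cType]
  exact ⟨fun H => ⟨H.1, H.3⟩, fun H => ⟨H.1, fun i k hk => if_neg (by
    rw [← deg_cType]; omega), H.2⟩⟩

lemma sum_cCoord (f : G.H → ℝ) (i) :
    ∑ k ∈ range (G.cCard i), cCoord G f i k = ∑ᶠ a ∈ G.circle i, f a := by
  rw [finsum_circle]; exact sum_congr rfl fun k hk => if_pos (mem_range.1 hk)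

lemma coord_len (len : LengthFunction G) : Coord (cType G).radialDegree (cCoord G len.1) :=
  coord_cCoord_iff.2 ⟨fun i k => by
    unfold cCoord; split_ifs
    exacts [(len.2.mem_Icc _).1, le_rfl], fun i => by rw [sum_cCoord, len.2.sum_circle]⟩

lemma ex_len {τ : Fin n → ℕ → ℝ} (hτ : Coord (cType G).radialDegree τ) :
    ∃ len : LengthFunction G, cCoord G len.1 = τ ∧ ∀ a, a ∉ G.admissibleEdges → len.1 a = 1 := by
  obtain ⟨len, h1, h2⟩ := ex_lengthFunction G τ hτ.nonneg fun i => by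
    rw [← deg_cType]; exact hτ.sum_eq i
  refine ⟨len, funext fun i => funext fun k => ?_, h2⟩; unfold cCoord; split_ifs with hk
  · exact h1 i k hk
  · exact (hτ.eq_zero i k (by rw [← deg_cType] at hk; omega)).symm

/-- The point of the harmonic compactification given by a fat graph and the lengths of the edges on
the admissible cycles. -/
def radPoint (G : AdmissibleFatGraph h n m) {τ : Fin n → ℕ → ℝ}
    (H : Coord (cType G).radialDegree τ) : Rad h n m :=
  Rad.point (cType G) H (coord_vertex _)

lemma cCoord_col_of_disj (c : G.Collapse G' F) (hF : InvClosed F) (hd : Disjoint F (G.circle i))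
    (H : ∀ a, a.1 ∈ G.admissibleEdges → f' (c.onH a) = f a.1) :
    cCoord G' f' i = cCoord G f i := by
  funext k; unfold cCoord; rw [c.card_eq_of_disj hF hd]; split_ifs with hk
  · rw [c.edge_eq hF hd hk, H _ (G.edge_mem_adm hk)]
  · rfl

lemma cCoord_col_self (hj : j < G.cCard i) (c : G.Collapse G' (G.pair (G.circleEdge i j)))
    (H : ∀ a, a.1 ∈ G.admissibleEdges → f' (c.onH a) = f a.1) (h0 : f (G.circleEdge i j) = 0) :
    cCoord G f i = coface j (cCoord G' f' i) := by
  have hc := card_col_self hj c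
  have key : ∀ k, k + 1 < G.cCard i →
      cCoord G' f' i k = f (G.circleEdge i (shift j k)) := fun k hk => by
    rw [cCoord, if_pos (by omega), edge_col_self hj c hk]
    exact H _ (G.edge_mem_adm (by unfold shift; split_ifs <;> omega))
  funext k; unfold coface; by_cases hk : k < G.cCard i
  · grind [cCoord, shift]
  grind [cCoord]

lemma radPoint_col {F : Set G.H} (c : G.Collapse G' F)
    (hF : InvClosed F) {f : G.H → ℝ} {f' : G'.H → ℝ}
    (H : ∀ a, a.1 ∈ G.admissibleEdges → f' (c.onH a) = f a.1)
    (h0 : ∀ a ∈ F, a ∈ G.admissibleEdges → f a = 0)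
    (hf : Coord (cType G).radialDegree (cCoord G f)) :
    ∃ hf' : Coord (cType G').radialDegree (cCoord G' f'), radPoint G hf = radPoint G' hf' := by
  induction hk : Nat.card G.H using strong_induction_on generalizing G with
  | _ k ih =>
  by_cases hd : Disjoint F G.admissibleEdges
  · have e1 := c.cType_eq hF hd
    have e2 : cCoord G' f' = cCoord G f := funext fun i =>
      cCoord_col_of_disj c hF (hd.mono_right (G.circle_subset i)) H
    have hf' : Coord (cType G').radialDegree (cCoord G' f') := by rw [← e1, e2]; exact hf
    exact ⟨hf', Rad.point_congr _ _ _ _ e1 e2.symm rfl⟩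
  obtain ⟨i, a, haF, hai⟩ : ∃ i, ∃ a ∈ F, a ∈ G.circle i := by
    obtain ⟨a, ha, i, h' | h'⟩ := Set.not_disjoint_iff.1 hd
    exacts [⟨i, a, ha, h'⟩, ⟨i, _, hF _ ha, h'⟩]
  have hcard : G.cCard i ≠ 1 := by
    intro h1; have h2 := c.card_eq hF i
    have h3 := G'.circleCard_pos i
    obtain ⟨b, hb⟩ := Set.ncard_eq_one.1 h1
    obtain ⟨b', hb1, hb2⟩ := (Set.ncard_pos (toFinite _)).1 (h2 ▸ h3)
    grind
  obtain ⟨G1, ⟨c1⟩⟩ := ex_ctr_circle hai hcard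
  obtain ⟨j, hj, rfl⟩ := G.ex_edge hai
  have hP := ic_pair (G := G.toFatGraph) (G.circleEdge i j)
  have hadm := G.edge_mem_adm hj
  have hsub : (G.pair (G.circleEdge i j)) ⊆ F := by
    rintro a (rfl | rfl); exacts [haF, hF _ haF]
  let f1 : G1.H → ℝ := fun y => f (c1.onH.symm y).1
  have hf1 : ∀ a, f1 (c1.onH a) = f a.1 := fun a => by simp [f1]
  have e1 : cCoord G f i = coface j (cCoord G1 f1 i) :=
    cCoord_col_self hj c1 (fun a _ => hf1 a) (h0 _ haF hadm)
  have e2 : ∀ k, k ≠ i → cCoord G f k = cCoord G1 f1 k := fun k hk =>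
    (cCoord_col_of_disj c1 hP (disj_pair_circle hj hk) fun a _ => hf1 a).symm
  have hc1 := card_col_self hj c1
  have hI : Coord (cType G1).radialDegree (cCoord G1 f1) := by
    rw [coord_cCoord_iff] at hf ⊢; refine ⟨fun k l => ?_, fun k => ?_⟩
    · by_cases hk : k = i
      · subst hk; have := hf.1 k (shift j l); rw [e1, coface, shift] at this; grind
      · rw [← e2 k hk]; exact hf.1 k l
    · by_cases hk : k = i
      · grind [sum_coface]
      · rw [← e2 k hk, card_col_of_ne hj c1 hk]; exact hf.2 k
  refine (ih _ (hk ▸ c1.card_lt) (c1.factor hP c hsub) (c1.ic_push hP hF) ?_ ?_ hI rfl).imp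
    fun _ => (Rad.point_radialFace _ _ hI _ (isRadialFace_cType hj c1) e1 e2 rfl).trans
  · intro y hy; exact H ⟨(c1.onH.symm y.1).1, _⟩ ((c1.mem_adm hP _).1 (by simpa using hy))
  · intro y hy hy'; exact h0 _ hy ((c1.mem_adm hP _).1 (by simpa using hy'))

/-- The map from metric fat graphs to the harmonic compactification. -/
def MFat.toRad : MFat h n m → Rad h n m := Quot.lift (fun x => radPoint x.1 (coord_len x.2)) (by
    rintro ⟨G1, len1⟩ ⟨G2, len2⟩ ⟨G', c, d, hcd⟩
    let f : G'.H → ℝ := fun y => len1.1 (c.onH.symm y).1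
    have hc : ∀ a, f (c.onH a) = len1.1 a.1 := fun a => by simp [f]
    have hd : ∀ a, f (d.onH a) = len2.1 a.1 := fun a => by grind
    obtain ⟨_, h1⟩ := radPoint_col c (fun a ha => (len1.2.len_inv a).trans ha)
      (fun a _ => hc a) (fun a ha _ => ha) (coord_len len1)
    obtain ⟨_, h2⟩ := radPoint_col d (fun a ha => (len2.2.len_inv a).trans ha)
      (fun a _ => hd a) (fun a ha _ => ha) (coord_len len2)
    exact h1.trans h2.symm)

/-- The map from Sullivan diagrams to the harmonic compactification. -/
def SD.toRad : SD h n m → Rad h n m := Quot.lift MFat.toRad (by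
    rintro _ _ ⟨G, G', len, len', F, c, rfl, rfl, hF, hd, -, H⟩
    exact (radPoint_col c hF.1 H (fun a ha ha' => (disjoint_left.1 hd ha ha').elim)
      (coord_len len)).choose_spec)

lemma SD.continuous_toRad : Continuous (SD.toRad (h := h) (n := n) (m := m)) := by
  refine continuous_quot_lift _ (continuous_quot_lift _ (continuous_sigma fun G => ?_))
  refine Rad.continuous_point _ (fun len => coord_len len) (fun _ => coord_vertex _)
    (fun i k => ?_) fun _ => continuous_const
  unfold cCoord; split_ifs
  exacts [(continuous_apply _).comp continuous_subtype_val, continuous_const]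

end FatGraphs

/-! # From radial slit configurations to Sullivan diagrams -/

namespace FatGraphs

open PermHit RadialSlit

variable {h n m : ℕ} {G G' : AdmissibleFatGraph h n m}

lemma SD.mk_eq_of_col (c : G.Collapse G' F) (hF : InvClosed F) (hd : Disjoint F G.admissibleEdges)
    (H : cCoord G len.1 = cCoord G' len'.1) : SD.mk G len = SD.mk G' len' := by
  refine Quot.sound ⟨G, G', len, len', F, c, rfl, rfl, c.isForest hF, hd,
    disjoint_left.2 fun _ ha => c.notMem_leaves hF ha, ?_⟩
  have key : ∀ i k, (hk : k < G.cCard i) → ∀ hn, len'.1 (c.onH ⟨G.circleEdge i k, hn⟩) =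
      len.1 (G.circleEdge i k) := fun i k hk hn => by
    have h1 := congrFun (congrFun H i) k
    have h2 := hd.mono_right (G.circle_subset i)
    rw [cCoord, cCoord, if_pos hk, if_pos (by rwa [c.card_eq_of_disj hF h2]),
      c.edge_eq hF h2 hk] at h1
    exact h1.symm
  grind [ClosedFatGraph.mem_adm, Collapse.inv_eq', IsLengthFunction.len_inv]

lemma SD.mk_eq_of_subset (c : G.Collapse G' F) (hF : InvClosed F) (h0 : ∀ a ∈ F, len.1 a = 0)
    (H : ∀ a, len'.1 (c.onH a) = len.1 a.1) : SD.mk G len = SD.mk G' len' := by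
  obtain ⟨G2, ⟨d⟩⟩ := len'.2.collapse_admissible
  have h1 : c.pull {a | len'.1 a = 0} = {a | len.1 a = 0} := by
    ext a; by_cases ha : a ∈ F
    · exact ⟨fun _ => h0 a ha, fun _ => c.subset_pull _ ha⟩
    · rw [c.mem_pull_iff ⟨a, ha⟩, mem_ofPred_eq, mem_ofPred_eq, H]
  have key : ∀ (E : Set G.H) (hE : c.pull {a | len'.1 a = 0} = E),
      ∃ d' : G.Collapse G2 E, ∀ a b, d'.onH a = d.onH b → len.1 a.1 = len'.1 b.1 := by
    rintro _ rfl; refine ⟨c.comp hF d, fun a b hab => ?_⟩; rw [← d.onH.injective hab, H]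
  obtain ⟨d', hd'⟩ := key _ h1
  exact congrArg (Quot.mk _) (Quot.sound ⟨G2, d', d, hd'⟩)

lemma Unf.mk_eq (H : Unf D G) (H' : Unf D G')
    (hc : cCoord G len.1 = cCoord G' len'.1) : SD.mk G len = SD.mk G' len' := by
  obtain ⟨_, A⟩ := H
  obtain ⟨_, A'⟩ := H'
  obtain ⟨c⟩ := A.nonempty_iso A'
  exact SD.mk_eq_of_col c (fun _ h' => h') (Set.empty_disjoint _) hc

lemma Unf.relabel (H : Unf D G) (τ) : Unf (D.relabel τ) G := by
  obtain ⟨att, A⟩ := H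
  exact ⟨fun x => att (exPerm τ x),
    { card := A.card, inj := A.inj.comp (exPerm τ).injective, notMem := fun x => A.notMem _
      cover := fun a => (A.cover a).imp_right (Or.imp_right fun ⟨x, hx⟩ =>
        ⟨(exPerm τ).symm x, (congrArg att (apply_symm_apply _ _)).trans hx⟩)
      inv_slit := fun i => (A.inv_slit (τ i)).trans (by
        show _ = att (inl (τ (τ⁻¹ (D.pairing (τ i)))))
        congr 2; exact (apply_symm_apply _ _).symm)
      inv_param := fun p => A.inv_param p
      src_eq := fun x => A.src_eq _
      rot_of_isZero := fun x hx => by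
        have h1 : exPerm τ ((D.relabel τ).succ x) = D.succ (exPerm τ x) := apply_symm_apply _ _
        rw [h1]; exact A.rot_of_isZero _ ⟨hx.1, (congrArg D.pos h1).symm.trans hx.2⟩
      rot_of_not_isZero := fun x hx => A.rot_of_not_isZero _ fun h' => hx ⟨h'.1, by
        have h1 : exPerm τ ((D.relabel τ).succ x) = D.succ (exPerm τ x) := apply_symm_apply _ _
        exact (congrArg D.pos h1).trans h'.2⟩ }⟩

lemma ex_len_of_card (H : ∀ i, G.cCard i = G'.cCard i)
    (len : LengthFunction G) : ∃ len' : LengthFunction G', cCoord G' len'.1 = cCoord G len.1 := by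
  suffices h2 : Coord _ _ from (ex_len h2).imp fun _ h3 => h3.1
  have h1 : (cType G').radialDegree = (cType G).radialDegree := funext fun i => by
    have := H i
    rw [← deg_cType, ← deg_cType] at this; omega
  rw [h1]; exact coord_len len

lemma Unf.mk_eq_jump (J : D.CanJump x j) (H : Unf D G) (H' : Unf (Diagram.jump J) G')
    (hc : cCoord G len.1 = cCoord G' len'.1) : SD.mk G len = SD.mk G' len' := by
  obtain ⟨att, A⟩ := H
  have hrot : G.rot (att x) = att (inl j) := by rw [A.rot_of_isZero _ J.isZero, J.succ_eq]
  have hroot : ∀ y i, att y ≠ G.inv (G.leaf (inl i)) := fun y i => A.att_ne_inv_leaf y i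
  have hval : 4 ≤ G.valence (G.src (att x)) := by
    obtain ⟨i, a, ha, hav⟩ := A.onCircle x
    obtain ⟨k, hk, rfl⟩ := G.ex_edge ha
    rw [G.src_edge' i hk] at hav; have hk' := mod_lt (k + 1) (G.circleCard_pos i)
    set b := G.inv (G.circleEdge i ((k + 1) % G.cCard i)) with hb
    have h1 : b ∈ G.admissibleEdges := G.ic_adm _ (G.edge_mem_adm hk')
    have h2 := G.edge_mem_adm hk
    have h3 : ({G.circleEdge i k, b, att x, att (inl j)} : Set G.H) ⊆
        {a | G.src a = G.src (att x)} := by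
      rintro a (rfl | rfl | rfl | rfl)
      · exact (G.src_edge' i hk).trans hav
      · exact hav
      · rfl
      · rw [mem_ofPred_eq, ← hrot, G.src_rot]
    have h4 : ∀ {a y}, a ∈ G.admissibleEdges → a ≠ att y := fun ha h' => A.notMem _ (h' ▸ ha)
    rw [G.valence_eq_ncard]; refine le_trans ?_ (Set.ncard_le_ncard h3 (toFinite _))
    rw [Set.ncard_insert_of_notMem, Set.ncard_insert_of_notMem, ncard_pair]
    · exact fun h' => J.ne (A.inj h')
    · grind
    grind [inv_edge_ne]
  obtain ⟨G0, g, x', y', c, hx, hy, hg, hsg, -, T, hcx, hcy⟩ := ex_expand G (att x) hval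
    (A.notMem x) (hrot ▸ A.notMem _) (hroot x) (fun i => hrot ▸ hroot _ i)
  have hP := ic_pair (G := G0.toFatGraph) g
  rw [hrot] at hcy
  have hadm : ∀ {a} (ha : a ∉ G0.pair g) {z}, c.onH ⟨a, ha⟩ = att z →
      a ∉ G0.admissibleEdges := fun ha z hz h' =>
    A.notMem z (hz ▸ (c.mem_adm hP _).2 h')
  have hsj : G0.src (G0.inv y') ≠ G0.src g := by
    intro h'; rcases T.eq_or h' with h' | h' | h'
    · exact hP.notMem hy (.inl h')
    · have h1 := c.inv_eq' hy (hP.notMem hy); rw [hcy, A.inv_slit] at h1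
      have h2 : c.onH ⟨G0.inv y', hP.notMem hy⟩ = c.onH ⟨x', hx⟩ := by congr 2
      exact J.ne_pairing (A.inj (h1.trans (h2.trans hcx))).symm
    · exact G0.inv_ne _ h'
  have hyc : Contr G0 y' := by
    refine ⟨fun h' => ?_, fun h' => h'.elim (fun h' => hsj (h'.symm.trans T.src_j)) fun h' => ?_⟩
    · exact A.slit_notMem_leaves j (hcy ▸ (c.mem_leaves_iff hP _).2 h')
    · obtain ⟨i, a, ha, hav⟩ := h'.1
      grind [IsTripod.eq_or, IsTripod.src_j, ClosedFatGraph.circle_subset]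
  obtain ⟨G3, ⟨d⟩⟩ := hyc.ex_col
  obtain ⟨J', H3⟩ := A.jump T c d hg hsg hsj hx hy hcx.symm hcy.symm
  have hcard : ∀ i, G.cCard i = G0.cCard i := fun i => c.card_eq_of_disj hP (disj_pair_circle' hg i)
  have hn := hyc.notMem_adm
  have hcard' : ∀ i, G0.cCard i = G3.cCard i := fun i =>
    (d.card_eq_of_disj (ic_pair _) (disj_pair_circle' hn i)).symm
  obtain ⟨len0, h0⟩ := ex_len_of_card hcard len
  obtain ⟨len3, h3⟩ := ex_len_of_card hcard' len0
  rw [← SD.mk_eq_of_col c hP (disj_pair hg) h0,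
    SD.mk_eq_of_col d (ic_pair _) (disj_pair hn) h3.symm]
  exact H3.mk_eq H' (h3.trans (h0.trans hc))

lemma unf_graph (D : Diagram h n m) : Unf D (Code.graph D) := ⟨_, Code.attachment D⟩

lemma card_graph (L : PreConfig h n m) (i : Fin n) :
    (Code.graph L.diagram).cCard i = L.radialDegree i + 1 := (Code.attachment L.diagram).card i

lemma coord_graph (t : (mk L).Cell) :
    Coord (cType (Code.graph L.diagram)).radialDegree fun i => coord (t.1 i) := by
  have h1 : (cType (Code.graph L.diagram)).radialDegree = (mk L).radialDegree :=
    funext fun i => Nat.succ_injective ((deg_cType _ i).trans (card_graph L i))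
  rw [h1]; exact coord_coord t.1

lemma sd_mk_eq {L L' : PreConfig h n m} (H : mk L = mk L') :
    ∀ {G G' : AdmissibleFatGraph h n m} {len : LengthFunction G} {len' : LengthFunction G'},
      Unf L.diagram G → Unf L'.diagram G' →
      cCoord G len.1 = cCoord G' len'.1 → SD.mk G len = SD.mk G' len' := by
  induction Quot.eqvGen_exact H with
  | rel L L' H' =>
    intro G G' len len' h1 h2 h3; rcases H' with H' | H' | H'
    · grind [PreConfig.Relabel.dg_eq, Unf.mk_eq, Unf.relabel]
    · obtain ⟨x, j, J, e⟩ := H'.dg_eq; exact h1.mk_eq_jump J (e ▸ h2) h3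
    · exact h1.mk_eq (H'.dg_eq ▸ h2) h3
  | refl L => exact fun h1 h2 h3 => h1.mk_eq h2 h3
  | symm L L' _ ih => grind
  | trans L L1 L' H1 H2 ih1 ih2 =>
    intro G G' len len' h1 h2 h3; have e1 : mk L = mk L1 := Quot.eqvGen_sound H1
    obtain ⟨len1, hl⟩ := ex_len_of_card (G' := Code.graph L1.diagram) (fun i => by
      obtain ⟨_, A⟩ := h1
      rw [card_graph]; exact (A.card i).trans (congrArg (fun T => T.radialDegree i + 1) e1)) len
    grind [unf_graph]

lemma ex_cellToSD (T : CombType h n m) (t : T.Cell) : ∃ s : SD h n m,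
    ∀ (L : PreConfig h n m) (G : AdmissibleFatGraph h n m) (len : LengthFunction G),
      mk L = T → Unf L.diagram G →
      (cCoord G len.1 = fun i => coord (t.1 i)) → SD.mk G len = s := by
  obtain ⟨L, rfl⟩ := Quot.exists_rep T
  obtain ⟨len, hl, -⟩ := ex_len (coord_graph t)
  exact ⟨SD.mk _ len, fun L' G len' h1 h2 h3 => sd_mk_eq h1 h2 (unf_graph _) (h3.trans hl.symm)⟩

/-- The Sullivan diagram of a point of a cell. -/
def cellToSD (T : CombType h n m) (t : T.Cell) : SD h n m := (ex_cellToSD T t).choose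

lemma mk_eq_cellToSD {L : PreConfig h n m} {t : (mk L).Cell} {len : LengthFunction G}
    (H : Unf L.diagram G) (hl : cCoord G len.1 = fun i => coord (t.1 i)) :
    SD.mk G len = cellToSD _ t := (ex_cellToSD _ t).choose_spec L G len rfl H hl

lemma cCoord_apply (H : cCoord G f = τ) (hk : k < G.cCard i) : f (G.circleEdge i k) = τ i k := by
  rw [← H, cCoord, if_pos hk]

lemma SD.continuous_mk (G : AdmissibleFatGraph h n m) : Continuous (SD.mk G) :=
  Continuous.comp (g := (Quot.mk _ : MFat h n m → SD h n m)) continuous_quot_mk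
    (Continuous.comp (g := (Quot.mk _ : _ → MFat h n m)) continuous_quot_mk continuous_sigmaMk)

lemma continuous_cellToSD (T : CombType h n m) : Continuous (cellToSD T) := by
  obtain ⟨L, rfl⟩ := Quot.exists_rep T
  choose len h1 h2 using fun t : (mk L).Cell => ex_len (coord_graph t)
  have h3 : cellToSD (mk L) = fun t => SD.mk _ (len t) :=
    funext fun t => (mk_eq_cellToSD (unf_graph _) (h1 t)).symm
  refine h3 ▸ (SD.continuous_mk _).comp ?_
  refine Continuous.subtype_mk (f := fun t => (len t).1) (continuous_pi fun a => ?_) fun t => (len t).2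
  by_cases ha : a ∈ (Code.graph L.diagram).admissibleEdges
  · obtain ⟨i, k, hk, hak⟩ := (Code.graph L.diagram).mem_adm.1 ha
    have h4 : ∀ t, (len t).1 a = (t.1 i).1 ⟨k, card_graph L i ▸ hk⟩ := fun t => by
      have h5 : (len t).1 a = (len t).1 ((Code.graph L.diagram).circleEdge i k) := by
        rcases hak with rfl | rfl; exacts [rfl, (len t).2.len_inv _]
      exact h5.trans ((cCoord_apply (h1 t) hk).trans (coord_of_lt _ _))
    simp only [h4]
    exact (continuous_apply _).comp (continuous_subtype_val.comp
      ((continuous_apply i).comp continuous_fst))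
  · simp only [h2 _ a ha]; exact continuous_const

lemma mk_eq_of_coface (hj : j < G.cCard i) (c : G.Collapse G' (G.pair (G.circleEdge i j)))
    (h1 : ∀ a, a ∉ G.admissibleEdges → len.1 a = 1)
    (h1' : ∀ a, a ∉ G'.admissibleEdges → len'.1 a = 1)
    (h2 : cCoord G len.1 i = coface j (cCoord G' len'.1 i))
    (h3 : ∀ k, k ≠ i → cCoord G len.1 k = cCoord G' len'.1 k) :
    SD.mk G len = SD.mk G' len' := by
  have hP := ic_pair (G := G.toFatGraph) (G.circleEdge i j)
  have h0 : len.1 (G.circleEdge i j) = 0 := by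
    rw [cCoord_apply (f := len.1) rfl hj, h2, coface, if_neg (lt_irrefl _), if_pos rfl]
  have key : ∀ i' k, k < G.cCard i' → ∀ hn, len'.1 (c.onH ⟨G.circleEdge i' k, hn⟩) =
      len.1 (G.circleEdge i' k) := fun i' k hk hn => by
    have hs := card_col_self hj c
    rw [cCoord_apply (f := len.1) rfl hk]
    by_cases hi : i' = i
    · subst hi
      obtain ⟨l, rfl⟩ : ∃ l, k = shift j l := by
        rcases lt_trichotomy k j with h' | rfl | h'
        exacts [⟨k, (if_pos h').symm⟩, (hn (.inl rfl)).elim,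
          ⟨k - 1, by rw [shift, if_neg (by omega)]; omega⟩]
      have hl : l + 1 < G.cCard i' := by unfold shift at hk; split_ifs at hk <;> omega
      rw [← edge_col_self hj c hl, cCoord_apply (f := len'.1) rfl (by omega), h2]
      unfold coface shift; split_ifs <;> first | rfl | omega
    · rw [← edge_col_of_ne hj c hi hk, h3 _ hi,
        cCoord_apply (f := len'.1) rfl (by rwa [card_col_of_ne hj c hi])]
  refine SD.mk_eq_of_subset c hP ?_ ?_
  · rintro a (rfl | rfl); exacts [h0, (len.2.len_inv _).trans h0]
  · rintro ⟨a, ha⟩; by_cases hadm : a ∈ G.admissibleEdges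
    · obtain ⟨i', k, hk, rfl | rfl⟩ := G.mem_adm.1 hadm
      · exact key i' k hk ha
      · rw [← c.inv_eq' (fun h' => ha (hP _ h')) ha, len'.2.len_inv, len.2.len_inv]
        exact key i' k hk _
    · rw [h1 a hadm, h1' _ fun h' => hadm ((c.mem_adm hP _).1 h')]

/-- The map from the harmonic compactification to Sullivan diagrams. -/
def toSD : Rad h n m → SD h n m := Quot.lift (fun x => cellToSD x.1 x.2) (by
    rintro ⟨_, t⟩ ⟨_, t'⟩ (⟨i, j, ⟨L, L', rfl, rfl, H⟩, h1, h2, -⟩ | ⟨j, ⟨L, L', rfl, rfl, H⟩, h1, -⟩)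
    · obtain ⟨hd, hj, hD⟩ := H.dg_eq; have hc := card_graph L i
      have hj' : j < (Code.graph L.diagram).cCard i := hc ▸ lt_succ_of_le hj
      obtain ⟨G', ⟨c⟩⟩ := ex_ctr_circle ((Code.graph L.diagram).edge_mem hj')
        (by rw [hc]; exact (lt_succ_of_le hd).ne')
      have hU : Unf L'.diagram G' := hD ▸ (Code.attachment L.diagram).collapse hd hj c
      obtain ⟨len, hl, hl1⟩ := ex_len (coord_graph t)
      obtain ⟨len', hl', hl1'⟩ := ex_len (G := G') (τ := fun i => coord (t'.1 i)) (by
        have h3 : (cType G').radialDegree = (mk L').radialDegree := by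
          rw [hU.cType_eq]; exact funext fun i => Diagram.deg_type _ i
        rw [h3]; exact coord_coord t'.1)
      show cellToSD _ t = cellToSD _ t'
      rw [← mk_eq_cellToSD (unf_graph _) hl, ← mk_eq_cellToSD hU hl']
      exact mk_eq_of_coface hj' c hl1 hl1' (by rw [hl, hl']; exact h1)
        fun k hk => by rw [hl, hl']; exact h2 k hk
    · obtain ⟨len, hl, -⟩ := ex_len (coord_graph t); show cellToSD _ t = cellToSD _ t'
      rw [← mk_eq_cellToSD (unf_graph _) hl]
      exact mk_eq_cellToSD (H.dg_eq ▸ unf_graph _) (hl.trans (funext h1)))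

lemma continuous_toSD : Continuous (toSD (h := h) (n := n) (m := m)) :=
  continuous_quot_lift _ (continuous_sigma fun T => continuous_cellToSD T)

lemma toSD_mk {L : PreConfig h n m} {t : (mk L).Cell} {len : LengthFunction G}
    (H : Unf L.diagram G) (hl : cCoord G len.1 = fun i => coord (t.1 i)) :
    toSD (Rad.mk _ t) = SD.mk G len := (mk_eq_cellToSD H hl).symm

lemma toSD_radPoint (len : LengthFunction G) : toSD (radPoint G (coord_len len)) = SD.mk G len := by
  have key : ∀ {T}, HasType G T → ∀ (hτ : Coord T.radialDegree (cCoord G len.1)),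
      toSD (Rad.point T hτ (coord_vertex _)) = SD.mk G len := by
    intro T H
    induction H with
    | @base D G H =>
      exact fun hτ => toSD_mk (D.dg_std.symm ▸ H) (funext fun i => (hτ.coord_toSimplex i).symm)
    | @step G G' _ e he c _ ih =>
      intro hτ; have hn := he.notMem_adm
      obtain ⟨len', hl⟩ := ex_len_of_card (fun i => (c.card_eq_of_disj
        (ic_pair e) (disj_pair_circle' hn i)).symm) len
      rw [SD.mk_eq_of_col c (ic_pair e) (disj_pair hn) hl.symm, ← ih len' (hl ▸ hτ)]; grind
  exact key (hasType_cType G) _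

lemma toSD_toRad (s : SD h n m) : toSD s.toRad = s := by
  induction s using Quot.ind with | _ s =>
  induction s using Quot.ind with | _ s =>
  exact toSD_radPoint s.2

lemma toRad_toSD_mk (L : PreConfig h n m) (t : (mk L).Cell) : (toSD (Rad.mk _ t)).toRad =
    Rad.point L.diagram.type (τ := fun i => coord (t.1 i)) (by
      rw [funext (Diagram.deg_type _)]; exact coord_coord t.1) (coord_vertex _) := by
  obtain ⟨len, hl, -⟩ := ex_len (coord_graph t)
  rw [toSD_mk (unf_graph _) hl]; exact Rad.point_congr _ _ _ _ (unf_graph _).cType_eq hl rfl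

end FatGraphs

/-! # Pushing the slits outwards -/

namespace RadialSlit

variable {h n m : ℕ}

namespace PreConfig

/-- Change the modulus of a point in an annulus. -/
def scale (φ : ℝ → ℝ) (p : Fin n × ℂ) : Fin n × ℂ := (p.1, ((φ ‖p.2‖ / ‖p.2‖ : ℝ) : ℂ) * p.2)

/-- The circles on which slits end, together with the boundary circles, are mapped into the
annulus. -/
structure IsRadiusMap (φ : ℝ → ℝ) : Prop where
  le : ∀ x, innerRadius ≤ x → innerRadius ≤ φ x
  ge : ∀ x, x ≤ outerRadius → φ x ≤ outerRadius
  outer : φ outerRadius = outerRadius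

variable {φ : ℝ → ℝ} (hφ : IsRadiusMap φ) (L : PreConfig h n m)

include hφ in
lemma norm_scale (hp : innerRadius ≤ ‖p.2‖) : ‖(scale φ p).2‖ = φ ‖p.2‖ := by
  have h1 := innerRadius_pos.trans_le hp
  have h2 := innerRadius_pos.trans_le (hφ.le _ hp)
  simp only [scale, norm_mul, Complex.norm_real, Real.norm_eq_abs, abs_of_pos (div_pos h2 h1)]
  exact div_mul_cancel₀ _ h1.ne'

lemma inner_le_modulus (x) : innerRadius ≤ L.modulus x := by
  rcases x with i | p; exacts [L.inner_le_slit i, inner_lt_outer.le.trans (L.norm_param p).ge]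

include hφ in
lemma scale_param (p) : scale φ (L.param p) = L.param p := by
  have h1 := innerRadius_pos.trans inner_lt_outer
  unfold scale; rw [L.norm_param, hφ.outer, div_self h1.ne', Complex.ofReal_one, one_mul]

include hφ in
lemma xi_scale (x) :
    (elim (fun i => scale φ (L.slit i)) L.param x : Fin n × ℂ) = scale φ (L.xi x) := by
  rcases x with i | p; exacts [rfl, (scale_param hφ L p).symm]

include hφ in
lemma angle_scale (x) : angle (scale φ (L.xi x)).2 = L.ang x :=
  angle_real_mul (div_pos (innerRadius_pos.trans_le (hφ.le _ (L.inner_le_modulus x)))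
    (L.modulus_pos x)) _

/-- Change the moduli of all slits. -/
def mapR : PreConfig h n m where
  slit i := scale φ (L.slit i)
  pairing := L.pairing
  succ := L.succ
  dist := L.dist
  param := L.param
  inner_le_slit i := (norm_scale hφ (L.inner_le_slit i)).ge.trans' (hφ.le _ (L.inner_le_slit i))
  slit_le_outer i := (norm_scale hφ (L.inner_le_slit i)).le.trans (hφ.ge _ (L.slit_le_outer i))
  norm_param := L.norm_param
  pairing_ne := L.pairing_ne
  pairing_pairing := L.pairing_pairing
  norm_pairing i := by grind [PreConfig.norm_scale, PreConfig.inner_le_slit, PreConfig.norm_pairing]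
  sameCycle_iff x y := by
    simp only [SlitData.ann, SlitData.xi, xi_scale hφ L]; exact L.sameCycle_iff x y
  annulus_nonempty j := by
    simp only [SlitData.ann, SlitData.xi, xi_scale hφ L]; exact L.annulus_nonempty j
  dist_nonneg := L.dist_nonneg
  dist_le := L.dist_le
  succ_ang x := by
    simp only [SlitData.ang, SlitData.xi, xi_scale hφ L]
    exact (angle_scale hφ L _).trans ((L.succ_ang x).trans (by rw [← angle_scale hφ L x]; rfl))
  dist_sum j := by simp only [SlitData.ann, SlitData.xi, xi_scale hφ L]; exact L.dist_sum j
  boundary := L.boundary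

lemma xi_mapR (x) : (L.mapR hφ).xi x = scale φ (L.xi x) := xi_scale hφ L x

lemma modulus_mapR (x) : (L.mapR hφ).modulus x = φ (L.modulus x) :=
  (congrArg (fun p : Fin n × ℂ => ‖p.2‖) (L.xi_mapR hφ x)).trans
    (norm_scale hφ (L.inner_le_modulus x))

lemma ann_mapR (x) : (L.mapR hφ).ann x = L.ann x := (congrArg Prod.fst (L.xi_mapR hφ x) :)

lemma walls_mapR (i) : (L.mapR hφ).walls i = L.walls i := by
  have h1 : (L.mapR hφ).ang = L.ang := funext fun x =>
    (congrArg (fun p : Fin n × ℂ => angle p.2) (L.xi_mapR hφ x)).trans (angle_scale hφ L x)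
  unfold walls; simp only [ann_mapR, h1]

lemma radialPos_mapR (x) : (L.mapR hφ).radialPos x = L.radialPos x := by
  have h1 : (L.mapR hφ).ang x = L.ang x :=
    (congrArg (fun p : Fin n × ℂ => angle p.2) (L.xi_mapR hφ x)).trans (angle_scale hφ L x)
  rw [radialPos, walls_mapR, ann_mapR, h1]; rfl

lemma deg_mapR (i) : (L.mapR hφ).radialDegree i = L.radialDegree i := by
  rw [radialDegree, walls_mapR]; rfl

lemma dg_mapR : (L.mapR hφ).diagram = L.diagram :=
  PreConfig.dg_eq ⟨rfl, rfl, L.ann_mapR hφ⟩ (L.deg_mapR hφ) (L.radialPos_mapR hφ) fun _ => Iff.rfl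

variable {L} {L' : PreConfig h n m}

lemma annCol_of_dg_eq (H : L'.diagram = L.diagram)
    (h1 : L'.annularDegree + 1 = L.annularDegree) (hj : j ≤ L.annularDegree)
    (h2 : ∀ k, L'.level k = if L.level k ≤ j then L.level k else L.level k - 1) :
    AnnularCollapse j L L' := by
  refine ⟨⟨congrArg Diagram.pairing H, congrArg Diagram.succ H, congrFun (congrArg Diagram.ann H)⟩,
    congrFun (congrArg Diagram.deg H), congrFun (congrArg Diagram.pos H), fun x => ?_, hj, h1, h2⟩
  rw [dist_zero_iff, dist_zero_iff, H]

lemma circles_eq (L : PreConfig h n m) : a ∈ L.circles ↔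
    a = innerRadius ∨ a = outerRadius ∨ ∃ i, L.modulus (inl i) = a := by
  simp only [circles, Finset.mem_union, mem_insert, Finset.mem_singleton, mem_image,
    mem_univ, true_and, or_assoc]

lemma two_le_card_circles (L : PreConfig h n m) : 2 ≤ L.circles.card := by
  rw [← card_pair inner_lt_outer.ne]; exact card_le_card Finset.subset_union_left

lemma card_circles (L : PreConfig h n m) : L.circles.card = L.annularDegree + 2 := by
  have := L.two_le_card_circles
  unfold annularDegree; omega

lemma circles_mem_Icc (L : PreConfig h n m) (ha : a ∈ L.circles) :
    innerRadius ≤ a ∧ a ≤ outerRadius := by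
  rcases L.circles_eq.1 ha with rfl | rfl | ⟨i, rfl⟩
  exacts [⟨le_rfl, inner_lt_outer.le⟩, ⟨inner_lt_outer.le, le_rfl⟩,
    ⟨L.inner_le_slit i, L.slit_le_outer i⟩]

/-- Some slit ends on the inner boundary. -/
def Inner (L : PreConfig h n m) : Prop := ∃ i, L.level i = 0

lemma level_eq_zero_iff {i : Fin (2 * h)} : L.level i = 0 ↔ L.modulus (inl i) = innerRadius := by
  unfold level; rw [Finset.card_eq_zero, Finset.filter_eq_empty_iff]; constructor
  · exact fun H => le_antisymm (not_lt.1 (H (L.circles_eq.2 (.inl rfl)))) (L.inner_le_slit i)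
  · exact fun H a ha => H ▸ (L.circles_mem_Icc ha).1.not_gt

/-- Halving the distance to the outer boundary. -/
def pushMap (x : ℝ) : ℝ := (x + outerRadius) / 2

lemma isRadiusMap_push : IsRadiusMap pushMap where
  le x hx := by have := inner_lt_outer; unfold pushMap; linarith
  ge x hx := by unfold pushMap; linarith
  outer := by unfold pushMap; ring

lemma pushMap_lt_iff : pushMap x < pushMap y ↔ x < y := by
  unfold pushMap; constructor <;> intro <;> linarith

lemma inner_lt_push (hx : innerRadius ≤ x) : innerRadius < pushMap x := by
  have := inner_lt_outer
  unfold pushMap; linarith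

/-- Push all slits away from the inner boundary. -/
abbrev push (L : PreConfig h n m) : PreConfig h n m := L.mapR isRadiusMap_push

open Classical in
lemma push_spec (L : PreConfig h n m) :
    L.push.annularDegree = L.annularDegree + (if L.Inner then 1 else 0) ∧
    ∀ i, L.push.level i = L.level i + if L.Inner then 1 else 0 := by
  let K := if L.Inner then L.circles else L.circles.erase innerRadius
  have hK : ∀ b, b ∈ K ↔ b ∈ L.circles ∧ (b = innerRadius → L.Inner) := by grind
  have h0 : L.push.circles = insert innerRadius (K.image pushMap) := by
    ext a; simp only [circles_eq, mem_insert, mem_image, hK, modulus_mapR]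
    refine or_congr_right ⟨?_, ?_⟩
    · rintro (rfl | ⟨i, rfl⟩)
      · grind [PreConfig.inner_lt_outer, PreConfig.IsRadiusMap.outer, PreConfig.isRadiusMap_push]
      · exact ⟨_, ⟨.inr (.inr ⟨i, rfl⟩), fun h' => ⟨i, level_eq_zero_iff.2 h'⟩⟩, rfl⟩
    · rintro ⟨b, ⟨h1 | rfl | ⟨i, rfl⟩, h2⟩, rfl⟩
      · obtain ⟨i, hi⟩ := h2 h1; exact .inr ⟨i, by rw [level_eq_zero_iff.1 hi, h1]⟩
      · exact .inl isRadiusMap_push.outer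
      · exact .inr ⟨i, rfl⟩
  have hinj : Injective pushMap := fun x y hxy => by unfold pushMap at hxy; linarith
  have hn : ∀ s ⊆ K, innerRadius ∉ s.image pushMap := by
    grind [PreConfig.inner_lt_push, PreConfig.circles_mem_Icc]
  have hin : innerRadius ∈ L.circles := L.circles_eq.2 (.inl rfl)
  constructor
  · have h1 := L.push.card_circles
    rw [h0, Finset.card_insert_of_notMem (hn K subset_rfl), Finset.card_image_of_injective _ hinj] at h1
    grind [PreConfig.card_circles]
  · intro i
    rw [level, h0, modulus_mapR, Finset.filter_insert, if_pos (inner_lt_push (L.inner_le_modulus _)),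
      Finset.filter_image, Finset.card_insert_of_notMem (hn _ (Finset.filter_subset _ _)),
      Finset.card_image_of_injective _ hinj]
    simp only [pushMap_lt_iff, level]; by_cases hL : L.Inner
    · simp only [K, hL, if_true]
    · simp only [K, hL, if_false, add_zero, Finset.filter_erase]
      refine Finset.card_erase_add_one (mem_filter.2 ⟨hin, ?_⟩)
      exact lt_of_le_of_ne (L.inner_le_slit i) fun h' => hL ⟨i, level_eq_zero_iff.2 h'.symm⟩

lemma not_inner_push (L : PreConfig h n m) : ¬ L.push.Inner := fun ⟨i, hi⟩ => by
  rw [level_eq_zero_iff, modulus_mapR] at hi; exact (inner_lt_push (L.inner_le_slit i)).ne' hi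

lemma uni_of_annularDegree (hL : ¬ L.Inner) (h0 : L.annularDegree = 0) : L.Unilevel := by
  have h1 := L.card_circles
  rw [h0, zero_add, ← card_pair inner_lt_outer.ne] at h1
  have h2 := Finset.eq_of_subset_of_card_le (s := {innerRadius, outerRadius}) (t := L.circles)
    Finset.subset_union_left h1.le
  intro i; have h3 : L.modulus (inl i) ∈ L.circles := L.circles_eq.2 (.inr (.inr ⟨i, rfl⟩))
  rw [← h2, mem_insert, Finset.mem_singleton] at h3
  exact h3.resolve_left fun h' => hL ⟨i, level_eq_zero_iff.2 h'⟩

lemma ex_outerCollapse (hL : L.annularDegree ≠ 0) :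
    ∃ L' : PreConfig h n m, AnnularCollapse L.annularDegree L L' := by
  classical
  have hin : innerRadius ∈ L.circles := L.circles_eq.2 (.inl rfl)
  have hout : outerRadius ∈ L.circles := L.circles_eq.2 (.inr (.inl rfl))
  have hc := L.card_circles
  have hin' := mem_erase.2 ⟨inner_lt_outer.ne, hin⟩
  set S := L.circles.erase outerRadius with hS
  have hSc : S.card = L.annularDegree + 1 := by rw [hS, card_erase_of_mem hout]; omega
  set a := S.max' ⟨_, hin'⟩ with ha
  have haS : a ∈ S := S.max'_mem _
  have hmax : ∀ b ∈ S, b ≤ a := fun b hb => S.le_max' b hb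
  obtain ⟨hao, haC⟩ := mem_erase.1 haS
  have hao : a < outerRadius := lt_of_le_of_ne (L.circles_mem_Icc haC).2 hao
  have hia : innerRadius < a := by
    refine lt_of_le_of_ne (hmax _ hin') fun h' => hL ?_
    have : S ⊆ {a} := fun b hb => Finset.mem_singleton.2
      (le_antisymm (hmax b hb) (h' ▸ (L.circles_mem_Icc (Finset.mem_of_mem_erase hb)).1))
    have := card_le_card this
    rw [Finset.card_singleton] at this
    omega
  let φ : ℝ → ℝ := fun x => if x < a then x else outerRadius
  have hφ : IsRadiusMap φ := by
    refine ⟨fun x hx => ?_, fun x hx => ?_, if_neg hao.not_gt⟩ <;> simp only [φ] <;> split_ifs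
    exacts [hx, inner_lt_outer.le, hx, le_rfl]
  have hbig : ∀ {b}, b ∈ L.circles → ¬ b < a → b = a ∨ b = outerRadius := fun hb h' => by
    by_contra! h2
    exact h' (lt_of_le_of_ne (hmax _ (mem_erase.2 ⟨h2.2, hb⟩)) h2.1)
  have h0 : (L.mapR hφ).circles = L.circles.erase a := by
    ext b
    rw [mem_erase, circles_eq]
    simp only [modulus_mapR, φ]
    constructor
    · grind [PreConfig.circles_eq]
    grind [PreConfig.circles_eq]
  have hSa : (S.erase a).card = L.annularDegree := by rw [card_erase_of_mem haS]; omega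
  refine ⟨L.mapR hφ, annCol_of_dg_eq (L.dg_mapR hφ) ?_ le_rfl fun i => ?_⟩
  · grind [PreConfig.card_circles]
  · have hi : L.modulus (inl i) ∈ L.circles := L.circles_eq.2 (.inr (.inr ⟨i, rfl⟩))
    rw [level, h0, modulus_mapR, level]
    generalize L.modulus (inl i) = ρ at hi
    have e3 : (L.circles.erase a).filter (· < outerRadius) = S.erase a := by grind
    by_cases hρ : ρ < a
    · have e1 : (L.circles.erase a).filter (· < ρ) = L.circles.filter (· < ρ) := by grind
      have e2 : (L.circles.filter (· < ρ)).card ≤ L.annularDegree := by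
        rw [← hSa]
        refine card_le_card fun b hb => ?_
        grind
      simp only [φ, if_pos hρ, e1, if_pos e2]
    · simp only [φ, if_neg hρ]
      rw [e3, hSa]
      rcases hbig hi hρ with rfl | rfl
      · have e1 : L.circles.filter (· < a) = S.erase a := by grind
        rw [e1, hSa, if_pos le_rfl]
      · have e1 : L.circles.filter (· < outerRadius) = S := by grind
        grind

lemma AnnularCollapse.inner (H : AnnularCollapse 0 L L') : L'.Inner := by
  classical
  obtain ⟨-, -, -, -, -, h1, h2⟩ := H
  by_contra hL'
  have h3 : ∀ i, 2 ≤ L.level i := fun i => by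
    have h4 : L'.level i ≠ 0 := fun h' => hL' ⟨i, h'⟩
    rw [h2] at h4
    split_ifs at h4 <;> omega
  have hc := L.card_circles
  have hin : innerRadius ∈ L.circles := L.circles_eq.2 (.inl rfl)
  have hne : (L.circles.erase innerRadius).Nonempty := by
    rw [← Finset.card_pos, card_erase_of_mem hin]; omega
  set a := (L.circles.erase innerRadius).min' hne with ha
  obtain ⟨h5, h6⟩ := mem_erase.1 (Finset.min'_mem _ hne)
  have h7 : (L.circles.filter (· < a)).card ≤ 1 := by
    rw [Finset.card_le_one_iff_subset_singleton]
    refine ⟨innerRadius, fun b hb => Finset.mem_singleton.2 ?_⟩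
    obtain ⟨hb1, hb2⟩ := mem_filter.1 hb
    by_contra hb3
    exact hb2.not_ge (Finset.min'_le _ _ (mem_erase.2 ⟨hb3, hb1⟩))
  rcases L.circles_eq.1 h6 with h' | h' | ⟨i, hi⟩
  · exact h5 h'
  · have h8 : L.circles ⊆ {innerRadius, outerRadius} := fun b hb => by
      by_cases hb1 : b = innerRadius
      · exact mem_insert.2 (.inl hb1)
      · have h9 := Finset.min'_le _ _ (mem_erase.2 ⟨hb1, hb⟩)
        exact mem_insert.2 (.inr (Finset.mem_singleton.2
          (le_antisymm (L.circles_mem_Icc hb).2 (h' ▸ h9))))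
    have h9 := card_le_card h8
    grind
  · have := h3 i
    rw [level, hi] at this
    exact absurd (this.trans h7) (by norm_num)

end PreConfig

end RadialSlit

/-! # The homotopy equivalence -/

namespace RadialSlit

open PreConfig FatGraphs

variable {h n m : ℕ}

namespace PreConfig

variable {L L' : PreConfig h n m}

lemma sameType_push (H : SameType L L') : SameType L.push L'.push := by
  have hI : L'.Inner = L.Inner := propext (exists_congr fun i => by rw [H.2.2.2.2.2 i])
  refine sameType_of_dg_eq ?_ ?_ fun i => ?_
  · rw [dg_mapR, dg_mapR, H.dg_eq]
  · rw [L.push_spec.1, L'.push_spec.1, H.2.2.2.2.1, hI]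
  · rw [L.push_spec.2, L'.push_spec.2, H.2.2.2.2.2, hI]

lemma typeStep_push (H : TypeStep L L') : TypeStep L.push L'.push := by
  rcases H with H | H | H
  · obtain ⟨τ, h1, h2, h3, h4, h5⟩ := H
    exact .inl ⟨τ, fun i => congrArg (scale pushMap) (h1 i), h2, h3, h4, h5⟩
  · obtain ⟨x, j, h1, h2, h3, h4, h5, h6, h7, h8, h9, h10⟩ := H
    refine .inr (.inl ⟨x, j, h1, h2, ?_, h4, h5, h6, h7, fun y hy => ?_, ?_, h10⟩)
    · rw [modulus_mapR, modulus_mapR]; unfold pushMap; linarith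
    · rw [xi_mapR, xi_mapR, h8 y hy]
    · have hp := L.modulus_pos x; have hq := L.modulus_pos (inl (L.pairing j))
      have hq' := L.push.modulus_pos (inl (L.pairing j))
      rw [modulus_mapR] at hq'
      have h11 : ‖((L.modulus x / L.modulus (inl (L.pairing j)) : ℝ) : ℂ) *
          (L.slit (L.pairing j)).2‖ = L.modulus x := by
        rw [norm_mul, Complex.norm_real, Real.norm_of_nonneg (div_pos hp hq).le]
        exact div_mul_cancel₀ _ hq.ne'
      rw [xi_mapR, h9]; refine Prod.ext rfl ?_
      show ((pushMap ‖_‖ / ‖_‖ : ℝ) : ℂ) * _ =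
        ((L.push.modulus x / L.push.modulus (inl (L.pairing j)) : ℝ) : ℂ) *
        (((pushMap (L.modulus (inl (L.pairing j))) /
        L.modulus (inl (L.pairing j)) : ℝ) : ℂ) * (L.slit (L.pairing j)).2)
      rw [modulus_mapR, modulus_mapR, h11, ← mul_assoc, ← mul_assoc, ← Complex.ofReal_mul,
        ← Complex.ofReal_mul]
      congr 2; field_simp
  · exact .inr (.inr (sameType_push H))

lemma radialCollapse_push (H : RadialCollapse i j L L') : RadialCollapse i j L.push L'.push := by
  obtain ⟨⟨h1, h2, h3⟩, h4, h5, h6, h7, h8, h9, h10, h11⟩ := H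
  have hI : L'.Inner = L.Inner := propext (exists_congr fun i => by rw [h11 i])
  unfold RadialCollapse SameFrame
  simp only [ann_mapR, deg_mapR, radialPos_mapR, push_spec, h10, h11]
  exact ⟨⟨h1, h2, h3⟩, h4, h5, h6, h7, h8, h9, by rw [hI], fun _ => by rw [hI]⟩

end PreConfig

namespace CombType

/-- The combinatorial type after pushing the slits away from the inner boundary. -/
def push (T : CombType h n m) : CombType h n m :=
  Quot.map PreConfig.push (fun _ _ => typeStep_push) T

lemma deg_push (T : CombType h n m) : T.push.radialDegree = T.radialDegree := by
  obtain ⟨L, rfl⟩ := Quot.exists_rep T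
  exact funext fun i => L.deg_mapR _ i

/-- The coordinates of a point after pushing slightly. -/
def pushCoord (T : CombType h n m) (σ : ℕ → ℝ) : ℕ → ℝ :=
  if T.push.annularDegree = T.annularDegree then σ else coface 0 σ

open Classical in
lemma pushCoord_mk (L : PreConfig h n m) (σ : ℕ → ℝ) :
    (mk L).pushCoord σ = if L.Inner then coface 0 σ else σ := by
  have h1 : (mk L).push.annularDegree = _ := L.push_spec.1
  unfold pushCoord; rw [h1]; by_cases hL : L.Inner
  · rw [if_pos hL, if_pos hL]; exact if_neg (Nat.succ_ne_self _)
  · rw [if_neg hL, if_neg hL]; exact if_pos rfl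

lemma coord_pushCoord {T : CombType h n m} {σ : ℕ → ℝ}
    (hσ : Coord (fun _ : Fin 1 => T.annularDegree) fun _ => σ) :
    Coord (fun _ : Fin 1 => T.push.annularDegree) fun _ => T.pushCoord σ := by
  classical
  obtain ⟨L, rfl⟩ := Quot.exists_rep T
  have h1 : (mk L).push.annularDegree = _ := L.push_spec.1
  show Coord (fun _ => (mk L).push.annularDegree) fun _ => (mk L).pushCoord σ
  rw [h1, pushCoord_mk]
  by_cases hL : L.Inner
  · rw [if_pos hL, if_pos hL]
    refine ⟨fun i k => ?_, fun i k hk => ?_, fun i => ?_⟩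
    · unfold coface; split_ifs; exacts [hσ.nonneg 0 _, le_rfl, hσ.nonneg 0 _]
    · rw [coface, if_neg (by omega), if_neg (by omega)]
      exact hσ.eq_zero 0 _ (Nat.lt_sub_of_add_lt hk)
    · rw [sum_coface, if_neg (by omega)]; exact hσ.sum_eq 0
  · rw [if_neg hL, if_neg hL]; exact hσ

end CombType

lemma Coord.convex (H : Coord q τ) (H' : Coord q τ')
    (h0 : 0 ≤ s) (h1 : s ≤ 1) : Coord q fun i k => (1 - s) * τ i k + s * τ' i k where
  nonneg i k := by
    have := H.nonneg i k
    have := H'.nonneg i k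
    have : 0 ≤ 1 - s := by linarith
    positivity
  eq_zero i k hk := by rw [H.eq_zero i k hk, H'.eq_zero i k hk]; ring
  sum_eq i := by rw [sum_add_distrib, ← mul_sum, ← mul_sum, H.sum_eq, H'.sum_eq]; ring

lemma coord_snd {T : CombType h n m} (t : T.Cell) :
    Coord (fun _ : Fin 1 => T.annularDegree) fun _ => coord t.2 := coord_coord fun _ => t.2

lemma coord_push {T : CombType h n m} (t : T.Cell) :
    Coord T.push.radialDegree fun i => coord (t.1 i) := by
  rw [T.deg_push]; exact coord_coord t.1

lemma coface_zero_coface (j) (u : ℕ → ℝ) : coface 0 (coface j u) = coface (j + 1) (coface 0 u) := by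
  funext k; unfold coface; split_ifs <;> first | rfl | omega

lemma coface_combination (j) (u v : ℕ → ℝ) (a b) :
    coface j (fun k => a * u k + b * v k) = fun k => a * coface j u k + b * coface j v k := by
  funext k; unfold coface; split_ifs <;> ring

lemma coface_vCoord (hj : j ≠ 0) : coface j vCoord = vCoord := by
  funext a; unfold coface vCoord; grind

lemma continuous_coord (a) : Continuous fun t : stdSimplex ℝ (Fin k) => coord t a := by
  unfold coord; split_ifs
  exacts [(continuous_apply _).comp continuous_subtype_val, continuous_const]

/-- The annular coordinates in the course of the deformation. -/
def pathCoord (T : CombType h n m) (σ : ℕ → ℝ) (s : ℝ) (k : ℕ) : ℝ :=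
  (1 - s) * T.pushCoord σ k + s * vCoord k

lemma coord_path {T : CombType h n m} (t : T.Cell) (s : unitInterval) :
    Coord (fun _ : Fin 1 => T.push.annularDegree) fun _ => pathCoord T (coord t.2) s :=
  (CombType.coord_pushCoord (coord_snd t)).convex (coord_vertex _) s.2.1 s.2.2

/-- The deformation on a cell. -/
def cellPath (T : CombType h n m) (t : T.Cell) (s : unitInterval) : Rad h n m :=
  Rad.point T.push (coord_push t) (coord_path t s)

lemma continuous_cellPath (T : CombType h n m) :
    Continuous fun p : T.Cell × unitInterval => cellPath T p.1 p.2 := by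
  refine Rad.continuous_point _ _ _ (fun i k => ?_) fun k => ?_
  · exact (continuous_coord k).comp ((continuous_apply i).comp (continuous_fst.comp continuous_fst))
  · have h2 : ∀ j, Continuous fun p : T.Cell × unitInterval => coord p.1.2 j := fun j =>
      (continuous_coord j).comp (continuous_snd.comp continuous_fst)
    have h1 : Continuous fun p : T.Cell × unitInterval => T.pushCoord (coord p.1.2) k := by
      unfold CombType.pushCoord; split_ifs
      · exact h2 _
      · unfold coface; split_ifs; exacts [h2 _, continuous_const, h2 _]
    have h3 : Continuous fun p : T.Cell × unitInterval => (p.2 : ℝ) :=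
      continuous_subtype_val.comp continuous_snd
    exact ((continuous_const.sub h3).mul h1).add (h3.mul continuous_const)

lemma cellPath_eq {x y : Σ T : CombType h n m, T.Cell} (H : FaceStep x y) (s : unitInterval) :
    cellPath x.1 x.2 s = cellPath y.1 y.2 s := by
  classical
  obtain ⟨_, t⟩ := x
  obtain ⟨_, t'⟩ := y
  rcases H with ⟨i, j, ⟨L, L', rfl, rfl, H⟩, h1, h2, h3⟩ | ⟨j, ⟨L, L', rfl, rfl, H⟩, h1, h2⟩
  · have hI : L'.Inner = L.Inner := propext (exists_congr fun i => by rw [H.2.2.2.2.2.2.2.2 i])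
    refine Rad.point_radialFace _ _ _ _ ⟨_, _, rfl, rfl, radialCollapse_push H⟩ h1 h2 ?_
    unfold pathCoord
    rw [CombType.pushCoord_mk, CombType.pushCoord_mk, hI]
    grind
  · have hl := H.2.2.2.2.2.2
    have e1 : (fun i => coord (t.1 i)) = fun i => coord (t'.1 i) := funext h1
    have hd : L'.push.diagram = L.push.diagram := by rw [dg_mapR, dg_mapR, H.dg_eq]
    have hp := H.2.2.2.2.2.1
    have hj := H.2.2.2.2.1
    have h2 : coord t.2 = coface j (coord t'.2) := h2
    have face : ∀ j', AnnularCollapse j' L.push L'.push → pathCoord (mk L) (coord t.2) s =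
          coface j' (pathCoord (mk L') (coord t'.2) s) →
        cellPath (mk L) t s = cellPath (mk L') t' s := fun j' hj' he =>
      Rad.point_annularFace _ _ _ _ ⟨_, _, rfl, rfl, hj'⟩ e1 he
    by_cases hL : L.Inner
    · have hL' : L'.Inner := hL.imp fun i hi => by rw [hl, hi]; rfl
      refine face (j + 1) (annCol_of_dg_eq hd ?_ ?_ fun k => ?_) ?_
      · rw [L.push_spec.1, L'.push_spec.1, if_pos hL, if_pos hL']; omega
      · rw [L.push_spec.1, if_pos hL]; omega
      · grind [PreConfig.push_spec]
      · unfold pathCoord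
        rw [CombType.pushCoord_mk, CombType.pushCoord_mk, if_pos hL, if_pos hL', h2,
          coface_zero_coface, coface_combination, coface_vCoord (Nat.succ_ne_zero j)]
    by_cases hj0 : j = 0
    · subst hj0
      have hL' := AnnularCollapse.inner H
      refine Rad.point_congr _ _ _ _ (Quot.sound (.inr (.inr (sameType_of_dg_eq hd ?_
        fun k => ?_)))) e1 ?_
      · rw [L.push_spec.1, L'.push_spec.1, if_neg hL, if_pos hL']; omega
      · have h3 : L.level k ≠ 0 := fun h' => hL ⟨k, h'⟩
        grind [PreConfig.push_spec]
      · unfold pathCoord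
        rw [CombType.pushCoord_mk, CombType.pushCoord_mk, if_neg hL, if_pos hL', h2]
    · have hL' : ¬ L'.Inner := fun ⟨k, hk⟩ => hL ⟨k, by rw [hl] at hk; split_ifs at hk <;> omega⟩
      refine face j (annCol_of_dg_eq hd ?_ ?_ fun k => ?_) ?_
      · rw [L.push_spec.1, L'.push_spec.1, if_neg hL, if_neg hL']; omega
      · rw [L.push_spec.1, if_neg hL]; omega
      · rw [L.push_spec.2, L'.push_spec.2, if_neg hL, if_neg hL', hl]; rfl
      · unfold pathCoord
        rw [CombType.pushCoord_mk, CombType.pushCoord_mk, if_neg hL, if_neg hL', h2,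
          coface_combination, coface_vCoord hj0]

lemma cellPath_zero (T : CombType h n m) (t : T.Cell) : cellPath T t 0 = Rad.mk T t := by
  classical
  obtain ⟨L, rfl⟩ := Quot.exists_rep T
  have e : pathCoord (mk L) (coord t.2) (0 : unitInterval) = (mk L).pushCoord (coord t.2) := by
    funext k
    unfold pathCoord
    rw [Set.Icc.coe_zero]
    ring
  rw [CombType.pushCoord_mk] at e
  refine Eq.trans ?_ (Rad.mk_eq_point (coord_coord t.1) (coord_snd t) (fun _ => rfl) rfl).symm
  by_cases hL : L.Inner
  · rw [if_pos hL] at e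
    refine Rad.point_annularFace _ _ _ _ (j := 0) ⟨_, _, rfl, rfl, annCol_of_dg_eq
      (L.dg_mapR isRadiusMap_push).symm ?_ (Nat.zero_le _) fun k => ?_⟩ rfl e
    · rw [L.push_spec.1, if_pos hL]
    · rw [L.push_spec.2, if_pos hL, if_neg (by omega)]; rfl
  · rw [if_neg hL] at e
    refine Rad.point_congr _ _ _ _ (Quot.sound (.inr (.inr (sameType_of_dg_eq
      (L.dg_mapR isRadiusMap_push).symm ?_ fun k => ?_)))) rfl e
    · rw [L.push_spec.1, if_neg hL]; rfl
    · rw [L.push_spec.2, if_neg hL]; rfl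

lemma point_vertex_eq (hL : ¬ L.Inner)
    (hτ : Coord (mk L).radialDegree τ) (hτ' : Coord L.diagram.type.radialDegree τ) :
    Rad.point (mk L) hτ (coord_vertex _) = Rad.point L.diagram.type hτ' (coord_vertex _) := by
  induction hp : L.annularDegree generalizing L with
  | zero => exact Rad.point_congr _ _ _ _ (uni_of_annularDegree hL hp).mk_eq_type rfl rfl
  | succ p ih =>
    have h0 : L.annularDegree ≠ 0 := by omega
    obtain ⟨L', H⟩ := ex_outerCollapse h0
    have hL' : ¬ L'.Inner := fun ⟨k, hk⟩ => hL ⟨k, by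
      rw [H.2.2.2.2.2.2] at hk; split_ifs at hk <;> omega⟩
    have hr : (mk L').radialDegree = (mk L).radialDegree := funext H.2.1
    rw [Rad.point_annularFace hτ (coord_vertex _) (hr ▸ hτ) (coord_vertex _)
      ⟨L, L', rfl, rfl, H⟩ rfl (coface_vCoord h0).symm]
    have hD := H.dg_eq
    rw [ih hL' (hr ▸ hτ) (hD ▸ hτ') (by have := H.2.2.2.2.2.1; omega)]
    grind

lemma cellPath_one (T : CombType h n m) (t : T.Cell) :
    cellPath T t 1 = (toSD (Rad.mk T t)).toRad := by
  obtain ⟨L, rfl⟩ := Quot.exists_rep T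
  have e : pathCoord (mk L) (coord t.2) (1 : unitInterval) = vCoord := by
    funext k; unfold pathCoord; rw [Set.Icc.coe_one]; ring
  have hD := L.dg_mapR isRadiusMap_push
  refine Eq.trans ?_ (toRad_toSD_mk L t).symm
  have h1 : Coord L.push.diagram.type.radialDegree fun i => coord (t.1 i) := by
    rw [hD, funext (Diagram.deg_type _)]; exact coord_coord t.1
  refine (Rad.point_congr _ _ _ (coord_vertex _) rfl rfl e).trans
    ((point_vertex_eq L.not_inner_push ?_ h1).trans (Rad.point_congr _ _ _ _ (by rw [hD]) rfl rfl))
  exact coord_push t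

/-- The deformation of the harmonic compactification. -/
def radPath : C(Rad h n m, C(unitInterval, Rad h n m)) where
  toFun := Quot.lift (fun x => ⟨cellPath x.1 x.2,
    (continuous_cellPath x.1).comp (continuous_const.prodMk continuous_id)⟩)
    fun _ _ H => ContinuousMap.ext (cellPath_eq H)
  continuous_toFun := continuous_quot_lift _ (continuous_sigma fun T =>
    (ContinuousMap.curry ⟨fun p : T.Cell × unitInterval => cellPath T p.1 p.2,
      continuous_cellPath T⟩).continuous)

/-- The homotopy equivalence of Sullivan diagrams and the harmonic compactification. -/
def homotopyEquiv : ContinuousMap.HomotopyEquiv (SD h n m) (Rad h n m) where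
  toFun := ⟨SD.toRad, SD.continuous_toRad⟩
  invFun := ⟨toSD, continuous_toSD⟩
  left_inv := by
    have : (⟨toSD, continuous_toSD⟩ : C(Rad h n m, SD h n m)).comp ⟨SD.toRad, SD.continuous_toRad⟩ =
      ContinuousMap.id _ := ContinuousMap.ext toSD_toRad
    exact this ▸ ContinuousMap.Homotopic.refl _
  right_inv := ContinuousMap.Homotopic.symm ⟨
    { toContinuousMap := radPath.uncurry.comp ContinuousMap.prodSwap, map_zero_left := fun x => by
        induction x using Quot.ind with | _ x => exact cellPath_zero x.1 x.2
      map_one_left := fun x => by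
        induction x using Quot.ind with | _ x => exact cellPath_one x.1 x.2 }⟩

end RadialSlit

/-! # The cells of the unilevel harmonic compactification -/

namespace RadialSlit

open PreConfig FatGraphs

variable {h n m : ℕ}

lemma Diagram.coord_type (D : Diagram h n m) (hτ : Coord D.deg τ) :
    Coord D.type.radialDegree τ := by
  rw [funext D.deg_type]; exact hτ

/-- The point of a unilevel cell with given coordinates. -/
def Diagram.radPoint (D : Diagram h n m) {τ : Fin n → ℕ → ℝ} (hτ : Coord D.deg τ) : Rad h n m :=
  Rad.point D.type (D.coord_type hτ) (coord_vertex _)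

namespace Diagram

variable {D D' : Diagram h n m} {τ τ' : Fin n → ℕ → ℝ}

lemma radPoint_congr (hτ : Coord D.deg τ) (hτ' : Coord D'.deg τ') (H : D.type = D'.type)
    (H' : τ = τ') : D.radPoint hτ = D'.radPoint hτ' :=
  Rad.point_congr _ _ _ _ H H' rfl

lemma radPoint_col {i : Fin n} {j : ℕ} (hd : 1 ≤ D.deg i) (hj : j ≤ D.deg i)
    (hτ : Coord D.deg τ) (hτ' : Coord (D.collapse i j hd hj).deg τ')
    (h1 : τ i = coface j (τ' i)) (h2 : ∀ k, k ≠ i → τ k = τ' k) :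
    D.radPoint hτ = (D.collapse i j hd hj).radPoint hτ' :=
  Rad.point_radialFace _ _ _ _ (D.isRadialFace_type hd hj) h1 h2 rfl

lemma coord_cell (H : D.type = T) (t : T.Cell) : Coord D.deg fun i => coord (t.1 i) := by
  subst H; exact (funext D.deg_type) ▸ coord_coord t.1

lemma mk_eq_radPoint (H : D.type = T) (t) : Rad.mk T t = D.radPoint (coord_cell H t) := by
  subst H
  exact Rad.mk_eq_point _ _ (fun _ => rfl) (coord_of_eq_one _ (by rw [D.uni_type.annularDegree_eq]))

lemma real_congr (e : D = D') (hτ : Coord D.deg τ) (hτ' : Coord D'.deg τ) :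
    D.real hτ = D'.real hτ' := by
  subst e; rfl

end Diagram

lemma real_invariant (H : CombType.mk L = CombType.mk L')
    : ∀ (hτ : Coord L.diagram.deg τ) (hτ' : Coord L'.diagram.deg τ),
    (CombType.mk (L.diagram.real hτ), (L.diagram.real hτ).walls) =
      (CombType.mk (L'.diagram.real hτ'), (L'.diagram.real hτ').walls) := by
  induction Quot.eqvGen_exact H with
  | rel L L' H' =>
    intro hτ hτ'
    rcases H' with H' | H' | H'
    · obtain ⟨τ, e⟩ := H'.dg_eq
      have R := L.diagram.relabel_real τ hτ
      rw [Diagram.real_congr e hτ' hτ, funext R.walls_eq]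
      exact Prod.ext (Quot.sound (.inl R)) rfl
    · obtain ⟨x, j, J, e⟩ := H'.dg_eq
      have R := Diagram.jump_real J hτ (e ▸ hτ')
      rw [Diagram.real_congr e hτ' (e ▸ hτ'), funext R.walls_eq]
      exact Prod.ext (Quot.sound (.inr (.inl R))) rfl
    · rw [Diagram.real_congr H'.dg_eq.symm hτ hτ']
  | refl L => exact fun _ _ => rfl
  | symm L L' _ ih => exact fun h1 h2 => (ih H.symm h2 h1).symm
  | trans L L1 L' H1 H2 ih1 ih2 =>
    intro h1 h2
    have e1 : CombType.mk L = CombType.mk L1 := Quot.eqvGen_sound H1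
    have e : L.radialDegree = L1.radialDegree := congrArg CombType.radialDegree e1
    have h3 : Coord L1.diagram.deg τ := by show Coord L1.radialDegree τ; rw [← e]; exact h1
    exact (ih1 e1 h1 h3).trans (ih2 (Quot.eqvGen_sound H2) h3 h2)

lemma ex_cellData (T : CombType h n m) (t : T.Cell) :
    ∃ c : CombType h n m × (Fin n → Finset ℝ), ∀ L, CombType.mk L = T →
      ∀ hτ : Coord L.diagram.deg fun i => coord (t.1 i),
        (CombType.mk (L.diagram.real hτ), (L.diagram.real hτ).walls) = c := by
  obtain ⟨L, rfl⟩ := Quot.exists_rep T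
  exact ⟨_, fun L' h1 hτ => real_invariant h1 hτ (coord_coord t.1)⟩

/-- The combinatorial type and the radial walls of the unilevel configuration which belongs to a
point of the harmonic compactification. -/
def Rad.data : Rad h n m → CombType h n m × (Fin n → Finset ℝ) :=
  Quot.lift (fun x => (ex_cellData x.1 x.2).choose) (by
    rintro ⟨_, t⟩ ⟨_, t'⟩ (⟨i, j, ⟨L, L', rfl, rfl, H⟩, h1, h2, -⟩ | ⟨j, ⟨L, L', rfl, rfl, H⟩, h1, -⟩)
    · obtain ⟨hd, hj, e⟩ := H.dg_eq
      have hτ' : Coord L'.diagram.deg fun i => coord (t'.1 i) := coord_coord t'.1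
      refine ((ex_cellData _ t).choose_spec L rfl (coord_coord t.1)).symm.trans
        (Eq.trans ?_ ((ex_cellData _ t').choose_spec L' rfl hτ'))
      rw [Diagram.real_congr e hτ' (e ▸ hτ'),
        Diagram.real_eq_of_coface hd hj (coord_coord t.1) (e ▸ hτ') h1 h2]
    · have hτ' : Coord L'.diagram.deg fun i => coord (t'.1 i) := coord_coord t'.1
      have e1 : (fun i => coord (t.1 i)) = fun i => coord (t'.1 i) := funext h1
      have hτ : Coord L.diagram.deg fun i => coord (t.1 i) := coord_coord t.1
      refine ((ex_cellData _ t).choose_spec L rfl hτ).symm.trans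
        (Eq.trans ?_ ((ex_cellData _ t').choose_spec L' rfl hτ'))
      grind [PreConfig.AnnularCollapse.dg_eq])

lemma Diagram.data_radPoint (D : Diagram h n m) (hτ : Coord D.deg τ) :
    (D.radPoint hτ).data = (CombType.mk (D.real hτ), (D.real hτ).walls) := by
  have key : ∀ (D' : Diagram h n m) (τ' : Fin n → ℕ → ℝ) (hτ' : Coord D'.deg τ'), D' = D → τ' = τ →
      (CombType.mk (D'.real hτ'), (D'.real hτ').walls) =
        (CombType.mk (D.real hτ), (D.real hτ).walls) := by
    rintro _ _ _ rfl rfl; rfl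
  have e := funext fun i => (D.coord_type hτ).coord_toSimplex i
  have h1 := key _ _ ((congrArg (Coord · _) (congrArg deg D.dg_std)).mpr
    ((congrArg (Coord D.deg) e).mpr hτ)) D.dg_std e
  exact ((ex_cellData _ _).choose_spec D.standard rfl _).symm.trans h1

lemma eq_of_image_eq {φ φ' : ℕ → ℝ} (hφ : ∀ a b, a < b → b < N → φ a < φ b)
    (hφ' : ∀ a b, a < b → b < N → φ' a < φ' b)
    (H : (range N).image φ = (range N).image φ') (hk : k < N) :
    φ k = φ' k := by
  have h1 : φ k ∈ (range N).image φ' := H ▸ Finset.mem_image_of_mem φ (mem_range.2 hk)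
  obtain ⟨l, hl, e⟩ := mem_image.1 h1
  have h2 := card_filter_lt_image hφ hk
  rw [H, ← e, card_filter_lt_image hφ' (mem_range.1 hl)] at h2; rw [← e, h2]

lemma Diagram.radPoint_inj {D D' : Diagram h n m} {hτ : Coord D.deg τ}
    {hτ' : Coord D'.deg τ'} (hpos : ∀ i k, k ≤ D.deg i → 0 < τ i k)
    (hpos' : ∀ i k, k ≤ D'.deg i → 0 < τ' i k) (H : D.radPoint hτ = D'.radPoint hτ') :
    D.type = D'.type ∧ τ = τ' := by
  have h1 := congrArg Rad.data H
  rw [data_radPoint, data_radPoint] at h1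
  obtain ⟨h2, h3⟩ := Prod.ext_iff.1 h1
  have e : ∀ (D : Diagram h n m) {τ} (hτ : Coord D.deg τ), (∀ i k, k ≤ D.deg i → 0 < τ i k) →
      CombType.mk (D.real hτ) = D.type := fun D τ hτ hpos =>
    mk_eq_of_dg_eq (D.uni_real hτ) D.uni_std (D.dg_std.trans (D.dg_real hτ hpos).symm)
  have h4 : D.type = D'.type := (e D hτ hpos).symm.trans (h2.trans (e D' hτ' hpos'))
  refine ⟨h4, ?_⟩
  have hdeg : ∀ i, D.deg i = D'.deg i := fun i => by rw [← D.deg_type, ← D'.deg_type, h4]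
  funext i
  have h5 : ∀ k, k < D.deg i + 1 → psum τ i k = psum τ' i k := fun k hk => by
    have h6 : (D.real hτ).walls i = (D'.real hτ').walls i := congrFun h3 i
    rw [walls_real _ hτ hpos, walls_real _ hτ' hpos', ← hdeg] at h6
    exact mul_left_cancel₀ Real.two_pi_pos.ne' (eq_of_image_eq (D.psum_strictMono hτ hpos i)
      (by rw [hdeg]; exact D'.psum_strictMono hτ' hpos' i) h6 hk)
  have h6 : ∀ k, k ≤ D.deg i + 1 → psum τ i k = psum τ' i k := fun k hk => by
    rcases hk.lt_or_eq with hk | rfl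
    · exact h5 k hk
    · exact (hτ.sum_eq i).trans (by rw [hdeg]; exact (hτ'.sum_eq i).symm)
  funext k
  by_cases hk : k ≤ D.deg i
  · have h7 := h6 (k + 1) (by omega)
    unfold psum at h7
    rw [sum_range_succ, sum_range_succ] at h7
    have h8 := h6 k (by omega)
    unfold psum at h8
    linarith
  · rw [hτ.eq_zero i k (by omega), hτ'.eq_zero i k (by rw [← hdeg]; omega)]

instance : Finite (Diagram h n m) := by
  let N := Fintype.card (Mark h m) + 1
  have hdeg : ∀ (D : Diagram h n m) i, D.deg i < N := fun D i => by
    choose x h1 h2 using fun k : Fin (D.deg i) => D.ex_pos i (k + 1) (by omega) (by omega)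
    have h3 : Injective x := fun k l hkl => by grind
    have := Fintype.card_le_of_injective x h3
    rw [Fintype.card_fin] at this; exact lt_succ_of_le this
  let code : Diagram h n m → Perm (Fin (2 * h)) × Perm (Mark h m) × (Mark h m → Fin n) ×
      (Fin n → Fin N) × (Mark h m → Fin N) × (Mark h m → Fin 2) := fun D =>
    (D.pairing, D.succ, D.ann, fun i => ⟨D.deg i, hdeg D i⟩,
      fun x => ⟨D.pos x, (D.pos_le x).trans_lt (hdeg D _)⟩,
      fun x => ⟨D.wrap x, lt_succ_of_le (D.wrap_le_one x)⟩)
  refine Finite.of_injective code fun D D' H => ?_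
  simp only [code, Prod.mk.injEq, funext_iff, Fin.mk.injEq] at H
  obtain ⟨h1, h2, h3, h4, h5, h6⟩ := H
  exact Diagram.ext h1 h2 (funext h3) (funext h4) (funext h5) (funext h6)

instance : Finite (UnilevelType h n m) :=
  Finite.of_surjective (fun D : Diagram h n m => (⟨D.type, D.uni_type⟩ : UnilevelType h n m))
    fun ⟨_, H⟩ => H.ex_dg.imp fun _ h' => Subtype.ext h'

lemma coord_coface_iff (hq : q i = q' i + 1) (hq' : ∀ k, k ≠ i → q k = q' k) (hj : j ≤ q i)
    (h1 : τ i = coface j (τ' i)) (h2 : ∀ k, k ≠ i → τ k = τ' k) : Coord q τ ↔ Coord q' τ' := by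
  have hs : ∑ k ∈ range (q i + 1), τ i k = ∑ k ∈ range (q' i + 1), τ' i k := by
    rw [h1, sum_coface, if_neg (by omega), hq]; rfl
  have h3 : ∀ k, τ' i k = τ i (if k < j then k else k + 1) := fun k => by
    rw [h1]; unfold coface; split_ifs <;> first | rfl | omega
  constructor
  · refine fun H => ⟨fun l k => ?_, fun l k hk => ?_, fun l => ?_⟩ <;> by_cases hl : l = i
    · subst hl; rw [h3]; exact H.nonneg _ _
    · rw [← h2 l hl]; exact H.nonneg _ _
    · subst hl; rw [h3]; exact H.eq_zero _ _ (by split_ifs <;> omega)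
    · rw [← h2 l hl]; exact H.eq_zero _ _ (by rwa [hq' l hl])
    · subst hl; rw [← hs]; exact H.sum_eq _
    · rw [← h2 l hl, ← hq' l hl]; exact H.sum_eq _
  · refine fun H => ⟨fun l k => ?_, fun l k hk => ?_, fun l => ?_⟩ <;> by_cases hl : l = i
    · subst hl; rw [h1]; unfold coface; split_ifs; exacts [H.nonneg _ _, le_rfl, H.nonneg _ _]
    · rw [h2 l hl]; exact H.nonneg _ _
    · subst hl
      rw [h1, coface, if_neg (by omega), if_neg (by omega)]; exact H.eq_zero _ _ (by omega)
    · rw [h2 l hl]; exact H.eq_zero _ _ (by rwa [← hq' l hl])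
    · subst hl; rw [hs]; exact H.sum_eq _
    · rw [h2 l hl, hq' l hl]; exact H.sum_eq _

lemma Diagram.col_deg (D : Diagram h n m) (hd : 1 ≤ D.deg i)
    (hj : j ≤ D.deg i) : D.deg i = (D.collapse i j hd hj).deg i + 1 ∧
      ∀ k, k ≠ i → D.deg k = (D.collapse i j hd hj).deg k := by
  refine ⟨?_, fun k hk => ?_⟩
  · simp [collapse]; omega
  · simp [collapse, hk]

lemma Diagram.ex_faces (D : Diagram h n m) :
    ∃ S : Set (Diagram h n m × ((Fin n → ℕ → ℝ) → Fin n → ℕ → ℝ)), S.Finite ∧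
      (∀ p ∈ S, Continuous p.2 ∧ (∀ u (hu : Coord p.1.deg u),
        ∃ hτ : Coord D.deg (p.2 u), D.radPoint hτ = p.1.radPoint hu) ∧
        ((∑ i, p.1.deg i) < ∑ i, D.deg i ∨ p = (D, id))) ∧
      ∀ τ, Coord D.deg τ → ∃ p ∈ S, ∃ u, Coord p.1.deg u ∧ (∀ i k, k ≤ p.1.deg i → 0 < u i k) ∧
        p.2 u = τ := by
  induction hN : ∑ i, D.deg i using strong_induction_on generalizing D with
  | _ N ih =>
  subst hN
  have hlt : ∀ i (j : Fin (D.deg i + 1)) (hd : 1 ≤ D.deg i),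
      ∑ k, (D.collapse i j hd (lt_succ_iff.1 j.2)).deg k < ∑ k, D.deg k := fun i j hd => by
    obtain ⟨h1, h2⟩ := D.col_deg hd (lt_succ_iff.1 j.2)
    refine Finset.sum_lt_sum (fun k _ => ?_) ⟨i, mem_univ _, by omega⟩; grind
  choose S hfin hS hS' using fun i j hd => ih _ (hlt i j hd) _ rfl
  refine ⟨{(D, id)} ∪ ⋃ i, ⋃ j : Fin (D.deg i + 1), ⋃ hd, (fun p => (p.1, fun u =>
    update (p.2 u) i (coface j (p.2 u i)))) '' S i j hd, ?_, ?_, fun τ hτ => ?_⟩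
  · exact (Set.finite_singleton _).union (Set.finite_iUnion fun i => Set.finite_iUnion fun j =>
      Set.finite_iUnion fun hd => (hfin i j hd).image _)
  · rintro p (rfl | hp)
    · exact ⟨continuous_id, fun u hu => ⟨hu, rfl⟩, .inr rfl⟩
    · simp only [Set.mem_iUnion] at hp; obtain ⟨i, j, hd, p, hp, rfl⟩ := hp
      obtain ⟨h1, h2, h3⟩ := hS i j hd p hp
      have hD := D.col_deg hd (lt_succ_iff.1 j.2)
      refine ⟨h1.update i ?_, fun u hu => ?_, .inl (lt_of_le_of_lt ?_ (hlt i j hd))⟩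
      · refine continuous_pi fun k => ?_
        have h4 : ∀ l, Continuous fun u => p.2 u i l := fun l =>
          (continuous_apply l).comp ((continuous_apply i).comp h1)
        unfold coface; split_ifs; exacts [h4 _, continuous_const, h4 _]
      · obtain ⟨hu', e⟩ := h2 u hu; have e1 := update_self i (coface j (p.2 u i)) (p.2 u)
        have e2 : ∀ k, k ≠ i → update (p.2 u) i (coface j (p.2 u i)) k = p.2 u k :=
          fun k hk => update_of_ne hk _ _
        have h5 := (coord_coface_iff hD.1 hD.2 (lt_succ_iff.1 j.2) e1 e2).2 hu'
        exact ⟨h5, (radPoint_col hd _ h5 hu' e1 e2).trans e⟩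
      grind
  · by_cases hpos : ∀ i k, k ≤ D.deg i → 0 < τ i k
    · exact ⟨_, .inl rfl, τ, hτ, hpos, rfl⟩
    push Not at hpos; obtain ⟨i, j, hj, h0⟩ := hpos
    have h0 : τ i j = 0 := le_antisymm h0 (hτ.nonneg i j)
    have hd : 1 ≤ D.deg i := by
      by_contra h'; have h1 := hτ.sum_eq i
      obtain rfl : j = 0 := by omega
      rw [show D.deg i = 0 by omega, Finset.sum_range_one, h0] at h1; exact zero_ne_one h1
    let τ' := update τ i fun k => τ i (if k < j then k else k + 1)
    have e2 : ∀ k, k ≠ i → τ k = τ' k := fun k hk => (update_of_ne hk _ _).symm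
    have e1 : τ i = coface j (τ' i) := by
      funext k; simp only [τ', update_self, coface]; grind
    have hD := D.col_deg hd hj
    obtain ⟨p, hp, u, hu, hpos, e⟩ := hS' i ⟨j, lt_succ_of_le hj⟩ hd τ'
      ((coord_coface_iff hD.1 hD.2 hj e1 e2).1 hτ)
    refine ⟨_, .inr (Set.mem_iUnion.2 ⟨i, Set.mem_iUnion.2 ⟨⟨j, lt_succ_of_le hj⟩,
      Set.mem_iUnion.2 ⟨hd, p, hp, rfl⟩⟩⟩), u, hu, hpos, ?_⟩
    funext k; by_cases hk : k = i
    · subst hk; simp only [update_self, e, e1]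
    · simp only [update_of_ne hk, e, e2 k hk]

end RadialSlit

/-! # The homeomorphism -/

namespace RadialSlit

open PreConfig FatGraphs

variable {h n m : ℕ}

namespace Diagram

variable {D D' : Diagram h n m} {τ τ' : Fin n → ℕ → ℝ}

lemma toRad_toSD_radPoint (hτ : Coord D.deg τ) : (toSD (D.radPoint hτ)).toRad = D.radPoint hτ :=
  (toRad_toSD_mk D.standard _).trans (Rad.point_congr _ _ _ _ (congrArg type D.dg_std)
    (funext fun i => (D.coord_type hτ).coord_toSimplex i) rfl)

lemma toSD_radPoint_inj :
    toSD (D.radPoint hτ) = toSD (D'.radPoint hτ') ↔ D.radPoint hτ = D'.radPoint hτ' :=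
  ⟨fun H => by rw [← toRad_toSD_radPoint hτ, H, toRad_toSD_radPoint], congrArg _⟩

end Diagram

lemma URad.ex_dg (x : URad h n m) :
    ∃ (D : Diagram h n m) (τ : _) (hτ : Coord D.deg τ), x.1 = D.radPoint hτ := by
  obtain ⟨_, T, t, H, rfl⟩ := x
  obtain ⟨D, e⟩ := H.ex_dg
  exact ⟨D, _, _, D.mk_eq_radPoint e t⟩

lemma ex_toRad (s : SD h n m) :
    ∃ (T : CombType h n m) (t : T.Cell), T.Unilevel ∧ s.toRad = Rad.mk T t := by
  obtain ⟨x, rfl⟩ := Quot.exists_rep s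
  obtain ⟨⟨G, len⟩, rfl⟩ := Quot.exists_rep x
  exact ⟨_, _, uni_cType G, rfl⟩

/-- The homeomorphism from the unilevel harmonic compactification to Sullivan diagrams. -/
def homeo : URad h n m ≃ₜ SD h n m where
  toFun x := toSD x.1
  invFun s := ⟨s.toRad, ex_toRad s⟩
  left_inv x := Subtype.ext (by
    obtain ⟨D, τ, hτ, e⟩ := x.ex_dg
    simp only [e]; exact Diagram.toRad_toSD_radPoint hτ)
  right_inv s := toSD_toRad s
  continuous_toFun := continuous_toSD.comp continuous_subtype_val
  continuous_invFun := SD.continuous_toRad.subtype_mk _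

lemma isCompact_coord (q : Fin n → ℕ) : IsCompact {τ | Coord q τ} := by
  refine (isCompact_univ_pi fun _ => isCompact_univ_pi fun _ : ℕ =>
    isCompact_Icc (a := (0 : ℝ)) (b := 1)).of_isClosed_subset ?_ ?_
  · have e : {τ | Coord q τ} = {τ | (∀ i k, 0 ≤ τ i k) ∧ (∀ i k, q i < k → τ i k = 0) ∧
        ∀ i, ∑ k ∈ range (q i + 1), τ i k = 1} :=
      Set.ext fun τ => ⟨fun H => ⟨H.1, H.2, H.3⟩, fun H => ⟨H.1, H.2.1, H.2.2⟩⟩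
    have h1 : ∀ i k, Continuous fun τ : Fin n → ℕ → ℝ => τ i k := fun i k => by fun_prop
    rw [e]; simp only [Set.ofPred_and, Set.ofPred_forall]
    exact (isClosed_iInter fun i => isClosed_iInter fun k => isClosed_le continuous_const (h1 i k)).inter
      ((isClosed_iInter fun i => isClosed_iInter fun k => isClosed_iInter fun _ =>
        isClosed_eq (h1 i k) continuous_const).inter (isClosed_iInter fun i =>
        isClosed_eq (continuous_finsetSum _ fun k _ => h1 i k) continuous_const))
  · intro τ H i _ k _; refine ⟨H.nonneg i k, ?_⟩; by_cases hk : q i < k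
    · rw [H.eq_zero i k hk]; exact zero_le_one
    · rw [← H.sum_eq i]
      exact Finset.single_le_sum (fun l _ => H.nonneg i l) (mem_range.2 (by omega))

variable (h n m) in
/-- The disjoint union of the closed cells of all diagrams. -/
abbrev Cells : Type := Σ D : Diagram h n m, {τ // Coord D.deg τ}

instance (D : Diagram h n m) : CompactSpace {τ // Coord D.deg τ} :=
  isCompact_iff_compactSpace.1 (isCompact_coord D.deg)

/-- The Sullivan diagram of a point of the disjoint union of all cells. -/
def Cells.toSD (x : Cells h n m) : SD h n m := FatGraphs.toSD (x.1.radPoint x.2.2)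

lemma continuous_radPoint (D : Diagram h n m) :
    Continuous fun τ : {τ // Coord D.deg τ} => D.radPoint τ.2 :=
  Rad.continuous_point _ _ _ (fun i k => (continuous_apply k).comp
    ((continuous_apply i).comp continuous_subtype_val)) fun _ => continuous_const

lemma isQuotientMap_toSD : Topology.IsQuotientMap (Cells.toSD (h := h) (n := n) (m := m)) := by
  have h1 : ∀ T : CombType h n m, T.out.diagram.deg = T.radialDegree := fun T =>
    congrArg CombType.radialDegree (Quot.out_eq T)
  let g : (Σ T : CombType h n m, T.Cell) → Cells h n m := fun x =>
    ⟨x.1.out.diagram, fun i => coord (x.2.1 i), (h1 x.1).symm ▸ coord_coord x.2.1⟩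
  have h4 : ∀ T : CombType h n m, Continuous fun t : T.Cell => fun i k => coord (t.1 i) k := fun T =>
    continuous_pi fun i => continuous_pi fun k =>
      (continuous_coord k).comp ((continuous_apply i).comp continuous_fst)
  have hg : Continuous g := continuous_sigma fun T => Continuous.comp
    (g := (Sigma.mk T.out.diagram : _ → Cells h n m)) continuous_sigmaMk
    (Continuous.subtype_mk (p := Coord T.out.diagram.deg) (h4 T) fun t => (g ⟨T, t⟩).2.2)
  refine Topology.IsQuotientMap.of_comp hg
    (continuous_sigma fun D => continuous_toSD.comp (continuous_radPoint D)) ?_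
  have h2 : Topology.IsQuotientMap (FatGraphs.toSD (h := h) (n := n) (m := m)) :=
    Topology.IsQuotientMap.of_inverse SD.continuous_toRad continuous_toSD toSD_toRad
  have h3 : Topology.IsQuotientMap fun x : Σ T : CombType h n m, T.Cell => Rad.mk x.1 x.2 :=
    isQuotientMap_quot_mk
  refine (?_ : Cells.toSD ∘ g = _) ▸ h2.comp h3; funext ⟨T, t⟩
  have key : ∀ (L : PreConfig h n m) (hL : mk L = T)
      (hτ : Coord L.diagram.deg fun i => coord (t.1 i)),
      FatGraphs.toSD (L.diagram.radPoint hτ) = FatGraphs.toSD (Rad.mk T t) := by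
    rintro L rfl hτ; rw [← toSD_toRad (FatGraphs.toSD (Rad.mk _ t)), toRad_toSD_mk]; rfl
  exact key _ (Quot.out_eq T) (g ⟨T, t⟩).2.2

lemma isClosed_eq_toSD : IsClosed {p : Cells h n m × Cells h n m | p.1.toSD = p.2.toSD} := by
  choose S hfin hS hS' using Diagram.ex_faces (h := h) (n := n) (m := m)
  let f : ∀ (D D' : Diagram h n m) (p : S D) (p' : S D'), p.1.1.type = p'.1.1.type →
      {τ // Coord p.1.1.deg τ} → Cells h n m × Cells h n m := fun D D' p p' e u =>
    (⟨D, p.1.2 u, ((hS D p p.2).2.1 u u.2).1⟩, ⟨D', p'.1.2 u, ((hS D' p' p'.2).2.1 u (by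
      rw [← funext p'.1.1.deg_type, ← e, funext p.1.1.deg_type]; exact u.2)).1⟩)
  have e : {p : Cells h n m × Cells h n m | p.1.toSD = p.2.toSD} =
      ⋃ D, ⋃ D', ⋃ p : S D, ⋃ p' : S D', ⋃ e, Set.range (f D D' p p' e) := by
    ext ⟨⟨D, τ, hτ⟩, ⟨D', τ', hτ'⟩⟩; simp only [Set.mem_iUnion, Set.mem_range, mem_ofPred_eq]
    refine Diagram.toSD_radPoint_inj.trans ⟨fun H => ?_, ?_⟩
    · obtain ⟨p, hp, u, hu, hpos, rfl⟩ := hS' D τ hτ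
      obtain ⟨p', hp', u', hu', hpos', rfl⟩ := hS' D' τ' hτ'
      obtain ⟨_, e1⟩ := (hS D p hp).2.1 u hu
      obtain ⟨_, e2⟩ := (hS D' p' hp').2.1 u' hu'
      obtain ⟨e3, rfl⟩ := Diagram.radPoint_inj hpos hpos' (e1.symm.trans (H.trans e2))
      exact ⟨D, D', ⟨p, hp⟩, ⟨p', hp'⟩, e3, ⟨u, hu⟩, rfl⟩
    · rintro ⟨D, D', ⟨p, hp⟩, ⟨p', hp'⟩, e, ⟨u, hu⟩, H⟩; obtain ⟨_, e1⟩ := (hS D p hp).2.1 u hu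
      have hu' : Coord p'.1.deg u := by
        rw [← funext p'.1.deg_type, ← e, funext p.1.deg_type]; exact hu
      grind [Diagram.deg_type, Diagram.radPoint_congr]
  have := fun D => (hfin D).to_subtype
  rw [e]
  refine isClosed_iUnion_of_finite fun D => isClosed_iUnion_of_finite fun D' =>
    isClosed_iUnion_of_finite fun p => isClosed_iUnion_of_finite fun p' =>
    isClosed_iUnion_of_finite fun e => (isCompact_range ?_).isClosed
  have h1 := ((hS D p p.2).1.comp continuous_subtype_val : Continuous
    fun u : {τ // Coord p.1.1.deg τ} => p.1.2 u)
  have h2 := ((hS D' p' p'.2).1.comp continuous_subtype_val : Continuous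
    fun u : {τ // Coord p.1.1.deg τ} => p'.1.2 u)
  exact (Continuous.comp (g := (Sigma.mk D : _ → Cells h n m)) continuous_sigmaMk
    (h1.subtype_mk fun u => ((hS D p p.2).2.1 u u.2).1)).prodMk
    (Continuous.comp (g := (Sigma.mk D' : _ → Cells h n m)) continuous_sigmaMk (h2.subtype_mk _))

lemma t2Space_of_isClosed_eq [TopologicalSpace X] [TopologicalSpace Y]
    [CompactSpace X] [T2Space X] {f : X → Y} (hf : Topology.IsQuotientMap f)
    (H : IsClosed {p : X × X | f p.1 = f p.2}) : T2Space Y := by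
  have hc : IsClosedMap f := fun C hC => by
    rw [← hf.isClosed_preimage]
    have e : f ⁻¹' (f '' C) = Prod.snd '' ({p : X × X | f p.1 = f p.2} ∩ Prod.fst ⁻¹' C) := by
      ext x
      exact ⟨fun ⟨y, hy, e⟩ => ⟨(y, x), ⟨e, hy⟩, rfl⟩, fun ⟨p, ⟨e, hy⟩, e'⟩ => ⟨p.1, hy, e' ▸ e⟩⟩
    rw [e]; exact ((H.inter (hC.preimage continuous_fst)).isCompact.image continuous_snd).isClosed
  have h1 : ∀ y, IsClosed (f ⁻¹' {y}) := fun y => by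
    obtain ⟨x, rfl⟩ := hf.surjective y
    exact H.preimage (continuous_id.prodMk continuous_const)
  refine ⟨fun y y' hy => ?_⟩
  obtain ⟨U, V, hU, hV, h2, h3, h4⟩ := normal_separation (h1 y) (h1 y')
    (disjoint_left.2 fun x hx hx' => hy (hx.symm.trans hx'))
  refine ⟨(f '' Uᶜ)ᶜ, (f '' Vᶜ)ᶜ, (hc _ hU.isClosed_compl).isOpen_compl,
    (hc _ hV.isClosed_compl).isOpen_compl, ?_, ?_, disjoint_left.2 fun z hz hz' => ?_⟩
  · rintro ⟨x, hx, e⟩; exact hx (h2 e)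
  · rintro ⟨x, hx, e⟩; exact hx (h3 e)
  · obtain ⟨x, rfl⟩ := hf.surjective z; grind

instance : T2Space (SD h n m) := t2Space_of_isClosed_eq isQuotientMap_toSD isClosed_eq_toSD

instance : T2Space (URad h n m) := homeo.symm.t2Space

end RadialSlit

/-! # Cell structures -/

namespace RadialSlit

open Metric Set Topology

lemma continuousOn_invFunOn [TopologicalSpace E] [TopologicalSpace X] [T2Space X]
    [Nonempty E] {f : E → X} {s K : Set E} (hK : IsCompact K) (hsK : s ⊆ K) (hf : ContinuousOn f K)
    (hinj : InjOn f s) (hd : ∀ x ∈ K, f x ∈ f '' s → x ∈ s) :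
    ContinuousOn (Function.invFunOn f s) (f '' s) := by
  rw [continuousOn_iff_isClosed]
  refine fun t ht => ⟨f '' (K ∩ t), ((hK.inter_right ht).image_of_continuousOn
    (hf.mono inter_subset_left)).isClosed, ?_⟩
  ext y; refine and_congr_left ?_; rintro ⟨x, hx, rfl⟩
  rw [mem_preimage, hinj.leftInvOn_invFunOn hx]; refine ⟨fun h' => ⟨x, ⟨hsK hx, h'⟩, rfl⟩, ?_⟩
  rintro ⟨z, ⟨hz, hz'⟩, e⟩; rwa [← hinj (hd z hz ⟨x, hx, e.symm⟩) hx e]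

lemma exists_cwComplex.{u} {ι : Type} [Finite ι] {X : Type u} [TopologicalSpace X] [T2Space X]
    (d : ι → ℕ) (O : ι → Set X) (hdisj : ∀ i j, ∀ x ∈ O i, x ∈ O j → i = j)
    (hunion : ∀ x, ∃ i, x ∈ O i)
    (H : ∀ i, ∃ f : (Fin (d i) → ℝ) → X, ContinuousOn f (closedBall 0 1) ∧ InjOn f (ball 0 1) ∧
      f '' ball 0 1 = O i ∧ ∀ x ∈ sphere 0 1, ∃ j, d j < d i ∧ f x ∈ O j) :
    ∃ (_ : CWComplex (univ : Set X)) (c : (Σ k, RelCWComplex.cell (univ : Set X) k) ≃ ι),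
      (∀ a, RelCWComplex.openCell a.1 a.2 = O (c a) ∧ a.1 = d (c a)) ∧
      ∀ k : ℕ, (RelCWComplex.skeleton (univ : Set X) k : Set X) = ⋃ j, ⋃ (_ : d j ≤ k), O j := by
  suffices h1 : ∃ (_ : CWComplex (univ : Set X)) (c : (Σ k, RelCWComplex.cell (univ : Set X) k) ≃ ι),
      ∀ a, RelCWComplex.openCell a.1 a.2 = O (c a) ∧ a.1 = d (c a) by
    obtain ⟨_, c, hc⟩ := h1
    refine ⟨inferInstance, c, hc, fun k => ?_⟩; rw [← CWComplex.iUnion_openCell_eq_skeletonLT]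
    ext x; simp only [mem_iUnion]
    have h2 : ∀ l : ℕ, (l : ℕ∞) < k + 1 ↔ l ≤ k := fun l => by
      rw [← Nat.cast_one, ← Nat.cast_add, Nat.cast_lt, lt_succ_iff]
    constructor
    · rintro ⟨l, hl, a, hx⟩; obtain ⟨h3, h4⟩ := hc ⟨l, a⟩; grind
    · rintro ⟨j, hj, hx⟩; obtain ⟨⟨l, a⟩, rfl⟩ := c.surjective j; grind
  have H' : ∀ k (i : ULift.{u} {i // d i = k}), ∃ f : (Fin k → ℝ) → X,
      ContinuousOn f (closedBall 0 1) ∧ InjOn f (ball 0 1) ∧ f '' ball 0 1 = O i.down ∧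
      ∀ x ∈ sphere 0 1, ∃ j, d j < k ∧ f x ∈ O j := by
    rintro _ ⟨i, rfl⟩; exact H i
  choose f h1 h2 h3 h4 using H'
  let g : ∀ k (i : ULift.{u} {i // d i = k}), PartialEquiv (Fin k → ℝ) X := fun k i =>
    (h2 k i).bijOn_image.toPartialEquiv (f k i) (ball 0 1) (f k i '' ball 0 1)
  have hO : ∀ x i, x ∈ O i → x ∈ f (d i) ⟨i, rfl⟩ '' closedBall 0 1 := fun x i hx =>
    image_mono ball_subset_closedBall ((h3 (d i) ⟨i, rfl⟩).symm ▸ hx)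
  refine ⟨CWComplex.mkFinite univ (fun k => ULift.{u} {i // d i = k}) g ?_ ?_ ?_ ?_ ?_ ?_ ?_ ?_, ?_⟩
  · have := (Set.finite_range d).bddAbove; obtain ⟨N, hN⟩ := this
    filter_upwards [Filter.eventually_gt_atTop N] with k hk
    exact ⟨fun ⟨i, hi⟩ => absurd (hN ⟨i, rfl⟩) (by omega)⟩
  · exact fun k => inferInstance
  · exact fun k i => rfl
  · exact fun k i => h1 k i
  · refine fun k i => continuousOn_invFunOn (isCompact_closedBall 0 1) ball_subset_closedBall (h1 k i)
      (h2 k i) fun x hx hx' => ?_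
    by_contra h'; obtain ⟨j, hj, hxj⟩ := h4 k i x (by rw [← closedBall_sdiff_ball]; exact ⟨hx, h'⟩)
    grind
  · rintro ⟨k, ⟨i, rfl⟩⟩ - ⟨l, ⟨j, rfl⟩⟩ - hne; refine disjoint_left.2 fun x hx hx' => hne ?_
    have e : i = j := hdisj i j x (h3 (d i) ⟨i, rfl⟩ ▸ hx) (h3 (d j) ⟨j, rfl⟩ ▸ hx')
    subst e; rfl
  · intro k i x hx; obtain ⟨j, hj, hx'⟩ := h4 k i x hx
    exact mem_iUnion₂.2 ⟨d j, hj, mem_iUnion.2 ⟨⟨j, rfl⟩, hO _ _ hx'⟩⟩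
  · refine eq_univ_of_forall fun x => ?_; obtain ⟨i, hi⟩ := hunion x
    exact mem_iUnion₂.2 ⟨d i, ⟨i, rfl⟩, hO _ _ hi⟩
  · refine ⟨(Equiv.sigmaCongrRight fun k => Equiv.ulift).trans (Equiv.sigmaFiberEquiv d), ?_⟩
    rintro ⟨k, ⟨i, rfl⟩⟩; exact ⟨h3 (d i) ⟨i, rfl⟩, rfl⟩

variable {h n m : ℕ}

lemma ex_chart (q : Fin n → ℕ) (hk : ∑ i, q i = k) :
    ∃ f : (Fin k → ℝ) → Fin n → ℕ → ℝ, Continuous f ∧ (∀ x ∈ closedBall 0 1, Coord q (f x)) ∧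
      InjOn f (ball 0 1) ∧ (∀ x ∈ ball 0 1, ∀ i k, k ≤ q i → 0 < f x i k) ∧
      (∀ τ, Coord q τ → (∀ i k, k ≤ q i → 0 < τ i k) → ∃ x ∈ ball 0 1, f x = τ) ∧
      ∀ x ∈ sphere 0 1, ∃ i k, k ≤ q i ∧ f x i k = 0 := by
  let e : Fin k ≃ Σ i, Fin (q i) := (Fintype.equivFinOfCardEq (by simp [hk])).symm
  obtain ⟨g, g_def⟩ : ∃ g : (Fin k → ℝ) → Fin n → ℕ → ℝ, ∀ x i l, g x i l =
      if hl : l < q i then x (e.symm ⟨i, l, hl⟩)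
      else if l = q i then 1 - ∑ j : Fin (q i), x (e.symm ⟨i, j⟩) else 0 := ⟨_, fun _ _ _ => rfl⟩
  have hgc : ∀ i l, Continuous fun x => g x i l := fun i l => by
    simp only [g_def]; split_ifs <;> fun_prop
  have hg : Continuous g := continuous_pi fun i => continuous_pi fun l => hgc i l
  have g_lt : ∀ x i (j : Fin (q i)), g x i j = x (e.symm ⟨i, j⟩) := fun x i j =>
    (g_def _ _ _).trans (dif_pos j.2)
  have g_last : ∀ x i, g x i (q i) = 1 - ∑ j : Fin (q i), x (e.symm ⟨i, j⟩) := fun x i => by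
    simp [g_def]
  have g_sum : ∀ x i, ∑ l ∈ range (q i + 1), g x i l = 1 := fun x i => by
    rw [sum_range_succ, g_last, sum_range]; simp only [g_lt]; ring
  have g_zero : ∀ x i l, q i < l → g x i l = 0 := fun x i l hl => by
    simp [g_def, not_lt_of_gt hl, hl.ne']
  have g_coord : ∀ x, (∀ i l, l ≤ q i → 0 ≤ g x i l) → Coord q (g x) := fun x hx =>
    ⟨fun i l => (le_or_gt l (q i)).elim (hx i l) fun hl => (g_zero x i l hl).ge, g_zero x, g_sum x⟩
  have g_inj : ∀ x y, g x = g y → x = y := fun x y hxy => funext fun a => by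
    have h1 := congrFun (congrFun hxy (e a).1) (e a).2
    rwa [g_lt, g_lt, Sigma.eta, e.symm_apply_apply] at h1
  have g_surj : ∀ τ, Coord q τ → ∃ x, g x = τ := fun τ hτ => by
    refine ⟨fun a => τ (e a).1 (e a).2, funext fun i => funext fun l => ?_⟩; have h1 := hτ.sum_eq i
    rw [sum_range_succ, sum_range] at h1; rcases lt_trichotomy l (q i) with hl | rfl | hl
    · grind
    · grind
    · rw [g_zero _ _ _ hl, hτ.eq_zero _ _ hl]
  let U : Set (Fin k → ℝ) := {x | ∀ i, ∀ l : Fin (q i + 1), 0 < g x i l}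
  have hU : IsOpen U := by
    simp only [U, Set.ofPred_forall]
    exact isOpen_iInter_of_finite fun i => isOpen_iInter_of_finite fun l =>
      isOpen_lt continuous_const (hgc _ _)
  have hcl : closure U ⊆ {x | ∀ i l, l ≤ q i → 0 ≤ g x i l} := by
    refine closure_minimal (fun x hx i l hl => (hx i ⟨l, lt_succ_of_le hl⟩).le) ?_
    simp only [Set.ofPred_forall]
    exact isClosed_iInter fun i => isClosed_iInter fun l => isClosed_iInter fun _ =>
      isClosed_le continuous_const (hgc _ _)
  have hconv : Convex ℝ U := by
    intro x hx y hy a b ha hb hab i l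
    have h1 : g (a • x + b • y) i l = a * g x i l + b * g y i l := by
      rcases (lt_succ_iff.1 l.2).lt_or_eq with hl | hl
      · simp [g_def, hl]
      · rw [hl, g_last, g_last, g_last]
        simp only [Pi.add_apply, Pi.smul_apply, smul_eq_mul, sum_add_distrib, ← mul_sum]
        linear_combination -hab
    rw [h1]; rcases ha.lt_or_eq with ha | rfl
    · exact add_pos_of_pos_of_nonneg (mul_pos ha (hx i l)) (mul_nonneg hb (hy i l).le)
    grind
  have hbdd : Bornology.IsBounded U := by
    refine (isBounded_Icc (0 : Fin k → ℝ) 1).subset fun x hx => ?_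
    have h1 : Coord q (g x) := g_coord x fun i l hl => (hx i ⟨l, lt_succ_of_le hl⟩).le
    have h2 : ∀ a, x a = g x (e a).1 (e a).2 := fun a => by rw [g_lt, Sigma.eta, e.symm_apply_apply]
    refine ⟨fun a => h2 a ▸ h1.nonneg _ _, fun a => ?_⟩; rw [h2, Pi.one_apply, ← h1.sum_eq (e a).1]
    exact Finset.single_le_sum (f := g x (e a).1) (fun l _ => h1.nonneg _ l)
      (mem_range.2 (by omega))
  have hne : U.Nonempty := by
    obtain ⟨x, hx⟩ := g_surj _ (Diagram.coord_uniform q)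
    exact ⟨x, fun i l => hx ▸ Diagram.uniform_pos (lt_succ_iff.1 l.2)⟩
  obtain ⟨φ, h1, h2, h3⟩ := exists_homeomorph_image_interior_closure_frontier_eq_unitBall hconv
    (hU.interior_eq.symm ▸ hne) hbdd
  rw [hU.interior_eq] at h1
  refine ⟨fun x => g (φ.symm x), hg.comp φ.symm.continuous, fun x hx => ?_, fun x _ y _ hxy =>
    φ.symm.injective (g_inj _ _ hxy), fun x hx i l hl => ?_, fun τ hτ hpos => ?_, fun x hx => ?_⟩
  · rw [← h2] at hx; obtain ⟨y, hy, rfl⟩ := hx; simp only [φ.symm_apply_apply]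
    exact g_coord y (hcl hy)
  · rw [← h1] at hx; obtain ⟨y, hy, rfl⟩ := hx; simp only [φ.symm_apply_apply]
    exact hy i ⟨l, lt_succ_of_le hl⟩
  · obtain ⟨x, rfl⟩ := g_surj τ hτ
    exact ⟨φ x, h1 ▸ ⟨x, fun i l => hpos i l (lt_succ_iff.1 l.2), rfl⟩, by
      simp only [φ.symm_apply_apply]⟩
  · rw [← h3, hU.frontier_eq] at hx; obtain ⟨y, ⟨hy, hy'⟩, rfl⟩ := hx
    simp only [φ.symm_apply_apply]; grind

lemma Diagram.mem_openCell {D : Diagram h n m} {T : UnilevelType h n m} (e : D.type = T.1)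
    {x : URad h n m} : x ∈ URad.openCell T ↔ ∃ (τ : _) (hτ : Coord D.deg τ),
      (∀ i k, k ≤ D.deg i → 0 < τ i k) ∧ x.1 = D.radPoint hτ := by
  obtain ⟨_, hT⟩ := T
  obtain rfl : D.type = _ := e
  constructor
  · rintro ⟨t, ht, hx⟩; refine ⟨_, _, fun i k hk => ?_, hx.trans (D.mk_eq_radPoint rfl t)⟩
    rw [coord_of_lt _ (by rw [D.deg_type]; omega)]; exact ht.1 i _
  · rintro ⟨τ, hτ, hpos, hx⟩
    refine ⟨⟨(D.coord_type hτ).toSimplex, _⟩, ⟨fun i k => ?_, fun k => ?_⟩, hx⟩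
    · exact hpos i k (lt_succ_iff.1 (k.2.trans_eq (congrArg (· + 1) (D.deg_type i))))
    · have h1 : k.1 = 0 := Nat.lt_one_iff.1 (k.2.trans_eq (congrArg (· + 1) hT.annularDegree_eq))
      show 0 < vCoord k.1
      rw [h1]; simp [vCoord]

lemma Diagram.dim_type (D : Diagram h n m) : D.type.dim = ∑ i, D.deg i := by
  grind [CombType.dim, CombType.Unilevel.annularDegree_eq, Diagram.uni_type, Diagram.deg_type]

lemma ex_mem_openCell (D : Diagram h n m) (hτ : Coord D.deg τ)
    (hx : x.1 = D.radPoint hτ) : ∃ T : UnilevelType h n m, x ∈ URad.openCell T ∧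
      (T.1.dim < ∑ i, D.deg i ∨ ∀ i k, k ≤ D.deg i → 0 < τ i k) := by
  obtain ⟨S, -, h1, h2⟩ := D.ex_faces
  obtain ⟨p, hp, u, hu, hpos, rfl⟩ := h2 τ hτ
  obtain ⟨-, h3, h4⟩ := h1 p hp
  obtain ⟨_, h5⟩ := h3 u hu
  refine ⟨⟨p.1.type, p.1.uni_type⟩, (Diagram.mem_openCell rfl).2 ⟨u, hu, hpos, hx.trans h5⟩, ?_⟩
  rw [p.1.dim_type]; exact h4.imp id fun h' => by subst h'; exact hpos

lemma eq_of_mem_openCell {T T' : UnilevelType h n m} {x : URad h n m}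
    (H : x ∈ URad.openCell T) (H' : x ∈ URad.openCell T') : T = T' := by
  obtain ⟨D, e⟩ := T.2.ex_dg
  obtain ⟨D', e'⟩ := T'.2.ex_dg
  grind [Diagram.mem_openCell, Diagram.radPoint_inj]

lemma ex_cell (T : UnilevelType h n m) : ∃ f : (Fin T.1.dim → ℝ) → URad h n m,
    ContinuousOn f (closedBall 0 1) ∧ InjOn f (ball 0 1) ∧ f '' ball 0 1 = URad.openCell T ∧
    ∀ x ∈ sphere 0 1, ∃ T' : UnilevelType h n m, T'.1.dim < T.1.dim ∧ f x ∈ URad.openCell T' := by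
  classical
  obtain ⟨D, e⟩ := T.2.ex_dg
  have hD : ∑ i, D.deg i = T.1.dim := by rw [← D.dim_type, e]
  obtain ⟨g, h1, h2, h3, h4, h5, h6⟩ := ex_chart D.deg hD
  let pt : {τ // Coord D.deg τ} → URad h n m := fun τ =>
    ⟨D.radPoint τ.2, D.type, _, D.uni_type, rfl⟩
  have hpt : Continuous pt := (continuous_radPoint D).subtype_mk _
  let f : (Fin T.1.dim → ℝ) → URad h n m := fun x =>
    if hx : Coord D.deg (g x) then pt ⟨g x, hx⟩ else pt ⟨_, Diagram.coord_uniform _⟩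
  have hf : ∀ x (hx : x ∈ closedBall 0 1), f x = pt ⟨g x, h2 x hx⟩ := fun x hx => dif_pos (h2 x hx)
  refine ⟨f, ?_, fun x hx y hy hxy => h3 hx hy ?_, ?_, fun x hx => ?_⟩
  · rw [continuousOn_iff_continuous_domRestrict]
    exact (funext fun x => hf x.1 x.2 : (closedBall 0 1).domRestrict f = _) ▸
      hpt.comp ((h1.comp continuous_subtype_val).subtype_mk _)
  · rw [hf x (ball_subset_closedBall hx), hf y (ball_subset_closedBall hy)] at hxy
    grind [Diagram.radPoint_inj]
  · ext y
    rw [Diagram.mem_openCell e]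
    constructor
    · rintro ⟨x, hx, rfl⟩
      exact ⟨g x, h2 x (ball_subset_closedBall hx), h4 x hx,
        congrArg Subtype.val (hf x (ball_subset_closedBall hx))⟩
    grind
  · have hx' := sphere_subset_closedBall hx
    grind [ex_mem_openCell]

end RadialSlit

/-! # Non-metric Sullivan diagrams -/

namespace RadialSlit

open PreConfig FatGraphs

variable {h n m : ℕ}

lemma mk_mem_openCell (len : LengthFunction G) (hpos : ∀ a ∈ G.admissibleEdges, 0 < len.1 a) :
    homeo.symm (SD.mk G len) ∈ URad.openCell ⟨cType G, uni_cType G⟩ := by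
  obtain ⟨D, e⟩ := (uni_cType G).ex_dg
  have hdeg : (cType G).radialDegree = D.deg := by rw [← e, funext D.deg_type]
  refine (Diagram.mem_openCell e).2 ⟨_, hdeg ▸ coord_len len, fun i k hk => ?_,
    Rad.point_congr _ _ _ _ e.symm rfl rfl⟩
  have hk' : k < G.cCard i := by rw [← deg_cType, hdeg]; omega
  rw [← cCoord_apply (f := len.1) rfl hk']
  exact hpos _ (G.edge_mem_adm hk')

lemma ex_mk_eq (e : D.type = T.1)
    (hx : x ∈ URad.openCell T) : ∃ len : LengthFunction (Code.graph D),
      (∀ a ∈ (Code.graph D).admissibleEdges, 0 < len.1 a) ∧ homeo x = SD.mk _ len := by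
  obtain ⟨τ, hτ, hpos, hx⟩ := (Diagram.mem_openCell e).1 hx
  have e1 := (unf_graph D).cType_eq
  have hdeg : (cType (Code.graph D)).radialDegree = D.deg := by rw [e1, funext D.deg_type]
  obtain ⟨len, hl, -⟩ := ex_len (G := Code.graph D) (τ := τ) (hdeg ▸ hτ)
  refine ⟨len, fun a ha => ?_, ?_⟩
  · obtain ⟨i, k, hk, ha⟩ := (Code.graph D).mem_adm.1 ha
    have h1 : 0 < len.1 ((Code.graph D).circleEdge i k) := by
      rw [cCoord_apply hl hk]; exact hpos i k (by rw [← deg_cType, hdeg] at hk; omega)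
    rcases ha with rfl | rfl; exacts [h1, (len.2.len_inv _).symm ▸ h1]
  · rw [← toSD_radPoint]
    exact congrArg toSD (hx.trans (Rad.point_congr _ _ _ _ e1.symm hl.symm rfl))

lemma toNonMetric_eq (hx : x ∈ URad.openCell T)
    (hy : y ∈ URad.openCell T) : (homeo x).toNonMetric = (homeo y).toNonMetric := by
  obtain ⟨D, e⟩ := T.2.ex_dg
  obtain ⟨len, h1, h2⟩ := ex_mk_eq e hx
  obtain ⟨len', h1', h2'⟩ := ex_mk_eq e hy
  exact Quot.sound ⟨_, len, len', fun a ha => ⟨h1 a ha, h1' a ha⟩, h2, h2'⟩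

lemma ex_openCell (x : URad h n m) : ∃ T, x ∈ URad.openCell T := by
  obtain ⟨D, τ, hτ, e⟩ := x.ex_dg
  exact (ex_mem_openCell D hτ e).imp fun _ h' => h'.1

lemma openCell_nonempty (T : UnilevelType h n m) : (URad.openCell T).Nonempty := by
  obtain ⟨f, -, -, h1, -⟩ := ex_cell T
  exact h1 ▸ ⟨_, 0, Metric.mem_ball_self one_pos, rfl⟩

/-- The type of the open cell of a non-metric Sullivan diagram. -/
def cellType : NonMetricSD h n m → UnilevelType h n m :=
  Quot.lift (fun s => (ex_openCell (homeo.symm s)).choose) (by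
    rintro _ _ ⟨G, len, len', hpos, rfl, rfl⟩
    exact (eq_of_mem_openCell (ex_openCell _).choose_spec
      (mk_mem_openCell len fun a ha => (hpos a ha).1)).trans (eq_of_mem_openCell
      (ex_openCell _).choose_spec (mk_mem_openCell len' fun a ha => (hpos a ha).2)).symm)

lemma cellType_eq_iff : cellType s.toNonMetric = T ↔ homeo.symm s ∈ URad.openCell T :=
  ⟨fun e => e ▸ (ex_openCell (homeo.symm s)).choose_spec, fun H =>
    eq_of_mem_openCell (ex_openCell (homeo.symm s)).choose_spec H⟩

lemma cellType_homeo (hx : x ∈ URad.openCell T) : cellType (homeo x).toNonMetric = T :=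
  cellType_eq_iff.2 (by rwa [homeo.symm_apply_apply])

/-- The bijection between the open cells. -/
def cellEquiv : UnilevelType h n m ≃ NonMetricSD h n m where
  toFun T := (homeo (openCell_nonempty T).choose).toNonMetric
  invFun := cellType
  left_inv T := cellType_homeo (openCell_nonempty T).choose_spec
  right_inv G := by
    obtain ⟨s, rfl⟩ := Quot.exists_rep G
    have h1 := toNonMetric_eq (openCell_nonempty (cellType s.toNonMetric)).choose_spec
      (cellType_eq_iff.1 rfl)
    rw [homeo.apply_symm_apply] at h1; exact h1

lemma image_openCell (T : UnilevelType h n m) :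
    homeo '' URad.openCell T = SD.openCell (cellEquiv T) := by
  ext s; constructor
  · rintro ⟨x, hx, rfl⟩; exact toNonMetric_eq hx (openCell_nonempty T).choose_spec
  · intro hs; refine ⟨_, cellType_eq_iff.1 ?_, homeo.apply_symm_apply s⟩
    rw [show s.toNonMetric = cellEquiv T from hs]; exact cellEquiv.left_inv T

end RadialSlit

open RadialSlit FatGraphs in
theorem mainTheorem2 (h n m : ℕ) (hn : 1 ≤ n) (hm : 1 ≤ m) :
    Nonempty (ContinuousMap.HomotopyEquiv (SD h n m) (Rad h n m)) ∧
    ∃ (f : UnilevelType h n m ≃ NonMetricSD h n m) (Φ : URad h n m ≃ₜ SD h n m)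
      (_ : T2Space (URad h n m)) (_ : T2Space (SD h n m))
      (_ : Topology.CWComplex (Set.univ : Set (URad h n m)))
      (_ : Topology.CWComplex (Set.univ : Set (SD h n m)))
      (cellsU : (Σ k, Topology.RelCWComplex.cell (Set.univ : Set (URad h n m)) k) ≃
        UnilevelType h n m)
      (cellsS : (Σ k, Topology.RelCWComplex.cell (Set.univ : Set (SD h n m)) k) ≃
        NonMetricSD h n m),
      (∀ c, Topology.RelCWComplex.openCell c.1 c.2 = URad.openCell (cellsU c) ∧
        c.1 = (cellsU c).1.dim) ∧
      (∀ c, Topology.RelCWComplex.openCell c.1 c.2 = SD.openCell (cellsS c)) ∧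
      (∀ T, Φ '' URad.openCell T = SD.openCell (f T)) ∧
      (∀ k : ℕ, Φ '' (Topology.RelCWComplex.skeleton (Set.univ : Set (URad h n m)) k : Set _) =
        (Topology.RelCWComplex.skeleton (Set.univ : Set (SD h n m)) k : Set _)) ∧
      (∀ L : PreConfig h n m, L.Unilevel → ∃ Γ : AdmissibleFatGraph h n m, IsUnfoldedGraph L Γ ∧
        ∀ (t : (mk L).Cell) (x : URad h n m), x.1 = Rad.mk (mk L) t →
          ∃ len : LengthFunction Γ, Φ x = SD.mk Γ len ∧
            ∀ i (k : Fin ((mk L).radialDegree i + 1)), len.1 (Γ.circleEdge i k) = (t.1 i).1 k) := by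
  obtain ⟨cwU, cU, hU, sU⟩ := exists_cwComplex (fun T : UnilevelType h n m => T.1.dim) URad.openCell
    (fun _ _ _ hx hx' => eq_of_mem_openCell hx hx') ex_openCell ex_cell
  obtain ⟨cwS, cS, hS, sS⟩ := exists_cwComplex (fun T : UnilevelType h n m => T.1.dim)
    (fun T => homeo '' URad.openCell T)
    (by
      rintro T T' _ ⟨x, hx, rfl⟩ ⟨y, hy, e⟩; exact eq_of_mem_openCell hx (homeo.injective e ▸ hy))
    (fun s => (ex_openCell (homeo.symm s)).imp fun _ hs => ⟨_, hs, homeo.apply_symm_apply s⟩)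
    (fun T => by
      obtain ⟨f, h1, h2, h3, h4⟩ := ex_cell T
      refine ⟨homeo ∘ f, homeo.continuous.comp_continuousOn h1, homeo.injective.comp_injOn h2, ?_,
        fun x hx => (h4 x hx).imp fun _ h' => ⟨h'.1, _, h'.2, rfl⟩⟩
      rw [Set.image_comp, h3])
  refine ⟨⟨homotopyEquiv⟩, cellEquiv, homeo, inferInstance, inferInstance, cwU, cwS, cU,
    cS.trans cellEquiv, hU, fun c => (hS c).1.trans (image_openCell _), image_openCell, fun k => ?_,
    fun L hL => ⟨Code.graph L.diagram, (unfGraph_iff _ _).2 (unf_graph _), fun t x hx => ?_⟩⟩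
  · rw [sU, sS]; simp only [Set.image_iUnion]
  · obtain ⟨len, hl, -⟩ := ex_len (coord_graph t)
    refine ⟨len, (congrArg toSD hx).trans (toSD_mk (unf_graph _) hl), fun i k => ?_⟩
    have hk : k.1 < (Code.graph L.diagram).cCard i := (card_graph L i).symm ▸ k.2
    exact (cCoord_apply hl hk).trans (coord_of_lt _ _)
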